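/- Let $F$ be a local field of characteristic zero and let $E$ be either a quadratic field extension of $F$ or $E=F\times F$; let $|\cdot|_F$, $|\cdot|_E$ be the normalized absolute values (so $|x|_E=|x|_F^2$ for $x\in F$, and $|(x,y)|_E=|x|_F|y|_F$ when $E=F\times F$). Let $n\ge 1$, let $G_n=\mathrm{GL}_n$, let $A_n$ and $N_n$ be its subgroups of diagonal and of unipotent upper triangular matrices, and let $K$ be the standard maximal compact subgroup of $G_n(E)$ ($G_n(\mathcal O_E)$ in the $p$-adic case; in the Archimedean case the group of $g$ with $g\,g^{*}=1$, i.e. $O(n)$, $U(n)$ or a product of two such groups), with its Haar measure of total mass one. Let $\psi:E\to\mathbb S^1$ be a non-trivial continuous additive character that is trivial on $F$, and $\psi_n(u)=\psi\big((-1)^n\sum_{i=1}^{n-1}u_{i,i+1}\big)$ for $u\in N_n(E)$. Let $\mathcal S(F^n)$ be the space of locally constant compactly supported functions ($p$-adic case) or the usual Schwartz space (Archimedean case) of complex-valued functions on $F^n$. Let $\mu=(\mu_1,\dots,\mu_n)\in\mathbb R^n$ and $\min(\mu)=\min_i\mu_i$. Let $\Delta$ be the set of simple roots ($t\mapsto t_i/t_{i+1}$,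 $1\le i<n$, for each factor of $G_n(E)$ when $E=F\times F$), and write $t^\alpha$ for the normalized absolute value of $\alpha(t)$. Let $e_\mu$ be the function on $G_n(E)$ with $e_\mu(bk)=\prod_{i}|b_{i,i}|_E^{\frac{n+1}{2}-i+\mu_i}$ for $b$ upper triangular and $k\in K$, let $\Xi_\mu(g)=\int_K e_\mu(kg)\,dk$, and let $\bar\sigma(g)=\sup(\{1\}\cup\{\log|\iota(g)_{a,b}|\})$ for the adjoint embedding $\iota$ of $G_n$ modulo its center into a general linear group (all components being taken together when $E=F\times F$). The space $\mathcal C_\mu(N_n(E)\backslash G_n(E),\psi_n)$ consists of the functions $W:G_n(E)\to\mathbb C$ such that $W(ug)=\psi_n(u)W(g)$ for $u\in N_n(E)$, $g\in G_n(E)$, and: - if $F$ is $p$-adic: $W$ is right-invariant by a compact open subgroup $J$ and there is $R>0$ such that for every $d>0$ $$|W(tk)|\ll \prod_{\alpha\in\Delta}(1+t^\alpha)^R\,\Xi_\mu(t)\,\bar\sigma(t)^{-d},\qquad t\in A_n(E),\ k\in K;$$ - if $F$ is Archimedean: $W$ is smooth and there is $R>0$ such that for every $d>0$ and every $u$ in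 the enveloping algebra of the complexification of the real Lie algebra $\mathfrak{gl}_n(E)$, the same bound holds for the right derivative $R(u)W$ in place of $W$. It carries the locally convex inductive limit topology of the subspaces with $(J,R)$ (resp. $R$) fixed, each of these being topologized by the best constants in the above bounds, as seminorms. Then for every $\phi\in\mathcal S(F^n)$ and every $W\in\mathcal C_\mu(N_n(E)\backslash G_n(E),\psi_n)$ the integral $$Z(s,W,\phi)=\int_{N_n(F)\backslash G_n(F)}W(h)\,\phi(e_nh)\,|\det h|_F^s\,dh,\qquad e_n=(0,\dots,0,1),$$ taken with respect to the quotient of Haar measures on $G_n(F)$ and $N_n(F)$, is absolutely convergent for all $s\in\mathbb C$ with $\Re(s)>-2\min(\mu)$. Moreover, $s\mapsto Z(s,W,\phi)$ is holomorphic on this half-plane and bounded in vertical strips: it is bounded on every closed vertical strip $V=\{a\le\Re(s)\le b\}$ with $-2\min(\mu)<a<b$. More precisely, for every such $V$ there is a continuous seminorm $p_{V,\phi}$ on $\mathcal C_\mu(N_n(E)\backslash G_n(E),\psi_n)$ such that $$|Z(s,W,\phi)|\le p_{V,\phi}(W)$$ for every $W\in\mathcal C_\mu(N_n(E)\backslash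 G_n(E),\psi_n)$ and every $s\in V$. -/

import Mathlib

open MeasureTheory
open scoped MatrixGroups ContDiff ENNReal Topology

noncomputable section

namespace AsaiZeta

/-! ## Absolute values and groups -/

/-- The normalized absolute value of a locally compact ring: `nabs R x` is the factor by which
multiplication by a unit `x` scales the additive Haar measure, and `0` on non-units.
For `R = ℝ` it is `|x|`, for `R = ℂ` it is `|z| ^ 2`, for a `p`-adic field it is `q ^ (-v(x))`,
and for a finite product of such fields it is the product of the absolute values of the
components. -/
def nabs (R : Type*) [CommRing R] [TopologicalSpace R] [IsTopologicalRing R]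
    [LocallyCompactSpace R] (x : R) : ℝ :=
  open Classical in if h : IsUnit x then (distribHaarChar R h.unit : ℝ) else 0

/-- The group of units of a commutative ring. -/
abbrev UnitGroup (R : Type*) [CommRing R] := Rˣ

/-- The group `GL_n(R)` for a commutative ring `R`. -/
abbrev GLn (n : ℕ) (R : Type*) [CommRing R] := GL (Fin n) R

/-- The unipotent upper triangular subgroup `N_n(R)` of `GL_n(R)`. -/
def unip (n : ℕ) (R : Type*) [CommRing R] : Subgroup (GLn n R) where
  carrier := {u | (∀ i j : Fin n, j < i → u.1 i j = 0) ∧ ∀ i : Fin n, u.1 i i = 1}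
  one_mem' := ⟨fun i j h => by simp [Matrix.one_apply_ne h.ne'], fun i => by simp⟩
  mul_mem' := by
    rintro a b ⟨ha, ha'⟩ ⟨hb, hb'⟩
    refine ⟨fun i j h => ?_, fun i => ?_⟩
    · rw [Units.val_mul, Matrix.mul_apply]
      refine Finset.sum_eq_zero fun k _ => ?_
      rcases lt_or_ge k i with hk | hk
      · rw [ha i k hk, zero_mul]
      · rw [hb k j (h.trans_le hk), mul_zero]
    · rw [Units.val_mul, Matrix.mul_apply, Finset.sum_eq_single i, ha', hb', one_mul]
      · intro k _ hk
        rcases lt_or_gt_of_ne hk with hk | hk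
        · rw [ha i k hk, zero_mul]
        · rw [hb k i hk, mul_zero]
      · simp
  inv_mem' := by
    rintro a ⟨ha, ha'⟩
    have hinv : Matrix.BlockTriangular (a⁻¹).1 id := by
      have h1 : Matrix.BlockTriangular a.1 id := fun i j h => ha i j h
      let _ := a.invertible
      have h2 := Matrix.blockTriangular_inv_of_blockTriangular h1
      rwa [← Matrix.coe_units_inv] at h2
    refine ⟨fun i j h => hinv h, fun i => ?_⟩
    have h3 : (a.1 * (a⁻¹).1) i i = 1 := by simp
    rw [Matrix.mul_apply, Finset.sum_eq_single i, ha', one_mul] at h3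
    · exact h3
    · intro k _ hk
      rcases lt_or_gt_of_ne hk with hk | hk
      · rw [ha i k hk, zero_mul]
      · rw [hinv hk, mul_zero]
    · simp

/-- The character `ψ_n(u) = ψ((-1) ^ n ∑_{i < n} u_{i,i+1})`. -/
def psiN {n : ℕ} {R : Type*} [CommRing R] (ψ : AddChar R Circle) (u : GLn n R) : ℂ :=
  (ψ ((-1) ^ n * ∑ i : Fin n, ∑ j : Fin n, if (j : ℕ) = i + 1 then u.1 i j else 0) : ℂ)

/-- The element of the diagonal torus `A_n(R)` with diagonal entries `t`. -/
def torus {n : ℕ} {R : Type*} [CommRing R] (t : Fin n → UnitGroup R) : GLn n R where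
  val := Matrix.diagonal fun i => (t i : R)
  inv := Matrix.diagonal fun i => ((t i)⁻¹ : UnitGroup R)
  val_inv := by simp [Matrix.diagonal_mul_diagonal]
  inv_val := by simp [Matrix.diagonal_mul_diagonal]

/-- The space of functions on `GL_n(R)` with `W(ug) = ψ_n(u) W(g)` for `u ∈ N_n(R)`. -/
def equivariant {n : ℕ} {R : Type*} [CommRing R] (ψ : AddChar R Circle) :
    Submodule ℂ (GLn n R → ℂ) where
  carrier := {W | ∀ u ∈ unip n R, ∀ g, W (u * g) = psiN ψ u * W g}
  zero_mem' := fun u _ g => by simp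
  add_mem' := fun {a b} ha hb u hu g => by
    simp only [Pi.add_apply, ha u hu g, hb u hu g]; ring
  smul_mem' := fun c a ha u hu g => by
    simp only [Pi.smul_apply, smul_eq_mul, ha u hu g]; ring

/-! ## Inductive limits of spaces of functions with weighted supremum seminorms -/

/-- The locally convex inductive limit topology on the union (supremum) of a family of subspaces
`step i`, each with the topology defined by a family of seminorms `p i`: the finest locally convex
vector space topology for which all inclusions `step i → ⨆ i, step i` are continuous. -/
abbrev limTopology {I A V : Type*} [Nonempty A] [AddCommGroup V] [Module ℂ V]
    (step : I → Submodule ℂ V) (p : (i : I) → SeminormFamily ℂ (step i) A) :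
    TopologicalSpace ↥(⨆ i, step i) :=
  sInf {τ | @IsTopologicalAddGroup _ τ _ ∧ @ContinuousSMul ℂ _ _ _ τ ∧
    @LocallyConvexSpace ℝ _ _ _ _ _ τ ∧
    ∀ i, Continuous[(p i).moduleFilterBasis.topology, τ]
      (Submodule.inclusion (le_iSup step i))}

theorem mem_iSup_step {I V : Type*} [Nonempty I] [AddCommGroup V] [Module ℂ V]
    (step : I → Submodule ℂ V) (h : Directed (· ≤ ·) step) (W : V) :
    W ∈ (⨆ i, step i) ↔ ∃ i, W ∈ step i :=
  Submodule.mem_iSup_of_directed step h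

/-- The seminorm `W ↦ sup_x |(D W)(x)| / v(x)`, where the supremum is finite by assumption. -/
def supSeminorm {V X : Type*} [AddCommGroup V] [Module ℂ V] (D : V →ₗ[ℂ] (X → ℂ)) (v : X → ℝ)
    (hv : ∀ x, 0 ≤ v x) (h : ∀ W, ∃ C : ℝ, ∀ x, ‖D W x‖ ≤ C * v x) : Seminorm ℂ V :=
  have hb : ∀ W, BddAbove (Set.range fun x => ‖D W x‖ / v x) := fun W => by
    obtain ⟨C, hC⟩ := h W
    refine ⟨max C 0, ?_⟩
    rintro _ ⟨x, rfl⟩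
    refine div_le_of_le_mul₀ (hv x) (le_max_right _ _) ((hC x).trans ?_)
    exact mul_le_mul_of_nonneg_right (le_max_left _ _) (hv x)
  Seminorm.of (fun W => ⨆ x, ‖D W x‖ / v x)
    (fun W W' => by
      refine Real.iSup_le (fun x => ?_) (add_nonneg
        (Real.iSup_nonneg fun x => div_nonneg (norm_nonneg _) (hv x))
        (Real.iSup_nonneg fun x => div_nonneg (norm_nonneg _) (hv x)))
      refine le_trans ?_ (add_le_add (le_ciSup (hb W) x) (le_ciSup (hb W') x))
      rw [map_add, Pi.add_apply, ← add_div]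
      exact div_le_div_of_nonneg_right (norm_add_le _ _) (hv x))
    (fun c W => by
      simp only [map_smul, Pi.smul_apply, norm_smul, mul_div_assoc]
      rw [Real.mul_iSup_of_nonneg (norm_nonneg c)])

/-! ## The Harish-Chandra function and the growth conditions

From here on the coefficient ring is a finite product `E = ∏ w, E w` of local fields, so that
`GL_n(E) = ∏ w, GL_n(E w)`. -/

section Growth

variable {n : ℕ} {ι : Type*} [Fintype ι] {E : ι → Type*} [∀ w, NontriviallyNormedField (E w)]
  [∀ w, LocallyCompactSpace (E w)]

/-- `δ(b)^{1/2} b^μ` for an upper triangular matrix `b`, where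
`δ(b) = ∏_{i<j} |b_i / b_j|_E = ∏_{i=1}^n |b_i|_E^{n+1-2i}` is the modular character of the Borel
subgroup and `b^μ = ∏ |b_i|_E^{μ_i}`. (Indices in `Fin n` start at `0`.) -/
def borelChar (μ : Fin n → ℝ) (b : GLn n ((w : ι) → E w)) : ℝ :=
  ∏ i : Fin n, nabs ((w : ι) → E w) (b.1 i i) ^ (((n : ℝ) - 1 - 2 * (i : ℕ)) / 2 + μ i)

/-- The spherical vector of the normalized induced representation of `μ`: its value at
`g = b k`, `b` upper triangular and `k ∈ K`, is `δ(b)^{1/2} b^μ`. -/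
def sphericalVector (K : Subgroup (GLn n ((w : ι) → E w))) (μ : Fin n → ℝ)
    (g : GLn n ((w : ι) → E w)) : ℝ :=
  open Classical in
  if h : ∃ b : GLn n ((w : ι) → E w), (∀ i j : Fin n, j < i → b.1 i j = 0) ∧ b⁻¹ * g ∈ K
  then borelChar μ h.choose else 0

/-- The Harish-Chandra function `Ξ_μ(g) = ∫_K e_μ(k g) dk`, i.e. the matrix coefficient of the
spherical vector `e_μ` against the spherical vector of the contragredient. -/
def Xi [MeasurableSpace (GLn n ((w : ι) → E w))]
    {K : Subgroup (GLn n ((w : ι) → E w))} (κ : Measure K) (μ : Fin n → ℝ)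
    (g : GLn n ((w : ι) → E w)) : ℝ :=
  ∫ k : K, sphericalVector K μ (k * g) ∂κ

/-- The log-norm on `GL_n(E)` modulo center: `sup {1, log |Ad(g)_{a,b}|_w}`, computed with the
adjoint embedding `PGL_n → GL(𝔤𝔩_n)`, whose matrix entries are `g_{ij} (g⁻¹)_{kl}`. -/
def sigmaBar (g : GLn n ((w : ι) → E w)) : ℝ :=
  max 1 (⨆ p : ι × (Fin n × Fin n) × (Fin n × Fin n),
    Real.log (nabs (E p.1) (g.1 p.2.1.1 p.2.1.2 p.1 * (g⁻¹).1 p.2.2.1 p.2.2.2 p.1)))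

/-- `∏_{α ∈ Δ} (1 + t^α)`, over the simple roots of `∏ w, GL_n(E w)`. -/
def rootFactor (t : Fin n → UnitGroup ((w : ι) → E w)) : ℝ :=
  ∏ w : ι, ∏ i : Fin n, ∏ j : Fin n,
    if (j : ℕ) = i + 1 then 1 + nabs (E w) ((t i).1 w / (t j).1 w) else 1

/-- The weight `∏_{α ∈ Δ} (1 + t^α)^R · Ξ_μ(t) · σ(t)^{-d}`. -/
def weight [MeasurableSpace (GLn n ((w : ι) → E w))]
    {K : Subgroup (GLn n ((w : ι) → E w))} (κ : Measure K) (μ : Fin n → ℝ)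
    (R d : ℝ) (t : Fin n → UnitGroup ((w : ι) → E w)) : ℝ :=
  rootFactor t ^ R * Xi κ μ (torus t) * sigmaBar (torus t) ^ (-d)

theorem nabs_nonneg {R : Type*} [CommRing R] [TopologicalSpace R] [IsTopologicalRing R]
    [LocallyCompactSpace R] (x : R) : 0 ≤ nabs R x := by
  unfold nabs
  split_ifs <;> simp

theorem one_le_rootFactor (t : Fin n → UnitGroup ((w : ι) → E w)) : 1 ≤ rootFactor t := by
  unfold rootFactor
  refine Finset.one_le_prod fun w _ => Finset.one_le_prod fun i _ => Finset.one_le_prod fun j _ => ?_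
  split_ifs
  · linarith [nabs_nonneg ((t i).1 w / (t j).1 w)]
  · exact le_rfl

variable [MeasurableSpace (GLn n ((w : ι) → E w))]
  {K : Subgroup (GLn n ((w : ι) → E w))} (κ : Measure K)

theorem weight_nonneg (μ : Fin n → ℝ) (R d : ℝ) (t : Fin n → UnitGroup ((w : ι) → E w)) :
    0 ≤ weight κ μ R d t := by
  unfold weight
  refine mul_nonneg (mul_nonneg (Real.rpow_nonneg (zero_le_one.trans (one_le_rootFactor t)) _) ?_)
    (Real.rpow_nonneg (zero_le_one.trans (le_max_left _ _)) _)
  refine integral_nonneg fun k => ?_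
  unfold sphericalVector
  split_ifs
  · exact Finset.prod_nonneg fun i _ => Real.rpow_nonneg (nabs_nonneg _) _
  · exact le_rfl

theorem weight_mono (μ : Fin n → ℝ) {R R' : ℝ} (h : R ≤ R') (d : ℝ)
    (t : Fin n → UnitGroup ((w : ι) → E w)) : weight κ μ R d t ≤ weight κ μ R' d t := by
  have h0 := weight_nonneg κ μ 0 d t
  unfold weight at h0 ⊢
  rw [Real.rpow_zero, one_mul] at h0
  rw [mul_assoc, mul_assoc]
  exact mul_le_mul_of_nonneg_right (Real.rpow_le_rpow_of_exponent_le (one_le_rootFactor t) h) h0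

/-- The functions satisfying, for every `d > 0`, a bound
`|f(tk)| ≪ ∏_{α ∈ Δ} (1 + t^α)^R · Ξ_μ(t) · σ(t)^{-d}` for `t ∈ A_n(E)`, `k ∈ K`. -/
def growth (μ : Fin n → ℝ) (R : ℝ) : Submodule ℂ (GLn n ((w : ι) → E w) → ℂ) where
  carrier := {f | ∀ d : ℝ, 0 < d → ∃ C : ℝ, ∀ x : (Fin n → UnitGroup ((w : ι) → E w)) × K,
    ‖f (torus x.1 * x.2)‖ ≤ C * weight κ μ R d x.1}
  zero_mem' := fun d _ => ⟨0, fun x => by simp⟩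
  add_mem' := fun {a b} ha hb d hd => by
    obtain ⟨C, hC⟩ := ha d hd
    obtain ⟨C', hC'⟩ := hb d hd
    exact ⟨C + C', fun x => by
      rw [add_mul]; exact (norm_add_le _ _).trans (add_le_add (hC x) (hC' x))⟩
  smul_mem' := fun c a ha d hd => by
    obtain ⟨C, hC⟩ := ha d hd
    exact ⟨‖c‖ * C, fun x => by
      rw [Pi.smul_apply, norm_smul, mul_assoc]
      exact mul_le_mul_of_nonneg_left (hC x) (norm_nonneg c)⟩

theorem growth_mono (μ : Fin n → ℝ) {R R' : ℝ} (h : R ≤ R') : growth κ μ R ≤ growth κ μ R' := by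
  intro f hf d hd
  obtain ⟨C, hC⟩ := hf d hd
  refine ⟨max C 0, fun x => (hC x).trans ?_⟩
  exact (mul_le_mul_of_nonneg_right (le_max_left _ _) (weight_nonneg κ μ R d x.1)).trans
    (mul_le_mul_of_nonneg_left (weight_mono κ μ h d x.1) (le_max_right _ _))

/-- Restriction of functions to the points `t k`, `t ∈ A_n(E)`, `k ∈ K`. -/
def restrictTK (K : Subgroup (GLn n ((w : ι) → E w))) :
    (GLn n ((w : ι) → E w) → ℂ) →ₗ[ℂ] ((Fin n → UnitGroup ((w : ι) → E w)) × K → ℂ) where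
  toFun f x := f (torus x.1 * x.2)
  map_add' _ _ := rfl
  map_smul' _ _ := rfl

/-! ### The space of Whittaker functions, non-Archimedean case -/

/-- The Whittaker functions right invariant by `J` that satisfy the growth condition with
exponent `R`, where the index is `i = (J, R)` with `J` compact open and `R > 0`. -/
def stepNA (ψ : AddChar ((w : ι) → E w) Circle) (μ : Fin n → ℝ)
    (i : {J : Subgroup (GLn n ((w : ι) → E w)) //
      IsOpen (J : Set (GLn n ((w : ι) → E w))) ∧
      IsCompact (J : Set (GLn n ((w : ι) → E w)))} × {R : ℝ // 0 < R}) :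
    Submodule ℂ (GLn n ((w : ι) → E w) → ℂ) :=
  equivariant ψ ⊓ growth κ μ i.2 ⊓
    { carrier := {W | ∀ j ∈ i.1.1, ∀ g, W (g * j) = W g}
      zero_mem' := fun _ _ _ => rfl
      add_mem' := fun {a b} ha hb j hj g => by simp only [Pi.add_apply, ha j hj g, hb j hj g]
      smul_mem' := fun c a ha j hj g => by simp only [Pi.smul_apply, ha j hj g] }

/-- The defining seminorms `W ↦ sup |W(tk)| / (∏ (1 + t^α)^R Ξ_μ(t) σ(t)^{-d})`, `d > 0`. -/
def seminormsNA (ψ : AddChar ((w : ι) → E w) Circle) (μ : Fin n → ℝ)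
    (i : {J : Subgroup (GLn n ((w : ι) → E w)) //
      IsOpen (J : Set (GLn n ((w : ι) → E w))) ∧
      IsCompact (J : Set (GLn n ((w : ι) → E w)))} × {R : ℝ // 0 < R}) :
    SeminormFamily ℂ (stepNA κ ψ μ i) {d : ℝ // 0 < d} := fun d =>
  supSeminorm (restrictTK K ∘ₗ (stepNA κ ψ μ i).subtype) (fun x => weight κ μ i.2 d x.1)
    (fun x => weight_nonneg κ μ i.2 d x.1) (fun W => W.2.1.2 d.1 d.2)

/-- The space `𝒞_μ(N_n(E) \ GL_n(E), ψ_n)`, non-Archimedean case. -/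
def spaceNA (ψ : AddChar ((w : ι) → E w) Circle) (μ : Fin n → ℝ) :
    Submodule ℂ (GLn n ((w : ι) → E w) → ℂ) :=
  ⨆ i, stepNA κ ψ μ i

instance : Nonempty {d : ℝ // 0 < d} := ⟨⟨1, one_pos⟩⟩

/-- The LF topology of `𝒞_μ(N_n(E) \ GL_n(E), ψ_n)`, non-Archimedean case. -/
abbrev topologyNA (ψ : AddChar ((w : ι) → E w) Circle) (μ : Fin n → ℝ) :
    TopologicalSpace (spaceNA κ ψ μ) :=
  limTopology (stepNA κ ψ μ) (seminormsNA κ ψ μ)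

/-- The seminormed steps are directed: their supremum is their union. -/
theorem mem_spaceNA (ψ : AddChar ((w : ι) → E w) Circle) (μ : Fin n → ℝ)
    (J₀ : {J : Subgroup (GLn n ((w : ι) → E w)) //
      IsOpen (J : Set (GLn n ((w : ι) → E w))) ∧
      IsCompact (J : Set (GLn n ((w : ι) → E w)))})
    (W : GLn n ((w : ι) → E w) → ℂ) :
    W ∈ spaceNA κ ψ μ ↔ ∃ i, W ∈ stepNA κ ψ μ i := by
  have : Nonempty ({J : Subgroup (GLn n ((w : ι) → E w)) //
      IsOpen (J : Set (GLn n ((w : ι) → E w))) ∧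
      IsCompact (J : Set (GLn n ((w : ι) → E w)))} × {R : ℝ // 0 < R}) := ⟨J₀, 1, one_pos⟩
  refine mem_iSup_step _ ?_ W
  rintro ⟨⟨J, hJ, hJ'⟩, R, hR⟩ ⟨⟨J', hJ2, hJ2'⟩, R', hR'⟩
  refine ⟨⟨⟨J ⊓ J', hJ.inter hJ2, hJ'.inter_right (J'.isClosed_of_isOpen hJ2)⟩,
    max R R', lt_max_of_lt_left hR⟩, ?_, ?_⟩
  · rintro f ⟨⟨h1, h2⟩, h3⟩
    exact ⟨⟨h1, growth_mono κ μ (le_max_left _ _) h2⟩, fun j hj => h3 j hj.1⟩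
  · rintro f ⟨⟨h1, h2⟩, h3⟩
    exact ⟨⟨h1, growth_mono κ μ (le_max_right _ _) h2⟩, fun j hj => h3 j hj.2⟩

end Growth

/-! ### The space of Whittaker functions, Archimedean case -/

section Arch

variable {n : ℕ} {ι : Type*} [Fintype ι] {E : ι → Type*} [∀ w, RCLike (E w)]

/-- Extension by zero of a function on `GL_n(E)` to all `n × n` matrices. -/
def extend (f : GLn n ((w : ι) → E w) → ℂ) (A : Matrix (Fin n) (Fin n) ((w : ι) → E w)) : ℂ :=
  open Classical in if h : IsUnit A then f h.unit else 0

/-- The space `C^∞(GL_n(E))` of complex valued functions that are smooth on `GL_n(E)`, seen as an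
open subset of the real vector space of `n × n` matrices. -/
def smoothFunctions (n : ℕ) {ι : Type*} [Fintype ι] (E : ι → Type*) [∀ w, RCLike (E w)] :
    Submodule ℂ (GLn n ((w : ι) → E w) → ℂ) where
  carrier := {f | ContDiffOn ℝ ∞
    (fun a : Fin n → Fin n → ((w : ι) → E w) => extend f (Matrix.of a)) {a | IsUnit (Matrix.of a)}}
  zero_mem' := by
    refine (contDiffOn_const (c := (0 : ℂ))).congr fun a _ => ?_
    simp [extend]
  add_mem' := fun {f g} hf hg => by
    refine (ContDiffOn.add hf hg).congr fun a ha => ?_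
    have ha' : IsUnit (Matrix.of a) := ha
    simp [extend, ha']
  smul_mem' := fun c f hf => by
    refine (ContDiffOn.const_smul c hf).congr fun a ha => ?_
    have ha' : IsUnit (Matrix.of a) := ha
    simp [extend, ha']

/-- Right translation by the Lie algebra element `X ∈ 𝔤𝔩_n(E)`:
`(R(X) f)(g) = d/dt f(g e^{tX})` at `t = 0`, i.e. the derivative at `g` in the direction `g X`. -/
def rightDeriv (X : Matrix (Fin n) (Fin n) ((w : ι) → E w))
    (f : GLn n ((w : ι) → E w) → ℂ) (g : GLn n ((w : ι) → E w)) : ℂ :=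
  lineDeriv ℝ (extend f) g.1 (g.1 * X)

theorem isOpen_units : IsOpen {a : Fin n → Fin n → ((w : ι) → E w) | IsUnit (Matrix.of a)} := by
  have h : {a : Fin n → Fin n → ((w : ι) → E w) | IsUnit (Matrix.of a)} =
      (fun a => (Matrix.of a).det) ⁻¹' {x : (w : ι) → E w | IsUnit x} := by
    ext a
    exact Matrix.isUnit_iff_isUnit_det _
  rw [h]
  refine Units.isOpen.preimage ?_
  exact Continuous.matrix_det (A := fun a => Matrix.of a) continuous_id

theorem rightDeriv_eq {f : GLn n ((w : ι) → E w) → ℂ} (hf : f ∈ smoothFunctions n E)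
    (X : Matrix (Fin n) (Fin n) ((w : ι) → E w)) (g : GLn n ((w : ι) → E w)) :
    LineDifferentiableAt ℝ (extend f) g.1 (g.1 * X) ∧
    rightDeriv X f g = fderiv ℝ (fun a : Fin n → Fin n → ((w : ι) → E w) => extend f (Matrix.of a))
      (fun i j => g.1 i j) (fun i j => (g.1 * X) i j) := by
  have hd : DifferentiableAt ℝ
      (fun a : Fin n → Fin n → ((w : ι) → E w) => extend f (Matrix.of a)) (fun i j => g.1 i j) :=
    (ContDiffOn.contDiffAt hf (isOpen_units.mem_nhds g.isUnit)).differentiableAt (by simp)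
  have hl := hd.hasFDerivAt.hasLineDerivAt (fun i j => (g.1 * X) i j)
  have hl' : HasLineDerivAt ℝ (extend f) (fderiv ℝ (fun a : Fin n → Fin n → ((w : ι) → E w) =>
      extend f (Matrix.of a)) (fun i j => g.1 i j) (fun i j => (g.1 * X) i j)) g.1 (g.1 * X) := hl
  exact ⟨hl'.lineDifferentiableAt, hl'.lineDeriv⟩

theorem rightDeriv_mem (X : Matrix (Fin n) (Fin n) ((w : ι) → E w))
    {f : GLn n ((w : ι) → E w) → ℂ} (hf : f ∈ smoothFunctions n E) :
    rightDeriv X f ∈ smoothFunctions n E := by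
  have h1 : ContDiffOn ℝ ∞
      (fderiv ℝ (fun a : Fin n → Fin n → ((w : ι) → E w) => extend f (Matrix.of a)))
      {a | IsUnit (Matrix.of a)} := ContDiffOn.fderiv_of_isOpen hf isOpen_units (by simp)
  have h2 : ContDiff ℝ ∞ (fun a : Fin n → Fin n → ((w : ι) → E w) =>
      fun i j => (Matrix.of a * X) i j) := by
    refine contDiff_pi.2 fun i => contDiff_pi.2 fun j => ?_
    simp only [Matrix.mul_apply, Matrix.of_apply]
    fun_prop
  refine (h1.clm_apply h2.contDiffOn).congr fun a ha => ?_
  have ha' : IsUnit (Matrix.of a) := ha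
  simp only [extend, ha', dite_true]
  exact (rightDeriv_eq hf X ha'.unit).2

/-- The operator `R(X)` on `C^∞(GL_n(E))`. -/
def lieDeriv (X : Matrix (Fin n) (Fin n) ((w : ι) → E w)) :
    Module.End ℂ (smoothFunctions n E) where
  toFun f := ⟨rightDeriv X f.1, rightDeriv_mem X f.2⟩
  map_add' f g := by
    ext x
    have h : extend (f.1 + g.1) = fun A => extend f.1 A + extend g.1 A := by
      funext A
      by_cases hA : IsUnit A <;> simp [extend, hA]
    change lineDeriv ℝ (extend (f.1 + g.1)) x.1 (x.1 * X) = _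
    rw [h]
    exact deriv_add (rightDeriv_eq f.2 X x).1 (rightDeriv_eq g.2 X x).1
  map_smul' c f := by
    ext x
    have h : extend (c • f.1) = fun A => c • extend f.1 A := by
      funext A
      by_cases hA : IsUnit A <;> simp [extend, hA]
    change lineDeriv ℝ (extend (c • f.1)) x.1 (x.1 * X) = _
    rw [h]
    exact deriv_const_smul c (rightDeriv_eq f.2 X x).1

/-- The operator `R(X_1 ⋯ X_k) = R(X_1) ⋯ R(X_k)` on `C^∞(GL_n(E))`. Together, these products span
the operators `R(u)` with `u` in the complexified enveloping algebra of `𝔤𝔩_n(E)`. -/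
def iterDeriv (L : List (Matrix (Fin n) (Fin n) ((w : ι) → E w))) :
    Module.End ℂ (smoothFunctions n E) :=
  (L.map lieDeriv).prod

variable [MeasurableSpace (GLn n ((w : ι) → E w))]
  {K : Subgroup (GLn n ((w : ι) → E w))} (κ : Measure K)

/-- The smooth Whittaker functions `W` such that all derivatives `R(X_1 ⋯ X_k) W` satisfy the growth
condition with exponent `R > 0`. -/
def stepArch (ψ : AddChar ((w : ι) → E w) Circle) (μ : Fin n → ℝ) (R : {R : ℝ // 0 < R}) :
    Submodule ℂ (smoothFunctions n E) :=
  (equivariant ψ).comap (smoothFunctions n E).subtype ⊓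
    ⨅ L, (growth κ μ R).comap ((smoothFunctions n E).subtype ∘ₗ iterDeriv L)

/-- The defining seminorms
`W ↦ sup |(R(X_1 ⋯ X_k) W)(tk)| / (∏ (1 + t^α)^R Ξ_μ(t) σ(t)^{-d})`, `d > 0`. -/
def seminormsArch (ψ : AddChar ((w : ι) → E w) Circle) (μ : Fin n → ℝ) (R : {R : ℝ // 0 < R}) :
    SeminormFamily ℂ (stepArch κ ψ μ R)
      (List (Matrix (Fin n) (Fin n) ((w : ι) → E w)) × {d : ℝ // 0 < d}) := fun a =>
  supSeminorm
    (restrictTK K ∘ₗ (smoothFunctions n E).subtype ∘ₗ iterDeriv a.1 ∘ₗ (stepArch κ ψ μ R).subtype)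
    (fun x => weight κ μ R a.2 x.1) (fun x => weight_nonneg κ μ R a.2 x.1)
    (fun W => (Submodule.mem_iInf _).1 W.2.2 a.1 a.2.1 a.2.2)

/-- The space `𝒞_μ(N_n(E) \ GL_n(E), ψ_n)`, Archimedean case. -/
def spaceArch (ψ : AddChar ((w : ι) → E w) Circle) (μ : Fin n → ℝ) :
    Submodule ℂ (smoothFunctions n E) :=
  ⨆ R, stepArch κ ψ μ R

/-- The LF topology of `𝒞_μ(N_n(E) \ GL_n(E), ψ_n)`, Archimedean case. -/
abbrev topologyArch (ψ : AddChar ((w : ι) → E w) Circle) (μ : Fin n → ℝ) :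
    TopologicalSpace (spaceArch κ ψ μ) :=
  limTopology (stepArch κ ψ μ) (seminormsArch κ ψ μ)

/-- The seminormed steps are increasing: their supremum is their union. -/
theorem mem_spaceArch (ψ : AddChar ((w : ι) → E w) Circle) (μ : Fin n → ℝ)
    (W : smoothFunctions n E) : W ∈ spaceArch κ ψ μ ↔ ∃ R, W ∈ stepArch κ ψ μ R := by
  refine mem_iSup_step _ ?_ W
  refine Monotone.directed_le fun R R' h W hW => ⟨hW.1, ?_⟩
  exact (Submodule.mem_iInf _).2 fun L =>
    growth_mono κ μ h ((Submodule.mem_iInf _).1 hW.2 L)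

end Arch

/-! ## Maximal compact subgroups and the zeta integral -/

/-- The ring of integers `𝒪_E = ∏ w, 𝒪_w = {x | |x_w| ≤ 1 for all w}`. -/
def integers {ι : Type*} (E : ι → Type*) [∀ w, NontriviallyNormedField (E w)]
    [∀ w, IsUltrametricDist (E w)] : Subring ((w : ι) → E w) :=
  ⨅ w, (NormedField.valuation (K := E w)).integer.comap (Pi.evalRingHom E w)

/-- The maximal compact subgroup `GL_n(𝒪_E)` of `GL_n(E)` in the non-Archimedean case. -/
def maxCompactNA (n : ℕ) {ι : Type*} (E : ι → Type*) [∀ w, NontriviallyNormedField (E w)]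
    [∀ w, IsUltrametricDist (E w)] : Subgroup (GLn n ((w : ι) → E w)) :=
  (Matrix.GeneralLinearGroup.map (n := Fin n) (integers E).subtype).range

/-- The maximal compact subgroup `{g | g g^* = 1}` (`O(n)` for `ℝ`, `U(n)` for `ℂ`, and products of
these) in the Archimedean case. -/
def maxCompactArch (n : ℕ) {ι : Type*} (E : ι → Type*) [∀ w, RCLike (E w)] :
    Subgroup (GLn n ((w : ι) → E w)) where
  carrier := {g | g.1 ∈ Matrix.unitaryGroup (Fin n) ((w : ι) → E w)}
  one_mem' := one_mem (Matrix.unitaryGroup (Fin n) ((w : ι) → E w))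
  mul_mem' ha hb := Submonoid.mul_mem (Matrix.unitaryGroup (Fin n) ((w : ι) → E w)) ha hb
  inv_mem' := by
    intro g hg
    have h1 : (g⁻¹).1 = star g.1 := by
      have h2 : g.1 * star g.1 = 1 := Matrix.mem_unitaryGroup_iff.1 hg
      exact (left_inv_eq_right_inv (by simp) h2)
    change (g⁻¹).1 ∈ Matrix.unitaryGroup (Fin n) ((w : ι) → E w)
    rw [h1]
    exact Unitary.star_mem hg

section Zeta

variable {n : ℕ} {F : Type*} [NontriviallyNormedField F]

/-- The homogeneous space `N_n(F) \ GL_n(F)` of cosets `N_n(F) h`. -/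
abbrev UnipQuotient (n : ℕ) (F : Type*) [NontriviallyNormedField F] : Type _ :=
  Quotient (QuotientGroup.rightRel (unip n F))

/-- `ν` is the invariant measure on `N_n(F) \ GL_n(F)` that is the quotient of the Haar measures
`lG` on `GL_n(F)` and `lN` on `N_n(F)`:
`∫_G f(h) dh = ∫_{N\G} ∫_N f(u h) du dh` for all measurable `f ≥ 0`. The inner integral does not
depend on the choice of the representative of the coset. -/
def IsQuotientMeasure [MeasurableSpace (GLn n F)] (lG : Measure (GLn n F))
    (lN : Measure (unip n F)) (ν : Measure (UnipQuotient n F)) : Prop :=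
  ∀ f : GLn n F → ℝ≥0∞, Measurable f →
    ∫⁻ h, f h ∂lG = ∫⁻ x, (∫⁻ u : unip n F, f (u * x.out) ∂lN) ∂ν

variable [LocallyCompactSpace F] {ι : Type*} {E : ι → Type*}
  [∀ w, NontriviallyNormedField (E w)] [∀ w, NormedAlgebra F (E w)]

/-- The function `h ↦ W(h) φ(e_n h) |det h|_F^s` on `N_n(F) \ GL_n(F)`, where
`e_n = (0, …, 0, 1)`. -/
def zetaIntegrand (W : GLn n ((w : ι) → E w) → ℂ) (φ : (Fin n → F) → ℂ) (s : ℂ)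
    (x : UnipQuotient n F) : ℂ :=
  W (Matrix.GeneralLinearGroup.map (algebraMap F ((w : ι) → E w)) x.out) *
    φ (Matrix.vecMul (fun i : Fin n => if (i : ℕ) + 1 = n then 1 else 0) x.out.1) *
    ((nabs F x.out.1.det : ℝ) : ℂ) ^ s

/-- The zeta integral `Z(s, W, φ) = ∫_{N_n(F) \ GL_n(F)} W(h) φ(e_n h) |det h|_F^s dh`. -/
def zeta [MeasurableSpace (GLn n F)] (ν : Measure (UnipQuotient n F))
    (W : GLn n ((w : ι) → E w) → ℂ) (φ : (Fin n → F) → ℂ) (s : ℂ) : ℂ :=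
  ∫ x, zetaIntegrand W φ s x ∂ν

end Zeta

end AsaiZeta

end

open MeasureTheory
open scoped MatrixGroups ContDiff ENNReal Topology

noncomputable section

namespace AsaiZeta
/-! ## The normalized absolute value -/

section Nabs

variable {R : Type*} [CommRing R] [TopologicalSpace R] [IsTopologicalRing R]
  [LocallyCompactSpace R]

/-! Write h = u t k by the Iwasawa decomposition of GL_n(F). Then |W(h)| = |W(tk)|, and the
invariant measure of N_n(F) \ GL_n(F) is dominated on the torus by δ_F(t)⁻¹ d^×t. On F one has |x|_E
= |x|_F², so the factor δ_E^{1/2}(t) in the bound for Ξ_μ(t) equals δ_F(t) and cancels this density.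
What remains is ∏ |t_i|_F^{σ + 2 min μ} d^×t_i with σ = Re s, up to an arbitrarily small loss, and
this is integrable near t_i = 0 because σ > -2 min μ.

Convergence at infinity comes from two sources. The value φ(e_n h) decays rapidly in the last
coordinate of t. The function W decays rapidly in the simple roots: in the p-adic case equivariance
under N and invariance under an open subgroup force W(tk) = 0 once some |t_i / t_{i+1}| is large
(`exists_rootNorm_le_of_ne_zero`); in the Archimedean case differentiation along a root subgroup
gains a factor |t_i / t_{i+1}|, which can be repeated (`exists_norm_root_mul_le`,
`DerivControlled`). The simple roots and the last coordinate together bound every |t_i|.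

The analytic core is an upper bound for Ξ_μ. Let T_i(g) be the absolute values of the diagonal part
of g in the Iwasawa decomposition and D_m the product of the T_i with i ≥ m. The integral over K is
turned into one over lower triangular unipotent l. The D_m(l t) are bounded below by minors and also
by D_m(l) up to a power of the size of t; interpolating the two bounds reduces everything to the
convergence of ∫ ∏ D_m(l)^{-(1+ε)} dl (`lintegral_lowM_lt_top`), at the price of a factor L^{aε},
where L bounds t and t⁻¹ (`exists_lintegral_spherical_le`). The same integral with exponent 2
compares the quotient measure with the torus (`exists_lintegral_quotient_le`).

All of this is combined in `exists_lintegral_zetaBase_le`, which bounds ∫ |W(h) φ(e_n h)| |det h|^σ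
dh by finitely many defining seminorms. Holomorphy, boundedness in strips and the continuous
seminorm follow formally (`zeta_properties`), the seminorm being the supremum of |Z(s, W, φ)| over
the strip. The algebra E is kept as a product of fields throughout, so both shapes of E are treated
at once. -/

theorem nabs_units (u : Rˣ) : nabs R (u : R) = distribHaarChar R u := by
  simp [nabs]

theorem nabs_of_not_isUnit {x : R} (h : ¬ IsUnit x) : nabs R x = 0 := by
  simp [nabs, h]

theorem nabs_pos {x : R} (h : IsUnit x) : 0 < nabs R x := by
  obtain ⟨u, rfl⟩ := h
  rw [nabs_units]
  exact_mod_cast distribHaarChar_pos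

theorem nabs_pos_iff {x : R} : 0 < nabs R x ↔ IsUnit x :=
  ⟨fun h => by by_contra h'; rw [nabs_of_not_isUnit h'] at h; exact lt_irrefl _ h, nabs_pos⟩

theorem nabs_one : nabs R (1 : R) = 1 := by
  have := nabs_units (1 : Rˣ)
  simpa using this

theorem nabs_mul (x y : R) : nabs R (x * y) = nabs R x * nabs R y := by
  by_cases hx : IsUnit x
  · by_cases hy : IsUnit y
    · obtain ⟨u, rfl⟩ := hx
      obtain ⟨v, rfl⟩ := hy
      rw [← Units.val_mul, nabs_units, nabs_units, nabs_units, map_mul, NNReal.coe_mul]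
    · rw [nabs_of_not_isUnit hy, mul_zero, nabs_of_not_isUnit]
      exact fun h => hy (isUnit_of_mul_isUnit_right h)
  · rw [nabs_of_not_isUnit hx, zero_mul, nabs_of_not_isUnit]
    exact fun h => hx (isUnit_of_mul_isUnit_left h)

variable (R) in
/-- The normalized absolute value as a homomorphism of monoids. -/
def nabsHom : R →* ℝ where
  toFun := nabs R
  map_one' := nabs_one
  map_mul' := nabs_mul

theorem nabs_prod {ι : Type*} (s : Finset ι) (f : ι → R) :
    nabs R (∏ i ∈ s, f i) = ∏ i ∈ s, nabs R (f i) := map_prod (nabsHom R) f s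

theorem nabs_pow (x : R) (m : ℕ) : nabs R (x ^ m) = nabs R x ^ m := map_pow (nabsHom R) x m

theorem nabs_units_inv (u : Rˣ) : nabs R ((u⁻¹ : Rˣ) : R) = (nabs R (u : R))⁻¹ := by
  rw [nabs_units, nabs_units, map_inv, NNReal.coe_inv]

variable [MeasurableSpace R] [BorelSpace R]

theorem map_unit_mul (μ : Measure R) [μ.IsAddHaarMeasure] [μ.Regular] (u : Rˣ) :
    μ.map (fun x => (u : R) * x) = ENNReal.ofReal (nabs R (u : R))⁻¹ • μ := by
  ext s hs
  have hm : Measurable fun x : R => (u : R) * x := by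
    have : Continuous fun x : R => (u : R) * x := by fun_prop
    exact this.measurable
  rw [Measure.map_apply hm hs, Measure.smul_apply, smul_eq_mul, ← nabs_units_inv, nabs_units,
    ENNReal.ofReal_coe_nnreal, distribHaarChar_mul]
  congr 1
  ext x
  rw [Set.mem_smul_set_iff_inv_smul_mem, inv_inv]
  rfl

end Nabs

/-! ## Scaling of Haar measures under additive automorphisms -/

section HaarChar

variable {V : Type*} [AddCommGroup V] [TopologicalSpace V] [IsTopologicalAddGroup V]
  [LocallyCompactSpace V] [MeasurableSpace V] [BorelSpace V]

theorem map_addEquiv_eq (μ : Measure V) [μ.IsAddHaarMeasure] [μ.Regular] (φ : V ≃ₜ+ V)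
    (h : addEquivAddHaarChar φ = 1) : MeasurePreserving φ μ μ := by
  refine ⟨φ.continuous.measurable, ?_⟩
  have := addEquivAddHaarChar_smul_map μ φ
  rwa [h, one_smul] at this

/-- An automorphism whose iterates map some set of positive measure into a fixed compact set does
not increase volumes. -/
theorem haarChar_le_one (φ : V ≃ₜ+ V) {B C : Set V} (hB : (interior B).Nonempty)
    (hBc : IsCompact B) (hC : IsCompact C) (h : ∀ m : ℕ, ∀ x ∈ B, φ^[m] x ∈ C) :
    addEquivAddHaarChar φ ≤ 1 := by
  by_contra! hlt
  let μ : Measure V := Measure.addHaar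
  have key : ∀ (S : Set V), μ (φ '' S) = addEquivAddHaarChar φ * μ S := by
    intro S
    have := addEquivAddHaarChar_smul_preimage μ (X := φ '' S) φ
    rw [Set.preimage_image_eq _ φ.injective] at this
    rw [← this]; rfl
  have key2 : ∀ m : ℕ, μ (φ^[m] '' B) = (addEquivAddHaarChar φ : ℝ≥0∞) ^ m * μ B := by
    intro m
    induction m with
    | zero => simp
    | succ m ih =>
      rw [Function.iterate_succ', Set.image_comp, key, ih, pow_succ]; ring
  have hB0 : 0 < μ B := (isOpen_interior.measure_pos μ hB).trans_le (measure_mono interior_subset)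
  have hBt : μ B ≠ ⊤ := hBc.measure_lt_top.ne
  -- All iterates of B lie in C, so the powers of the scaling factor stay below μ(C) / μ(B), which
  -- is impossible for a factor larger than 1.
  have hle : ∀ m : ℕ, (addEquivAddHaarChar φ : ℝ≥0∞) ^ m ≤ μ C / μ B := by
    intro m
    rw [ENNReal.le_div_iff_mul_le (Or.inl hB0.ne') (Or.inl hBt), ← key2]
    refine measure_mono ?_
    rintro _ ⟨x, hx, rfl⟩
    exact h m x hx
  have hfin : μ C / μ B ≠ ⊤ := ENNReal.div_ne_top hC.measure_lt_top.ne hB0.ne'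
  have htend := ENNReal.tendsto_pow_atTop_nhds_top_iff.2
    (show (1 : ℝ≥0∞) < addEquivAddHaarChar φ by exact_mod_cast hlt)
  exact hfin (top_le_iff.1 (le_of_tendsto' htend hle))

theorem haarChar_mul_symm (φ : V ≃ₜ+ V) :
    addEquivAddHaarChar φ * addEquivAddHaarChar φ.symm = 1 := by
  rw [addEquivAddHaarChar_symm]
  exact mul_inv_cancel₀ (addEquivAddHaarChar_pos φ).ne'

/-- Used for elements of a bounded group: their powers in both directions stay bounded, so they
preserve Haar measure without any determinant being computed. -/
theorem haarChar_eq_one (φ : V ≃ₜ+ V) {B C : Set V} (hB : (interior B).Nonempty)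
    (hBc : IsCompact B) (hC : IsCompact C) (h : ∀ m : ℕ, ∀ x ∈ B, φ^[m] x ∈ C)
    (h' : ∀ m : ℕ, ∀ x ∈ B, φ.symm^[m] x ∈ C) :
    addEquivAddHaarChar φ = 1 := by
  have h1 := haarChar_le_one φ hB hBc hC h
  have h2 := haarChar_le_one φ.symm hB hBc hC h'
  refine le_antisymm h1 ?_
  have h3 := haarChar_mul_symm φ
  calc (1 : NNReal) = addEquivAddHaarChar φ * addEquivAddHaarChar φ.symm := h3.symm
    _ ≤ addEquivAddHaarChar φ * 1 := by gcongr
    _ = _ := mul_one _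

end HaarChar

/-! ### Diagonal changes of variables on R^n -/

section Pi

variable {R : Type*} [CommRing R] [TopologicalSpace R] [IsTopologicalRing R]
  [LocallyCompactSpace R] [SecondCountableTopology R] [MeasureSpace R] [BorelSpace R]
  [(volume : Measure R).IsAddHaarMeasure]

theorem map_pi_unit_mul {n : ℕ} (u : Fin n → Rˣ) :
    (volume : Measure (Fin n → R)).map (fun x i => (u i : R) * x i) =
      ENNReal.ofReal (∏ i, nabs R (u i : R))⁻¹ • volume := by
  have hs : ∀ i, (volume : Measure R).map (fun x => (u i : R) * x) =
      ENNReal.ofReal (nabs R (u i : R))⁻¹ • volume := fun i => map_unit_mul volume (u i)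
  have hm : ∀ i, Measurable fun x : R => (u i : R) * x := fun i =>
    (continuous_const.mul continuous_id).measurable
  have hf : ∀ i, SigmaFinite ((volume : Measure R).map (fun x => (u i : R) * x)) := fun i => by
    rw [hs]
    exact inferInstanceAs (SigmaFinite ((Real.toNNReal _) • (volume : Measure R)))
  rw [volume_pi, Measure.pi_map_pi (fun i => (hm i).aemeasurable)]
  refine Measure.pi_eq fun s _ => ?_
  simp only [hs, Measure.smul_apply, smul_eq_mul, Measure.pi_pi, Finset.prod_mul_distrib]
  rw [← Finset.prod_inv_distrib, ENNReal.ofReal_prod_of_nonneg]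
  intro i _
  exact inv_nonneg.2 (nabs_nonneg _)

/-- The change of variables `x ↦ u x` in an integral over `R ^ n`. -/
theorem lintegral_pi_unit_mul {n : ℕ} (u : Fin n → Rˣ) (f : (Fin n → R) → ℝ≥0∞)
    (hf : Measurable f) :
    ∫⁻ x : Fin n → R, f (fun i => (u i : R) * x i) =
      ENNReal.ofReal (∏ i, nabs R (u i : R))⁻¹ * ∫⁻ x, f x := by
  have hm : Measurable fun (x : Fin n → R) i => (u i : R) * x i :=
    (by fun_prop : Continuous fun (x : Fin n → R) i => (u i : R) * x i).measurable
  rw [← lintegral_map hf hm, map_pi_unit_mul, lintegral_smul_measure, smul_eq_mul]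

end Pi

/-! ## Bordered matrices -/

section Blk

variable {R : Type*} {n : ℕ}

/-- The matrix with blocks `h`, `y` (last column), `z` (last row) and `w` (last entry). -/
def blk (h : Matrix (Fin n) (Fin n) R) (y z : Fin n → R) (w : R) :
    Matrix (Fin (n + 1)) (Fin (n + 1)) R :=
  Matrix.of (Fin.snoc (α := fun _ => Fin (n + 1) → R)
    (fun i => Fin.snoc (α := fun _ => R) (h i) (y i)) (Fin.snoc (α := fun _ => R) z w))

variable (h : Matrix (Fin n) (Fin n) R) (y z : Fin n → R) (w : R)

@[simp] theorem blk_castSucc_castSucc (i j : Fin n) : blk h y z w i.castSucc j.castSucc = h i j := by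
  simp [blk]

@[simp] theorem blk_castSucc_last (i : Fin n) : blk h y z w i.castSucc (Fin.last n) = y i := by
  simp [blk]

@[simp] theorem blk_last_castSucc (j : Fin n) : blk h y z w (Fin.last n) j.castSucc = z j := by
  simp [blk]

@[simp] theorem blk_last_last : blk h y z w (Fin.last n) (Fin.last n) = w := by
  simp [blk]

theorem ext_blk {A B : Matrix (Fin (n + 1)) (Fin (n + 1)) R}
    (h1 : ∀ i j : Fin n, A i.castSucc j.castSucc = B i.castSucc j.castSucc)
    (h2 : ∀ i : Fin n, A i.castSucc (Fin.last n) = B i.castSucc (Fin.last n))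
    (h3 : ∀ j : Fin n, A (Fin.last n) j.castSucc = B (Fin.last n) j.castSucc)
    (h4 : A (Fin.last n) (Fin.last n) = B (Fin.last n) (Fin.last n)) : A = B := by
  ext i j
  refine Fin.lastCases ?_ (fun i => ?_) i <;> refine Fin.lastCases ?_ (fun j => ?_) j
  exacts [h4, h3 j, h2 i, h1 i j]

variable [CommRing R]

theorem blk_mul_blk (h h' : Matrix (Fin n) (Fin n) R) (y y' z z' : Fin n → R) (w w' : R) :
    blk h y z w * blk h' y' z' w' =
      blk (h * h' + Matrix.vecMulVec y z') (h.mulVec y' + w' • y) (Matrix.vecMul z h' + w • z')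
        (z ⬝ᵥ y' + w * w') := by
  refine ext_blk (fun i j => ?_) (fun i => ?_) (fun j => ?_) ?_ <;>
    simp [Matrix.mul_apply, Fin.sum_univ_castSucc, Matrix.vecMulVec, Matrix.mulVec, Matrix.vecMul,
      dotProduct, mul_comm]

theorem blk_one : blk (1 : Matrix (Fin n) (Fin n) R) 0 0 1 = 1 := by
  refine ext_blk (fun i j => ?_) (fun i => ?_) (fun j => ?_) ?_ <;>
    simp [Matrix.one_apply, Fin.ext_iff]
  all_goals omega

theorem blk_diagonal (t : Fin n → R) (w : R) :
    blk (Matrix.diagonal t) 0 0 w = Matrix.diagonal (Fin.snoc (α := fun _ => R) t w) := by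
  refine ext_blk (fun i j => ?_) (fun i => ?_) (fun j => ?_) ?_ <;>
    simp [Matrix.diagonal_apply, Fin.ext_iff]
  all_goals omega

/-- One step of the Gauss decomposition. -/
theorem blk_gauss (h : Matrix (Fin n) (Fin n) R) (y z : Fin n → R) (w : R) :
    blk 1 y 0 1 * blk h 0 0 w * blk 1 0 z 1 =
      blk (h + Matrix.vecMulVec (w • y) z) (w • y) (w • z) w := by
  simp [blk_mul_blk]

/-- Borders a decomposition u t l of the upper left block to one of the whole matrix; this is the
algebra behind the induction in `lintegral_cell`. -/
theorem blk_cell (u l : Matrix (Fin n) (Fin n) R) (t y z : Fin n → R) (w : R) :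
    blk 1 y 0 1 * blk (u * Matrix.diagonal t * l) 0 0 w * blk 1 0 z 1 =
      blk u y 0 1 * Matrix.diagonal (Fin.snoc (α := fun _ => R) t w) * blk l 0 z 1 := by
  rw [← blk_diagonal]
  simp [blk_mul_blk]

end Blk

/-! ## Measures on matrix spaces -/

section MatrixMeasure

variable {R : Type*} {n : ℕ}

instance [MeasurableSpace R] : MeasurableSpace (Matrix (Fin n) (Fin n) R) :=
  inferInstanceAs (MeasurableSpace (Fin n → Fin n → R))

instance [MeasureSpace R] : MeasureSpace (Matrix (Fin n) (Fin n) R) :=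
  inferInstanceAs (MeasureSpace (Fin n → Fin n → R))

instance [TopologicalSpace R] [SecondCountableTopology R] [MeasurableSpace R] [BorelSpace R] :
    BorelSpace (Matrix (Fin n) (Fin n) R) :=
  inferInstanceAs (BorelSpace (Fin n → Fin n → R))

instance [TopologicalSpace R] [SecondCountableTopology R] :
    SecondCountableTopology (Matrix (Fin n) (Fin n) R) :=
  inferInstanceAs (SecondCountableTopology (Fin n → Fin n → R))

instance [TopologicalSpace R] [LocallyCompactSpace R] :
    LocallyCompactSpace (Matrix (Fin n) (Fin n) R) :=
  inferInstanceAs (LocallyCompactSpace (Fin n → Fin n → R))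

instance [TopologicalSpace R] [SigmaCompactSpace R] :
    SigmaCompactSpace (Matrix (Fin n) (Fin n) R) :=
  inferInstanceAs (SigmaCompactSpace (Fin n → Fin n → R))

variable [NormedCommRing R] [ProperSpace R] [MeasureSpace R] [BorelSpace R]
  [(volume : Measure R).IsAddHaarMeasure]

instance : (volume : Measure (Matrix (Fin n) (Fin n) R)).IsAddHaarMeasure :=
  have : (volume : Measure (Fin n → R)).IsAddHaarMeasure := Measure.pi.isAddHaarMeasure _
  Measure.pi.isAddHaarMeasure fun _ : Fin n => (volume : Measure (Fin n → R))

instance : SFinite (volume : Measure (Matrix (Fin n) (Fin n) R)) :=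
  inferInstanceAs (SFinite (volume : Measure (Fin n → Fin n → R)))

variable (R) in
/-- The Haar measure on lower triangular unipotent matrices, in coordinates. -/
def lowM : (n : ℕ) → Measure (Matrix (Fin n) (Fin n) R)
  | 0 => Measure.dirac 1
  | n + 1 => ((volume : Measure (Fin n → R)).prod (lowM n)).map fun p => blk p.2 0 p.1 1

variable (R) in
/-- The Haar measure on upper triangular unipotent matrices, in coordinates. -/
def upM : (n : ℕ) → Measure (Matrix (Fin n) (Fin n) R)
  | 0 => Measure.dirac 1
  | n + 1 => ((volume : Measure (Fin n → R)).prod (upM n)).map fun p => blk p.2 p.1 0 1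

instance sfinite_lowM : (n : ℕ) → SFinite (lowM R n)
  | 0 => by unfold lowM; infer_instance
  | n + 1 => by
    have := sfinite_lowM n
    unfold lowM
    infer_instance

instance sfinite_upM : (n : ℕ) → SFinite (upM R n)
  | 0 => by unfold upM; infer_instance
  | n + 1 => by
    have := sfinite_upM n
    unfold upM
    infer_instance

theorem continuous_blk : Continuous fun p : Matrix (Fin n) (Fin n) R × (Fin n → R) × (Fin n → R) × R =>
    blk p.1 p.2.1 p.2.2.1 p.2.2.2 := by
  refine continuous_matrix fun i j => ?_
  refine Fin.lastCases ?_ (fun i => ?_) i <;> refine Fin.lastCases ?_ (fun j => ?_) j <;> simp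
  · fun_prop
  · fun_prop
  · fun_prop
  · exact (continuous_apply_apply i j).comp continuous_fst

theorem Continuous.blk' {X : Type*} [TopologicalSpace X] {h : X → Matrix (Fin n) (Fin n) R}
    {y z : X → Fin n → R} {w : X → R} (hh : Continuous h) (hy : Continuous y) (hz : Continuous z)
    (hw : Continuous w) : Continuous fun x => blk (h x) (y x) (z x) (w x) :=
  continuous_blk.comp (hh.prodMk (hy.prodMk (hz.prodMk hw)))

theorem measurable_blk : Measurable fun p : Matrix (Fin n) (Fin n) R × (Fin n → R) × (Fin n → R) × R =>
    blk p.1 p.2.1 p.2.2.1 p.2.2.2 := continuous_blk.measurable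

theorem Measurable.blk' {X : Type*} [MeasurableSpace X] {h : X → Matrix (Fin n) (Fin n) R}
    {y z : X → Fin n → R} {w : X → R} (hh : Measurable h) (hy : Measurable y) (hz : Measurable z)
    (hw : Measurable w) : Measurable fun x => blk (h x) (y x) (z x) (w x) :=
  measurable_blk.comp (hh.prodMk (hy.prodMk (hz.prodMk hw)))

theorem lintegral_lowM_succ {f : Matrix (Fin (n + 1)) (Fin (n + 1)) R → ℝ≥0∞} (hf : Measurable f) :
    ∫⁻ l, f l ∂(lowM R (n + 1)) = ∫⁻ z : Fin n → R, ∫⁻ l, f (blk l 0 z 1) ∂(lowM R n) := by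
  have hm : Measurable fun p : (Fin n → R) × Matrix (Fin n) (Fin n) R => blk p.2 0 p.1 1 :=
    Measurable.blk' measurable_snd measurable_const measurable_fst measurable_const
  have hg : Measurable fun p : (Fin n → R) × Matrix (Fin n) (Fin n) R => f (blk p.2 0 p.1 1) :=
    hf.comp hm
  rw [lowM, lintegral_map hf hm, lintegral_prod _ hg.aemeasurable]

theorem lintegral_upM_succ {f : Matrix (Fin (n + 1)) (Fin (n + 1)) R → ℝ≥0∞} (hf : Measurable f) :
    ∫⁻ u, f u ∂(upM R (n + 1)) = ∫⁻ y : Fin n → R, ∫⁻ u, f (blk u y 0 1) ∂(upM R n) := by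
  have hm : Measurable fun p : (Fin n → R) × Matrix (Fin n) (Fin n) R => blk p.2 p.1 0 1 :=
    Measurable.blk' measurable_snd measurable_fst measurable_const measurable_const
  have hg : Measurable fun p : (Fin n → R) × Matrix (Fin n) (Fin n) R => f (blk p.2 p.1 0 1) :=
    hf.comp hm
  rw [upM, lintegral_map hf hm, lintegral_prod _ hg.aemeasurable]

theorem lintegral_pi_snoc {f : (Fin (n + 1) → R) → ℝ≥0∞} (hf : Measurable f) :
    ∫⁻ t, f t = ∫⁻ w : R, ∫⁻ t : Fin n → R, f (Fin.snoc (α := fun _ => R) t w) := by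
  have h1 := (measurePreserving_piFinSuccAbove
    (fun _ : Fin (n + 1) => (volume : Measure R)) (Fin.last n)).symm
  have hg : Measurable fun a => f ((MeasurableEquiv.piFinSuccAbove (fun _ => R) (Fin.last n)).symm a) :=
    hf.comp h1.measurable
  rw [volume_pi, ← h1.lintegral_comp hf, lintegral_prod _ hg.aemeasurable]
  refine lintegral_congr fun w => ?_
  rw [volume_pi]
  have h3 : (fun j : Fin n => (volume : Measure R)) = fun j => volume := rfl
  refine lintegral_congr fun t => ?_
  congr 1
  ext i
  refine Fin.lastCases ?_ (fun i => ?_) i <;>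
    simp [MeasurableEquiv.piFinSuccAbove, Fin.insertNthEquiv]

theorem measurable_blk_comp {f : Matrix (Fin (n + 1)) (Fin (n + 1)) R → ℝ≥0∞} (hf : Measurable f)
    {X : Type*} [MeasurableSpace X] {h : X → Matrix (Fin n) (Fin n) R}
    {y z : X → Fin n → R} {w : X → R} (hh : Measurable h) (hy : Measurable y) (hz : Measurable z)
    (hw : Measurable w) : Measurable fun x => f (blk (h x) (y x) (z x) (w x)) :=
  hf.comp (Measurable.blk' hh hy hz hw)

variable (R n) in
/-- Bordered matrices as an isomorphism of topological groups. -/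
def blkEquiv : (R × (Fin n → R) × (Fin n → R) × Matrix (Fin n) (Fin n) R) ≃ₜ+
    Matrix (Fin (n + 1)) (Fin (n + 1)) R where
  toFun p := blk p.2.2.2 p.2.2.1 p.2.1 p.1
  invFun A := (A (Fin.last n) (Fin.last n), fun j => A (Fin.last n) j.castSucc,
    fun i => A i.castSucc (Fin.last n), Matrix.of fun i j => A i.castSucc j.castSucc)
  left_inv p := by
    obtain ⟨w, z, y, h⟩ := p
    simp only [blk_last_last, blk_last_castSucc, blk_castSucc_last, blk_castSucc_castSucc]
    rfl
  right_inv A := by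
    refine ext_blk (fun i j => ?_) (fun i => ?_) (fun j => ?_) ?_ <;> simp
  map_add' p q := by
    refine ext_blk (fun i j => ?_) (fun i => ?_) (fun j => ?_) ?_ <;> simp
  continuous_toFun := Continuous.blk' (by fun_prop) (by fun_prop) (by fun_prop) (by fun_prop)
  continuous_invFun := by
    refine Continuous.prodMk ?_ (Continuous.prodMk ?_ (Continuous.prodMk ?_ ?_))
    · exact continuous_apply_apply _ _
    · exact continuous_pi fun j => continuous_apply_apply _ _
    · exact continuous_pi fun j => continuous_apply_apply _ _
    · exact continuous_matrix fun i j => continuous_apply_apply _ _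

/-- Both sides are Haar measures on the same additive group, hence proportional. The value of the
constant plays no role anywhere in the proof. -/
theorem exists_volume_blk : ∃ c : ℝ≥0∞, c ≠ 0 ∧ c ≠ ⊤ ∧
    ∀ f : Matrix (Fin (n + 1)) (Fin (n + 1)) R → ℝ≥0∞, Measurable f → ∫⁻ X, f X =
      c * ∫⁻ w : R, ∫⁻ z : Fin n → R, ∫⁻ y : Fin n → R, ∫⁻ h : Matrix (Fin n) (Fin n) R,
        f (blk h y z w) := by
  let μ : Measure (R × (Fin n → R) × (Fin n → R) × Matrix (Fin n) (Fin n) R) := volume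
  have h0 : (volume : Measure (Fin n → R)).IsAddHaarMeasure := Measure.pi.isAddHaarMeasure _
  have h1 := Measure.prod.instIsAddHaarMeasure (volume : Measure (Fin n → R))
    (volume : Measure (Matrix (Fin n) (Fin n) R))
  have h2 := Measure.prod.instIsAddHaarMeasure (volume : Measure (Fin n → R))
    (Measure.prod (volume : Measure (Fin n → R)) (volume : Measure (Matrix (Fin n) (Fin n) R)))
  have h3 : μ.IsAddHaarMeasure := Measure.prod.instIsAddHaarMeasure (volume : Measure R) _
  have : (μ.map (blkEquiv R n)).IsAddHaarMeasure := (blkEquiv R n).isAddHaarMeasure_map μ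
  have heq := Measure.isAddLeftInvariant_eq_smul
    (volume : Measure (Matrix (Fin (n + 1)) (Fin (n + 1)) R)) (μ.map (blkEquiv R n))
  have hpos := Measure.addHaarScalarFactor_pos_of_isAddHaarMeasure
    (volume : Measure (Matrix (Fin (n + 1)) (Fin (n + 1)) R)) (μ.map (blkEquiv R n))
  refine ⟨_, ENNReal.coe_ne_zero.2 hpos.ne', ENNReal.coe_ne_top, fun f hf => ?_⟩
  have hm : Measurable (blkEquiv R n) := (blkEquiv R n).continuous.measurable
  have hg : Measurable fun p => f (blkEquiv R n p) := hf.comp hm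
  conv_lhs => rw [heq]
  rw [lintegral_smul_measure, lintegral_map hf hm]
  change _ * ∫⁻ a, _ ∂(Measure.prod volume (Measure.prod volume (Measure.prod volume volume))) = _
  rw [lintegral_prod _ hg.aemeasurable]
  congr 1
  refine lintegral_congr fun w => ?_
  have hg1 : Measurable fun p => f (blkEquiv R n (w, p)) := hg.comp measurable_prodMk_left
  rw [lintegral_prod _ hg1.aemeasurable]
  refine lintegral_congr fun z => ?_
  have hg2 : Measurable fun p => f (blkEquiv R n (w, z, p)) := hg1.comp measurable_prodMk_left
  rw [lintegral_prod _ hg2.aemeasurable]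
  rfl

end MatrixMeasure

/-! ## Integration over the open cell -/

/-- Tonelli for the six variables of the induction step. Gauss elimination produces them in the
order w, z, y, l, t, u, while the recursive definitions of the lower, diagonal and upper coordinates
need z, l, w, t, y, u. -/
theorem lintegral_reorder {α β γ δ ε ζ : Type*} [MeasurableSpace α] [MeasurableSpace β]
    [MeasurableSpace γ] [MeasurableSpace δ] [MeasurableSpace ε] [MeasurableSpace ζ]
    (μa : Measure α) (μb : Measure β) (μc : Measure γ) (μd : Measure δ) (μe : Measure ε)
    (μz : Measure ζ) [SFinite μa] [SFinite μb] [SFinite μc] [SFinite μd] [SFinite μe] [SFinite μz]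
    (g : α → β → γ → δ → ε → ζ → ℝ≥0∞)
    (hg : Measurable fun p : α × β × γ × δ × ε × ζ =>
      g p.1 p.2.1 p.2.2.1 p.2.2.2.1 p.2.2.2.2.1 p.2.2.2.2.2) :
    ∫⁻ a, ∫⁻ b, ∫⁻ c, ∫⁻ d, ∫⁻ e, ∫⁻ z, g a b c d e z ∂μz ∂μe ∂μd ∂μc ∂μb ∂μa =
      ∫⁻ b, ∫⁻ d, ∫⁻ a, ∫⁻ e, ∫⁻ c, ∫⁻ z, g a b c d e z ∂μz ∂μc ∂μe ∂μa ∂μd ∂μb := by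
  have hg5 : Measurable fun p : α × β × γ × δ × ε =>
      ∫⁻ z, g p.1 p.2.1 p.2.2.1 p.2.2.2.1 p.2.2.2.2 z ∂μz := by
    refine Measurable.lintegral_prod_right' (f := fun q : (α × β × γ × δ × ε) × ζ =>
      g q.1.1 q.1.2.1 q.1.2.2.1 q.1.2.2.2.1 q.1.2.2.2.2 q.2) ?_
    exact hg.comp (f := fun q : (α × β × γ × δ × ε) × ζ =>
      (q.1.1, q.1.2.1, q.1.2.2.1, q.1.2.2.2.1, q.1.2.2.2.2, q.2)) (by fun_prop)
  have hg4 : Measurable fun p : α × β × γ × δ =>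
      ∫⁻ e, ∫⁻ z, g p.1 p.2.1 p.2.2.1 p.2.2.2 e z ∂μz ∂μe := by
    refine Measurable.lintegral_prod_right' (f := fun q : (α × β × γ × δ) × ε =>
      ∫⁻ z, g q.1.1 q.1.2.1 q.1.2.2.1 q.1.2.2.2 q.2 z ∂μz) ?_
    exact hg5.comp (f := fun q : (α × β × γ × δ) × ε =>
      (q.1.1, q.1.2.1, q.1.2.2.1, q.1.2.2.2, q.2)) (by fun_prop)
  have hg3 : Measurable fun p : α × β × γ =>
      ∫⁻ d, ∫⁻ e, ∫⁻ z, g p.1 p.2.1 p.2.2 d e z ∂μz ∂μe ∂μd := by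
    refine Measurable.lintegral_prod_right' (f := fun q : (α × β × γ) × δ =>
      ∫⁻ e, ∫⁻ z, g q.1.1 q.1.2.1 q.1.2.2 q.2 e z ∂μz ∂μe) ?_
    exact hg4.comp (f := fun q : (α × β × γ) × δ => (q.1.1, q.1.2.1, q.1.2.2, q.2)) (by fun_prop)
  have hg2 : Measurable fun p : α × β =>
      ∫⁻ c, ∫⁻ d, ∫⁻ e, ∫⁻ z, g p.1 p.2 c d e z ∂μz ∂μe ∂μd ∂μc := by
    refine Measurable.lintegral_prod_right' (f := fun q : (α × β) × γ =>
      ∫⁻ d, ∫⁻ e, ∫⁻ z, g q.1.1 q.1.2 q.2 d e z ∂μz ∂μe ∂μd) ?_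
    exact hg3.comp (f := fun q : (α × β) × γ => (q.1.1, q.1.2, q.2)) (by fun_prop)
  rw [lintegral_lintegral_swap hg2.aemeasurable]
  refine lintegral_congr fun b => ?_
  have h1 : ∀ a, ∫⁻ c, ∫⁻ d, ∫⁻ e, ∫⁻ z, g a b c d e z ∂μz ∂μe ∂μd ∂μc =
      ∫⁻ d, ∫⁻ c, ∫⁻ e, ∫⁻ z, g a b c d e z ∂μz ∂μe ∂μc ∂μd := fun a =>
    lintegral_lintegral_swap (hg4.comp (f := fun q : γ × δ => (a, b, q.1, q.2))
      (by fun_prop)).aemeasurable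
  simp only [h1]
  have hg3' : Measurable fun p : α × δ =>
      ∫⁻ c, ∫⁻ e, ∫⁻ z, g p.1 b c p.2 e z ∂μz ∂μe ∂μc := by
    refine Measurable.lintegral_prod_right' (f := fun q : (α × δ) × γ =>
      ∫⁻ e, ∫⁻ z, g q.1.1 b q.2 q.1.2 e z ∂μz ∂μe) ?_
    exact hg4.comp (f := fun q : (α × δ) × γ => (q.1.1, b, q.2, q.1.2)) (by fun_prop)
  rw [lintegral_lintegral_swap hg3'.aemeasurable]
  refine lintegral_congr fun d => lintegral_congr fun a => ?_
  exact lintegral_lintegral_swap (hg5.comp (f := fun q : γ × ε => (a, b, q.1, d, q.2))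
    (by fun_prop)).aemeasurable

section Cell

variable {R : Type*} {n : ℕ} [NormedCommRing R] [ProperSpace R] [MeasureSpace R] [BorelSpace R]
  [(volume : Measure R).IsAddHaarMeasure]

/-- The density `∏ |t_i| ^ (2 i)` of the Haar measure on matrices in the coordinates
`u t l` of the open cell. -/
def cellDensity (t : Fin n → R) : ℝ≥0∞ := ∏ i : Fin n, ENNReal.ofReal (nabs R (t i)) ^ (2 * (i : ℕ))

theorem cellDensity_snoc (t : Fin n → R) (w : R) :
    cellDensity (Fin.snoc (α := fun _ => R) t w) =
      cellDensity t * ENNReal.ofReal (nabs R w) ^ (2 * n) := by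
  simp [cellDensity, Fin.prod_univ_castSucc]

theorem lintegral_unit_smul {w : R} (hw : IsUnit w) {f : (Fin n → R) → ℝ≥0∞} (hf : Measurable f) :
    ∫⁻ z, f z = ENNReal.ofReal (nabs R w) ^ n * ∫⁻ z : Fin n → R, f (w • z) := by
  obtain ⟨u, rfl⟩ := hw
  have h := lintegral_pi_unit_mul (fun _ : Fin n => u) f hf
  have h0 := nabs_pos u.isUnit
  rw [show (fun z : Fin n → R => f ((u : R) • z)) = fun z => f (fun i => (u : R) * z i) from rfl, h,
    ← mul_assoc, Finset.prod_const, Finset.card_univ, Fintype.card_fin,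
    ← ENNReal.ofReal_pow h0.le, ← ENNReal.ofReal_mul (by positivity),
    mul_inv_cancel₀ (by positivity), ENNReal.ofReal_one, one_mul]

theorem measurable_diagonal : Measurable fun t : Fin n → R => Matrix.diagonal t :=
  (continuous_id.matrix_diagonal : Continuous fun t : Fin n → R => Matrix.diagonal t).measurable

theorem measurable_snoc : Measurable fun p : (Fin n → R) × R =>
    (Fin.snoc (α := fun _ => R) p.1 p.2 : Fin (n + 1) → R) := by
  refine measurable_pi_lambda _ fun i => ?_
  refine Fin.lastCases ?_ (fun i => ?_) i <;> simp
  · exact measurable_snd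
  · exact (measurable_pi_apply i).comp measurable_fst

theorem Measurable.matrix_mul {X : Type*} [MeasurableSpace X] {f g : X → Matrix (Fin n) (Fin n) R}
    (hf : Measurable f) (hg : Measurable g) : Measurable fun x => f x * g x :=
  (continuous_fst.matrix_mul continuous_snd : Continuous fun p : Matrix (Fin n) (Fin n) R ×
    Matrix (Fin n) (Fin n) R => p.1 * p.2).measurable.comp (hf.prodMk hg)

theorem measurable_cellDensity (hn : Measurable (nabs R)) :
    Measurable fun t : Fin n → R => cellDensity t := by
  unfold cellDensity
  refine Finset.measurable_prod _ fun i _ => ?_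
  exact ((hn.comp (measurable_pi_apply i)).ennreal_ofReal).pow_const _

/-- Eliminating with the pivot w replaces y by w y and z by w z, each at the cost of |w|^n, and
translates the block h, which costs nothing. The pivot has to be a unit, hence the hypothesis that
almost every element is one. -/
theorem lintegral_gauss_step (hu : ∀ᵐ x : R, IsUnit x) : ∃ c : ℝ≥0∞, c ≠ 0 ∧ c ≠ ⊤ ∧
    ∀ f : Matrix (Fin (n + 1)) (Fin (n + 1)) R → ℝ≥0∞, Measurable f → ∫⁻ X, f X =
      c * ∫⁻ w : R, ∫⁻ z : Fin n → R, ∫⁻ y : Fin n → R, ∫⁻ h : Matrix (Fin n) (Fin n) R,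
        f (blk 1 y 0 1 * blk h 0 0 w * blk 1 0 z 1) * ENNReal.ofReal (nabs R w) ^ (2 * n) := by
  obtain ⟨c, hc, hc', h⟩ := exists_volume_blk (R := R) (n := n)
  refine ⟨c, hc, hc', fun f hf => ?_⟩
  rw [h f hf]
  congr 1
  refine lintegral_congr_ae (hu.mono fun w hw => ?_)
  simp only
  have hm : Measurable fun p : ((Fin n → R) × (Fin n → R)) × Matrix (Fin n) (Fin n) R =>
      f (blk p.2 p.1.2 p.1.1 w) :=
    measurable_blk_comp hf (by fun_prop) (by fun_prop) (by fun_prop) measurable_const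
  have hm2 : Measurable fun p : (Fin n → R) × (Fin n → R) =>
      ∫⁻ h : Matrix (Fin n) (Fin n) R, f (blk h p.2 p.1 w) := hm.lintegral_prod_right'
  have hm3 : Measurable fun z : Fin n → R =>
      ∫⁻ y : Fin n → R, ∫⁻ h : Matrix (Fin n) (Fin n) R, f (blk h y z w) := hm2.lintegral_prod_right'
  rw [lintegral_unit_smul hw hm3, ← lintegral_const_mul' _ _ (by simp)]
  refine lintegral_congr fun z => ?_
  have hm4 : Measurable fun y : Fin n → R =>
      ∫⁻ h : Matrix (Fin n) (Fin n) R, f (blk h y (w • z) w) := hm2.comp measurable_prodMk_left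
  rw [lintegral_unit_smul hw hm4, ← mul_assoc, ← pow_add, ← two_mul,
    ← lintegral_const_mul' _ _ (by simp)]
  refine lintegral_congr fun y => ?_
  rw [lintegral_mul_const' _ _ (by simp), mul_comm]
  congr 1
  rw [← lintegral_add_right_eq_self (μ := (volume : Measure (Matrix (Fin n) (Fin n) R)))
    (fun h => f (blk h (w • y) (w • z) w)) (Matrix.vecMulVec (w • y) z)]
  simp only [blk_gauss]

theorem lintegral_cell_coordinates (Φ : Matrix (Fin (n + 1)) (Fin (n + 1)) R → (Fin (n + 1) → R) →
    Matrix (Fin (n + 1)) (Fin (n + 1)) R → ℝ≥0∞)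
    (hΦ : Measurable fun p : (Matrix (Fin (n + 1)) (Fin (n + 1)) R × (Fin (n + 1) → R)) ×
      Matrix (Fin (n + 1)) (Fin (n + 1)) R => Φ p.1.1 p.1.2 p.2) :
    ∫⁻ l, ∫⁻ t, ∫⁻ u, Φ l t u ∂(upM R (n + 1)) ∂volume ∂(lowM R (n + 1)) =
      ∫⁻ z : Fin n → R, ∫⁻ l, ∫⁻ w : R, ∫⁻ t : Fin n → R, ∫⁻ y : Fin n → R, ∫⁻ u,
        Φ (blk l 0 z 1) (Fin.snoc (α := fun _ => R) t w) (blk u y 0 1)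
          ∂(upM R n) ∂volume ∂volume ∂volume ∂(lowM R n) := by
  have h2 : Measurable fun p : Matrix (Fin (n + 1)) (Fin (n + 1)) R × (Fin (n + 1) → R) =>
      ∫⁻ u, Φ p.1 p.2 u ∂(upM R (n + 1)) := hΦ.lintegral_prod_right'
  have h3 : Measurable fun l => ∫⁻ t, ∫⁻ u, Φ l t u ∂(upM R (n + 1)) ∂volume :=
    h2.lintegral_prod_right'
  rw [lintegral_lowM_succ h3]
  refine lintegral_congr fun z => lintegral_congr fun l => ?_
  have h4 : Measurable fun t => ∫⁻ u, Φ (blk l 0 z 1) t u ∂(upM R (n + 1)) :=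
    h2.comp measurable_prodMk_left
  rw [lintegral_pi_snoc h4]
  refine lintegral_congr fun w => lintegral_congr fun t => ?_
  have h5 : Measurable fun u => Φ (blk l 0 z 1) (Fin.snoc (α := fun _ => R) t w) u :=
    hΦ.comp (measurable_prodMk_left (x := (blk l 0 z 1, Fin.snoc (α := fun _ => R) t w)))
  rw [lintegral_upM_succ h5]

/-- Integration over all matrices in the coordinates of the open cell. -/
theorem lintegral_cell (hu : ∀ᵐ x : R, IsUnit x) (hn : Measurable (nabs R)) (n : ℕ) :
    ∃ c : ℝ≥0∞, c ≠ 0 ∧ c ≠ ⊤ ∧ ∀ f : Matrix (Fin n) (Fin n) R → ℝ≥0∞, Measurable f →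
      ∫⁻ X, f X = c * ∫⁻ l, ∫⁻ t : Fin n → R, ∫⁻ u, f (u * Matrix.diagonal t * l) * cellDensity t
        ∂(upM R n) ∂volume ∂(lowM R n) := by
  induction n with
  | zero =>
    refine ⟨1, one_ne_zero, ENNReal.one_ne_top, fun f _ => ?_⟩
    have h1 : (volume : Measure (Matrix (Fin 0) (Fin 0) R)) = Measure.dirac 1 := by
      change Measure.pi _ = _
      rw [Measure.pi_of_empty]
      congr 1
      exact Subsingleton.elim _ _
    have h2 : (volume : Measure (Fin 0 → R)) = Measure.dirac 0 := by
      rw [volume_pi, Measure.pi_of_empty]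
      congr 1
      exact Subsingleton.elim _ _
    have h3 : ∀ A : Matrix (Fin 0) (Fin 0) R, A = 1 := fun A => Subsingleton.elim _ _
    rw [h1, h2]
    simp [lowM, upM, cellDensity, lintegral_dirac]
    rw [h3 (Matrix.of _)]
  | succ n ih =>
    obtain ⟨c, hc, hc', ih⟩ := ih
    obtain ⟨c', hc1, hc1', h⟩ := lintegral_gauss_step (R := R) (n := n) hu
    refine ⟨c' * c, mul_ne_zero hc1 hc, ENNReal.mul_ne_top hc1' hc', fun f hf => ?_⟩
    rw [h f hf, mul_assoc]
    congr 1
    let g : R → (Fin n → R) → (Fin n → R) → Matrix (Fin n) (Fin n) R → (Fin n → R) →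
      Matrix (Fin n) (Fin n) R → ℝ≥0∞ := fun w z y l t u =>
        f (blk u y 0 1 * Matrix.diagonal (Fin.snoc (α := fun _ => R) t w) * blk l 0 z 1) *
          cellDensity (Fin.snoc (α := fun _ => R) t w)
    have hg : Measurable fun p : R × (Fin n → R) × (Fin n → R) × Matrix (Fin n) (Fin n) R ×
        (Fin n → R) × Matrix (Fin n) (Fin n) R =>
        g p.1 p.2.1 p.2.2.1 p.2.2.2.1 p.2.2.2.2.1 p.2.2.2.2.2 := by
      have hs : Measurable fun p : R × (Fin n → R) × (Fin n → R) × Matrix (Fin n) (Fin n) R ×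
          (Fin n → R) × Matrix (Fin n) (Fin n) R =>
          (Fin.snoc (α := fun _ => R) p.2.2.2.2.1 p.1 : Fin (n + 1) → R) :=
        measurable_snoc.comp (f := fun p : R × (Fin n → R) × (Fin n → R) ×
          Matrix (Fin n) (Fin n) R × (Fin n → R) × Matrix (Fin n) (Fin n) R =>
          (p.2.2.2.2.1, p.1)) (by fun_prop)
      refine (hf.comp (Measurable.matrix_mul (Measurable.matrix_mul ?_
        (measurable_diagonal.comp hs)) ?_)).mul ((measurable_cellDensity hn).comp hs)
      · exact Measurable.blk' (by fun_prop) (by fun_prop) measurable_const measurable_const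
      · exact Measurable.blk' (by fun_prop) measurable_const (by fun_prop) measurable_const
    -- The induction hypothesis, applied to the integral over the upper left block with the border
    -- held fixed.
    have hstep : ∀ (w : R) (z y : Fin n → R), ∫⁻ h : Matrix (Fin n) (Fin n) R,
        f (blk 1 y 0 1 * blk h 0 0 w * blk 1 0 z 1) * ENNReal.ofReal (nabs R w) ^ (2 * n) =
        c * ∫⁻ l, ∫⁻ t : Fin n → R, ∫⁻ u, g w z y l t u ∂(upM R n) ∂volume ∂(lowM R n) := by
      intro w z y
      rw [ih]
      · congr 1
        refine lintegral_congr fun l => lintegral_congr fun t => lintegral_congr fun u => ?_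
        simp only [g, cellDensity_snoc, blk_cell]
        rw [mul_comm (cellDensity t), mul_assoc]
      · refine Measurable.mul_const (hf.comp (Measurable.matrix_mul (Measurable.matrix_mul
          measurable_const ?_) measurable_const)) _
        exact Measurable.blk' measurable_id measurable_const measurable_const measurable_const
    simp only [hstep]
    simp only [lintegral_const_mul' _ _ hc']
    congr 1
    rw [lintegral_reorder _ _ _ _ _ _ g hg]
    have hF : Measurable fun p : (Matrix (Fin (n + 1)) (Fin (n + 1)) R × (Fin (n + 1) → R)) ×
        Matrix (Fin (n + 1)) (Fin (n + 1)) R =>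
        f (p.2 * Matrix.diagonal p.1.2 * p.1.1) * cellDensity p.1.2 :=
      (hf.comp (Measurable.matrix_mul (Measurable.matrix_mul measurable_snd
        (measurable_diagonal.comp (measurable_snd.comp measurable_fst)))
        (measurable_fst.comp measurable_fst))).mul
        ((measurable_cellDensity hn).comp (measurable_snd.comp measurable_fst))
    rw [lintegral_cell_coordinates (fun l t u => f (u * Matrix.diagonal t * l) * cellDensity t) hF]

end Cell

/-! ## Triangular matrices -/

section Triangular

variable {R : Type*} [CommRing R] {n : ℕ}

theorem upper_mul_diag {a b : Matrix (Fin n) (Fin n) R} (ha : a.BlockTriangular id)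
    (hb : b.BlockTriangular id) (i : Fin n) : (a * b) i i = a i i * b i i := by
  rw [Matrix.mul_apply, Finset.sum_eq_single i]
  · intro k _ hk
    rcases lt_or_gt_of_ne hk with hk | hk
    · rw [ha (show id k < id i from hk), zero_mul]
    · rw [hb (show id i < id k from hk), mul_zero]
  · simp

theorem upper_inv {b : GLn n R} (hb : b.1.BlockTriangular id) : (b⁻¹).1.BlockTriangular id := by
  let _ := b.invertible
  have h2 := Matrix.blockTriangular_inv_of_blockTriangular hb
  rwa [← Matrix.coe_units_inv] at h2

theorem upper_diag_mul_inv {b : GLn n R} (hb : b.1.BlockTriangular id) (i : Fin n) :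
    b.1 i i * (b⁻¹).1 i i = 1 := by
  rw [← upper_mul_diag hb (upper_inv hb)]
  simp

theorem upper_diag_isUnit {b : GLn n R} (hb : b.1.BlockTriangular id) (i : Fin n) :
    IsUnit (b.1 i i) := IsUnit.of_mul_eq_one _ (upper_diag_mul_inv hb i)

/-- The matrix `g` with the rows above the `m`-th one replaced by those of the identity. -/
def cornerMat (m : Fin n) (g : Matrix (Fin n) (Fin n) R) : Matrix (Fin n) (Fin n) R :=
  Matrix.of fun i j => if i < m then (1 : Matrix (Fin n) (Fin n) R) i j else g i j

/-- Left multiplication by an upper triangular matrix combines a row only with rows below it, so the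
bottom rows of b g depend only on those of b and g. Taking determinants gives multiplicativity of
the lower right minors under such b. -/
theorem cornerMat_mul {b : Matrix (Fin n) (Fin n) R} (hb : b.BlockTriangular id) (m : Fin n)
    (g : Matrix (Fin n) (Fin n) R) : cornerMat m (b * g) = cornerMat m b * cornerMat m g := by
  ext i j
  by_cases hi : i < m
  · rw [Matrix.mul_apply, Finset.sum_eq_single i]
    · simp [cornerMat, hi]
    · intro k _ hk
      simp [cornerMat, hi, Matrix.one_apply_ne hk.symm]
    · simp
  · simp only [cornerMat, Matrix.of_apply, hi, if_false, Matrix.mul_apply]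
    refine Finset.sum_congr rfl fun k _ => ?_
    by_cases hk : k < m
    · rw [hb (show id k < id i from hk.trans_le (not_lt.1 hi)), zero_mul, zero_mul]
    · simp [hk]

theorem det_cornerMat_upper {b : Matrix (Fin n) (Fin n) R} (hb : b.BlockTriangular id) (m : Fin n) :
    (cornerMat m b).det = ∏ i ∈ Finset.Ici m, b i i := by
  have h : (cornerMat m b).BlockTriangular id := by
    intro i j hij
    have hij' : j < i := hij
    by_cases hi : i < m
    · simp [cornerMat, hi, Matrix.one_apply_ne hij'.ne']
    · simp [cornerMat, hi, hb hij]
  rw [Matrix.det_of_isUpperTriangular h]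
  rw [← Finset.prod_subset (Finset.subset_univ (Finset.Ici m))]
  · refine Finset.prod_congr rfl fun i hi => ?_
    simp [cornerMat, not_lt.2 (Finset.mem_Ici.1 hi)]
  · intro i _ hi
    have : i < m := not_le.1 fun h => hi (Finset.mem_Ici.2 h)
    simp [cornerMat, this]

theorem det_cornerMat_lower {l : Matrix (Fin n) (Fin n) R} (hl : ∀ i j, i < j → l i j = 0)
    (m : Fin n) : (cornerMat m l).det = ∏ i ∈ Finset.Ici m, l i i := by
  have h : (cornerMat m l).BlockTriangular OrderDual.toDual := by
    intro i j hij
    have hij' : i < j := hij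
    by_cases hi : i < m
    · simp [cornerMat, hi, Matrix.one_apply_ne hij'.ne]
    · simp [cornerMat, hi, hl i j hij']
  rw [Matrix.det_of_isLowerTriangular _ h]
  rw [← Finset.prod_subset (Finset.subset_univ (Finset.Ici m))]
  · refine Finset.prod_congr rfl fun i hi => ?_
    simp [cornerMat, not_lt.2 (Finset.mem_Ici.1 hi)]
  · intro i _ hi
    have : i < m := not_le.1 fun h => hi (Finset.mem_Ici.2 h)
    simp [cornerMat, this]

end Triangular

/-! ## Iwasawa decompositions -/

section Iwasawa

variable {R : Type*} [NormedCommRing R] [NormOneClass R] [ProperSpace R]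

variable (R) in
/-- The normalized absolute value is continuous and dominated by a power of the norm. -/
structure TameNabs : Prop where
  continuous_nabs : Continuous (nabs R)
  nabs_le : ∃ c : ℝ, 0 ≤ c ∧ ∀ x, nabs R x ≤ ‖x‖ ^ c

/-- A compatible family of bounded closed subgroups `K n` of `GL_n(R)` with `GL_n(R) = B_n K_n`. -/
structure IwasawaFamily (K : ∀ n, Subgroup (GLn n R)) : Prop where
  norm_le : ∀ n, ∀ k ∈ K n, ∀ i j, ‖k.1 i j‖ ≤ 1
  exists_upper : ∀ n (g : GLn n R), ∃ b : GLn n R, b.1.BlockTriangular id ∧ b⁻¹ * g ∈ K n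
  blk_mem : ∀ n, ∀ k ∈ K n, ∀ k' : GLn (n + 1) R, k'.1 = blk k.1 0 0 1 → k' ∈ K (n + 1)
  isClosed : ∀ n, IsClosed ((fun k : GLn n R => k.1) '' (K n : Set (GLn n R)))

theorem norm_det_le {n : ℕ} (A : Matrix (Fin n) (Fin n) R) {B : ℝ} (h : ∀ i j, ‖A i j‖ ≤ B) :
    ‖A.det‖ ≤ n.factorial * B ^ n := by
  rw [Matrix.det_apply]
  refine (norm_sum_le _ _).trans ?_
  have h1 : ∀ σ ∈ (Finset.univ : Finset (Equiv.Perm (Fin n))),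
      ‖Equiv.Perm.sign σ • ∏ i, A (σ i) i‖ ≤ B ^ n := by
    intro σ _
    have h2 : ‖∏ i, A (σ i) i‖ ≤ B ^ n := by
      refine (Finset.norm_prod_le _ _).trans ?_
      refine (Finset.prod_le_prod (fun _ _ => norm_nonneg _) fun i _ => h (σ i) i).trans ?_
      simp
    rcases Int.units_eq_one_or (Equiv.Perm.sign σ) with hs | hs <;> rw [hs]
    · simpa using h2
    · simpa using h2
  refine (Finset.sum_le_sum h1).trans ?_
  simp [Fintype.card_perm]

variable {K : ∀ n, Subgroup (GLn n R)} {n : ℕ}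

theorem TameNabs.le_of_norm_le (hR : TameNabs R) : ∃ c : ℝ, 0 ≤ c ∧
    ∀ (x : R) (B : ℝ), ‖x‖ ≤ B → nabs R x ≤ B ^ c := by
  obtain ⟨c, hc, h⟩ := hR.nabs_le
  exact ⟨c, hc, fun x B hx => (h x).trans (Real.rpow_le_rpow (norm_nonneg _) hx hc)⟩

theorem TameNabs.le_one (hR : TameNabs R) {x : R} (hx : ‖x‖ ≤ 1) : nabs R x ≤ 1 := by
  obtain ⟨c, hc, h⟩ := hR.le_of_norm_le
  simpa using h x 1 hx

/-- The diagonal entries of b and of its inverse both have absolute value at most 1 and multiply to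
1. This makes the T_i independent of the chosen Iwasawa decomposition. -/
theorem nabs_diag_eq_one (hR : TameNabs R) (hK : IwasawaFamily K) {b : GLn n R} (hb : b ∈ K n)
    (hu : b.1.BlockTriangular id) (i : Fin n) : nabs R (b.1 i i) = 1 := by
  have h1 := hR.le_one (hK.norm_le n b hb i i)
  have h2 := hR.le_one (hK.norm_le n b⁻¹ (inv_mem hb) i i)
  have h3 : nabs R (b.1 i i) * nabs R ((b⁻¹).1 i i) = 1 := by
    rw [← nabs_mul, upper_diag_mul_inv hu, nabs_one]
  nlinarith [nabs_nonneg (b.1 i i), nabs_nonneg ((b⁻¹).1 i i)]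

/-- The Leibniz formula only gives a bound by a power of n!, but it holds for all powers of k with
the same constant, and that forces the determinant to have absolute value at most 1. -/
theorem nabs_det_le_one (hR : TameNabs R) (hK : IwasawaFamily K) {k : GLn n R} (hk : k ∈ K n) :
    nabs R k.1.det ≤ 1 := by
  obtain ⟨c, hc, h⟩ := hR.le_of_norm_le
  have h1 : ∀ m : ℕ, nabs R k.1.det ^ m ≤ ((n.factorial : ℝ) * 1 ^ n) ^ c := by
    intro m
    rw [← nabs_pow, ← Matrix.det_pow, ← Units.val_pow_eq_pow_val]
    exact h _ _ (norm_det_le _ (hK.norm_le n (k ^ m) (pow_mem hk m)))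
  by_contra! hlt
  obtain ⟨m, hm⟩ := pow_unbounded_of_one_lt (((n.factorial : ℝ) * 1 ^ n) ^ c) hlt
  exact absurd (h1 m) (not_le.2 hm)

theorem nabs_det_eq_one (hR : TameNabs R) (hK : IwasawaFamily K) {k : GLn n R} (hk : k ∈ K n) :
    nabs R k.1.det = 1 := by
  have h1 := nabs_det_le_one hR hK hk
  have h2 := nabs_det_le_one hR hK (inv_mem hk)
  have h3 : nabs R k.1.det * nabs R (k⁻¹).1.det = 1 := by
    rw [← nabs_mul, ← Matrix.det_mul, ← Units.val_mul, mul_inv_cancel, Units.val_one,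
      Matrix.det_one, nabs_one]
  nlinarith [nabs_nonneg (k.1.det), nabs_nonneg ((k⁻¹).1.det)]

/-- The normalized absolute values of the diagonal entries of `b` in a decomposition `X = b k` with
`b` upper triangular and `k ∈ K`; zero if `X` is not invertible. -/
def iwasawaT (K : Subgroup (GLn n R)) (X : Matrix (Fin n) (Fin n) R) (i : Fin n) : ℝ :=
  open Classical in
  if h : ∃ b : GLn n R, b.1.BlockTriangular id ∧ ∃ k ∈ K, X = b.1 * k.1 then
    nabs R (h.choose.1 i i) else 0

/-- Two decompositions of the same element differ by an element of B ∩ K, whose diagonal has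
absolute value 1 by `nabs_diag_eq_one`. -/
theorem iwasawaT_mul (hR : TameNabs R) (hK : IwasawaFamily K) {b k : GLn n R}
    (hb : b.1.BlockTriangular id) (hk : k ∈ K n) (i : Fin n) :
    iwasawaT (K n) (b.1 * k.1) i = nabs R (b.1 i i) := by
  have h : ∃ b' : GLn n R, b'.1.BlockTriangular id ∧ ∃ k' ∈ K n, b.1 * k.1 = b'.1 * k'.1 :=
    ⟨b, hb, k, hk, rfl⟩
  rw [iwasawaT, dif_pos h]
  obtain ⟨hb', k', hk', he⟩ := h.choose_spec
  set b' := h.choose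
  have he' : b * k = b' * k' := Units.ext he
  have h2 : b'⁻¹ * b = k' * k⁻¹ := by
    rw [inv_mul_eq_iff_eq_mul, ← mul_assoc, ← he', mul_inv_cancel_right]
  have h3 : b'⁻¹ * b ∈ K n := h2 ▸ mul_mem hk' (inv_mem hk)
  have h4 : (b'⁻¹ * b).1.BlockTriangular id := (upper_inv hb').mul hb
  have h5 := nabs_diag_eq_one hR hK h3 h4 i
  have h6 : b.1 i i = b'.1 i i * (b'⁻¹ * b).1 i i := by
    rw [← upper_mul_diag hb' h4, ← Units.val_mul, mul_inv_cancel_left]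
  rw [h6, nabs_mul, h5, mul_one]

theorem exists_iwasawa (hK : IwasawaFamily K) (g : GLn n R) :
    ∃ b : GLn n R, b.1.BlockTriangular id ∧ ∃ k ∈ K n, g = b * k := by
  obtain ⟨b, hb, hk⟩ := hK.exists_upper n g
  exact ⟨b, hb, _, hk, by simp⟩

theorem iwasawaT_pos (hR : TameNabs R) (hK : IwasawaFamily K) (g : GLn n R) (i : Fin n) :
    0 < iwasawaT (K n) g.1 i := by
  obtain ⟨b, hb, k, hk, rfl⟩ := exists_iwasawa hK g
  rw [Units.val_mul, iwasawaT_mul hR hK hb hk]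
  exact nabs_pos (upper_diag_isUnit hb i)

theorem iwasawaT_nonneg (K : Subgroup (GLn n R)) (X : Matrix (Fin n) (Fin n) R) (i : Fin n) :
    0 ≤ iwasawaT K X i := by
  unfold iwasawaT
  split_ifs
  · exact nabs_nonneg _
  · exact le_rfl

theorem iwasawaT_mul_left (hR : TameNabs R) (hK : IwasawaFamily K) {b : GLn n R}
    (hb : b.1.BlockTriangular id) (g : GLn n R) (i : Fin n) :
    iwasawaT (K n) (b.1 * g.1) i = nabs R (b.1 i i) * iwasawaT (K n) g.1 i := by
  obtain ⟨b', hb', k, hk, rfl⟩ := exists_iwasawa hK g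
  rw [Units.val_mul, iwasawaT_mul hR hK hb' hk, ← mul_assoc, ← Units.val_mul,
    iwasawaT_mul hR hK (b := b * b') (hb.mul hb') hk, Units.val_mul, upper_mul_diag hb hb', nabs_mul]

theorem iwasawaT_mul_right (hR : TameNabs R) (hK : IwasawaFamily K) (g : GLn n R) {k : GLn n R}
    (hk : k ∈ K n) (i : Fin n) : iwasawaT (K n) (g.1 * k.1) i = iwasawaT (K n) g.1 i := by
  obtain ⟨b', hb', k', hk', rfl⟩ := exists_iwasawa hK g
  rw [Units.val_mul, iwasawaT_mul hR hK hb' hk', mul_assoc, ← Units.val_mul,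
    iwasawaT_mul hR hK hb' (mul_mem hk' hk)]

theorem prod_iwasawaT (hR : TameNabs R) (hK : IwasawaFamily K) (g : GLn n R) :
    ∏ i, iwasawaT (K n) g.1 i = nabs R g.1.det := by
  obtain ⟨b, hb, k, hk, rfl⟩ := exists_iwasawa hK g
  simp only [Units.val_mul, iwasawaT_mul hR hK hb hk]
  rw [Matrix.det_mul, nabs_mul, nabs_det_eq_one hR hK hk, mul_one,
    Matrix.det_of_isUpperTriangular hb, nabs_prod]

theorem norm_matrix_mul_le {A B : Matrix (Fin n) (Fin n) R} {a b : ℝ} (ha : 0 ≤ a)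
    (hA : ∀ i j, ‖A i j‖ ≤ a) (hB : ∀ i j, ‖B i j‖ ≤ b) (i j : Fin n) :
    ‖(A * B) i j‖ ≤ n * (a * b) := by
  rw [Matrix.mul_apply]
  refine (norm_sum_le _ _).trans ?_
  refine (Finset.sum_le_sum fun k _ => (norm_mul_le _ _).trans
    (mul_le_mul (hA i k) (hB k j) (norm_nonneg _) ha)).trans ?_
  simp

/-- Minors of the bottom rows of `g` are bounded by the corresponding product of the `T_i(g)`. -/
theorem exists_corner_bound (hR : TameNabs R) (hK : IwasawaFamily K) (n : ℕ) : ∃ C : ℝ, 0 < C ∧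
    ∀ (g : GLn n R) (p : Matrix (Fin n) (Fin n) R), (∀ i j, ‖p i j‖ ≤ 2) → ∀ m : Fin n,
      nabs R (cornerMat m (g.1 * p)).det ≤ C * ∏ i ∈ Finset.Ici m, iwasawaT (K n) g.1 i := by
  obtain ⟨c, hc, h⟩ := hR.le_of_norm_le
  refine ⟨((n.factorial : ℝ) * (n * (1 * 2) + 1 : ℝ) ^ n) ^ c, by positivity,
    fun g p hp m => ?_⟩
  obtain ⟨b, hb, k, hk, rfl⟩ := exists_iwasawa hK g
  simp only [Units.val_mul, iwasawaT_mul hR hK hb hk]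
  -- Write g = b k. The minor of b is the product of the T_i exactly, and the other factor is the
  -- determinant of a matrix with bounded entries because k and p are bounded.
  rw [mul_assoc, cornerMat_mul hb, Matrix.det_mul, det_cornerMat_upper hb, nabs_mul, nabs_prod,
    mul_comm]
  refine mul_le_mul_of_nonneg_right ?_ (Finset.prod_nonneg fun _ _ => nabs_nonneg _)
  refine h _ _ (norm_det_le _ fun i j => ?_)
  by_cases hi : i < m
  · simp only [cornerMat, Matrix.of_apply, hi, if_true]
    have : ‖(1 : Matrix (Fin n) (Fin n) R) i j‖ ≤ 1 := by
      rw [Matrix.one_apply]; split_ifs <;> simp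
    have : (0 : ℝ) ≤ n * (1 * 2) := by positivity
    linarith
  · simp only [cornerMat, Matrix.of_apply, hi, if_false]
    have := norm_matrix_mul_le zero_le_one (hK.norm_le n k hk) hp i j
    linarith

theorem norm_mul_diagonal_le {A : Matrix (Fin n) (Fin n) R} (hA : ∀ i j, ‖A i j‖ ≤ 1) {t : Fin n → R}
    {B : ℝ} (ht : ∀ i, ‖t i‖ ≤ B) (i j : Fin n) : ‖(A * Matrix.diagonal t) i j‖ ≤ B := by
  rw [Matrix.mul_diagonal]
  refine (norm_mul_le _ _).trans ?_
  calc ‖A i j‖ * ‖t j‖ ≤ 1 * B := mul_le_mul (hA i j) (ht j) (norm_nonneg _) zero_le_one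
    _ = B := one_mul _

/-- Right multiplication by a diagonal matrix changes the `T_i` by a bounded amount. -/
theorem exists_iwasawaT_torus_le (hR : TameNabs R) (hK : IwasawaFamily K) (n : ℕ) : ∃ c : ℝ, 0 ≤ c ∧
    ∀ (g : GLn n R) (t : Fin n → UnitGroup R) (B : ℝ), (∀ i, ‖(t i : R)‖ ≤ B) → ∀ i,
      iwasawaT (K n) (g * torus t).1 i ≤ (n * B) ^ c * iwasawaT (K n) g.1 i := by
  obtain ⟨c, hc, h⟩ := hR.le_of_norm_le
  refine ⟨c, hc, fun g t B hB i => ?_⟩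
  have hB0 : 0 ≤ B := (norm_nonneg _).trans (hB i)
  obtain ⟨b, hb, k, hk, rfl⟩ := exists_iwasawa hK g
  obtain ⟨b', hb', k', hk', he⟩ := exists_iwasawa hK (k * torus t)
  rw [mul_assoc, he, ← mul_assoc, Units.val_mul,
    iwasawaT_mul hR hK (b := b * b') (hb.mul hb') hk', Units.val_mul, Units.val_mul,
    upper_mul_diag hb hb', iwasawaT_mul hR hK hb hk, nabs_mul, mul_comm]
  refine mul_le_mul_of_nonneg_right ?_ (nabs_nonneg _)
  refine h _ _ ?_
  -- If k t = b' k', then b' is t multiplied on both sides by bounded matrices, so its diagonal is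
  -- bounded by the size of t.
  have h1 : b' = k * torus t * k'⁻¹ := by rw [he, mul_inv_cancel_right]
  rw [h1, Units.val_mul]
  have := norm_matrix_mul_le hB0 (fun i j => norm_mul_diagonal_le (hK.norm_le n k hk) hB i j)
    (hK.norm_le n k'⁻¹ (inv_mem hk')) i i
  rwa [mul_one] at this

theorem torus_inv (t : Fin n → UnitGroup R) : (torus t)⁻¹ = torus fun i => (t i)⁻¹ := by
  refine inv_eq_of_mul_eq_one_right (Units.ext ?_)
  simp [torus, Matrix.diagonal_mul_diagonal]

theorem exists_le_iwasawaT_torus (hR : TameNabs R) (hK : IwasawaFamily K) (n : ℕ) : ∃ c : ℝ, 0 ≤ c ∧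
    ∀ (g : GLn n R) (t : Fin n → UnitGroup R) (B : ℝ), (∀ i, ‖(((t i)⁻¹ : Rˣ) : R)‖ ≤ B) → ∀ i,
      iwasawaT (K n) g.1 i ≤ (n * B) ^ c * iwasawaT (K n) (g * torus t).1 i := by
  obtain ⟨c, hc, h⟩ := exists_iwasawaT_torus_le hR hK n
  refine ⟨c, hc, fun g t B hB i => ?_⟩
  have := h (g * torus t) (fun i => (t i)⁻¹) B hB i
  rwa [← torus_inv, mul_inv_cancel_right] at this

/-- For r > 0 the set where T_i ≥ r is the image under multiplication of a set of pairs (b, k).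
Bounding the diagonal of b below by 1/(q+1) makes this set closed for each q while keeping b
invertible; the union over q is σ-compact, and so is its continuous image. -/
theorem measurable_iwasawaT [MeasurableSpace R] [BorelSpace R] (hR : TameNabs R)
    (hK : IwasawaFamily K) (i : Fin n) : Measurable fun X => iwasawaT (K n) X i := by
  refine measurable_of_Ici fun r => ?_
  rcases le_or_gt r 0 with hr | hr
  · convert MeasurableSet.univ
    ext X
    simpa using hr.trans (iwasawaT_nonneg _ _ _)
  let S : ℕ → Set (Matrix (Fin n) (Fin n) R × Matrix (Fin n) (Fin n) R) := fun q =>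
    {p | (∀ a c, c < a → p.1 a c = 0) ∧ (∀ j, 1 / ((q : ℝ) + 1) ≤ nabs R (p.1 j j)) ∧
      r ≤ nabs R (p.1 i i) ∧ p.2 ∈ (fun k : GLn n R => k.1) '' (K n : Set (GLn n R))}
  have hentry : ∀ a c : Fin n, Continuous fun p : Matrix (Fin n) (Fin n) R ×
      Matrix (Fin n) (Fin n) R => p.1 a c := fun a c =>
    (continuous_apply_apply a c).comp continuous_fst
  have hS : ∀ q, IsClosed (S q) := by
    intro q
    refine IsClosed.inter ?_ (IsClosed.inter ?_ (IsClosed.inter ?_ ?_))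
    · change IsClosed {p : Matrix (Fin n) (Fin n) R × Matrix (Fin n) (Fin n) R |
        ∀ a c, c < a → p.1 a c = 0}
      simp only [Set.ofPred_forall]
      exact isClosed_iInter fun a => isClosed_iInter fun c => isClosed_iInter fun _ =>
        isClosed_eq (hentry a c) continuous_const
    · change IsClosed {p : Matrix (Fin n) (Fin n) R × Matrix (Fin n) (Fin n) R |
        ∀ j, 1 / ((q : ℝ) + 1) ≤ nabs R (p.1 j j)}
      simp only [Set.ofPred_forall]
      exact isClosed_iInter fun j => isClosed_le continuous_const
        (hR.continuous_nabs.comp (hentry j j))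
    · exact isClosed_le continuous_const (hR.continuous_nabs.comp (hentry i i))
    · exact (hK.isClosed n).preimage continuous_snd
  have hS2 : IsSigmaCompact (⋃ q, S q) :=
    isSigmaCompact_iUnion _ fun q => isSigmaCompact_univ.of_isClosed_subset (hS q)
      (Set.subset_univ _)
  have hmul : Continuous fun p : Matrix (Fin n) (Fin n) R × Matrix (Fin n) (Fin n) R => p.1 * p.2 :=
    continuous_fst.matrix_mul continuous_snd
  obtain ⟨Q, hQ, hQ2⟩ := hS2.image hmul
  have heq : (fun X => iwasawaT (K n) X i) ⁻¹' Set.Ici r =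
      (fun p : Matrix (Fin n) (Fin n) R × Matrix (Fin n) (Fin n) R => p.1 * p.2) '' (⋃ q, S q) := by
    ext X
    simp only [Set.mem_preimage, Set.mem_Ici, Set.mem_image, Set.mem_iUnion]
    constructor
    · intro hX
      by_cases h : ∃ b : GLn n R, b.1.BlockTriangular id ∧ ∃ k ∈ K n, X = b.1 * k.1
      · obtain ⟨b, hb, k, hk, rfl⟩ := h
        rw [iwasawaT_mul hR hK hb hk] at hX
        have : ∃ q : ℕ, ∀ j, 1 / ((q : ℝ) + 1) ≤ nabs R (b.1 j j) := by
          have hpos : ∀ j, ∃ q : ℕ, 1 / ((q : ℝ) + 1) < nabs R (b.1 j j) := fun j =>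
            exists_nat_one_div_lt (nabs_pos (upper_diag_isUnit hb j))
          choose q hq using hpos
          refine ⟨Finset.univ.sup q, fun j => le_trans ?_ (hq j).le⟩
          have : q j ≤ Finset.univ.sup q := Finset.le_sup (Finset.mem_univ j)
          gcongr
        obtain ⟨q, hq⟩ := this
        exact ⟨(b.1, k.1), ⟨q, fun a c h => hb h, hq, hX, k, hk, rfl⟩, rfl⟩
      · rw [iwasawaT, dif_neg h] at hX
        exact absurd hX (not_le.2 hr)
    · rintro ⟨⟨b, _⟩, ⟨q, h1, h2, h3, ⟨k, hk, rfl⟩⟩, rfl⟩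
      have hbt : b.BlockTriangular id := fun a c h => h1 a c h
      have hbu : IsUnit b := by
        rw [Matrix.isUnit_iff_isUnit_det, Matrix.det_of_isUpperTriangular hbt]
        rw [← nabs_pos_iff, nabs_prod]
        exact Finset.prod_pos fun j _ => lt_of_lt_of_le (by positivity) (h2 j)
      have := iwasawaT_mul hR hK (b := hbu.unit) (k := k) hbt hk i
      simp only [IsUnit.unit_spec] at this
      simp only [this]
      exact h3
  rw [heq, ← hQ2]
  exact MeasurableSet.iUnion fun q => (hQ q).measurableSet

end Iwasawa

/-! ## Convergence of the integral over lower triangular unipotent matrices -/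

section LowerIntegral

variable {R : Type*} [NormedCommRing R] [NormOneClass R] [ProperSpace R] [MeasureSpace R]
  [BorelSpace R] [(volume : Measure R).IsAddHaarMeasure]

theorem lintegral_pi_prod {n : ℕ} (f : Fin n → R → ℝ≥0∞) (hf : ∀ i, Measurable (f i)) :
    ∫⁻ z : Fin n → R, ∏ i, f i (z i) = ∏ i, ∫⁻ x, f i x := by
  induction n with
  | zero =>
    simp [volume_pi, Measure.pi_of_empty]
  | succ n ih =>
    have hm : Measurable fun z : Fin (n + 1) → R => ∏ i, f i (z i) :=
      Finset.measurable_prod _ fun i _ => (hf i).comp (measurable_pi_apply i)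
    have hm' : Measurable fun z : Fin n → R => ∏ i : Fin n, f i.castSucc (z i) :=
      Finset.measurable_prod _ fun i _ => (hf _).comp (measurable_pi_apply i)
    rw [lintegral_pi_snoc hm]
    simp only [Fin.prod_univ_castSucc, Fin.snoc_castSucc, Fin.snoc_last]
    simp only [lintegral_mul_const _ hm']
    rw [ih _ fun i => hf _, lintegral_const_mul _ (hf _)]

variable (R) in
/-- There is a height function `M ≥ 1` on `R` that is bounded by `|e + (1 - e) x|` for a suitable
bounded `e` depending on `x` and such that `M ^ (-s)` is integrable for `s > 1`. -/
def HasHeight : Prop := ∃ M : R → ℝ, Measurable M ∧ (∀ x, 1 ≤ M x) ∧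
  (∀ x, ∃ e : R, ‖e‖ ≤ 1 ∧ ‖1 - e‖ ≤ 1 ∧ M x ≤ nabs R (e + (1 - e) * x)) ∧
  ∀ s : ℝ, 1 < s → ∫⁻ x, ENNReal.ofReal (M x ^ (-s)) < ⊤

variable {n : ℕ}

/-- The invertible matrix with blocks `h`, `0`, `z`, `1`. -/
def glLow (h : GLn n R) (z : Fin n → R) : GLn (n + 1) R where
  val := blk h.1 0 z 1
  inv := blk (h⁻¹).1 0 (-(Matrix.vecMul z (h⁻¹).1)) 1
  val_inv := by rw [blk_mul_blk, ← blk_one]; simp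
  inv_val := by rw [blk_mul_blk, ← blk_one]; simp [Matrix.neg_vecMul, Matrix.vecMul_vecMul]

variable (K : ∀ n, Subgroup (GLn n R))

/-- The products `∏_{i ≥ m} T_i(X)` in terms of the Iwasawa decomposition of `X`. -/
def iwasawaD (K : Subgroup (GLn n R)) (X : Matrix (Fin n) (Fin n) R) (m : Fin n) : ℝ :=
  ∏ i ∈ Finset.Ici m, iwasawaT K X i

theorem iwasawaD_eq (K : Subgroup (GLn n R)) (X : Matrix (Fin n) (Fin n) R) (m : Fin n) :
    iwasawaD K X m = ∏ i, if m ≤ i then iwasawaT K X i else 1 := by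
  rw [iwasawaD, ← Finset.prod_filter]
  congr 1
  ext i
  simp

variable {K}

theorem measurable_iwasawaD (hR : TameNabs R) (hK : IwasawaFamily K) (m : Fin n) :
    Measurable fun X => iwasawaD (K n) X m :=
  Finset.measurable_prod _ fun i _ => measurable_iwasawaT hR hK i

theorem iwasawaD_pos (hR : TameNabs R) (hK : IwasawaFamily K) (g : GLn n R) (m : Fin n) :
    0 < iwasawaD (K n) g.1 m := Finset.prod_pos fun i _ => iwasawaT_pos hR hK g i

/-- Since diag(bk, 1) with last row z factors as diag(b, 1) times the unipotent with last row z k⁻¹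
times diag(k, 1), the left factor scales the T_i and the right factor is invisible to them. -/
theorem iwasawaT_glLow (hR : TameNabs R) (hK : IwasawaFamily K) {b k : GLn n R}
    (hb : b.1.BlockTriangular id) (hk : k ∈ K n) (z : Fin n → R) :
    (∀ i : Fin n, iwasawaT (K (n + 1)) (glLow (b * k) z).1 i.castSucc = iwasawaT (K n) (b * k).1 i *
      iwasawaT (K (n + 1)) (glLow 1 (Matrix.vecMul z (k⁻¹).1)).1 i.castSucc) ∧
    iwasawaT (K (n + 1)) (glLow (b * k) z).1 (Fin.last n) =
      iwasawaT (K (n + 1)) (glLow 1 (Matrix.vecMul z (k⁻¹).1)).1 (Fin.last n) := by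
  have h1 : glLow (b * k) z = glLow b 0 * (glLow 1 (Matrix.vecMul z (k⁻¹).1) * glLow k 0) := by
    refine Units.ext ?_
    simp only [glLow, Units.val_mul, blk_mul_blk]
    simp [Matrix.vecMul_vecMul]
  have h2 : glLow k 0 ∈ K (n + 1) := hK.blk_mem n k hk _ rfl
  have h3 : (glLow b 0).1.BlockTriangular id := by
    intro i j hij
    have hij' : j < i := hij
    revert hij'
    refine Fin.lastCases ?_ (fun i => ?_) i <;> refine Fin.lastCases ?_ (fun j => ?_) j
    · simp
    · simp [glLow]
    · intro h; exact absurd h (not_lt.2 (Fin.le_last _))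
    · intro h; simpa [glLow] using hb (show id j < id i from h)
  have h4 : ∀ i, iwasawaT (K (n + 1)) (glLow (b * k) z).1 i = nabs R ((glLow b 0).1 i i) *
      iwasawaT (K (n + 1)) (glLow 1 (Matrix.vecMul z (k⁻¹).1)).1 i := by
    intro i
    rw [h1, Units.val_mul, iwasawaT_mul_left hR hK h3, Units.val_mul, iwasawaT_mul_right hR hK _ h2]
  refine ⟨fun i => ?_, ?_⟩
  · rw [h4, Units.val_mul, iwasawaT_mul hR hK hb hk]
    simp [glLow]
  · rw [h4]
    simp [glLow, nabs_one]

theorem iwasawaD_castSucc (K : Subgroup (GLn (n + 1) R)) (X : Matrix (Fin (n + 1)) (Fin (n + 1)) R)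
    (m : Fin n) : iwasawaD K X m.castSucc =
      (∏ i : Fin n, if m ≤ i then iwasawaT K X i.castSucc else 1) * iwasawaT K X (Fin.last n) := by
  rw [iwasawaD_eq, Fin.prod_univ_castSucc]
  simp [Fin.le_last]

theorem iwasawaD_last (K : Subgroup (GLn (n + 1) R)) (X : Matrix (Fin (n + 1)) (Fin (n + 1)) R) :
    iwasawaD K X (Fin.last n) = iwasawaT K X (Fin.last n) := by
  rw [iwasawaD_eq, Fin.prod_univ_castSucc]
  simp

theorem prod_iwasawaD_glLow (hR : TameNabs R) (hK : IwasawaFamily K) {b k : GLn n R}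
    (hb : b.1.BlockTriangular id) (hk : k ∈ K n) (z : Fin n → R) :
    ∏ m, iwasawaD (K (n + 1)) (glLow (b * k) z).1 m = (∏ m, iwasawaD (K n) (b * k).1 m) *
      ∏ m, iwasawaD (K (n + 1)) (glLow 1 (Matrix.vecMul z (k⁻¹).1)).1 m := by
  obtain ⟨h1, h2⟩ := iwasawaT_glLow hR hK hb hk z
  rw [Fin.prod_univ_castSucc, Fin.prod_univ_castSucc, ← mul_assoc, ← Finset.prod_mul_distrib,
    iwasawaD_last, iwasawaD_last, h2]
  congr 1
  refine Finset.prod_congr rfl fun m _ => ?_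
  rw [iwasawaD_castSucc, iwasawaD_castSucc, iwasawaD_eq, h2, ← mul_assoc, ← Finset.prod_mul_distrib]
  congr 1
  refine Finset.prod_congr rfl fun i _ => ?_
  split_ifs
  · exact h1 i
  · simp

theorem continuous_matrix_entry {R : Type*} [TopologicalSpace R] {n : ℕ} (i j : Fin n) :
    Continuous fun A : Matrix (Fin n) (Fin n) R => A i j := continuous_apply_apply i j

/-- Right multiplication of row vectors by an invertible matrix. -/
def vecMulEquiv (k : GLn n R) : (Fin n → R) ≃ₜ+ (Fin n → R) where
  toFun z := Matrix.vecMul z k.1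
  invFun z := Matrix.vecMul z (k⁻¹).1
  left_inv z := by simp [Matrix.vecMul_vecMul]
  right_inv z := by simp [Matrix.vecMul_vecMul]
  map_add' x y := Matrix.add_vecMul k.1 x y
  continuous_toFun := by fun_prop
  continuous_invFun := by fun_prop

theorem vecMulEquiv_iterate (k : GLn n R) (m : ℕ) (z : Fin n → R) :
    (vecMulEquiv k)^[m] z = Matrix.vecMul z (k ^ m).1 := by
  induction m with
  | zero => simp
  | succ m ih =>
    rw [Function.iterate_succ_apply', ih]
    change Matrix.vecMul (Matrix.vecMul z (k ^ m).1) k.1 = _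
    rw [Matrix.vecMul_vecMul, pow_succ, Units.val_mul]

theorem norm_vecMul_le (hK : IwasawaFamily K) {k : GLn n R} (hk : k ∈ K n) {z : Fin n → R}
    (hz : ‖z‖ ≤ 1) : ‖Matrix.vecMul z k.1‖ ≤ n := by
  rw [pi_norm_le_iff_of_nonneg (Nat.cast_nonneg n)]
  intro j
  rw [Matrix.vecMul, dotProduct]
  refine (norm_sum_le _ _).trans ?_
  refine (Finset.sum_le_sum fun i _ => (norm_mul_le _ _).trans (mul_le_mul
    ((norm_le_pi_norm z i).trans hz) (hK.norm_le n k hk i j) (norm_nonneg _) zero_le_one)).trans ?_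
  simp

/-- Powers of k and of its inverse map the unit ball into the ball of radius n, so `haarChar_eq_one`
applies. -/
theorem measurePreserving_vecMul (hK : IwasawaFamily K) {k : GLn n R} (hk : k ∈ K n) :
    MeasurePreserving (vecMulEquiv k) volume volume := by
  have h0 : (volume : Measure (Fin n → R)).IsAddHaarMeasure := Measure.pi.isAddHaarMeasure _
  refine map_addEquiv_eq _ _ (haarChar_eq_one _ (B := Metric.closedBall 0 1)
    (C := Metric.closedBall 0 n) ?_ (isCompact_closedBall _ _) (isCompact_closedBall _ _) ?_ ?_)
  · exact ⟨0, mem_interior_iff_mem_nhds.2 (Metric.closedBall_mem_nhds _ one_pos)⟩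
  · intro m x hx
    rw [vecMulEquiv_iterate, mem_closedBall_zero_iff]
    exact norm_vecMul_le hK (pow_mem hk m) (mem_closedBall_zero_iff.1 hx)
  · intro m x hx
    change (vecMulEquiv k⁻¹)^[m] x ∈ _
    rw [vecMulEquiv_iterate, mem_closedBall_zero_iff]
    exact norm_vecMul_le hK (pow_mem (inv_mem hk) m) (mem_closedBall_zero_iff.1 hx)

theorem det_glLow_one (z : Fin n → R) : (glLow (1 : GLn n R) z).1.det = 1 := by
  have h : (glLow (1 : GLn n R) z).1.BlockTriangular OrderDual.toDual := by
    intro i j hij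
    have hij' : i < j := hij
    revert hij'
    refine Fin.lastCases ?_ (fun i => ?_) i <;> refine Fin.lastCases ?_ (fun j => ?_) j
    · simp
    · intro h; exact absurd h (not_lt.2 (Fin.le_last _))
    · simp [glLow]
    · intro h; simp [glLow, Matrix.one_apply_ne (show i ≠ j from (Fin.castSucc_lt_castSucc_iff.1 h).ne)]
  rw [Matrix.det_of_isLowerTriangular _ h, Fin.prod_univ_castSucc]
  simp [glLow]

/-- Apply the minor bound with p = e + (1 - e) σ, where σ transposes column j with the last one. The
rows strictly between j and the last are unaffected by p, so the minor of the rows below j is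
triangular with the single nontrivial diagonal entry e + (1 - e) z_j. The element e allows the
choice between 1 and z_j to be made separately in each factor of a product of fields. -/
theorem exists_le_iwasawaD_glLow (hR : TameNabs R) (hK : IwasawaFamily K) (n : ℕ) : ∃ C : ℝ, 0 < C ∧
    ∀ (z : Fin n → R) (j : Fin n) (e : R), ‖e‖ ≤ 1 → ‖1 - e‖ ≤ 1 →
      nabs R (e + (1 - e) * z j) ≤ C * iwasawaD (K (n + 1)) (glLow 1 z).1 j.succ := by
  obtain ⟨C, hC, h⟩ := exists_corner_bound hR hK (n + 1)
  refine ⟨C, hC, fun z j e he he' => ?_⟩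
  let p : Matrix (Fin (n + 1)) (Fin (n + 1)) R :=
    e • 1 + (1 - e) • (Matrix.of fun a c => (1 : Matrix (Fin (n + 1)) (Fin (n + 1)) R) a
      (Equiv.swap j.castSucc (Fin.last n) c))
  have hone : ∀ a c, ‖(1 : Matrix (Fin (n + 1)) (Fin (n + 1)) R) a c‖ ≤ 1 := by
    intro a c; rw [Matrix.one_apply]; split_ifs <;> simp
  have hp : ∀ a c, ‖p a c‖ ≤ 2 := by
    intro a c
    simp only [p, Matrix.add_apply, Matrix.smul_apply, Matrix.of_apply, smul_eq_mul]
    refine (norm_add_le _ _).trans ?_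
    have h1 := (norm_mul_le e ((1 : Matrix (Fin (n + 1)) (Fin (n + 1)) R) a c)).trans
      (mul_le_one₀ he (norm_nonneg _) (hone a c))
    have h2 := (norm_mul_le (1 - e) ((1 : Matrix (Fin (n + 1)) (Fin (n + 1)) R) a
      (Equiv.swap j.castSucc (Fin.last n) c))).trans (mul_le_one₀ he' (norm_nonneg _) (hone _ _))
    linarith
  refine le_trans (le_of_eq ?_) (h (glLow 1 z) p hp j.succ)
  congr 1
  let g := (glLow 1 z).1
  have hrow : ∀ i : Fin n, j < i → ∀ c, (g * p) i.castSucc c =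
      (1 : Matrix (Fin (n + 1)) (Fin (n + 1)) R) i.castSucc c := by
    intro i hi c
    have h1 : (g * p) i.castSucc c = p i.castSucc c := by
      rw [Matrix.mul_apply, Finset.sum_eq_single i.castSucc]
      · simp [g, glLow]
      · intro a _ ha
        revert ha
        refine Fin.lastCases ?_ (fun a => ?_) a
        · simp [g, glLow]
        · intro ha
          have : i ≠ a := fun h => ha (by rw [h])
          simp [g, glLow, Matrix.one_apply_ne this]
      · simp
    rw [h1]
    simp only [p, Matrix.add_apply, Matrix.smul_apply, Matrix.of_apply, smul_eq_mul,
      Matrix.one_apply]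
    have h2 : (i.castSucc = Equiv.swap j.castSucc (Fin.last n) c) ↔ i.castSucc = c := by
      rw [← Equiv.symm_apply_eq, Equiv.symm_swap, Equiv.swap_apply_of_ne_of_ne]
      · exact fun h => hi.ne' (Fin.castSucc_injective _ h)
      · exact (Fin.castSucc_lt_last i).ne
    simp only [h2]
    split_ifs <;> ring
  have hlow : ∀ a c, a < c → cornerMat j.succ (g * p) a c = 0 := by
    intro a c hac
    by_cases ha : a < j.succ
    · simp [cornerMat, ha, Matrix.one_apply_ne hac.ne]
    · simp only [cornerMat, Matrix.of_apply, ha, if_false]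
      revert hac ha
      refine Fin.lastCases ?_ (fun a => ?_) a
      · intro h; exact absurd h (not_lt.2 (Fin.le_last _))
      · intro hac ha
        rw [hrow a _ c, Matrix.one_apply_ne hac.ne]
        rw [not_lt, Fin.le_def] at ha
        rw [Fin.lt_def]
        simp at ha
        omega
  have hlast : (g * p) (Fin.last n) (Fin.last n) = e + (1 - e) * z j := by
    rw [Matrix.mul_apply, Fin.sum_univ_castSucc]
    have h3 : ∀ i : Fin n, p i.castSucc (Fin.last n) = if i = j then 1 - e else 0 := by
      intro i
      simp only [p, Matrix.add_apply, Matrix.smul_apply, Matrix.of_apply, smul_eq_mul,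
        Equiv.swap_apply_right, Matrix.one_apply]
      simp [Fin.ext_iff, i.2.ne]
    have h4 : p (Fin.last n) (Fin.last n) = e := by
      simp only [p, Matrix.add_apply, Matrix.smul_apply, Matrix.of_apply, smul_eq_mul,
        Equiv.swap_apply_right, Matrix.one_apply]
      simp [Fin.ext_iff, j.2.ne']
    simp [h3, h4, g, glLow]
    ring
  have hdet : (cornerMat j.succ (g * p)).det = (g * p) (Fin.last n) (Fin.last n) := by
    have h5 : (cornerMat j.succ (g * p)).BlockTriangular OrderDual.toDual := fun a c h =>
      hlow a c h
    rw [Matrix.det_of_isLowerTriangular _ h5, Fin.prod_univ_castSucc]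
    have h6 : ∀ i : Fin n, cornerMat j.succ (g * p) i.castSucc i.castSucc = 1 := by
      intro i
      by_cases hi : i.castSucc < j.succ
      · simp [cornerMat, hi]
      · simp only [cornerMat, Matrix.of_apply, hi, if_false]
        rw [hrow, Matrix.one_apply_eq]
        rw [not_lt, Fin.le_def] at hi
        rw [Fin.lt_def]
        simp at hi
        omega
    simp only [h6, Finset.prod_const_one, one_mul]
    simp [cornerMat, not_lt.2 (Fin.le_last j.succ)]
  change _ = (cornerMat j.succ (g * p)).det
  rw [hdet, hlast]

theorem iwasawaD_zero (hR : TameNabs R) (hK : IwasawaFamily K) (g : GLn (n + 1) R) :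
    iwasawaD (K (n + 1)) g.1 0 = nabs R g.1.det := by
  rw [← prod_iwasawaT hR hK, iwasawaD_eq]
  simp

/-- D_0 is the absolute value of the determinant, which is 1, and each D_{j+1} dominates the height
of z_j. The integrand is thus bounded by a product of integrable functions of one variable each. -/
theorem lintegral_glLow_lt_top (hR : TameNabs R) (hK : IwasawaFamily K) (hM : HasHeight R) {s : ℝ}
    (hs : 1 < s) : ∫⁻ z : Fin n → R,
      ENNReal.ofReal ((∏ m, iwasawaD (K (n + 1)) (glLow 1 z).1 m) ^ (-s)) < ⊤ := by
  obtain ⟨M, hMm, hM1, hMe, hMs⟩ := hM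
  obtain ⟨C, hC, h⟩ := exists_le_iwasawaD_glLow hR hK n
  have hle : ∀ z : Fin n → R, ENNReal.ofReal ((∏ m, iwasawaD (K (n + 1)) (glLow 1 z).1 m) ^ (-s)) ≤
      ENNReal.ofReal ((C ^ (-s)) ^ n)⁻¹ * ∏ j : Fin n, ENNReal.ofReal (M (z j) ^ (-s)) := by
    intro z
    rw [← ENNReal.ofReal_prod_of_nonneg
      (fun j _ => Real.rpow_nonneg (zero_le_one.trans (hM1 _)) _),
      ← ENNReal.ofReal_mul (by positivity)]
    refine ENNReal.ofReal_le_ofReal ?_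
    rw [Fin.prod_univ_succ, iwasawaD_zero hR hK, det_glLow_one, nabs_one, one_mul,
      ← Real.finsetProd_rpow _ _ (fun j _ => (iwasawaD_pos hR hK _ _).le), ← inv_pow]
    have h1 : ∀ j : Fin n, iwasawaD (K (n + 1)) (glLow 1 z).1 j.succ ^ (-s) ≤
        (C ^ (-s))⁻¹ * M (z j) ^ (-s) := by
      intro j
      obtain ⟨e, he, he', hle⟩ := hMe (z j)
      have h2 : M (z j) ≤ C * iwasawaD (K (n + 1)) (glLow 1 z).1 j.succ :=
        hle.trans (h z j e he he')
      have hMpos : 0 < M (z j) := zero_lt_one.trans_le (hM1 _)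
      have h3 := Real.rpow_le_rpow_of_nonpos hMpos h2 (by linarith : -s ≤ 0)
      rw [Real.mul_rpow hC.le (iwasawaD_pos hR hK _ _).le] at h3
      rw [inv_mul_eq_div, le_div_iff₀ (by positivity), mul_comm]
      exact h3
    refine (Finset.prod_le_prod (fun j _ => Real.rpow_nonneg (iwasawaD_pos hR hK _ _).le _)
      fun j _ => h1 j).trans (le_of_eq ?_)
    rw [Finset.prod_mul_distrib]
    simp
  refine (lintegral_mono hle).trans_lt ?_
  rw [lintegral_const_mul' _ _ ENNReal.ofReal_ne_top]
  refine ENNReal.mul_lt_top ENNReal.ofReal_lt_top ?_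
  rw [lintegral_pi_prod (fun _ x => ENNReal.ofReal (M x ^ (-s)))
    (fun _ => (hMm.pow_const _).ennreal_ofReal)]
  exact ENNReal.prod_lt_top fun _ _ => hMs s hs

/-- The unipotent lower triangular matrices. -/
def IsLowUnip (l : Matrix (Fin n) (Fin n) R) : Prop := (∀ i j, i < j → l i j = 0) ∧ ∀ i, l i i = 1

/-- The unipotent upper triangular matrices. -/
def IsUpUnip (l : Matrix (Fin n) (Fin n) R) : Prop := (∀ i j, j < i → l i j = 0) ∧ ∀ i, l i i = 1

theorem isClosed_isLowUnip : IsClosed {l : Matrix (Fin n) (Fin n) R | IsLowUnip l} := by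
  refine IsClosed.inter ?_ ?_
  · change IsClosed {l : Matrix (Fin n) (Fin n) R | ∀ i j, i < j → l i j = 0}
    simp only [Set.ofPred_forall]
    exact isClosed_iInter fun a => isClosed_iInter fun c => isClosed_iInter fun _ =>
      isClosed_eq (continuous_matrix_entry a c) continuous_const
  · change IsClosed {l : Matrix (Fin n) (Fin n) R | ∀ i, l i i = 1}
    simp only [Set.ofPred_forall]
    exact isClosed_iInter fun a => isClosed_eq (continuous_matrix_entry a a) continuous_const

theorem isClosed_isUpUnip : IsClosed {l : Matrix (Fin n) (Fin n) R | IsUpUnip l} := by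
  refine IsClosed.inter ?_ ?_
  · change IsClosed {l : Matrix (Fin n) (Fin n) R | ∀ i j, j < i → l i j = 0}
    simp only [Set.ofPred_forall]
    exact isClosed_iInter fun a => isClosed_iInter fun c => isClosed_iInter fun _ =>
      isClosed_eq (continuous_matrix_entry a c) continuous_const
  · change IsClosed {l : Matrix (Fin n) (Fin n) R | ∀ i, l i i = 1}
    simp only [Set.ofPred_forall]
    exact isClosed_iInter fun a => isClosed_eq (continuous_matrix_entry a a) continuous_const

theorem isLowUnip_blk {l : Matrix (Fin n) (Fin n) R} (hl : IsLowUnip l) (z : Fin n → R) :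
    IsLowUnip (blk l 0 z 1) := by
  refine ⟨fun i j => ?_, fun i => ?_⟩
  · refine Fin.lastCases ?_ (fun i => ?_) i <;> refine Fin.lastCases ?_ (fun j => ?_) j
    · simp
    · intro h; exact absurd h (not_lt.2 (Fin.le_last _))
    · simp
    · intro h; simpa using hl.1 i j h
  · refine Fin.lastCases ?_ (fun i => ?_) i
    · simp
    · simpa using hl.2 i

theorem isUpUnip_blk {l : Matrix (Fin n) (Fin n) R} (hl : IsUpUnip l) (z : Fin n → R) :
    IsUpUnip (blk l z 0 1) := by
  refine ⟨fun i j => ?_, fun i => ?_⟩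
  · refine Fin.lastCases ?_ (fun i => ?_) i <;> refine Fin.lastCases ?_ (fun j => ?_) j
    · simp
    · simp
    · intro h; exact absurd h (not_lt.2 (Fin.le_last _))
    · intro h; simpa using hl.1 i j h
  · refine Fin.lastCases ?_ (fun i => ?_) i
    · simp
    · simpa using hl.2 i

theorem ae_lowM : ∀ n : ℕ, ∀ᵐ l ∂(lowM R n), IsLowUnip l
  | 0 => by
    unfold lowM
    rw [ae_dirac_iff isClosed_isLowUnip.measurableSet]
    exact ⟨fun i => i.elim0, fun i => i.elim0⟩
  | n + 1 => by
    unfold lowM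
    have hm : Measurable fun p : (Fin n → R) × Matrix (Fin n) (Fin n) R => blk p.2 0 p.1 1 :=
      Measurable.blk' measurable_snd measurable_const measurable_fst measurable_const
    rw [ae_map_iff hm.aemeasurable isClosed_isLowUnip.measurableSet]
    have h := (Measure.quasiMeasurePreserving_snd
      (μ := (volume : Measure (Fin n → R))) (ν := lowM R n)).ae (ae_lowM n)
    exact h.mono fun p hp => isLowUnip_blk hp _

theorem ae_upM : ∀ n : ℕ, ∀ᵐ l ∂(upM R n), IsUpUnip l
  | 0 => by
    unfold upM
    rw [ae_dirac_iff isClosed_isUpUnip.measurableSet]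
    exact ⟨fun i => i.elim0, fun i => i.elim0⟩
  | n + 1 => by
    unfold upM
    have hm : Measurable fun p : (Fin n → R) × Matrix (Fin n) (Fin n) R => blk p.2 p.1 0 1 :=
      Measurable.blk' measurable_snd measurable_fst measurable_const measurable_const
    rw [ae_map_iff hm.aemeasurable isClosed_isUpUnip.measurableSet]
    have h := (Measure.quasiMeasurePreserving_snd
      (μ := (volume : Measure (Fin n → R))) (ν := upM R n)).ae (ae_upM n)
    exact h.mono fun p hp => isUpUnip_blk hp _

theorem IsLowUnip.det {l : Matrix (Fin n) (Fin n) R} (hl : IsLowUnip l) : l.det = 1 := by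
  have h : l.BlockTriangular OrderDual.toDual := fun i j h => hl.1 i j h
  rw [Matrix.det_of_isLowerTriangular _ h]
  simp [hl.2]

theorem IsLowUnip.isUnit {l : Matrix (Fin n) (Fin n) R} (hl : IsLowUnip l) : IsUnit l := by
  rw [Matrix.isUnit_iff_isUnit_det, hl.det]
  exact isUnit_one

theorem IsUpUnip.det {l : Matrix (Fin n) (Fin n) R} (hl : IsUpUnip l) : l.det = 1 := by
  have h : l.BlockTriangular id := fun i j h => hl.1 i j h
  rw [Matrix.det_of_isUpperTriangular h]
  simp [hl.2]

theorem IsUpUnip.isUnit {l : Matrix (Fin n) (Fin n) R} (hl : IsUpUnip l) : IsUnit l := by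
  rw [Matrix.isUnit_iff_isUnit_det, hl.det]
  exact isUnit_one

/-- Convergence of `∫ ∏_m D_m(l) ^ (-s) dl` over the lower triangular unipotent matrices. -/
theorem lintegral_lowM_lt_top (hR : TameNabs R) (hK : IwasawaFamily K) (hM : HasHeight R) {s : ℝ}
    (hs : 1 < s) (n : ℕ) :
    ∫⁻ l, ENNReal.ofReal ((∏ m, iwasawaD (K n) l m) ^ (-s)) ∂(lowM R n) < ⊤ := by
  induction n with
  | zero => simp [lowM]
  | succ n ih =>
    have hm : ∀ n : ℕ, Measurable fun l : Matrix (Fin n) (Fin n) R =>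
        ENNReal.ofReal ((∏ m, iwasawaD (K n) l m) ^ (-s)) := fun n =>
      ((Finset.measurable_prod _ fun i _ => measurable_iwasawaD hR hK i).pow_const _).ennreal_ofReal
    have hm' : Measurable fun p : (Fin n → R) × Matrix (Fin n) (Fin n) R =>
        ENNReal.ofReal ((∏ m, iwasawaD (K (n + 1)) (blk p.2 0 p.1 1) m) ^ (-s)) :=
      measurable_blk_comp (hm (n + 1)) measurable_snd measurable_const measurable_fst
        measurable_const
    rw [lintegral_lowM_succ (hm (n + 1)), lintegral_lintegral_swap hm'.aemeasurable]
    -- Write l = b k. After the measure preserving substitution z ↦ z k⁻¹ the product of the D_m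
    -- splits into a factor depending on l alone and one depending on z alone, so the integral over
    -- the last row is the same constant for almost every l.
    have hstep : ∀ᵐ l ∂(lowM R n), ∫⁻ z : Fin n → R,
        ENNReal.ofReal ((∏ m, iwasawaD (K (n + 1)) (blk l 0 z 1) m) ^ (-s)) =
        (∫⁻ z : Fin n → R,
          ENNReal.ofReal ((∏ m, iwasawaD (K (n + 1)) (glLow 1 z).1 m) ^ (-s))) *
        ENNReal.ofReal ((∏ m, iwasawaD (K n) l m) ^ (-s)) := by
      refine (ae_lowM n).mono fun l hl => ?_
      obtain ⟨g, rfl⟩ := hl.isUnit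
      obtain ⟨b, hb, k, hk, rfl⟩ := exists_iwasawa hK g
      have hint : Measurable fun z : Fin n → R =>
          ENNReal.ofReal ((∏ m, iwasawaD (K (n + 1)) (glLow 1 z).1 m) ^ (-s)) :=
        measurable_blk_comp (hm (n + 1)) measurable_const measurable_const measurable_id
          measurable_const
      rw [← (measurePreserving_vecMul hK (inv_mem hk)).lintegral_comp hint,
        ← lintegral_mul_const' _ _ ENNReal.ofReal_ne_top]
      refine lintegral_congr fun z => ?_
      rw [← ENNReal.ofReal_mul (Real.rpow_nonneg (Finset.prod_nonneg fun _ _ =>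
        (iwasawaD_pos hR hK _ _).le) _), ← Real.mul_rpow (Finset.prod_nonneg fun _ _ =>
        (iwasawaD_pos hR hK _ _).le) (Finset.prod_nonneg fun _ _ =>
        (iwasawaD_pos hR hK _ _).le), mul_comm]
      exact congrArg (fun x => ENNReal.ofReal (x ^ (-s))) (prod_iwasawaD_glLow hR hK hb hk z)
    rw [lintegral_congr_ae hstep, lintegral_const_mul _ (hm n)]
    exact ENNReal.mul_lt_top (lintegral_glLow_lt_top hR hK hM hs) ih

end LowerIntegral

/-! ## Integration over `K` in terms of lower triangular matrices -/

section HalfMod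

variable {n : ℕ}

/-- The character `∏ x_i ^ ((n - 1 - 2 i) / 2)`. -/
def halfMod (x : Fin n → ℝ) : ℝ := ∏ i : Fin n, x i ^ (((n : ℝ) - 1 - 2 * (i : ℕ)) / 2)

theorem halfMod_mul {x y : Fin n → ℝ} (hx : ∀ i, 0 ≤ x i) (hy : ∀ i, 0 ≤ y i) :
    halfMod (fun i => x i * y i) = halfMod x * halfMod y := by
  simp only [halfMod, ← Finset.prod_mul_distrib]
  exact Finset.prod_congr rfl fun i _ => Real.mul_rpow (hx i) (hy i)

theorem halfMod_nonneg {x : Fin n → ℝ} (hx : ∀ i, 0 ≤ x i) : 0 ≤ halfMod x :=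
  Finset.prod_nonneg fun i _ => Real.rpow_nonneg (hx i) _

theorem halfMod_pos {x : Fin n → ℝ} (hx : ∀ i, 0 < x i) : 0 < halfMod x :=
  Finset.prod_pos fun i _ => Real.rpow_pos_of_pos (hx i) _

theorem prod_prod_Ici (x : Fin n → ℝ) :
    ∏ m, ∏ i ∈ Finset.Ici m, x i = ∏ i : Fin n, x i ^ ((i : ℕ) + 1) := by
  have h : ∀ m : Fin n, ∏ i ∈ Finset.Ici m, x i = ∏ i, if m ≤ i then x i else 1 := by
    intro m
    rw [← Finset.prod_filter]
    congr 1
    ext i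
    simp
  simp only [h]
  rw [Finset.prod_comm]
  refine Finset.prod_congr rfl fun i _ => ?_
  rw [← Finset.prod_filter, Finset.prod_const]
  congr 1
  have : (Finset.univ.filter fun m : Fin n => m ≤ i) = Finset.Iic i := by ext; simp
  rw [this, Fin.card_Iic]

/-- The variable x_i occurs in i + 1 of the products over i ≥ m, and (n - 1 - 2i)/2 = (n + 1)/2 - (i
+ 1). In this form the square root of the modular character is a power of the determinant divided by
the product of the D_m. -/
theorem halfMod_eq {x : Fin n → ℝ} (hx : ∀ i, 0 < x i) :
    halfMod x = (∏ i, x i) ^ (((n : ℝ) + 1) / 2) * (∏ m, ∏ i ∈ Finset.Ici m, x i)⁻¹ := by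
  rw [prod_prod_Ici, ← Real.finsetProd_rpow _ _ (fun i _ => (hx i).le), ← Finset.prod_inv_distrib,
    ← Finset.prod_mul_distrib]
  refine Finset.prod_congr rfl fun i _ => ?_
  rw [← Real.rpow_natCast, ← Real.rpow_neg (hx i).le, ← Real.rpow_add (hx i)]
  congr 1
  push_cast
  ring

end HalfMod

section SigmaCompactImage

theorem measurableSet_image_of_isClosed {X Y : Type*} [TopologicalSpace X] [SigmaCompactSpace X]
    [TopologicalSpace Y] [T2Space Y] [MeasurableSpace Y] [OpensMeasurableSpace Y] {f : X → Y}
    (hf : Continuous f) {S : Set X} (hS : IsClosed S) : MeasurableSet (f '' S) := by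
  obtain ⟨Q, hQ, hQ2⟩ := (isSigmaCompact_univ.of_isClosed_subset hS (Set.subset_univ _)).image hf
  rw [← hQ2]
  exact MeasurableSet.iUnion fun q => (hQ q).measurableSet

end SigmaCompactImage

theorem eq_blk {R : Type*} {n : ℕ} (A : Matrix (Fin (n + 1)) (Fin (n + 1)) R) :
    A = blk (Matrix.of fun i j => A i.castSucc j.castSucc) (fun i => A i.castSucc (Fin.last n))
      (fun j => A (Fin.last n) j.castSucc) (A (Fin.last n) (Fin.last n)) := by
  refine ext_blk (fun i j => ?_) (fun i => ?_) (fun j => ?_) ?_ <;> simp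

/-! ### Functions equivariant under B, integrated over the open cell -/

section KIntegral

variable {R : Type*} [NormedCommRing R] [NormOneClass R] [ProperSpace R] [MeasureSpace R]
  [BorelSpace R] [(volume : Measure R).IsAddHaarMeasure] {n : ℕ}

/-- For fixed u the last column is merely translated by u y', so integrating over it first removes
that part of v; the remaining block is handled by induction. -/
theorem lintegral_upM_mul_right : ∀ (n : ℕ) {v : Matrix (Fin n) (Fin n) R} (_ : IsUpUnip v)
    {f : Matrix (Fin n) (Fin n) R → ℝ≥0∞} (_ : Measurable f),
    ∫⁻ u, f (u * v) ∂(upM R n) = ∫⁻ u, f u ∂(upM R n)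
  | 0, v, _, f, _ => by
    have h : ∀ u : Matrix (Fin 0) (Fin 0) R, u * v = u := fun u => Subsingleton.elim _ _
    simp only [h]
  | n + 1, v, hv, f, hf => by
    obtain ⟨v', y', hv', rfl⟩ : ∃ (v' : Matrix (Fin n) (Fin n) R) (y' : Fin n → R),
        IsUpUnip v' ∧ v = blk v' y' 0 1 := by
      refine ⟨Matrix.of fun i j => v i.castSucc j.castSucc, fun i => v i.castSucc (Fin.last n),
        ⟨fun i j h => ?_, fun i => ?_⟩, (eq_blk v).trans ?_⟩
      · exact hv.1 _ _ (Fin.castSucc_lt_castSucc_iff.2 h)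
      · exact hv.2 _
      · congr 1
        · ext j; exact hv.1 _ _ (Fin.castSucc_lt_last j)
        · exact hv.2 _
    have hm : Measurable fun u => f (u * blk v' y' 0 1) :=
      hf.comp (Measurable.matrix_mul measurable_id measurable_const)
    have hm1 : Measurable fun p : (Fin n → R) × Matrix (Fin n) (Fin n) R =>
        f (blk (p.2 * v') (p.2.mulVec y' + p.1) 0 1) :=
      measurable_blk_comp hf (Measurable.matrix_mul measurable_snd measurable_const)
        ((by fun_prop : Continuous fun p : (Fin n → R) × Matrix (Fin n) (Fin n) R =>
          p.2.mulVec y' + p.1).measurable) measurable_const measurable_const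
    have hm2 : Measurable fun p : (Fin n → R) × Matrix (Fin n) (Fin n) R =>
        f (blk (p.2 * v') p.1 0 1) :=
      measurable_blk_comp hf (Measurable.matrix_mul measurable_snd measurable_const)
        measurable_fst measurable_const measurable_const
    rw [lintegral_upM_succ hm, lintegral_upM_succ hf]
    have h1 : ∀ (u : Matrix (Fin n) (Fin n) R) (y : Fin n → R),
        blk u y 0 1 * blk v' y' 0 1 = blk (u * v') (u.mulVec y' + y) 0 1 := by
      intro u y; simp [blk_mul_blk]
    simp only [h1]
    rw [lintegral_lintegral_swap hm1.aemeasurable]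
    have h2 : ∀ u : Matrix (Fin n) (Fin n) R, ∫⁻ y : Fin n → R,
        f (blk (u * v') (u.mulVec y' + y) 0 1) = ∫⁻ y : Fin n → R, f (blk (u * v') y 0 1) :=
      fun u => lintegral_add_left_eq_self (μ := (volume : Measure (Fin n → R)))
        (fun y => f (blk (u * v') y 0 1)) (u.mulVec y')
    simp only [h2]
    rw [← lintegral_lintegral_swap hm2.aemeasurable]
    refine lintegral_congr fun y => ?_
    exact lintegral_upM_mul_right n hv' (f := fun u => f (blk u y 0 1))
      (measurable_blk_comp hf measurable_id measurable_const measurable_const measurable_const)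

variable {K : ∀ n, Subgroup (GLn n R)}

theorem measurePreserving_mul_right (hK : IwasawaFamily K) {k : GLn n R} (hk : k ∈ K n) :
    MeasurePreserving (fun X : Matrix (Fin n) (Fin n) R => X * k.1) volume volume := by
  have h := measurePreserving_pi (fun _ : Fin n => (volume : Measure (Fin n → R)))
    (fun _ : Fin n => (volume : Measure (Fin n → R))) (fun _ => measurePreserving_vecMul hK hk)
  exact h

/-- The upper triangular matrix `b` is a product of a unipotent and a diagonal one. -/
theorem exists_unip_mul_torus {b : GLn n R} (hb : b.1.BlockTriangular id) :
    ∃ (u : Matrix (Fin n) (Fin n) R) (t : Fin n → Rˣ), IsUpUnip u ∧ b.1 = u * (torus t).1 ∧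
      ∀ i, b.1 i i = t i := by
  let t : Fin n → Rˣ := fun i => (upper_diag_isUnit hb i).unit
  have ht : ∀ i, b.1 i i = t i := fun i => rfl
  refine ⟨b.1 * (torus fun i => (t i)⁻¹).1, t, ⟨fun i j h => ?_, fun i => ?_⟩, ?_, ht⟩
  · change (b.1 * Matrix.diagonal fun i => (((t i)⁻¹ : Rˣ) : R)) i j = 0
    rw [Matrix.mul_diagonal, hb (show id j < id i from h), zero_mul]
  · change (b.1 * Matrix.diagonal fun i => (((t i)⁻¹ : Rˣ) : R)) i i = 1
    rw [Matrix.mul_diagonal, ht, Units.mul_inv]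
  · rw [mul_assoc, ← Units.val_mul, ← torus_inv, inv_mul_cancel, Units.val_one, mul_one]

theorem torus_upper (t : Fin n → Rˣ) : (torus t).1.BlockTriangular id := by
  intro i j h
  exact Matrix.diagonal_apply_ne _ (ne_of_gt (show j < i from h))

theorem cellDensity_units (t : Fin n → Rˣ) :
    cellDensity (fun i => (t i : R)) = ENNReal.ofReal (∏ i : Fin n, nabs R (t i) ^ (2 * (i : ℕ))) := by
  rw [cellDensity, ENNReal.ofReal_prod_of_nonneg (fun i _ => pow_nonneg (nabs_nonneg _) _)]
  exact Finset.prod_congr rfl fun i _ => (ENNReal.ofReal_pow (nabs_nonneg _) _).symm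

theorem ae_forall_isUnit (hu : ∀ᵐ x : R, IsUnit x) :
    ∀ᵐ t : Fin n → R, ∀ i, IsUnit (t i) := by
  rw [ae_all_iff]
  intro i
  exact (Measure.quasiMeasurePreserving_eval (fun _ => (volume : Measure R)) i).ae hu

/-- Each factor of halfMod(x)² ∏ x_i^{2i} equals x_i^{n-1}, so this product is 1 when ∏ x_i = 1.
Hence dividing t by x changes the torus density by exactly the factor halfMod(x). -/
theorem halfMod_shift {x y : Fin n → ℝ} (hx : ∀ i, 0 < x i) (hy : ∀ i, 0 < y i)
    (hp : ∏ i, x i = 1) :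
    (∏ i, x i)⁻¹ * (halfMod (fun i => (x i)⁻¹ * y i) * ∏ i : Fin n, ((x i)⁻¹ * y i) ^ (2 * (i : ℕ))) =
      halfMod x * (halfMod y * ∏ i : Fin n, y i ^ (2 * (i : ℕ))) := by
  have h1 : halfMod x * (halfMod x * ∏ i : Fin n, x i ^ (2 * (i : ℕ))) = 1 := by
    have : ∀ i : Fin n, x i ^ (((n : ℝ) - 1 - 2 * (i : ℕ)) / 2) *
        (x i ^ (((n : ℝ) - 1 - 2 * (i : ℕ)) / 2) * x i ^ (2 * (i : ℕ))) = x i ^ ((n : ℝ) - 1) := by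
      intro i
      rw [← Real.rpow_natCast, ← Real.rpow_add (hx i), ← Real.rpow_add (hx i)]
      congr 1
      push_cast
      ring
    simp only [halfMod, ← Finset.prod_mul_distrib, this]
    rw [Real.finsetProd_rpow _ _ (fun i _ => (hx i).le), hp, Real.one_rpow]
  have h2 : halfMod (fun i => (x i)⁻¹) * halfMod x = 1 := by
    rw [← halfMod_mul (fun i => (inv_pos.2 (hx i)).le) (fun i => (hx i).le)]
    simp [fun i => inv_mul_cancel₀ (hx i).ne', halfMod]
  rw [halfMod_mul (fun i => (inv_pos.2 (hx i)).le) (fun i => (hy i).le), hp, inv_one, one_mul]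
  simp only [mul_pow, Finset.prod_mul_distrib, inv_pow, Finset.prod_inv_distrib]
  have hxp : 0 < ∏ i : Fin n, x i ^ (2 * (i : ℕ)) := Finset.prod_pos fun i _ => pow_pos (hx i) _
  have hh := halfMod_pos hx
  have h3 : halfMod (fun i => (x i)⁻¹) = (halfMod x)⁻¹ := eq_inv_of_mul_eq_one_left h2
  rw [h3]
  field_simp
  linear_combination (-(halfMod y * ∏ i : Fin n, y i ^ (2 * (i : ℕ)))) * h1

variable (hR : TameNabs R) (hK : IwasawaFamily K)
include hR hK

/-- The function on `GL_n(R)` given by the modular character on `B` and invariant under `K`. -/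
theorem lintegral_cell_equivariant (hu : ∀ᵐ x : R, IsUnit x) (n : ℕ)
    {θ : Matrix (Fin n) (Fin n) R → ℝ≥0∞} (hθ : Measurable θ)
    (hθK : ∀ (g : GLn n R), ∀ k ∈ K n, θ (g.1 * k.1) = θ g.1) :
    ∃ c : ℝ≥0∞, ∀ F : Matrix (Fin n) (Fin n) R → ℝ≥0∞, Measurable F →
      (∀ b g : GLn n R, b.1.BlockTriangular id →
        F (b.1 * g.1) = ENNReal.ofReal (halfMod fun i => nabs R (b.1 i i)) * F g.1) →
      ∫⁻ X, F X * θ X =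
        c * ∫⁻ l, F l * ENNReal.ofReal (halfMod (iwasawaT (K n) l)) ∂(lowM R n) := by
  have hn : Measurable (nabs R) := hR.continuous_nabs.measurable
  obtain ⟨c, hc, hc', hcell⟩ := lintegral_cell hu hn n
  -- The weighted integral of θ over upper triangular matrices. It does not depend on F, and it is
  -- not yet known to be finite.
  let c2 : ℝ≥0∞ := ∫⁻ t : Fin n → R, ∫⁻ u, θ (u * Matrix.diagonal t) *
    (ENNReal.ofReal (halfMod fun i => nabs R (t i)) * cellDensity t) ∂(upM R n) ∂volume
  refine ⟨c * c2, fun F hF hFe => ?_⟩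
  have hmeas : Measurable fun l => F l * ENNReal.ofReal (halfMod (iwasawaT (K n) l)) :=
    hF.mul (Measurable.ennreal_ofReal (Finset.measurable_prod _ fun i _ =>
      (measurable_iwasawaT hR hK i).pow_const _))
  rw [hcell (fun X => F X * θ X) (hF.mul hθ), mul_assoc]
  congr 1
  rw [← lintegral_const_mul c2 hmeas]
  refine lintegral_congr_ae ((ae_lowM n).mono fun l hl => ?_)
  simp only
  obtain ⟨g, hg⟩ := hl.isUnit
  obtain ⟨b, hb, k, hk, hbk⟩ := exists_iwasawa hK g
  obtain ⟨v, t₁, hv, hbv, hbt⟩ := exists_unip_mul_torus hb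
  have hl1 : l = b.1 * k.1 := by rw [← hg, hbk, Units.val_mul]
  have hT : ∀ i, iwasawaT (K n) l i = nabs R (t₁ i : R) := fun i => by
    rw [hl1, iwasawaT_mul hR hK hb hk, hbt]
  have hprod : ∏ i, nabs R (t₁ i : R) = 1 := by
    have := prod_iwasawaT hR hK g
    rw [hg, hl.det, nabs_one] at this
    simpa [hT] using this
  -- the inner integral for fixed `t`
  have hθm : ∀ A : Matrix (Fin n) (Fin n) R, Measurable fun u => θ (u * A) := fun A =>
    hθ.comp (Measurable.matrix_mul measurable_id measurable_const)
  let G : (Fin n → R) → ℝ≥0∞ := fun t => ∫⁻ u, θ (u * Matrix.diagonal t) *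
    (ENNReal.ofReal (halfMod fun i => nabs R ((((t₁ i)⁻¹ : Rˣ) : R) * t i)) *
      cellDensity (fun i => (((t₁ i)⁻¹ : Rˣ) : R) * t i)) ∂(upM R n)
  have hmod : Measurable fun t : Fin n → R => ENNReal.ofReal (halfMod fun i => nabs R (t i)) :=
    Measurable.ennreal_ofReal (Finset.measurable_prod _ fun i _ =>
      (hn.comp (measurable_pi_apply i)).pow_const _)
  have hGm : Measurable G := by
    have hsh : Measurable fun (t : Fin n → R) i => (((t₁ i)⁻¹ : Rˣ) : R) * t i :=
      (by fun_prop : Continuous fun (t : Fin n → R) i => (((t₁ i)⁻¹ : Rˣ) : R) * t i).measurable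
    refine Measurable.lintegral_prod_right' (f := fun p : (Fin n → R) × Matrix (Fin n) (Fin n) R =>
      θ (p.2 * Matrix.diagonal p.1) *
        (ENNReal.ofReal (halfMod fun i => nabs R ((((t₁ i)⁻¹ : Rˣ) : R) * p.1 i)) *
        cellDensity (fun i => (((t₁ i)⁻¹ : Rˣ) : R) * p.1 i))) ?_
    refine Measurable.mul (hθ.comp (Measurable.matrix_mul measurable_snd
      (measurable_diagonal.comp measurable_fst))) (Measurable.mul ?_ ?_)
    · exact (hmod.comp hsh).comp measurable_fst
    · exact ((measurable_cellDensity hn).comp hsh).comp measurable_fst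
  have hinner : ∀ᵐ t : Fin n → R, ∫⁻ u, F (u * Matrix.diagonal t * l) * θ (u * Matrix.diagonal t * l) * cellDensity t
      ∂(upM R n) = F l * G (fun i => (t₁ i : R) * t i) := by
    refine (ae_forall_isUnit hu).mono fun t ht => ?_
    choose t' ht' using ht
    obtain rfl : (fun i => (t' i : R)) = t := funext ht'
    -- With l = v t₁ k and the diagonal t fixed, u t l = (u w)(t t₁) k where w = t v t⁻¹ is again
    -- unipotent. Right invariance of du removes w, and θ does not see k.
    let w : Matrix (Fin n) (Fin n) R := (torus t').1 * v * (torus t')⁻¹.1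
    have hw : IsUpUnip w := by
      refine ⟨fun i j hij => ?_, fun i => ?_⟩ <;>
      · simp only [w, torus_inv]
        change (Matrix.diagonal (fun i => (t' i : R)) * v *
          Matrix.diagonal fun i => (((t' i)⁻¹ : Rˣ) : R)) _ _ = _
        rw [Matrix.mul_diagonal, Matrix.diagonal_mul]
        first
          | rw [hv.1 _ _ hij]; simp
          | rw [hv.2]; simp
    have hae : ∀ᵐ u ∂(upM R n), F (u * Matrix.diagonal (fun i => (t' i : R)) * l) *
        θ (u * Matrix.diagonal (fun i => (t' i : R)) * l) *
        cellDensity (fun i => (t' i : R)) =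
        F l * (θ (u * w * Matrix.diagonal (fun i => (t₁ i : R) * t' i)) *
          (ENNReal.ofReal (halfMod fun i => nabs R (t' i : R)) *
          cellDensity (fun i => (t' i : R)))) := by
      refine (ae_upM n).mono fun u hu' => ?_
      obtain ⟨u₀, hu₀⟩ := hu'.isUnit
      have hub : (u₀ * torus t').1.BlockTriangular id := by
        refine Matrix.BlockTriangular.mul ?_ (torus_upper t')
        rw [hu₀]
        exact fun i j h => hu'.1 i j h
      have hdiag : ∀ i, (u₀ * torus t').1 i i = t' i := by
        intro i
        rw [Units.val_mul, hu₀]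
        change (u * Matrix.diagonal fun i => (t' i : R)) i i = _
        rw [Matrix.mul_diagonal, hu'.2, one_mul]
      have hFv : F (u * Matrix.diagonal (fun i => (t' i : R)) * l) =
          ENNReal.ofReal (halfMod fun i => nabs R (t' i : R)) * F l := by
        have := hFe (u₀ * torus t') g hub
        simp only [hdiag, hg] at this
        rw [← this, Units.val_mul, hu₀]
        rfl
      have hθv : θ (u * Matrix.diagonal (fun i => (t' i : R)) * l) =
          θ (u * w * Matrix.diagonal (fun i => (t₁ i : R) * t' i)) := by
        have h1 : u * Matrix.diagonal (fun i => (t' i : R)) * l =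
            (u₀ * torus t' * b).1 * k.1 := by
          rw [hl1, Units.val_mul, Units.val_mul, hu₀, ← mul_assoc]
          rfl
        have h2 : (u₀ * torus t' * b).1 = u * w * Matrix.diagonal (fun i => (t₁ i : R) * t' i) := by
          have h3 : Matrix.diagonal (fun i => (t₁ i : R) * t' i) = (torus t').1 * (torus t₁).1 := by
            change _ = Matrix.diagonal (fun i => (t' i : R)) * Matrix.diagonal fun i => (t₁ i : R)
            rw [Matrix.diagonal_mul_diagonal]
            exact congrArg _ (funext fun i => mul_comm _ _)
          rw [h3, Units.val_mul, Units.val_mul, hu₀, hbv]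
          simp only [w, mul_assoc]
          rw [← mul_assoc ((torus t')⁻¹).1 (torus t').1, ← Units.val_mul, inv_mul_cancel,
            Units.val_one, one_mul]
        rw [h1, hθK _ k hk, h2]
      rw [hFv, hθv]
      ring
    rw [lintegral_congr_ae hae, lintegral_const_mul]
    swap
    · refine Measurable.mul_const (hθ.comp ?_) _
      exact Measurable.matrix_mul (Measurable.matrix_mul measurable_id measurable_const)
        measurable_const
    congr 1
    rw [lintegral_upM_mul_right n hw
      (f := fun u => θ (u * Matrix.diagonal (fun i => (t₁ i : R) * t' i)) *
          (ENNReal.ofReal (halfMod fun i => nabs R (t' i : R)) *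
          cellDensity (fun i => (t' i : R)))) ((hθm _).mul_const _)]
    simp only [G, Units.inv_mul_cancel_left]
  rw [lintegral_congr_ae hinner, lintegral_const_mul]
  swap
  · exact hGm.comp ((by fun_prop : Continuous fun (t : Fin n → R) i => (t₁ i : R) * t i).measurable)
  -- The substitution that absorbs t₁ into t. The comparison of the two densities that remains is
  -- `halfMod_shift`, applicable because ∏ |t₁ i| = |det l| = 1.
  rw [lintegral_pi_unit_mul t₁ G hGm, mul_left_comm c2]
  congr 1
  rw [mul_comm c2, ← lintegral_const_mul' _ _ ENNReal.ofReal_ne_top]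
  simp only [c2]
  rw [← lintegral_const_mul' _ _ ENNReal.ofReal_ne_top]
  refine lintegral_congr_ae ((ae_forall_isUnit hu).mono fun t ht => ?_)
  choose t' ht' using ht
  obtain rfl : (fun i => (t' i : R)) = t := funext ht'
  simp only [G]
  rw [← lintegral_const_mul' _ _ ENNReal.ofReal_ne_top,
    ← lintegral_const_mul' _ _ ENNReal.ofReal_ne_top]
  refine lintegral_congr fun u => ?_
  rw [mul_left_comm, mul_left_comm (ENNReal.ofReal (halfMod _))]
  congr 1
  have h1 : (fun i => (((t₁ i)⁻¹ : Rˣ) : R) * (t' i : R)) = fun i => (((t₁ i)⁻¹ * t' i : Rˣ) : R) :=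
    funext fun i => (Units.val_mul _ _).symm
  have hnn : ∀ i, 0 ≤ nabs R (t' i : R) := fun i => nabs_nonneg _
  rw [h1, cellDensity_units, cellDensity_units, ← ENNReal.ofReal_mul (halfMod_nonneg fun i =>
    nabs_nonneg _), ← ENNReal.ofReal_mul (halfMod_nonneg fun i => nabs_nonneg _),
    ← ENNReal.ofReal_mul (inv_nonneg.2 (Finset.prod_nonneg fun i _ => nabs_nonneg _)),
    ← ENNReal.ofReal_mul (halfMod_nonneg fun i => iwasawaT_nonneg _ _ _)]
  congr 1
  have h2 := halfMod_shift (x := fun i => nabs R (t₁ i : R)) (y := fun i => nabs R (t' i : R))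
    (fun i => nabs_pos (t₁ i).isUnit) (fun i => nabs_pos (t' i).isUnit) hprod
  simp only [Units.val_mul, nabs_mul, nabs_units_inv]
  rw [show iwasawaT (K n) l = fun i => nabs R (t₁ i : R) from funext hT]
  exact h2

end KIntegral

/-! ## Bounds for spherical functions -/

theorem isClosed_entry_le {R : Type*} [NormedCommRing R] {n : ℕ} (B : ℝ) :
    IsClosed {Y : Matrix (Fin n) (Fin n) R | ∀ i j, ‖Y i j‖ ≤ B} := by
  change IsClosed {Y : Matrix (Fin n) (Fin n) R | ∀ i j, ‖Y i j‖ ≤ B}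
  simp only [Set.ofPred_forall]
  exact isClosed_iInter fun i => isClosed_iInter fun j =>
    isClosed_le (continuous_matrix_entry i j).norm continuous_const

theorem isCompact_entry_le {R : Type*} [NormedCommRing R] [ProperSpace R] {n : ℕ} (B : ℝ) :
    IsCompact {Y : Matrix (Fin n) (Fin n) R | ∀ i j, ‖Y i j‖ ≤ B} := by
  have h : IsCompact (Set.univ.pi fun _ : Fin n => Set.univ.pi fun _ : Fin n =>
      Metric.closedBall (0 : R) B) :=
    isCompact_univ_pi fun _ => isCompact_univ_pi fun _ => isCompact_closedBall _ _
  have he : {Y : Matrix (Fin n) (Fin n) R | ∀ i j, ‖Y i j‖ ≤ B} = Set.univ.pi fun _ : Fin n =>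
      Set.univ.pi fun _ : Fin n => Metric.closedBall (0 : R) B := by
    ext Y
    change _ ↔ ∀ i ∈ Set.univ, ∀ j ∈ Set.univ, Y i j ∈ Metric.closedBall (0 : R) B
    simp
  rw [he]
  exact h

section UnitMatrices

variable {R : Type*} [NormedCommRing R] [CompleteSpace R] {n : ℕ}

theorem isOpen_isUnit_matrix : IsOpen {X : Matrix (Fin n) (Fin n) R | IsUnit X} := by
  have h : {X : Matrix (Fin n) (Fin n) R | IsUnit X} = Matrix.det ⁻¹' {x : R | IsUnit x} := by
    ext a
    exact Matrix.isUnit_iff_isUnit_det _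
  rw [h]
  exact Units.isOpen.preimage (Continuous.matrix_det continuous_id)

end UnitMatrices

/-! ### From integrals over K to integrals over lower unipotents, and the bound for Ξ_μ -/

section Spherical

variable {R : Type*} [NormedCommRing R] [NormOneClass R] [ProperSpace R] [MeasureSpace R]
  [BorelSpace R] [(volume : Measure R).IsAddHaarMeasure] {n : ℕ}
  {K : ∀ n, Subgroup (GLn n R)}

/-- The invertible matrices in a bounded right `K`-invariant neighbourhood of `1`. -/
def kBall (K : Subgroup (GLn n R)) : Set (Matrix (Fin n) (Fin n) R) :=
  {X | IsUnit X ∧ ∃ Y : Matrix (Fin n) (Fin n) R, (∀ i j, ‖Y i j‖ ≤ 2) ∧ ∃ k ∈ K, X = Y * k.1}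

theorem kBall_mul_right (K : Subgroup (GLn n R)) (X : Matrix (Fin n) (Fin n) R) {k : GLn n R}
    (hk : k ∈ K) : X * k.1 ∈ kBall K ↔ X ∈ kBall K := by
  constructor
  · rintro ⟨hu, Y, hY, k', hk', he⟩
    refine ⟨?_, Y, hY, k' * k⁻¹, mul_mem hk' (inv_mem hk), ?_⟩
    · simpa using hu.mul (k⁻¹).isUnit
    · rw [Units.val_mul, ← mul_assoc, ← he, mul_assoc, ← Units.val_mul, mul_inv_cancel,
        Units.val_one, mul_one]
  · rintro ⟨hu, Y, hY, k', hk', rfl⟩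
    exact ⟨hu.mul k.isUnit, Y, hY, k' * k, mul_mem hk' hk, by rw [Units.val_mul, mul_assoc]⟩

theorem measurableSet_kBall (hK : IwasawaFamily K) : MeasurableSet (kBall (K n)) := by
  have h : kBall (K n) = {X | IsUnit X} ∩ (fun p : Matrix (Fin n) (Fin n) R ×
      Matrix (Fin n) (Fin n) R => p.1 * p.2) '' ({Y | ∀ i j, ‖Y i j‖ ≤ 2} ×ˢ
        ((fun k : GLn n R => k.1) '' (K n : Set (GLn n R)))) := by
    ext X
    constructor
    · rintro ⟨hu, Y, hY, k, hk, rfl⟩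
      exact ⟨hu, (Y, k.1), ⟨hY, k, hk, rfl⟩, rfl⟩
    · rintro ⟨hu, ⟨Y, _⟩, ⟨hY, k, hk, rfl⟩, rfl⟩
      exact ⟨hu, Y, hY, k, hk, rfl⟩
  rw [h]
  refine isOpen_isUnit_matrix.measurableSet.inter (measurableSet_image_of_isClosed ?_ ?_)
  · exact continuous_fst.matrix_mul continuous_snd
  · exact (isClosed_entry_le 2).prod (hK.isClosed n)

theorem volume_kBall_ne_zero (K : Subgroup (GLn n R)) : volume (kBall K) ≠ 0 := by
  have ho : IsOpen ({X : Matrix (Fin n) (Fin n) R | IsUnit X} ∩ {X | ∀ i j, ‖X i j‖ < 2}) := by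
    refine isOpen_isUnit_matrix.inter ?_
    change IsOpen {Y : Matrix (Fin n) (Fin n) R | ∀ i j, ‖Y i j‖ < 2}
    simp only [Set.ofPred_forall]
    exact isOpen_iInter_of_finite fun i => isOpen_iInter_of_finite fun j =>
      isOpen_lt (continuous_matrix_entry i j).norm continuous_const
  have h1 : (1 : Matrix (Fin n) (Fin n) R) ∈
      {X : Matrix (Fin n) (Fin n) R | IsUnit X} ∩ {X | ∀ i j, ‖X i j‖ < 2} := by
    refine ⟨isUnit_one, fun i j => ?_⟩
    rw [Matrix.one_apply]
    split_ifs <;> simp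
  have h2 := ho.measure_pos volume ⟨1, h1⟩
  refine (h2.trans_le (measure_mono ?_)).ne'
  rintro X ⟨hX, hX'⟩
  exact ⟨hX, X, fun i j => (hX' i j).le, 1, one_mem _, by simp⟩

theorem volume_kBall_ne_top (hK : IwasawaFamily K) : volume (kBall (K n)) ≠ ⊤ := by
  refine ((measure_mono ?_).trans_lt (isCompact_entry_le (R := R) (n := n)
    ((n : ℝ) * (2 * 1))).measure_lt_top).ne
  rintro X ⟨-, Y, hY, k, hk, rfl⟩ i j
  exact norm_matrix_mul_le zero_le_two hY (hK.norm_le n k hk) i j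

variable (hR : TameNabs R) (hK : IwasawaFamily K)
include hR hK

/-- Integrals over `K` of functions in the principal series, as integrals over lower triangular
matrices. -/
theorem exists_lintegral_K_eq (hu : ∀ᵐ x : R, IsUnit x) (n : ℕ)
    [MeasurableSpace (GLn n R)] [BorelSpace (GLn n R)] (κ : Measure (K n))
    [κ.IsMulLeftInvariant] [IsProbabilityMeasure κ] :
    ∃ C : ℝ≥0∞, C ≠ ⊤ ∧ ∀ F : Matrix (Fin n) (Fin n) R → ℝ≥0∞, Measurable F →
      (∀ b g : GLn n R, b.1.BlockTriangular id →
        F (b.1 * g.1) = ENNReal.ofReal (halfMod fun i => nabs R (b.1 i i)) * F g.1) →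
      ∫⁻ k : K n, F k.1.1 ∂κ =
        C * ∫⁻ l, F l * ENNReal.ofReal (halfMod (iwasawaT (K n) l)) ∂(lowM R n) := by
  have hE : Measurable fun X : Matrix (Fin n) (Fin n) R => halfMod (iwasawaT (K n) X) :=
    Finset.measurable_prod _ fun i _ => (measurable_iwasawaT hR hK i).pow_const _
  have hEK : ∀ (g : GLn n R), ∀ k ∈ K n,
      halfMod (iwasawaT (K n) (g.1 * k.1)) = halfMod (iwasawaT (K n) g.1) := fun g k hk => by
    congr 1
    exact funext fun i => iwasawaT_mul_right hR hK g hk i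
  -- A cut-off to a right K-invariant bounded set, divided by the spherical function of the same
  -- equivariance as F. At X = b k₀ the factors depending on b cancel in F(Xk) θ(X), leaving F(k₀
  -- k).
  let θ : Matrix (Fin n) (Fin n) R → ℝ≥0∞ := (kBall (K n)).indicator
    fun X => ENNReal.ofReal (halfMod (iwasawaT (K n) X))⁻¹
  have hθ : Measurable θ := (Measurable.ennreal_ofReal hE.inv).indicator (measurableSet_kBall hK)
  have hθK : ∀ X : Matrix (Fin n) (Fin n) R, ∀ k ∈ K n, θ (X * k.1) = θ X := by
    intro X k hk
    by_cases hX : X ∈ kBall (K n)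
    · have hX' := (kBall_mul_right (K n) X hk).2 hX
      obtain ⟨g, rfl⟩ := hX.1
      simp only [θ, Set.indicator_of_mem hX, Set.indicator_of_mem hX', hEK g k hk]
    · have hX' := fun h => hX ((kBall_mul_right (K n) X hk).1 h)
      simp only [θ, Set.indicator_of_notMem hX, Set.indicator_of_notMem hX']
  obtain ⟨c, hc⟩ := lintegral_cell_equivariant hR hK hu n hθ fun g k hk => hθK g.1 k hk
  have hval : Measurable fun k : K n => k.1.1 :=
    (Units.continuous_val.comp continuous_subtype_val).measurable
  -- averaging over `K`
  have key : ∀ F : Matrix (Fin n) (Fin n) R → ℝ≥0∞, Measurable F →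
      (∀ b g : GLn n R, b.1.BlockTriangular id →
        F (b.1 * g.1) = ENNReal.ofReal (halfMod fun i => nabs R (b.1 i i)) * F g.1) →
      ∫⁻ X, F X * θ X = volume (kBall (K n)) * ∫⁻ k : K n, F k.1.1 ∂κ := by
    intro F hF hFe
    have h1 : ∀ k : K n, ∫⁻ X, F (X * k.1.1) * θ X = ∫⁻ X, F X * θ X := by
      intro k
      have := (measurePreserving_mul_right hK k.2).lintegral_comp (hF.mul hθ)
      rw [← show ∫⁻ X, (F * θ) (X * k.1.1) = ∫⁻ X, F X * θ X from this]
      exact lintegral_congr fun X => by rw [Pi.mul_apply, hθK X k.1 k.2]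
    -- Right multiplication by K preserves both dX and θ, so X may be replaced by X k and averaged
    -- over K.
    have h2 : ∫⁻ X, F X * θ X = ∫⁻ k : K n, ∫⁻ X, F (X * k.1.1) * θ X ∂volume ∂κ := by
      simp only [h1, lintegral_const, measure_univ, mul_one]
    have hm : Measurable fun p : K n × Matrix (Fin n) (Fin n) R => F (p.2 * p.1.1.1) * θ p.2 :=
      (hF.comp (Measurable.matrix_mul measurable_snd (hval.comp measurable_fst))).mul
        (hθ.comp measurable_snd)
    rw [h2, lintegral_lintegral_swap hm.aemeasurable, mul_comm (volume (kBall (K n))),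
      ← lintegral_indicator_const (measurableSet_kBall hK)]
    refine lintegral_congr fun X => ?_
    by_cases hX : X ∈ kBall (K n)
    · obtain ⟨g, rfl⟩ := hX.1
      have hFg : Measurable fun k : K n => F (g.1 * k.1.1) :=
        hF.comp (Measurable.matrix_mul measurable_const hval)
      rw [lintegral_mul_const _ hFg, Set.indicator_of_mem hX]
      simp only [θ, Set.indicator_of_mem hX]
      obtain ⟨b, hb, k₀, hk₀, rfl⟩ := exists_iwasawa hK g
      have h3 : ∀ k : K n, F ((b * k₀).1 * k.1.1) =
          ENNReal.ofReal (halfMod fun i => nabs R (b.1 i i)) *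
            F (((⟨k₀, hk₀⟩ : K n) * k : K n).1.1) := by
        intro k
        rw [Units.val_mul, mul_assoc, ← Units.val_mul, hFe b (k₀ * k.1) hb]
        rfl
      simp only [h3]
      rw [lintegral_const_mul' _ _ ENNReal.ofReal_ne_top,
        lintegral_mul_left_eq_self (fun k : K n => F k.1.1) (⟨k₀, hk₀⟩ : K n)]
      have h4 : iwasawaT (K n) (b * k₀).1 = fun i => nabs R (b.1 i i) :=
        funext fun i => by rw [Units.val_mul, iwasawaT_mul hR hK hb hk₀]
      have h5 : 0 < halfMod fun i => nabs R (b.1 i i) :=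
        halfMod_pos fun i => nabs_pos (upper_diag_isUnit hb i)
      rw [h4, mul_right_comm, ← ENNReal.ofReal_mul h5.le, mul_inv_cancel₀ h5.ne',
        ENNReal.ofReal_one, one_mul]
    · rw [Set.indicator_of_notMem hX]
      simp [θ, Set.indicator_of_notMem hX]
  have hEe : ∀ b g : GLn n R, b.1.BlockTriangular id →
      ENNReal.ofReal (halfMod (iwasawaT (K n) (b.1 * g.1))) =
      ENNReal.ofReal (halfMod fun i => nabs R (b.1 i i)) *
        ENNReal.ofReal (halfMod (iwasawaT (K n) g.1)) := by
    intro b g hb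
    rw [← ENNReal.ofReal_mul (halfMod_nonneg fun i => nabs_nonneg _),
      ← halfMod_mul (fun i => nabs_nonneg _) (fun i => iwasawaT_nonneg _ _ _)]
    congr 2
    exact funext fun i => iwasawaT_mul_left hR hK hb g i
  have hvol := volume_kBall_ne_zero (K n)
  have hvol' := volume_kBall_ne_top (n := n) hK
  -- Test with the spherical function itself, which is 1 on K: then c times an integral equals the
  -- volume of the cut-off set. If c were infinite, this volume would be 0 or infinite, and it is
  -- neither.
  have hcfin : c ≠ ⊤ := by
    have h1 := key (fun X => ENNReal.ofReal (halfMod (iwasawaT (K n) X))) hE.ennreal_ofReal hEe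
    rw [hc _ hE.ennreal_ofReal hEe] at h1
    have h2 : ∀ k : K n, ENNReal.ofReal (halfMod (iwasawaT (K n) k.1.1)) = 1 := by
      intro k
      have h3 : iwasawaT (K n) k.1.1 = fun _ => 1 := funext fun i => by
        have := iwasawaT_mul hR hK (b := 1) (k := k.1) (by
          intro i j h; exact Matrix.one_apply_ne (ne_of_gt (show j < i from h))) k.2 i
        simpa [nabs_one] using this
      rw [h3]
      simp [halfMod]
    simp only [h2, lintegral_const, measure_univ, mul_one] at h1
    rintro rfl
    by_cases h0 : ∫⁻ l, ENNReal.ofReal (halfMod (iwasawaT (K n) l)) *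
        ENNReal.ofReal (halfMod (iwasawaT (K n) l)) ∂(lowM R n) = 0
    · rw [h0, mul_zero] at h1
      exact hvol h1.symm
    · rw [ENNReal.top_mul h0] at h1
      exact hvol' h1.symm
  refine ⟨(volume (kBall (K n)))⁻¹ * c, ENNReal.mul_ne_top (ENNReal.inv_ne_top.2 hvol) hcfin,
    fun F hF hFe => ?_⟩
  rw [mul_assoc, ← hc F hF hFe, key F hF hFe, ← mul_assoc, ENNReal.inv_mul_cancel hvol hvol',
    one_mul]

/-- Two lower bounds for D_m(l t) are available. The lower right minor of l t is the product of the
t_i with i ≥ m, which gives the sharp torus factor but no decay in l. The bounded distortion of the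
T_i under t gives D_m(l) up to a power of L, hence decay in l. Their geometric mean with weights 1 -
ε and ε keeps the sharp factor, gains D_m(l)^{-ε}, and loses only L^{aε}. -/
theorem exists_le_iwasawaD_torus (n : ℕ) : ∃ C : ℝ, 0 < C ∧ ∃ a : ℝ, 0 ≤ a ∧
    ∀ (l : GLn n R), IsLowUnip l.1 → ∀ (t : Fin n → UnitGroup R) (L : ℝ), 1 ≤ L →
      (∀ i, ‖(t i : R)‖ ≤ L) → (∀ i, ‖(((t i)⁻¹ : Rˣ) : R)‖ ≤ L) → ∀ m, ∀ ε : ℝ, 0 ≤ ε → ε ≤ 1 →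
      (iwasawaD (K n) (l * torus t).1 m)⁻¹ ≤ C * L ^ (a * ε) *
        (∏ i ∈ Finset.Ici m, nabs R (t i))⁻¹ * iwasawaD (K n) l.1 m ^ (-ε) := by
  obtain ⟨C₁, hC₁, h₁⟩ := exists_corner_bound hR hK n
  obtain ⟨c, hc, h₂⟩ := exists_le_iwasawaT_torus hR hK n
  obtain ⟨c', hc', h₃⟩ := hR.le_of_norm_le
  refine ⟨max C₁ 1 * ((n + 1 : ℝ) ^ (c * n)), by positivity, c * n + c' * n, by positivity,
    fun l hl t L hL ht ht' m ε hε hε1 => ?_⟩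
  set P := ∏ i ∈ Finset.Ici m, nabs R (t i : R) with hP
  set D := iwasawaD (K n) (l * torus t).1 m with hD
  set D₀ := iwasawaD (K n) l.1 m with hD₀
  have hDp : 0 < D := iwasawaD_pos hR hK _ m
  have hD₀p : 0 < D₀ := iwasawaD_pos hR hK _ m
  have hPp : 0 < P := Finset.prod_pos fun i _ => nabs_pos (t i).isUnit
  have hL0 : 0 < L := one_pos.trans_le hL
  have hcard : ((Finset.Ici m).card : ℝ) ≤ n := by
    have := Finset.card_le_univ (Finset.Ici m)
    rw [Fintype.card_fin] at this
    exact_mod_cast this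
  have hn1 : (1 : ℝ) ≤ n + 1 := by linarith [(Nat.cast_nonneg n : (0 : ℝ) ≤ n)]
  have e1 : P ≤ C₁ * D := by
    have := h₁ (l * torus t) 1 (fun i j => by
      rw [Matrix.one_apply]; split_ifs <;> simp) m
    rw [mul_one, det_cornerMat_lower (m := m), nabs_prod] at this
    · refine le_trans (le_of_eq ?_) this
      refine Finset.prod_congr rfl fun i _ => ?_
      rw [Units.val_mul]
      change _ = nabs R ((l.1 * Matrix.diagonal fun i => (t i : R)) i i)
      rw [Matrix.mul_diagonal, hl.2, one_mul]
    · intro i j hij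
      rw [Units.val_mul]
      change (l.1 * Matrix.diagonal fun i => (t i : R)) i j = 0
      rw [Matrix.mul_diagonal, hl.1 i j hij, zero_mul]
  have e2 : D₀ ≤ ((n + 1) * L) ^ (c * n) * D := by
    have hb : (1 : ℝ) ≤ ((n + 1) * L) ^ c := Real.one_le_rpow (one_le_mul_of_one_le_of_one_le hn1 hL) hc
    calc D₀ = ∏ i ∈ Finset.Ici m, iwasawaT (K n) l.1 i := rfl
      _ ≤ ∏ i ∈ Finset.Ici m, (((n + 1) * L) ^ c * iwasawaT (K n) (l * torus t).1 i) := by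
          refine Finset.prod_le_prod (fun i _ => iwasawaT_nonneg _ _ _) fun i _ => ?_
          refine (h₂ l t L ht' i).trans (mul_le_mul_of_nonneg_right ?_ (iwasawaT_nonneg _ _ _))
          refine Real.rpow_le_rpow (by positivity) ?_ hc
          nlinarith
      _ = (((n + 1) * L) ^ c) ^ (Finset.Ici m).card * D := by
          rw [Finset.prod_mul_distrib, Finset.prod_const]; rfl
      _ ≤ ((n + 1) * L) ^ (c * n) * D := by
          refine mul_le_mul_of_nonneg_right ?_ hDp.le
          rw [← Real.rpow_natCast, ← Real.rpow_mul (by positivity)]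
          exact Real.rpow_le_rpow_of_exponent_le (one_le_mul_of_one_le_of_one_le hn1 hL)
            (mul_le_mul_of_nonneg_left hcard hc)
  have e3 : P ≤ L ^ (c' * n) := by
    calc P ≤ ∏ i ∈ Finset.Ici m, L ^ c' :=
          Finset.prod_le_prod (fun i _ => nabs_nonneg _) fun i _ => h₃ _ _ (ht i)
      _ = L ^ (c' * (Finset.Ici m).card) := by
          rw [Finset.prod_const, ← Real.rpow_natCast, ← Real.rpow_mul hL0.le]
      _ ≤ L ^ (c' * n) := Real.rpow_le_rpow_of_exponent_le hL (mul_le_mul_of_nonneg_left hcard hc')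
  have f1 : D⁻¹ ≤ max C₁ 1 * P⁻¹ := by
    rw [inv_le_comm₀ hDp (by positivity), mul_inv, inv_inv, ← div_eq_inv_mul,
      div_le_iff₀ (by positivity)]
    calc P ≤ C₁ * D := e1
      _ ≤ max C₁ 1 * D := mul_le_mul_of_nonneg_right (le_max_left _ _) hDp.le
      _ = D * max C₁ 1 := mul_comm _ _
  have f2 : D⁻¹ ≤ ((n + 1) * L) ^ (c * n) * D₀⁻¹ := by
    rw [inv_le_comm₀ hDp (by positivity), mul_inv, inv_inv, ← div_eq_inv_mul,
      div_le_iff₀ (by positivity), mul_comm]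
    exact e2
  have hX : (1 : ℝ) ≤ max C₁ 1 := le_max_right _ _
  have hDi : 0 < D⁻¹ := inv_pos.2 hDp
  -- The exponent a = c n + c' n has two contributions: the distortion factor raised to ε, and the
  -- factor P^ε that is needed to restore the full power P⁻¹.
  calc D⁻¹ = D⁻¹ ^ (1 - ε) * D⁻¹ ^ ε := by
        rw [← Real.rpow_add hDi, sub_add_cancel, Real.rpow_one]
    _ ≤ (max C₁ 1 * P⁻¹) ^ (1 - ε) * (((n + 1) * L) ^ (c * n) * D₀⁻¹) ^ ε :=
        mul_le_mul (Real.rpow_le_rpow hDi.le f1 (by linarith)) (Real.rpow_le_rpow hDi.le f2 hε)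
          (by positivity) (by positivity)
    _ = max C₁ 1 ^ (1 - ε) * ((n + 1 : ℝ) ^ (c * n)) ^ ε * (P ^ ε * (L ^ (c * n)) ^ ε) * P⁻¹ *
          D₀ ^ (-ε) := by
        rw [Real.mul_rpow (by positivity) (by positivity), Real.mul_rpow (by positivity)
          (by positivity), Real.mul_rpow (by positivity) (by positivity), Real.mul_rpow
          (by positivity) (by positivity), Real.inv_rpow hD₀p.le, Real.rpow_neg hD₀p.le,
          Real.inv_rpow hPp.le, Real.rpow_sub hPp, Real.rpow_one]
        field_simp
    _ ≤ max C₁ 1 * ((n + 1 : ℝ) ^ (c * n)) * (L ^ (c' * n * ε) * L ^ (c * n * ε)) * P⁻¹ *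
          D₀ ^ (-ε) := by
        have g1 : max C₁ 1 ^ (1 - ε) ≤ max C₁ 1 := by
          conv_rhs => rw [← Real.rpow_one (max C₁ 1)]
          exact Real.rpow_le_rpow_of_exponent_le hX (by linarith)
        have g2 : ((n + 1 : ℝ) ^ (c * n)) ^ ε ≤ (n + 1 : ℝ) ^ (c * n) := by
          conv_rhs => rw [← Real.rpow_one ((n + 1 : ℝ) ^ (c * n))]
          exact Real.rpow_le_rpow_of_exponent_le (Real.one_le_rpow hn1 (by positivity)) hε1
        have g3 : P ^ ε ≤ L ^ (c' * n * ε) := by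
          rw [Real.rpow_mul hL0.le]
          exact Real.rpow_le_rpow hPp.le e3 hε
        have g4 : (L ^ (c * n)) ^ ε = L ^ (c * n * ε) := (Real.rpow_mul hL0.le _ _).symm
        rw [g4]
        gcongr
    _ = max C₁ 1 * ((n + 1 : ℝ) ^ (c * n)) * L ^ ((c * n + c' * n) * ε) * P⁻¹ * D₀ ^ (-ε) := by
        rw [← Real.rpow_add hL0]
        congr 4
        ring

/-- On lower unipotents the integrand halfMod(T(lt)) halfMod(T(l)) equals |det t|^{(n+1)/2} ∏
D_m(lt)⁻¹ D_m(l)⁻¹, because det l = 1. The interpolated bound turns the dependence on l into ∏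
D_m(l)^{-(1+ε)}, which is integrable. The factor L^{aε} stands in for the power of the logarithm in
the Harish-Chandra estimate, and the bound is valid on the whole torus. -/
theorem exists_lintegral_halfMod_le (hu : ∀ᵐ x : R, IsUnit x) (hM : HasHeight R) (n : ℕ)
    [MeasurableSpace (GLn n R)] [BorelSpace (GLn n R)] (κ : Measure (K n))
    [κ.IsMulLeftInvariant] [IsProbabilityMeasure κ] :
    ∃ a : ℝ, 0 ≤ a ∧ ∀ ε : ℝ, 0 < ε → ε ≤ 1 → ∃ C : ℝ, 0 ≤ C ∧
      ∀ (t : Fin n → UnitGroup R) (L : ℝ), 1 ≤ L → (∀ i, ‖(t i : R)‖ ≤ L) →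
        (∀ i, ‖(((t i)⁻¹ : Rˣ) : R)‖ ≤ L) →
        ∫⁻ k : K n, ENNReal.ofReal (halfMod (iwasawaT (K n) (k.1 * torus t).1)) ∂κ ≤
          ENNReal.ofReal (C * L ^ (a * ε) * halfMod fun i => nabs R (t i)) := by
  obtain ⟨C₀, hC₀, hKint⟩ := exists_lintegral_K_eq hR hK hu n κ
  obtain ⟨C₁, hC₁, a, ha, hD⟩ := exists_le_iwasawaD_torus hR hK n
  refine ⟨a * n, by positivity, fun ε hε hε1 => ?_⟩
  have hfin := lintegral_lowM_lt_top hR hK hM (s := 1 + ε) (by linarith) n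
  set I := ∫⁻ l, ENNReal.ofReal ((∏ m, iwasawaD (K n) l m) ^ (-(1 + ε))) ∂(lowM R n)
  refine ⟨C₁ ^ n * (C₀ * I).toReal, by positivity, fun t L hL ht ht' => ?_⟩
  have hE : Measurable fun X : Matrix (Fin n) (Fin n) R => halfMod (iwasawaT (K n) X) :=
    Finset.measurable_prod _ fun i _ => (measurable_iwasawaT hR hK i).pow_const _
  have hL0 : 0 < L := one_pos.trans_le hL
  have htp : 0 < halfMod fun i => nabs R (t i : R) := halfMod_pos fun i => nabs_pos (t i).isUnit
  refine (hKint (fun X => ENNReal.ofReal (halfMod (iwasawaT (K n) (X * (torus t).1)))) ?_ ?_).trans_le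
    ?_
  rotate_left
  rotate_left
  · have hae : ∀ᵐ l ∂(lowM R n), ENNReal.ofReal (halfMod (iwasawaT (K n) (l * (torus t).1))) *
        ENNReal.ofReal (halfMod (iwasawaT (K n) l)) ≤
        ENNReal.ofReal (C₁ ^ n * L ^ (a * n * ε) * halfMod fun i => nabs R (t i)) *
          ENNReal.ofReal ((∏ m, iwasawaD (K n) l m) ^ (-(1 + ε))) := by
      refine (ae_lowM n).mono fun l hl => ?_
      obtain ⟨g, rfl⟩ := hl.isUnit
      rw [← Units.val_mul, ← ENNReal.ofReal_mul (halfMod_nonneg fun i => iwasawaT_nonneg _ _ _),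
        ← ENNReal.ofReal_mul (by positivity)]
      refine ENNReal.ofReal_le_ofReal ?_
      rw [halfMod_eq (fun i => iwasawaT_pos hR hK (g * torus t) i),
        halfMod_eq (fun i => iwasawaT_pos hR hK g i),
        halfMod_eq (fun i => nabs_pos (t i).isUnit), prod_iwasawaT hR hK, prod_iwasawaT hR hK,
        hl.det, nabs_one, Real.one_rpow, one_mul, Units.val_mul, Matrix.det_mul, hl.det, one_mul]
      have hdt : nabs R (torus t).1.det = ∏ i, nabs R (t i : R) := by
        change nabs R (Matrix.diagonal fun i => (t i : R)).det = _
        rw [Matrix.det_diagonal, nabs_prod]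
      rw [hdt]
      have hDpos : ∀ m, 0 < iwasawaD (K n) g.1 m := fun m => iwasawaD_pos hR hK g m
      have hprod : ∏ m, (iwasawaD (K n) (g * torus t).1 m)⁻¹ ≤
          C₁ ^ n * L ^ (a * n * ε) * (∏ m, ∏ i ∈ Finset.Ici m, nabs R (t i : R))⁻¹ *
            (∏ m, iwasawaD (K n) g.1 m) ^ (-ε) := by
        calc ∏ m, (iwasawaD (K n) (g * torus t).1 m)⁻¹ ≤ ∏ m, (C₁ * L ^ (a * ε) *
              (∏ i ∈ Finset.Ici m, nabs R (t i))⁻¹ * iwasawaD (K n) g.1 m ^ (-ε)) :=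
              Finset.prod_le_prod (fun m _ => inv_nonneg.2 (iwasawaD_pos hR hK _ m).le)
                fun m _ => hD g hl t L hL ht ht' m ε hε.le hε1
          _ = _ := by
              rw [Finset.prod_mul_distrib, Finset.prod_mul_distrib, Finset.prod_const,
                Real.finsetProd_rpow _ _ (fun m _ => (hDpos m).le), Finset.prod_inv_distrib,
                Finset.card_univ, Fintype.card_fin, mul_pow, ← Real.rpow_natCast (L ^ _),
                ← Real.rpow_mul hL0.le, mul_right_comm a ε]
      have hrw : (∏ m, iwasawaD (K n) g.1 m) ^ (-(1 + ε)) =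
          (∏ m, iwasawaD (K n) g.1 m) ^ (-ε) * (∏ m, iwasawaD (K n) g.1 m)⁻¹ := by
        rw [neg_add, add_comm, Real.rpow_add (Finset.prod_pos fun m _ => hDpos m),
          Real.rpow_neg_one]
      have hDi : 0 ≤ (∏ m, iwasawaD (K n) g.1 m)⁻¹ :=
        inv_nonneg.2 (Finset.prod_nonneg fun m _ => (hDpos m).le)
      have htt : 0 ≤ (∏ i, nabs R (t i : R)) ^ (((n : ℝ) + 1) / 2) :=
        Real.rpow_nonneg (Finset.prod_nonneg fun i _ => nabs_nonneg _) _
      rw [hrw]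
      rw [Finset.prod_inv_distrib] at hprod
      have := mul_le_mul_of_nonneg_left (mul_le_mul_of_nonneg_right hprod hDi) htt
      calc _ = (∏ i, nabs R (t i : R)) ^ (((n : ℝ) + 1) / 2) *
            ((∏ m, iwasawaD (K n) (g * torus t).1 m)⁻¹ * (∏ m, iwasawaD (K n) g.1 m)⁻¹) := by
              rw [← mul_assoc, ← Units.val_mul]; rfl
        _ ≤ _ := this
        _ = _ := by ring
    refine (mul_le_mul_right (lintegral_mono_ae hae) C₀).trans (le_of_eq ?_)
    rw [lintegral_const_mul' _ _ ENNReal.ofReal_ne_top, mul_left_comm,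
      ← ENNReal.ofReal_toReal (ENNReal.mul_ne_top hC₀ hfin.ne), ← ENNReal.ofReal_mul (by positivity),
      ENNReal.toReal_ofReal ENNReal.toReal_nonneg]
    congr 1
    ring
  · exact (hE.comp (Measurable.matrix_mul measurable_id measurable_const)).ennreal_ofReal
  · intro b g hb
    rw [mul_assoc, ← Units.val_mul, ← ENNReal.ofReal_mul (halfMod_nonneg fun i => nabs_nonneg _),
      ← halfMod_mul (fun i => nabs_nonneg _) (fun i => iwasawaT_nonneg _ _ _)]
    congr 2
    exact funext fun i => iwasawaT_mul_left hR hK hb _ i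

/-- A bound for the spherical function with real exponents `μ`. -/
theorem exists_lintegral_spherical_le (hu : ∀ᵐ x : R, IsUnit x) (hM : HasHeight R) (n : ℕ)
    [MeasurableSpace (GLn n R)] [BorelSpace (GLn n R)] (κ : Measure (K n))
    [κ.IsMulLeftInvariant] [IsProbabilityMeasure κ] (μ : Fin n → ℝ) {r : ℝ} (hr : ∀ i, r ≤ μ i) :
    ∃ a : ℝ, 0 ≤ a ∧ ∀ ε : ℝ, 0 < ε → ε ≤ 1 → ∃ C : ℝ, 0 ≤ C ∧
      ∀ (t : Fin n → UnitGroup R) (B L : ℝ), 1 ≤ B → (∀ i, ‖(t i : R)‖ ≤ B) → 1 ≤ L →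
        (∀ i, ‖(t i : R)‖ ≤ L) → (∀ i, ‖(((t i)⁻¹ : Rˣ) : R)‖ ≤ L) →
        ∫⁻ k : K n, ENNReal.ofReal (∏ i : Fin n, iwasawaT (K n) (k.1 * torus t).1 i ^
          (((n : ℝ) - 1 - 2 * (i : ℕ)) / 2 + μ i)) ∂κ ≤
          ENNReal.ofReal (C * B ^ a * L ^ (a * ε) *
            ∏ i : Fin n, nabs R (t i) ^ (((n : ℝ) - 1 - 2 * (i : ℕ)) / 2 + r)) := by
  obtain ⟨a, ha, hmain⟩ := exists_lintegral_halfMod_le hR hK hu hM n κ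
  obtain ⟨c, hc, hT⟩ := exists_iwasawaT_torus_le hR hK n
  set S := ∑ i, (μ i - r) with hS
  have hS0 : 0 ≤ S := Finset.sum_nonneg fun i _ => by linarith [hr i]
  refine ⟨max a (c * S), le_max_of_le_left ha, fun ε hε hε1 => ?_⟩
  obtain ⟨C, hC, hb⟩ := hmain ε hε hε1
  refine ⟨(n + 1 : ℝ) ^ (c * S) * C, by positivity, fun t B L hB htB hL ht ht' => ?_⟩
  have hB0 : 0 < B := one_pos.trans_le hB
  have hL0 : 0 < L := one_pos.trans_le hL
  have hn1 : (1 : ℝ) ≤ n + 1 := by linarith [(Nat.cast_nonneg n : (0 : ℝ) ≤ n)]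
  have htn : ∀ i, 0 < nabs R (t i : R) := fun i => nabs_pos (t i).isUnit
  have hP : 0 < ∏ i, nabs R (t i : R) := Finset.prod_pos fun i _ => htn i
  have hk : ∀ k : K n, ENNReal.ofReal (∏ i : Fin n, iwasawaT (K n) (k.1 * torus t).1 i ^
      (((n : ℝ) - 1 - 2 * (i : ℕ)) / 2 + μ i)) ≤
      ENNReal.ofReal (((n + 1) * B) ^ (c * S) * (∏ i, nabs R (t i : R)) ^ r) *
        ENNReal.ofReal (halfMod (iwasawaT (K n) (k.1 * torus t).1)) := by
    intro k
    rw [← ENNReal.ofReal_mul (by positivity)]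
    refine ENNReal.ofReal_le_ofReal ?_
    set T := iwasawaT (K n) (k.1 * torus t).1 with hTdef
    have hTp : ∀ i, 0 < T i := fun i => iwasawaT_pos hR hK _ i
    have hTk : ∀ i, T i ≤ ((n + 1) * B) ^ c := by
      intro i
      refine (hT k.1 t B htB i).trans ?_
      have h3 : iwasawaT (K n) k.1.1 i = 1 := by
        have := iwasawaT_mul hR hK (b := 1) (k := k.1) (by
          intro i j h; exact Matrix.one_apply_ne (ne_of_gt (show j < i from h))) k.2 i
        simpa [nabs_one] using this
      rw [h3, mul_one]
      refine Real.rpow_le_rpow (by positivity) ?_ hc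
      nlinarith
    have hdet : ∏ i, T i = ∏ i, nabs R (t i : R) := by
      rw [hTdef, prod_iwasawaT hR hK, Units.val_mul, Matrix.det_mul, nabs_mul,
        nabs_det_eq_one hR hK k.2, one_mul]
      change nabs R (Matrix.diagonal fun i => (t i : R)).det = _
      rw [Matrix.det_diagonal, nabs_prod]
    -- The surplus exponents μ_i - r are nonnegative and T_i(kt) is at most a power of the upper
    -- bound B alone, so they cost a power of B and nothing in t⁻¹. The common exponent r
    -- contributes |det t|^r exactly.
    have h1 : ∏ i, T i ^ (μ i - r) ≤ ((n + 1) * B) ^ (c * S) := by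
      calc ∏ i, T i ^ (μ i - r) ≤ ∏ i, ((n + 1) * B) ^ (c * (μ i - r)) := by
            refine Finset.prod_le_prod (fun i _ => Real.rpow_nonneg (hTp i).le _) fun i _ => ?_
            rw [Real.rpow_mul (by positivity)]
            exact Real.rpow_le_rpow (hTp i).le (hTk i) (by linarith [hr i])
        _ = _ := by
            rw [← Real.rpow_sum_of_pos (by positivity), hS, Finset.mul_sum]
    have h2 : ∏ i : Fin n, T i ^ (((n : ℝ) - 1 - 2 * (i : ℕ)) / 2 + μ i) =
        (∏ i, T i ^ (μ i - r)) * (∏ i, nabs R (t i : R)) ^ r * halfMod T := by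
      rw [← hdet, ← Real.finsetProd_rpow _ _ (fun i _ => (hTp i).le), halfMod,
        ← Finset.prod_mul_distrib, ← Finset.prod_mul_distrib]
      refine Finset.prod_congr rfl fun i _ => ?_
      rw [← Real.rpow_add (hTp i), ← Real.rpow_add (hTp i)]
      congr 1
      ring
    rw [h2]
    have : 0 ≤ halfMod T := halfMod_nonneg fun i => (hTp i).le
    gcongr
  refine (lintegral_mono hk).trans ?_
  rw [lintegral_const_mul' _ _ ENNReal.ofReal_ne_top]
  refine (mul_le_mul_right (hb t L hL ht ht') _).trans ?_
  rw [← ENNReal.ofReal_mul (by positivity)]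
  refine ENNReal.ofReal_le_ofReal ?_
  have h3 : ∏ i : Fin n, nabs R (t i : R) ^ (((n : ℝ) - 1 - 2 * (i : ℕ)) / 2 + r) =
      (∏ i, nabs R (t i : R)) ^ r * halfMod fun i => nabs R (t i : R) := by
    rw [← Real.finsetProd_rpow _ _ (fun i _ => (htn i).le), halfMod, ← Finset.prod_mul_distrib]
    refine Finset.prod_congr rfl fun i _ => ?_
    rw [← Real.rpow_add (htn i), add_comm]
  have hh : 0 < halfMod fun i => nabs R (t i : R) := halfMod_pos htn
  rw [h3, Real.mul_rpow (by positivity) hB0.le]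
  have h4 : B ^ (c * S) ≤ B ^ max a (c * S) :=
    Real.rpow_le_rpow_of_exponent_le hB (le_max_right _ _)
  have h5 : L ^ (a * ε) ≤ L ^ (max a (c * S) * ε) :=
    Real.rpow_le_rpow_of_exponent_le hL (mul_le_mul_of_nonneg_right (le_max_left _ _) hε.le)
  calc _ = (n + 1 : ℝ) ^ (c * S) * C * B ^ (c * S) * L ^ (a * ε) *
        ((∏ i, nabs R (t i : R)) ^ r * halfMod fun i => nabs R (t i : R)) := by ring
    _ ≤ _ := by gcongr

end Spherical

/-! ## Haar measure on `GL_n` of a local field -/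

section GLTopology

variable {R : Type*} [NormedCommRing R] {n : ℕ}

instance [SecondCountableTopology R] : SecondCountableTopology (GLn n R) := by
  have : SecondCountableTopology (Matrix (Fin n) (Fin n) R)ᵐᵒᵖ :=
    MulOpposite.opHomeomorph.symm.isEmbedding.secondCountableTopology
  exact Units.isEmbedding_embedProduct.secondCountableTopology

instance [LocallyCompactSpace R] : LocallyCompactSpace (GLn n R) :=
  inferInstanceAs (LocallyCompactSpace (Matrix (Fin n) (Fin n) R)ˣ)

theorem isEmbedding_GL_val [CompleteSpace R] :
    Topology.IsEmbedding (fun g : GLn n R => g.1) := by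
  refine Units.isEmbedding_val_mk' (f := fun X : Matrix (Fin n) (Fin n) R => X⁻¹) ?_ ?_
  · intro X hX
    refine (continuousAt_matrix_inv X ?_).continuousWithinAt
    obtain ⟨u, hu⟩ := (Matrix.isUnit_iff_isUnit_det X).1 hX
    rw [← hu]
    exact NormedRing.inverse_continuousAt u
  · intro u
    rw [Matrix.coe_units_inv]

theorem range_GL_val : Set.range (fun g : GLn n R => g.1) =
    {X : Matrix (Fin n) (Fin n) R | IsUnit X} := by
  ext X
  exact ⟨fun ⟨g, hg⟩ => hg ▸ g.isUnit, fun ⟨g, hg⟩ => ⟨g, hg⟩⟩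

theorem isOpenEmbedding_GL_val [CompleteSpace R] :
    Topology.IsOpenEmbedding (fun g : GLn n R => g.1) :=
  ⟨isEmbedding_GL_val, range_GL_val (R := R) (n := n) ▸ isOpen_isUnit_matrix⟩

end GLTopology

/-! ### The measure |det X|^{-n} dX on invertible matrices -/

section Scaling

open scoped Pointwise

variable {F : Type*} [NontriviallyNormedField F] [ProperSpace F] {n : ℕ}

/-- A transvection is a commutator: conjugating the transvection with parameter (x - 1)⁻¹ c by a
diagonal matrix with entry x at i multiplies its parameter by x, that is, adds c. An x of norm
larger than 1 ensures x ≠ 1. -/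
theorem monoidHom_transvection {A : Type*} [CommGroup A] (χ : GLn n F →* A)
    {g : GLn n F} {i j : Fin n} (hij : i ≠ j) (c : F) (hg : g.1 = Matrix.transvection i j c) :
    χ g = 1 := by
  obtain ⟨x, hx⟩ := NormedField.exists_one_lt_norm F
  have hx0 : x ≠ 0 := norm_pos_iff.1 (one_pos.trans hx)
  have hx1 : x - 1 ≠ 0 := by
    intro h
    rw [sub_eq_zero.1 h, norm_one] at hx
    exact lt_irrefl _ hx
  let d : GLn n F := torus fun k => if k = i then Units.mk0 x hx0 else 1
  let h : GLn n F :=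
    { val := Matrix.transvection i j ((x - 1)⁻¹ * c)
      inv := Matrix.transvection i j (-((x - 1)⁻¹ * c))
      val_inv := by
        rw [Matrix.transvection_mul_transvection_same i j hij, add_neg_cancel,
          Matrix.transvection_zero]
      inv_val := by
        rw [Matrix.transvection_mul_transvection_same i j hij, neg_add_cancel,
          Matrix.transvection_zero] }
  have key : g * h * d = d * h := by
    refine Units.ext ?_
    rw [Units.val_mul, Units.val_mul, Units.val_mul, hg]
    change Matrix.transvection i j c * Matrix.transvection i j ((x - 1)⁻¹ * c) *
      Matrix.diagonal (fun k => ((if k = i then Units.mk0 x hx0 else 1 : Fˣ) : F)) =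
      Matrix.diagonal (fun k => ((if k = i then Units.mk0 x hx0 else 1 : Fˣ) : F)) *
        Matrix.transvection i j ((x - 1)⁻¹ * c)
    rw [Matrix.transvection_mul_transvection_same i j hij]
    ext a b
    rw [Matrix.mul_diagonal, Matrix.diagonal_mul]
    simp only [Matrix.transvection, Matrix.add_apply, Matrix.one_apply, Matrix.single_apply]
    by_cases ha : a = i
    · subst ha
      by_cases hb : b = a
      · subst hb; simp [hij.symm]
      · by_cases hb' : j = b
        · subst hb'
          simp [hij, hij.symm]
          field_simp
          ring
        · simp [hb, hb', Ne.symm hb]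
    · simp only [ha, Ne.symm ha, if_false, false_and, add_zero, one_mul]
      by_cases hab : a = b
      · subst hab; simp [ha]
      · simp [hab]
  have h1 := congrArg χ key
  rw [map_mul, map_mul, map_mul, mul_comm (χ d), mul_assoc] at h1
  simpa using h1

/-- Diagonal matrices and transvections generate GL_n(F), and the latter are killed by any
homomorphism into a commutative group. -/
theorem monoidHom_eq_of_torus {A : Type*} [CommGroup A] (χ χ' : GLn n F →* A)
    (h : ∀ t, χ (torus t) = χ' (torus t)) : χ = χ' := by
  ext g
  have key : ∀ M : Matrix (Fin n) (Fin n) F, M.det ≠ 0 → ∀ g : GLn n F, g.1 = M → χ g = χ' g := by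
    intro M hM
    refine Matrix.diagonal_transvection_induction_of_det_ne_zero
      (fun M => ∀ g : GLn n F, g.1 = M → χ g = χ' g) M hM ?_ ?_ ?_
    · intro D hD g hg
      rw [Matrix.det_diagonal] at hD
      have hD' : ∀ i, D i ≠ 0 := fun i => (Finset.prod_ne_zero_iff.1 hD) i (Finset.mem_univ i)
      have : g = torus fun i => Units.mk0 (D i) (hD' i) := Units.ext hg
      rw [this, h]
    · intro t g hg
      rw [monoidHom_transvection χ t.hij t.c hg, monoidHom_transvection χ' t.hij t.c hg]
    · intro A B hA hB h1 h2 g hg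
      let a := Matrix.GeneralLinearGroup.mkOfDetNeZero A hA
      let b := Matrix.GeneralLinearGroup.mkOfDetNeZero B hB
      have : g = a * b := Units.ext hg
      rw [this, map_mul, map_mul, h1 a rfl, h2 b rfl]
  exact key g.1 (by
    have := (Matrix.isUnit_iff_isUnit_det g.1).1 g.isUnit
    exact this.ne_zero) g rfl

variable [MeasureSpace F] [BorelSpace F] [(volume : Measure F).IsAddHaarMeasure]

theorem volume_unit_smul (u : Fˣ) (s : Set F) (hs : MeasurableSet s) :
    volume ((fun x => (u : F) * x) '' s) = ENNReal.ofReal (nabs F u) * volume s := by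
  have h := congrArg (fun μ : Measure F => μ s) (map_unit_mul (volume : Measure F) u⁻¹)
  have hm : Measurable fun x : F => ((u⁻¹ : Fˣ) : F) * x :=
    (by fun_prop : Continuous fun x : F => ((u⁻¹ : Fˣ) : F) * x).measurable
  rw [Measure.map_apply hm hs, Measure.smul_apply, smul_eq_mul, nabs_units_inv, inv_inv] at h
  rw [← h]
  congr 1
  ext x
  constructor
  · rintro ⟨y, hy, rfl⟩
    simpa using hy
  · intro hx
    exact ⟨_, hx, by simp⟩

/-- Measured on the unit box: row i is scaled by t_i and has n entries. -/
theorem distribHaarChar_torus (t : Fin n → UnitGroup F) :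
    (distribHaarChar (Matrix (Fin n) (Fin n) F) (torus t) : ℝ) = nabs F (torus t).1.det ^ n := by
  let S : Set (Matrix (Fin n) (Fin n) F) := {X | ∀ i j, X i j ∈ Metric.closedBall (0 : F) 1}
  have hbox : ∀ U : Fin n → Set F, volume {X : Matrix (Fin n) (Fin n) F | ∀ i j, X i j ∈ U i} =
      ∏ i, volume (U i) ^ n := by
    intro U
    have h1 : {X : Matrix (Fin n) (Fin n) F | ∀ i j, X i j ∈ U i} =
        Set.univ.pi fun i => Set.univ.pi fun _ : Fin n => U i := by
      ext X
      change _ ↔ ∀ i ∈ Set.univ, ∀ j ∈ Set.univ, X i j ∈ U i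
      simp
    rw [h1]
    change (volume : Measure (Fin n → Fin n → F)) _ = _
    rw [volume_pi_pi]
    refine Finset.prod_congr rfl fun i _ => ?_
    rw [volume_pi_pi]
    simp
  have hb0 : volume (Metric.closedBall (0 : F) 1) ≠ 0 :=
    (Metric.measure_closedBall_pos _ _ one_pos).ne'
  have hbt : volume (Metric.closedBall (0 : F) 1) ≠ ⊤ :=
    (isCompact_closedBall (0 : F) 1).measure_lt_top.ne
  have hS : volume S = ∏ _i : Fin n, volume (Metric.closedBall (0 : F) 1) ^ n :=
    hbox fun _ => Metric.closedBall (0 : F) 1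
  have hS0 : volume S ≠ 0 := by
    rw [hS]; exact Finset.prod_ne_zero_iff.2 fun _ _ => pow_ne_zero _ hb0
  have hSt : volume S ≠ ⊤ := by
    rw [hS]; exact ENNReal.prod_ne_top fun _ _ => ENNReal.pow_ne_top hbt
  have hgS : (torus t : GLn n F) • S = {X : Matrix (Fin n) (Fin n) F | ∀ i j, X i j ∈
      (fun x => (t i : F) * x) '' Metric.closedBall (0 : F) 1} := by
    ext X
    constructor
    · rintro ⟨Y, hY, rfl⟩ i j
      refine ⟨Y i j, hY i j, ?_⟩
      change _ = (Matrix.diagonal (fun i => (t i : F)) * Y) i j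
      rw [Matrix.diagonal_mul]
    · intro hX
      choose Y hY hY' using hX
      refine ⟨Matrix.of Y, fun i j => hY i j, ?_⟩
      ext i j
      change (Matrix.diagonal (fun i => (t i : F)) * Matrix.of Y) i j = _
      rw [Matrix.diagonal_mul, ← hY']
      rfl
  have hdet : nabs F (torus t).1.det = ∏ i, nabs F (t i : F) := by
    change nabs F (Matrix.diagonal fun i => (t i : F)).det = _
    rw [Matrix.det_diagonal, nabs_prod]
  have hr : 0 ≤ nabs F (torus t).1.det ^ n := pow_nonneg (nabs_nonneg _) _
  have := distribHaarChar_eq_of_measure_smul_eq_mul (μ := (volume : Measure (Matrix (Fin n) (Fin n) F)))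
    (g := (torus t : GLn n F)) hS0 hSt (r := (nabs F (torus t).1.det ^ n).toNNReal) (by
      rw [hgS, hbox, hS, ← Finset.prod_congr rfl fun i _ => (congrArg (· ^ n)
        (volume_unit_smul (t i) _ Metric.isClosed_closedBall.measurableSet)).symm]
      simp only [mul_pow, Finset.prod_mul_distrib]
      congr 1
      change _ = ENNReal.ofReal (nabs F (torus t).1.det ^ n)
      rw [hdet, ← Finset.prod_pow, ENNReal.ofReal_prod_of_nonneg
        (fun i _ => pow_nonneg (nabs_nonneg _) _)]
      exact Finset.prod_congr rfl fun i _ => (ENNReal.ofReal_pow (nabs_nonneg _) _).symm)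
  rw [this, Real.coe_toNNReal _ hr]

/-- Left multiplication by `g` scales the Haar measure of `M_n(F)` by `|det g| ^ n`. -/
theorem distribHaarChar_matrix (g : GLn n F) :
    (distribHaarChar (Matrix (Fin n) (Fin n) F) g : ℝ) = nabs F g.1.det ^ n := by
  let χ : GLn n F →* ℝˣ := ((NNReal.toRealHom : NNReal →* ℝ).comp
    (distribHaarChar (Matrix (Fin n) (Fin n) F))).toHomUnits
  let χ' : GLn n F →* ℝˣ := ((powMonoidHom n).comp ((nabsHom F).comp
    ((Matrix.detMonoidHom).comp (Units.coeHom (Matrix (Fin n) (Fin n) F))))).toHomUnits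
  have h : χ = χ' := monoidHom_eq_of_torus χ χ' fun t => Units.ext (distribHaarChar_torus t)
  exact congrArg (fun x : GLn n F →* ℝˣ => ((x g : ℝˣ) : ℝ)) h

theorem lintegral_GL_mul_left (g : GLn n F) {f : Matrix (Fin n) (Fin n) F → ℝ≥0∞}
    (hf : Measurable f) : ENNReal.ofReal (nabs F g.1.det ^ n) * ∫⁻ X, f (g.1 * X) = ∫⁻ X, f X := by
  have hm : Measurable fun X : Matrix (Fin n) (Fin n) F => g.1 * X :=
    Measurable.matrix_mul measurable_const measurable_id
  have h : ENNReal.ofReal (nabs F g.1.det ^ n) •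
      (volume : Measure (Matrix (Fin n) (Fin n) F)).map (fun X => g.1 * X) = volume := by
    ext s hs
    rw [Measure.smul_apply, Measure.map_apply hm hs, smul_eq_mul, ← distribHaarChar_matrix,
      ENNReal.ofReal_coe_nnreal, distribHaarChar_mul]
    congr 1
    ext X
    constructor
    · rintro ⟨Y, hY, rfl⟩
      exact hY
    · intro hX
      refine ⟨(g⁻¹).1 * X, ?_, ?_⟩
      · change g.1 * ((g⁻¹).1 * X) ∈ s
        rw [← mul_assoc, ← Units.val_mul, mul_inv_cancel, Units.val_one, one_mul]
        exact hX
      · change g.1 * ((g⁻¹).1 * X) = X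
        rw [← mul_assoc, ← Units.val_mul, mul_inv_cancel, Units.val_one, one_mul]
  conv_rhs => rw [← h]
  rw [lintegral_smul_measure, lintegral_map hf hm, smul_eq_mul]

/-- The density `|det X| ^ (-n)` of the Haar measure of `GL_n(F)`. -/
def detDensity (X : Matrix (Fin n) (Fin n) F) : ℝ≥0∞ := (ENNReal.ofReal (nabs F X.det ^ n))⁻¹

theorem detDensity_mul (g : GLn n F) (X : Matrix (Fin n) (Fin n) F) :
    detDensity X = ENNReal.ofReal (nabs F g.1.det ^ n) * detDensity (g.1 * X) := by
  have hg : 0 < nabs F g.1.det ^ n :=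
    pow_pos (nabs_pos ((Matrix.isUnit_iff_isUnit_det g.1).1 g.isUnit)) _
  rw [detDensity, detDensity, Matrix.det_mul, nabs_mul, mul_pow, ENNReal.ofReal_mul hg.le,
    ENNReal.mul_inv (Or.inl (by simpa using hg)) (Or.inl ENNReal.ofReal_ne_top), ← mul_assoc,
    ENNReal.mul_inv_cancel (by simpa using hg) ENNReal.ofReal_ne_top, one_mul]

theorem measurable_detDensity (hn : Measurable (nabs F)) :
    Measurable (detDensity : Matrix (Fin n) (Fin n) F → ℝ≥0∞) := by
  have hd : Measurable fun X : Matrix (Fin n) (Fin n) F => X.det :=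
    (Continuous.matrix_det continuous_id).measurable
  exact ((hn.comp hd).pow_const n).ennreal_ofReal.inv

/-- The measure |det X|^{-n} dX restricted to invertible matrices is left invariant, finite on
compact sets and nonzero, hence a multiple of Haar measure. An inequality suffices, so the singular
matrices may simply be added on the right without showing that they are null. -/
theorem exists_lintegral_GL_le (hF : TameNabs F) (n : ℕ) [MeasurableSpace (GLn n F)]
    [BorelSpace (GLn n F)] (lG : Measure (GLn n F)) [lG.IsHaarMeasure] :
    ∃ c : ℝ≥0∞, c ≠ ⊤ ∧ ∀ f : Matrix (Fin n) (Fin n) F → ℝ≥0∞, Measurable f →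
      ∫⁻ g, f g.1 ∂lG ≤ c * ∫⁻ X, f X * detDensity X := by
  have hn : Measurable (nabs F) := hF.continuous_nabs.measurable
  have hρ := measurable_detDensity (n := n) hn
  have he : MeasurableEmbedding (fun g : GLn n F => g.1) :=
    isOpenEmbedding_GL_val.measurableEmbedding
  let μ : Measure (Matrix (Fin n) (Fin n) F) := volume.withDensity detDensity
  let m : Measure (GLn n F) := μ.comap fun g => g.1
  have hmap : m.map (fun g => g.1) = μ.restrict {X | IsUnit X} := by
    rw [he.map_comap, range_GL_val]
  have hms : ∀ s : Set (GLn n F), MeasurableSet s → m s = ∫⁻ X in (fun g : GLn n F => g.1) '' s,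
      detDensity X := by
    intro s hs
    rw [he.comap_apply, withDensity_apply _ (he.measurableSet_image.2 hs)]
  have hinv : m.IsMulLeftInvariant := by
    refine ⟨fun g => ?_⟩
    ext s hs
    have hgm : Measurable fun h : GLn n F => g * h := (continuous_const_mul g).measurable
    rw [Measure.map_apply hgm hs, hms _ (hgm hs), hms s hs,
      ← lintegral_indicator (he.measurableSet_image.2 (hgm hs)),
      ← lintegral_indicator (he.measurableSet_image.2 hs),
      ← lintegral_GL_mul_left g (hρ.indicator (he.measurableSet_image.2 hs)),
      ← lintegral_const_mul' _ _ ENNReal.ofReal_ne_top]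
    refine lintegral_congr fun X => ?_
    by_cases hX : X ∈ (fun g : GLn n F => g.1) '' ((fun h : GLn n F => g * h) ⁻¹' s)
    · have hX' : g.1 * X ∈ (fun g : GLn n F => g.1) '' s := by
        obtain ⟨x, hx, rfl⟩ := hX
        exact ⟨g * x, hx, rfl⟩
      rw [Set.indicator_of_mem hX, Set.indicator_of_mem hX', ← detDensity_mul]
    · have hX' : g.1 * X ∉ (fun g : GLn n F => g.1) '' s := by
        rintro ⟨x, hx, hxe⟩
        refine hX ⟨g⁻¹ * x, by simpa using hx, ?_⟩
        change (g⁻¹ * x).1 = X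
        have hxe' : x.1 = g.1 * X := hxe
        rw [Units.val_mul, hxe', ← mul_assoc, ← Units.val_mul, inv_mul_cancel, Units.val_one,
          one_mul]
      rw [Set.indicator_of_notMem hX, Set.indicator_of_notMem hX', mul_zero]
  have hfin : IsFiniteMeasureOnCompacts m := by
    refine ⟨fun C hC => ?_⟩
    have hC' : IsCompact ((fun g : GLn n F => g.1) '' C) := hC.image Units.continuous_val
    have hcont : Continuous fun g : GLn n F => (nabs F g.1.det ^ n)⁻¹ := by
      refine Continuous.inv₀ ((hF.continuous_nabs.comp
        (Continuous.matrix_det Units.continuous_val)).pow n) fun g => ?_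
      exact (pow_pos (nabs_pos ((Matrix.isUnit_iff_isUnit_det g.1).1 g.isUnit)) _).ne'
    obtain ⟨B, hB⟩ := (hC.image hcont).bddAbove
    rw [hms C hC.measurableSet]
    refine (setLIntegral_mono (g := fun _ => ENNReal.ofReal B) measurable_const ?_).trans_lt ?_
    · rintro _ ⟨g, hg, rfl⟩
      have hp : 0 < nabs F g.1.det ^ n :=
        pow_pos (nabs_pos ((Matrix.isUnit_iff_isUnit_det g.1).1 g.isUnit)) _
      rw [detDensity, ← ENNReal.ofReal_inv_of_pos hp]
      exact ENNReal.ofReal_le_ofReal (hB ⟨g, hg, rfl⟩)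
    · rw [setLIntegral_const]
      exact ENNReal.mul_lt_top ENNReal.ofReal_lt_top hC'.measure_lt_top
  have hne : m ≠ 0 := by
    intro h0
    have h1 := hms Set.univ MeasurableSet.univ
    rw [h0, Set.image_univ, range_GL_val] at h1
    have h2 : volume {X : Matrix (Fin n) (Fin n) F | IsUnit X} ≠ 0 :=
      (isOpen_isUnit_matrix.measure_pos volume ⟨1, isUnit_one⟩).ne'
    have h3 : ∀ X : Matrix (Fin n) (Fin n) F, detDensity X ≠ 0 := fun X =>
      ENNReal.inv_ne_zero.2 ENNReal.ofReal_ne_top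
    have h4 := (setLIntegral_eq_zero_iff isOpen_isUnit_matrix.measurableSet hρ).1 h1.symm
    apply h2
    rw [measure_eq_zero_iff_ae_notMem]
    exact h4.mono fun X hX hX' => h3 X (hX hX')
  have heq := Measure.isMulLeftInvariant_eq_smul m lG
  set c₀ := Measure.haarScalarFactor m lG
  have hc₀ : (c₀ : ℝ≥0∞) ≠ 0 := by
    intro h0
    apply hne
    rw [heq]
    have : c₀ = 0 := by exact_mod_cast h0
    rw [this, zero_smul]
  refine ⟨(c₀ : ℝ≥0∞)⁻¹, ENNReal.inv_ne_top.2 hc₀, fun f hf => ?_⟩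
  have h1 : ∫⁻ g, f g.1 ∂m = c₀ * ∫⁻ g, f g.1 ∂lG := by
    rw [heq, lintegral_smul_measure]
    rfl
  have h2 : ∫⁻ g, f g.1 ∂m ≤ ∫⁻ X, f X * detDensity X := by
    rw [← he.lintegral_map (μ := m) f, hmap]
    refine (lintegral_mono' Measure.restrict_le_self le_rfl).trans ?_
    rw [lintegral_withDensity_eq_lintegral_mul _ hρ hf]
    exact le_of_eq (lintegral_congr fun X => by rw [Pi.mul_apply, mul_comm])
  calc ∫⁻ g, f g.1 ∂lG = (c₀ : ℝ≥0∞)⁻¹ * (c₀ * ∫⁻ g, f g.1 ∂lG) := by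
        rw [← mul_assoc, ENNReal.inv_mul_cancel hc₀ ENNReal.coe_ne_top, one_mul]
    _ ≤ _ := by rw [← h1]; exact mul_le_mul_right h2 _

end Scaling

/-! ## Invariance of the measure on unipotent matrices -/

section UnipInvariance

variable {R : Type*} [NormedCommRing R] [NormOneClass R] [ProperSpace R] [MeasureSpace R]
  [BorelSpace R] [(volume : Measure R).IsAddHaarMeasure] {n : ℕ}

theorem IsUpUnip.exists_blk {v : Matrix (Fin (n + 1)) (Fin (n + 1)) R} (hv : IsUpUnip v) :
    ∃ (v' : Matrix (Fin n) (Fin n) R) (y' : Fin n → R), IsUpUnip v' ∧ v = blk v' y' 0 1 := by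
  refine ⟨Matrix.of fun i j => v i.castSucc j.castSucc, fun i => v i.castSucc (Fin.last n),
    ⟨fun i j h => ?_, fun i => ?_⟩, (eq_blk v).trans ?_⟩
  · exact hv.1 _ _ (Fin.castSucc_lt_castSucc_iff.2 h)
  · exact hv.2 _
  · congr 1
    · ext j; exact hv.1 _ _ (Fin.castSucc_lt_last j)
    · exact hv.2 _

theorem blk_mulVec_snoc (v : Matrix (Fin n) (Fin n) R) (w y : Fin n → R) (z : R) :
    (blk v w 0 1).mulVec (Fin.snoc (α := fun _ => R) y z) =
      Fin.snoc (α := fun _ => R) (z • w + v.mulVec y) z := by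
  ext i
  refine Fin.lastCases ?_ (fun i => ?_) i
  · simp [Matrix.mulVec, dotProduct, Fin.sum_univ_castSucc]
  · simp [Matrix.mulVec, dotProduct, Fin.sum_univ_castSucc, mul_comm, add_comm]

theorem measurable_mulVec (v : Matrix (Fin n) (Fin n) R) :
    Measurable fun y : Fin n → R => v.mulVec y :=
  (by fun_prop : Continuous fun y : Fin n → R => v.mulVec y).measurable

theorem lintegral_upUnip_mulVec : ∀ (n : ℕ) {v : Matrix (Fin n) (Fin n) R} (_ : IsUpUnip v)
    {f : (Fin n → R) → ℝ≥0∞} (_ : Measurable f), ∫⁻ y, f (v.mulVec y) = ∫⁻ y, f y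
  | 0, v, _, f, _ => by
    have h : ∀ y : Fin 0 → R, v.mulVec y = y := fun y => Subsingleton.elim _ _
    simp only [h]
  | n + 1, v, hv, f, hf => by
    obtain ⟨v', w, hv', rfl⟩ := hv.exists_blk
    have h0 : Measurable fun y => f ((blk v' w 0 1).mulVec y) := hf.comp (measurable_mulVec _)
    rw [lintegral_pi_snoc h0, lintegral_pi_snoc hf]
    refine lintegral_congr fun z => ?_
    simp only [blk_mulVec_snoc]
    have hs : Measurable fun y : Fin n → R => f (Fin.snoc (α := fun _ => R) y z) :=
      hf.comp (measurable_snoc.comp (measurable_id.prodMk measurable_const))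
    have hs' : Measurable fun y : Fin n → R => f (Fin.snoc (α := fun _ => R) (z • w + y) z) :=
      hs.comp (measurable_const_add (z • w))
    rw [lintegral_upUnip_mulVec n hv' hs']
    exact lintegral_add_left_eq_self (μ := (volume : Measure (Fin n → R)))
      (fun y => f (Fin.snoc (α := fun _ => R) y z)) (z • w)

/-- Here the block u is integrated first, by induction; the last column then undergoes a unipotent
linear map followed by a translation. -/
theorem lintegral_upM_mul_left : ∀ (n : ℕ) {v : Matrix (Fin n) (Fin n) R} (_ : IsUpUnip v)
    {f : Matrix (Fin n) (Fin n) R → ℝ≥0∞} (_ : Measurable f),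
    ∫⁻ u, f (v * u) ∂(upM R n) = ∫⁻ u, f u ∂(upM R n)
  | 0, v, _, f, _ => by
    have h : ∀ u : Matrix (Fin 0) (Fin 0) R, v * u = u := fun u => Subsingleton.elim _ _
    simp only [h]
  | n + 1, v, hv, f, hf => by
    obtain ⟨v', w, hv', rfl⟩ := hv.exists_blk
    have hm : Measurable fun u => f (blk v' w 0 1 * u) :=
      hf.comp (Measurable.matrix_mul measurable_const measurable_id)
    rw [lintegral_upM_succ hm, lintegral_upM_succ hf]
    have h1 : ∀ (u : Matrix (Fin n) (Fin n) R) (y : Fin n → R),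
        blk v' w 0 1 * blk u y 0 1 = blk (v' * u) (w + v'.mulVec y) 0 1 := by
      intro u y; simp [blk_mul_blk, add_comm]
    simp only [h1]
    have h2 : ∀ y : Fin n → R, ∫⁻ u, f (blk (v' * u) (w + v'.mulVec y) 0 1) ∂(upM R n) =
        ∫⁻ u, f (blk u (w + v'.mulVec y) 0 1) ∂(upM R n) := fun y =>
      lintegral_upM_mul_left n hv' (f := fun u => f (blk u (w + v'.mulVec y) 0 1))
        (measurable_blk_comp hf measurable_id measurable_const measurable_const measurable_const)
    simp only [h2]
    have hg : Measurable fun y : Fin n → R => ∫⁻ u, f (blk u y 0 1) ∂(upM R n) :=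
      Measurable.lintegral_prod_right' (f := fun p : (Fin n → R) × Matrix (Fin n) (Fin n) R =>
        f (blk p.2 p.1 0 1)) (measurable_blk_comp hf measurable_snd measurable_fst
          measurable_const measurable_const)
    rw [lintegral_upUnip_mulVec n hv' (f := fun y => ∫⁻ u, f (blk u (w + y) 0 1) ∂(upM R n))
      (hg.comp (measurable_const_add w))]
    exact lintegral_add_left_eq_self (μ := (volume : Measure (Fin n → R)))
      (fun y => ∫⁻ u, f (blk u y 0 1) ∂(upM R n)) w

/-- Serves both to normalize the cut-off in the unipotent direction and to see that the coordinate
measure is nonzero and finite on compact sets. -/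
theorem upM_entry_le {B : ℝ} (hB : 1 ≤ B) : ∀ n : ℕ,
    upM R n {u | ∀ i j, ‖u i j‖ ≤ B} ≠ 0 ∧ upM R n {u | ∀ i j, ‖u i j‖ ≤ B} ≠ ⊤
  | 0 => by
    have : {u : Matrix (Fin 0) (Fin 0) R | ∀ i j, ‖u i j‖ ≤ B} = Set.univ := by
      ext u; simp
    rw [this]
    simp [upM]
  | n + 1 => by
    obtain ⟨h0, ht⟩ := upM_entry_le hB n
    have hb : (volume : Measure (Fin n → R)).IsAddHaarMeasure := Measure.pi.isAddHaarMeasure _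
    have hm : Measurable fun p : (Fin n → R) × Matrix (Fin n) (Fin n) R => blk p.2 p.1 0 1 :=
      Measurable.blk' measurable_snd measurable_fst measurable_const measurable_const
    have hpre : (fun p : (Fin n → R) × Matrix (Fin n) (Fin n) R => blk p.2 p.1 0 1) ⁻¹'
        {u | ∀ i j, ‖u i j‖ ≤ B} = Metric.closedBall 0 B ×ˢ {u | ∀ i j, ‖u i j‖ ≤ B} := by
      ext ⟨y, u⟩
      simp only [Set.mem_preimage, Set.mem_prod, mem_closedBall_zero_iff,
        pi_norm_le_iff_of_nonneg (zero_le_one.trans hB)]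
      constructor
      · intro h
        exact ⟨fun i => by simpa using h i.castSucc (Fin.last n),
          fun i j => by simpa using h i.castSucc j.castSucc⟩
      · rintro ⟨h1, h2⟩ i j
        refine Fin.lastCases ?_ (fun i => ?_) i <;> refine Fin.lastCases ?_ (fun j => ?_) j
        · simpa using hB
        · simpa using zero_le_one.trans hB
        · simpa using h1 i
        · simpa using h2 i j
    rw [upM, Measure.map_apply hm (isClosed_entry_le B).measurableSet, hpre, Measure.prod_prod]
    have hB0 : 0 < B := one_pos.trans_le hB
    exact ⟨mul_ne_zero (Metric.measure_closedBall_pos _ _ hB0).ne' h0,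
      ENNReal.mul_ne_top (isCompact_closedBall (0 : Fin n → R) B).measure_lt_top.ne ht⟩

theorem isClosedEmbedding_unip_val :
    Topology.IsClosedEmbedding (fun u : unip n R => u.1.1) := by
  refine ⟨isEmbedding_GL_val.comp Topology.IsEmbedding.subtypeVal, ?_⟩
  have : Set.range (fun u : unip n R => u.1.1) = {X | IsUpUnip X} := by
    ext X
    constructor
    · rintro ⟨u, rfl⟩
      exact u.2
    · intro hX
      obtain ⟨g, rfl⟩ := IsUpUnip.isUnit hX
      exact ⟨⟨g, hX⟩, rfl⟩
  rw [this]
  exact isClosed_isUpUnip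

/-- Every Haar measure on the unipotent group is a multiple of the standard one. -/
theorem exists_lintegral_unip [MeasurableSpace (GLn n R)] [BorelSpace (GLn n R)]
    (lN : Measure (unip n R)) [lN.IsHaarMeasure] :
    ∃ c : ℝ≥0∞, c ≠ 0 ∧ c ≠ ⊤ ∧ ∀ f : Matrix (Fin n) (Fin n) R → ℝ≥0∞, Measurable f →
      ∫⁻ u : unip n R, f u.1.1 ∂lN = c * ∫⁻ u, f u ∂(upM R n) := by
  have hce := isClosedEmbedding_unip_val (R := R) (n := n)
  have he : MeasurableEmbedding (fun u : unip n R => u.1.1) := hce.measurableEmbedding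
  have : LocallyCompactSpace (unip n R) := hce.locallyCompactSpace
  have : SecondCountableTopology (unip n R) := hce.isEmbedding.secondCountableTopology
  have hrange : ∀ᵐ u ∂(upM R n), u ∈ Set.range (fun u : unip n R => u.1.1) := by
    refine (ae_upM n).mono fun u hu => ?_
    obtain ⟨g, rfl⟩ := hu.isUnit
    exact ⟨⟨g, hu⟩, rfl⟩
  let m : Measure (unip n R) := (upM R n).comap fun u => u.1.1
  have hmap : m.map (fun u => u.1.1) = upM R n := by
    rw [he.map_comap, Measure.restrict_eq_self_of_ae_mem hrange]
  have hinv : m.IsMulLeftInvariant := by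
    refine ⟨fun g => ?_⟩
    ext s hs
    have hgm : Measurable fun h : unip n R => g * h := (continuous_const_mul g).measurable
    rw [Measure.map_apply hgm hs, he.comap_apply, he.comap_apply,
      ← lintegral_indicator_one (he.measurableSet_image.2 (hgm hs)),
      ← lintegral_indicator_one (he.measurableSet_image.2 hs),
      ← lintegral_upM_mul_left n g.2 (f := Set.indicator _ 1)
        (measurable_one.indicator (he.measurableSet_image.2 hs))]
    refine lintegral_congr fun X => ?_
    by_cases hX : X ∈ (fun u : unip n R => u.1.1) '' ((fun h : unip n R => g * h) ⁻¹' s)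
    · have hX' : g.1.1 * X ∈ (fun u : unip n R => u.1.1) '' s := by
        obtain ⟨x, hx, rfl⟩ := hX
        exact ⟨g * x, hx, rfl⟩
      rw [Set.indicator_of_mem hX, Set.indicator_of_mem hX']
      rfl
    · have hX' : g.1.1 * X ∉ (fun u : unip n R => u.1.1) '' s := by
        rintro ⟨x, hx, hxe⟩
        refine hX ⟨g⁻¹ * x, by simpa using hx, ?_⟩
        change (g.1⁻¹ * x.1).1 = X
        have hxe' : x.1.1 = g.1.1 * X := hxe
        rw [Units.val_mul, hxe', ← mul_assoc, ← Units.val_mul, inv_mul_cancel, Units.val_one,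
          one_mul]
      rw [Set.indicator_of_notMem hX, Set.indicator_of_notMem hX']
  have hfin : IsFiniteMeasureOnCompacts m := by
    refine ⟨fun C hC => ?_⟩
    have hB : ∃ B : ℝ, 1 ≤ B ∧ ∀ X ∈ (fun u : unip n R => u.1.1) '' C, ∀ i j, ‖X i j‖ ≤ B := by
      have hb : ∀ i j, ∃ B : ℝ, ∀ X ∈ (fun u : unip n R => u.1.1) '' C, ‖X i j‖ ≤ B := by
        intro i j
        obtain ⟨B, hB⟩ := ((hC.image hce.continuous).image
          (continuous_matrix_entry i j).norm).bddAbove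
        exact ⟨B, fun X hX => hB ⟨X, hX, rfl⟩⟩
      choose B hB using hb
      refine ⟨1 + ∑ i, ∑ j, |B i j|, ?_, fun X hX i j => (hB i j X hX).trans ?_⟩
      · have : 0 ≤ ∑ i, ∑ j, |B i j| := by positivity
        linarith
      · have h1 := Finset.single_le_sum (f := fun j => |B i j|) (fun j _ => abs_nonneg _)
          (Finset.mem_univ j)
        have h2 := Finset.single_le_sum (f := fun i => ∑ j, |B i j|)
          (fun i _ => Finset.sum_nonneg fun j _ => abs_nonneg _) (Finset.mem_univ i)
        have := le_abs_self (B i j)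
        linarith
    obtain ⟨B, hB1, hB⟩ := hB
    rw [he.comap_apply]
    exact (measure_mono fun X hX => hB X hX).trans_lt (upM_entry_le hB1 n).2.lt_top
  have hne : m ≠ 0 := by
    intro h0
    rw [h0, Measure.map_zero] at hmap
    have := (upM_entry_le (R := R) le_rfl n).1
    rw [← hmap] at this
    simp at this
  have heq := Measure.isMulLeftInvariant_eq_smul m lN
  set c₀ := Measure.haarScalarFactor m lN
  have hc₀ : (c₀ : ℝ≥0∞) ≠ 0 := by
    intro h0
    apply hne
    rw [heq]
    have : c₀ = 0 := by exact_mod_cast h0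
    rw [this, zero_smul]
  refine ⟨(c₀ : ℝ≥0∞)⁻¹, ENNReal.inv_ne_zero.2 ENNReal.coe_ne_top, ENNReal.inv_ne_top.2 hc₀,
    fun f hf => ?_⟩
  have h1 : ∫⁻ u : unip n R, f u.1.1 ∂m = c₀ * ∫⁻ u : unip n R, f u.1.1 ∂lN := by
    rw [heq, lintegral_smul_measure]
    rfl
  rw [← hmap, he.lintegral_map, h1, ← mul_assoc, ENNReal.inv_mul_cancel hc₀ ENNReal.coe_ne_top,
    one_mul]

end UnipInvariance

/-! ## The quotient measure -/

section Quotient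

variable {F : Type*} [NontriviallyNormedField F] [ProperSpace F] {n : ℕ}

variable [MeasureSpace F] [BorelSpace F] [(volume : Measure F).IsAddHaarMeasure]

/-- The matrix u'⁻¹ u t equals t' l' l⁻¹, so it is upper and lower triangular at once. Since t has
no zero entry, u'⁻¹ u is diagonal, and it is unipotent. -/
theorem upUnip_unique {u u' l l' : Matrix (Fin n) (Fin n) F} (hu : IsUpUnip u) (hu' : IsUpUnip u')
    (hl : IsLowUnip l) (hl' : IsLowUnip l') {t t' : Fin n → F} (ht : ∀ i, t i ≠ 0)
    (h : u * Matrix.diagonal t * l = u' * Matrix.diagonal t' * l') : u = u' := by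
  have hlu : IsUnit l.det := by rw [hl.det]; exact isUnit_one
  have huu : IsUnit u'.det := by rw [hu'.det]; exact isUnit_one
  let _ := l.invertibleOfIsUnitDet hlu
  let _ := u'.invertibleOfIsUnitDet huu
  have hlt : l.BlockTriangular OrderDual.toDual := fun i j h => hl.1 i j h
  have hlt' : l'.BlockTriangular OrderDual.toDual := fun i j h => hl'.1 i j h
  have hut : u.BlockTriangular id := fun i j h => hu.1 i j h
  have hut' : u'.BlockTriangular id := fun i j h => hu'.1 i j h
  have hli : (l⁻¹).BlockTriangular OrderDual.toDual :=
    Matrix.blockTriangular_inv_of_blockTriangular hlt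
  have hui : (u'⁻¹).BlockTriangular id := Matrix.blockTriangular_inv_of_blockTriangular hut'
  set B := u'⁻¹ * u with hB
  have hBt : B.BlockTriangular id := hui.mul hut
  have huB : u' * B = u := by rw [hB, ← mul_assoc, Matrix.mul_nonsing_inv _ huu, one_mul]
  have key : B * Matrix.diagonal t = Matrix.diagonal t' * (l' * l⁻¹) := by
    calc B * Matrix.diagonal t = u'⁻¹ * (u * Matrix.diagonal t * l) * l⁻¹ := by
          rw [hB]
          simp only [mul_assoc]
          rw [Matrix.mul_nonsing_inv _ hlu, mul_one]
      _ = _ := by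
          rw [h]
          simp only [← mul_assoc]
          rw [Matrix.nonsing_inv_mul _ huu, one_mul]
  have hB1 : B = 1 := by
    ext i j
    rcases lt_trichotomy i j with hij | rfl | hij
    · have h1 := congrFun (congrFun key i) j
      rw [Matrix.mul_diagonal, Matrix.diagonal_mul, (hlt'.mul hli)
        (show OrderDual.toDual j < OrderDual.toDual i from hij), mul_zero] at h1
      rw [Matrix.one_apply_ne hij.ne]
      exact (mul_eq_zero.1 h1).resolve_right (ht j)
    · have h1 := upper_mul_diag hut' hBt i
      rw [huB, hu.2, hu'.2, one_mul] at h1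
      rw [Matrix.one_apply_eq, ← h1]
    · rw [Matrix.one_apply_ne hij.ne']
      exact hBt hij
  rw [← huB, hB1, mul_one]

variable (F n) in
/-- The products `u t l` with `u` upper triangular unipotent satisfying `P`, `t` diagonal and `l`
lower triangular unipotent. -/
def cellSet (P : Set (Matrix (Fin n) (Fin n) F)) : Set (Matrix (Fin n) (Fin n) F) :=
  {X | ∃ u, IsUpUnip u ∧ u ∈ P ∧ ∃ (t : Fin n → F) (l : Matrix (Fin n) (Fin n) F), IsLowUnip l ∧
    X = u * Matrix.diagonal t * l}

theorem measurableSet_cellSet {P : Set (Matrix (Fin n) (Fin n) F)} (hP : IsClosed P) :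
    MeasurableSet (cellSet F n P) := by
  have h : cellSet F n P = (fun p : Matrix (Fin n) (Fin n) F × (Fin n → F) ×
      Matrix (Fin n) (Fin n) F => p.1 * Matrix.diagonal p.2.1 * p.2.2) ''
      (({u | IsUpUnip u} ∩ P) ×ˢ (Set.univ ×ˢ {l | IsLowUnip l})) := by
    ext X
    constructor
    · rintro ⟨u, hu, huP, t, l, hl, rfl⟩
      exact ⟨(u, t, l), ⟨⟨hu, huP⟩, trivial, hl⟩, rfl⟩
    · rintro ⟨⟨u, t, l⟩, ⟨⟨hu, huP⟩, -, hl⟩, rfl⟩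
      exact ⟨u, hu, huP, t, l, hl, rfl⟩
  rw [h]
  refine measurableSet_image_of_isClosed ?_ ?_
  · have h1 : Continuous fun p : Matrix (Fin n) (Fin n) F × (Fin n → F) ×
        Matrix (Fin n) (Fin n) F => Matrix.diagonal p.2.1 :=
      Continuous.matrix_diagonal (continuous_fst.comp continuous_snd)
    exact (continuous_fst.matrix_mul h1).matrix_mul (continuous_snd.comp continuous_snd)
  · exact (isClosed_isUpUnip.inter hP).prod (isClosed_univ.prod isClosed_isLowUnip)

/-- A function on `GL_n` with `∫_N η(u g) du` bounded below. -/
def cellWeight (X : Matrix (Fin n) (Fin n) F) : ℝ≥0∞ :=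
  (cellSet F n {u | ∀ i j, ‖u i j‖ ≤ 1}).indicator 1 X + (cellSet F n Set.univ)ᶜ.indicator 1 X

theorem measurable_cellWeight :
    Measurable (cellWeight : Matrix (Fin n) (Fin n) F → ℝ≥0∞) :=
  (measurable_one.indicator (measurableSet_cellSet (isClosed_entry_le 1))).add
    (measurable_one.indicator (measurableSet_cellSet isClosed_univ).compl)

/-- On the open cell the weight is the indicator of the unit ball in the u-coordinate, which is well
defined by `upUnip_unique`. -/
theorem cellWeight_eq {u l : Matrix (Fin n) (Fin n) F} (hu : IsUpUnip u) (hl : IsLowUnip l)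
    {t : Fin n → F} (ht : ∀ i, t i ≠ 0) : cellWeight (u * Matrix.diagonal t * l) =
      Set.indicator {u : Matrix (Fin n) (Fin n) F | ∀ i j, ‖u i j‖ ≤ 1} 1 u := by
  have h1 : u * Matrix.diagonal t * l ∈ cellSet F n Set.univ := ⟨u, hu, trivial, t, l, hl, rfl⟩
  rw [cellWeight, Set.indicator_of_notMem (s := (cellSet F n Set.univ)ᶜ) (fun h => h h1), add_zero]
  by_cases h : u ∈ {u : Matrix (Fin n) (Fin n) F | ∀ i j, ‖u i j‖ ≤ 1}
  · rw [Set.indicator_of_mem h, Set.indicator_of_mem]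
    · rfl
    · exact ⟨u, hu, h, t, l, hl, rfl⟩
  · rw [Set.indicator_of_notMem h, Set.indicator_of_notMem]
    rintro ⟨u', hu', hP, t', l', hl', he⟩
    exact h (upUnip_unique hu hu' hl hl' ht he ▸ hP)

/-- If N g lies in the open cell, right invariance of du shows that the first term of the weight
contributes at least the volume of the unit ball of N. Otherwise the whole coset avoids the cell,
and the second term, equal to 1 there, contributes the total mass of N, which is no smaller. -/
theorem le_lintegral_cellWeight [MeasurableSpace (GLn n F)] [BorelSpace (GLn n F)]
    (lN : Measure (unip n F)) [lN.IsHaarMeasure] :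
    ∃ c : ℝ≥0∞, c ≠ 0 ∧ c ≠ ⊤ ∧ ∀ g : GLn n F, c ≤ ∫⁻ u : unip n F, cellWeight (u.1 * g).1 ∂lN := by
  obtain ⟨c, hc, hc', h⟩ := exists_lintegral_unip lN
  have hb := upM_entry_le (R := F) le_rfl n
  have hind : Measurable (Set.indicator {u : Matrix (Fin n) (Fin n) F | ∀ i j, ‖u i j‖ ≤ 1}
      (1 : Matrix (Fin n) (Fin n) F → ℝ≥0∞)) :=
    measurable_one.indicator (isClosed_entry_le 1).measurableSet
  refine ⟨c * upM F n {u | ∀ i j, ‖u i j‖ ≤ 1}, mul_ne_zero hc hb.1, ENNReal.mul_ne_top hc' hb.2,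
    fun g => ?_⟩
  by_cases hg : g.1 ∈ cellSet F n Set.univ
  · obtain ⟨v, hv, -, t, l, hl, hgv⟩ := hg
    have h1 : ∀ u : unip n F, Set.indicator {u : Matrix (Fin n) (Fin n) F | ∀ i j, ‖u i j‖ ≤ 1} 1
        (u.1.1 * v) ≤ cellWeight (u.1 * g).1 := by
      intro u
      by_cases hx : u.1.1 * v ∈ {u : Matrix (Fin n) (Fin n) F | ∀ i j, ‖u i j‖ ≤ 1}
      swap
      · rw [Set.indicator_of_notMem hx]
        exact bot_le
      rw [Set.indicator_of_mem hx]
      refine le_trans (le_of_eq ?_) le_self_add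
      rw [Set.indicator_of_mem]
      · rfl
      · obtain ⟨v₀, rfl⟩ := hv.isUnit
        exact ⟨u.1.1 * v₀.1, (unip n F).mul_mem u.2 (show v₀ ∈ unip n F from hv), hx, t, l, hl, by
          rw [Units.val_mul, hgv]; simp only [mul_assoc]⟩
    refine le_trans (le_of_eq ?_) (lintegral_mono h1)
    rw [h (fun u => Set.indicator {u : Matrix (Fin n) (Fin n) F | ∀ i j, ‖u i j‖ ≤ 1} 1 (u * v))
      (hind.comp (Measurable.matrix_mul measurable_id measurable_const)),
      lintegral_upM_mul_right n hv hind, lintegral_indicator_one (isClosed_entry_le 1).measurableSet]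
  · have h1 : ∀ u : unip n F, 1 ≤ cellWeight (u.1 * g).1 := by
      intro u
      refine le_trans (le_of_eq ?_) le_add_self
      rw [Set.indicator_of_mem]
      · rfl
      · rintro ⟨v, hv, -, t, l, hl, hgv⟩
        apply hg
        obtain ⟨v₀, rfl⟩ := hv.isUnit
        refine ⟨(u.1⁻¹ * v₀).1, (unip n F).mul_mem ((unip n F).inv_mem u.2)
          (show v₀ ∈ unip n F from hv), trivial, t, l, hl, ?_⟩
        rw [Units.val_mul, mul_assoc, mul_assoc, ← mul_assoc v₀.1, ← hgv, ← Units.val_mul,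
          inv_mul_cancel_left]
    refine le_trans ?_ (lintegral_mono h1)
    rw [h (fun _ => 1) measurable_const, lintegral_one]
    gcongr
    exact Set.subset_univ _

variable (F n) in
/-- The density on the diagonal torus, with respect to the additive measure. -/
def torusDensity (t : Fin n → F) : ℝ≥0∞ :=
  ENNReal.ofReal (∏ i : Fin n, nabs F (t i) ^ (2 * ((i : ℕ) : ℝ) - n))

theorem measurable_torusDensity (hn : Measurable (nabs F)) : Measurable (torusDensity F n) :=
  Measurable.ennreal_ofReal (Finset.measurable_prod _ fun i _ =>
    (hn.comp (measurable_pi_apply i)).pow_const _)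

/-- The density |det|^{-n} of GL_n combines with the cell density ∏ |t_i|^{2i}. Since 2i - n = -(n -
1 - 2i) - 1, the result is δ_F(t)⁻¹ d^×t. -/
theorem torusDensity_eq {u l : Matrix (Fin n) (Fin n) F} (hu : IsUpUnip u) (hl : IsLowUnip l)
    (t : Fin n → Fˣ) : detDensity (u * Matrix.diagonal (fun i => (t i : F)) * l) *
      cellDensity (fun i => (t i : F)) = torusDensity F n (fun i => (t i : F)) := by
  have ht : ∀ i, 0 < nabs F (t i : F) := fun i => nabs_pos (t i).isUnit
  have hP : 0 < ∏ i, nabs F (t i : F) := Finset.prod_pos fun i _ => ht i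
  rw [cellDensity_units, detDensity, Matrix.det_mul, Matrix.det_mul, hu.det, hl.det, one_mul,
    mul_one, Matrix.det_diagonal, nabs_prod, ← ENNReal.ofReal_inv_of_pos (pow_pos hP n),
    ← ENNReal.ofReal_mul (by positivity), torusDensity]
  congr 1
  rw [← Finset.prod_pow, ← Finset.prod_inv_distrib, ← Finset.prod_mul_distrib]
  refine Finset.prod_congr rfl fun i _ => ?_
  rw [Real.rpow_sub (ht i), Real.rpow_natCast,
    show 2 * ((i : ℕ) : ℝ) = ((2 * (i : ℕ) : ℕ) : ℝ) by push_cast; ring, Real.rpow_natCast,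
    div_eq_inv_mul]

/-- The exponent n - 2i of |t₁ i| is (n + 2) - 2(i + 1). The first part disappears because the
product of the |t₁ i| is 1, and the second gives the inverse square of the product of the D_m. -/
theorem torusDensity_shift {t₁ t : Fin n → Fˣ} (h : ∏ i, nabs F (t₁ i : F) = 1) :
    torusDensity F n (fun i => (((t₁ i)⁻¹ : Fˣ) : F) * t i) =
      torusDensity F n (fun i => (t i : F)) *
        ENNReal.ofReal ((∏ m, ∏ i ∈ Finset.Ici m, nabs F (t₁ i : F)) ^ (-2 : ℝ)) := by
  have h0 : ∀ i, 0 < nabs F (t₁ i : F) := fun i => nabs_pos (t₁ i).isUnit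
  have h1 : ∀ i, 0 < nabs F (t i : F) := fun i => nabs_pos (t i).isUnit
  rw [torusDensity, torusDensity, ← ENNReal.ofReal_mul (Finset.prod_nonneg fun i _ =>
    Real.rpow_nonneg (nabs_nonneg _) _)]
  congr 1
  have h2 : (∏ i, nabs F (t₁ i : F)) ^ ((n : ℝ) + 2) = 1 := by rw [h, Real.one_rpow]
  have h3 : ∀ i, nabs F ((((t₁ i)⁻¹ : Fˣ) : F) * t i) ^ (2 * ((i : ℕ) : ℝ) - n) =
      nabs F (t i : F) ^ (2 * ((i : ℕ) : ℝ) - n) * (nabs F (t₁ i : F) ^ ((i : ℕ) + 1)) ^ (-2 : ℝ) *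
        nabs F (t₁ i : F) ^ ((n : ℝ) + 2) := by
    intro i
    rw [nabs_mul, nabs_units_inv, Real.mul_rpow (inv_pos.2 (h0 i)).le (h1 i).le,
      Real.inv_rpow (h0 i).le, ← Real.rpow_neg (h0 i).le, ← Real.rpow_natCast,
      ← Real.rpow_mul (h0 i).le, mul_assoc, ← Real.rpow_add (h0 i), mul_comm]
    congr 2
    push_cast
    ring
  simp only [h3]
  rw [Finset.prod_mul_distrib, Finset.prod_mul_distrib, Real.finsetProd_rpow _ _
    (fun i _ => (h0 i).le), h2, mul_one, prod_prod_Ici,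
    Real.finsetProd_rpow _ _ (fun i _ => (pow_pos (h0 i) _).le)]

/-- Integrals over `N_n(F) \ GL_n(F)` of right `K`-invariant functions, in terms of the torus. -/
theorem exists_lintegral_quotient_le {K : ∀ n, Subgroup (GLn n F)} (hF : TameNabs F)
    (hK : IwasawaFamily K) (hM : HasHeight F) (n : ℕ) [MeasurableSpace (GLn n F)]
    [BorelSpace (GLn n F)] (lG : Measure (GLn n F)) [lG.IsHaarMeasure] (lN : Measure (unip n F))
    [lN.IsHaarMeasure] (ν : Measure (UnipQuotient n F)) (hν : IsQuotientMeasure lG lN ν) :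
    ∃ C : ℝ≥0∞, C ≠ ⊤ ∧ ∀ h : (Fin n → ℝ) → ℝ≥0∞, Measurable h →
      ∫⁻ x, h (iwasawaT (K n) x.out.1) ∂ν ≤
        C * ∫⁻ t : Fin n → F, h (fun i => nabs F (t i)) * torusDensity F n t := by
  have hn : Measurable (nabs F) := hF.continuous_nabs.measurable
  have hu : ∀ᵐ x : F, IsUnit x := by
    have : ∀ᵐ x : F, x ≠ 0 := by
      rw [ae_iff]; simp
    exact this.mono fun x hx => isUnit_iff_ne_zero.2 hx
  obtain ⟨c₀, hc₀, hc₀', hη⟩ := le_lintegral_cellWeight lN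
  obtain ⟨cG, hcG, hG⟩ := exists_lintegral_GL_le hF n lG
  obtain ⟨c, hc, hc', hcell⟩ := lintegral_cell hu hn n
  -- The exponent is the one produced by `torusDensity_shift`; all that matters is 2 > 1.
  have hfin := lintegral_lowM_lt_top hF hK hM (s := 2) (by norm_num) n
  set I := ∫⁻ l, ENNReal.ofReal ((∏ m, iwasawaD (K n) l m) ^ (-2 : ℝ)) ∂(lowM F n)
  have hb := upM_entry_le (R := F) le_rfl n
  set V := upM F n {u | ∀ i j, ‖u i j‖ ≤ 1}
  refine ⟨c₀⁻¹ * (cG * (c * (I * V))), ENNReal.mul_ne_top (ENNReal.inv_ne_top.2 hc₀)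
    (ENNReal.mul_ne_top hcG (ENNReal.mul_ne_top hc' (ENNReal.mul_ne_top hfin.ne hb.2))),
    fun h hh => ?_⟩
  have hTm : Measurable fun X : Matrix (Fin n) (Fin n) F => h (iwasawaT (K n) X) :=
    hh.comp (measurable_pi_lambda _ fun i => measurable_iwasawaT hF hK i)
  have hval : Measurable fun g : GLn n F => g.1 := Units.continuous_val.measurable
  have hwm : Measurable fun X : Matrix (Fin n) (Fin n) F =>
      h (iwasawaT (K n) X) * cellWeight X := hTm.mul measurable_cellWeight
  -- from the quotient to the group
  have step1 : c₀ * ∫⁻ x, h (iwasawaT (K n) x.out.1) ∂ν ≤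
      ∫⁻ g : GLn n F, h (iwasawaT (K n) g.1) * cellWeight g.1 ∂lG := by
    rw [hν (fun g => h (iwasawaT (K n) g.1) * cellWeight g.1) (hwm.comp hval)]
    refine (lintegral_const_mul_le _ _).trans (lintegral_mono fun x => ?_)
    have hT : ∀ u : unip n F, iwasawaT (K n) (u.1 * x.out).1 = iwasawaT (K n) x.out.1 := by
      intro u
      funext i
      rw [Units.val_mul, iwasawaT_mul_left hF hK (fun i j hij => u.2.1 i j hij), u.2.2, nabs_one,
        one_mul]
    simp only [hT]
    rw [mul_comm]
    exact (mul_le_mul_right (hη x.out) _).trans (lintegral_const_mul_le _ _)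
  have step2 := hG _ hwm
  have hρ := measurable_detDensity (n := n) hn
  rw [hcell (fun X => h (iwasawaT (K n) X) * cellWeight X * detDensity X) (hwm.mul hρ)] at step2
  set J := ∫⁻ t : Fin n → F, h (fun i => nabs F (t i)) * torusDensity F n t
  have hJm : ∀ x : Fin n → Fˣ, Measurable fun t : Fin n → F =>
      h (fun i => nabs F (t i)) * torusDensity F n (fun i => (((x i)⁻¹ : Fˣ) : F) * t i) := by
    intro x
    have hsh : Measurable fun (t : Fin n → F) i => (((x i)⁻¹ : Fˣ) : F) * t i :=
      (by fun_prop : Continuous fun (t : Fin n → F) i => (((x i)⁻¹ : Fˣ) : F) * t i).measurable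
    refine Measurable.mul (hh.comp (measurable_pi_lambda _ fun i =>
      hn.comp (measurable_pi_apply i))) ((measurable_torusDensity hn).comp hsh)
  -- the inner integrals
  have hind : Measurable (Set.indicator {u : Matrix (Fin n) (Fin n) F | ∀ i j, ‖u i j‖ ≤ 1}
      (1 : Matrix (Fin n) (Fin n) F → ℝ≥0∞)) :=
    measurable_one.indicator (isClosed_entry_le 1).measurableSet
  have step3 : ∀ᵐ l ∂(lowM F n), (∫⁻ t : Fin n → F, ∫⁻ u,
      h (iwasawaT (K n) (u * Matrix.diagonal t * l)) * cellWeight (u * Matrix.diagonal t * l) *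
        detDensity (u * Matrix.diagonal t * l) * cellDensity t ∂(upM F n) ∂volume) =
      ENNReal.ofReal ((∏ m, iwasawaD (K n) l m) ^ (-2 : ℝ)) * (V * J) := by
    refine (ae_lowM n).mono fun l hl => ?_
    obtain ⟨g, rfl⟩ := hl.isUnit
    obtain ⟨b, hb, k, hk, hbk⟩ := exists_iwasawa hK g
    let t₁ : Fin n → Fˣ := fun i => (upper_diag_isUnit hb i).unit
    have ht₁ : ∀ i, iwasawaT (K n) g.1 i = nabs F (t₁ i : F) := fun i => by
      rw [hbk, Units.val_mul, iwasawaT_mul hF hK hb hk]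
      rfl
    have hprod : ∏ i, nabs F (t₁ i : F) = 1 := by
      have := prod_iwasawaT hF hK g
      rw [hl.det, nabs_one] at this
      simpa [ht₁] using this
    have hae : ∀ᵐ t : Fin n → F, ∫⁻ u,
        h (iwasawaT (K n) (u * Matrix.diagonal t * g.1)) * cellWeight (u * Matrix.diagonal t * g.1) *
        detDensity (u * Matrix.diagonal t * g.1) * cellDensity t ∂(upM F n) =
        V * (h (fun i => nabs F ((t₁ i : F) * t i)) *
          torusDensity F n (fun i => (((t₁ i)⁻¹ : Fˣ) : F) * ((t₁ i : F) * t i))) := by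
      refine (ae_forall_isUnit hu).mono fun t ht => ?_
      choose t' ht' using ht
      obtain rfl : (fun i => (t' i : F)) = t := funext ht'
      have hau : ∀ᵐ u ∂(upM F n), h (iwasawaT (K n) (u * Matrix.diagonal (fun i => (t' i : F)) * g.1)) *
          cellWeight (u * Matrix.diagonal (fun i => (t' i : F)) * g.1) *
          detDensity (u * Matrix.diagonal (fun i => (t' i : F)) * g.1) *
          cellDensity (fun i => (t' i : F)) =
          Set.indicator {u : Matrix (Fin n) (Fin n) F | ∀ i j, ‖u i j‖ ≤ 1} 1 u *
            (h (fun i => nabs F ((t₁ i : F) * t' i)) * torusDensity F n (fun i => (t' i : F))) := by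
        refine (ae_upM n).mono fun u hu' => ?_
        rw [mul_assoc _ (detDensity _), torusDensity_eq hu' hl, cellWeight_eq hu' hl
          (fun i => (t' i).ne_zero)]
        obtain ⟨u₀, rfl⟩ := hu'.isUnit
        have hub : (u₀ * torus t').1.BlockTriangular id :=
          Matrix.BlockTriangular.mul (fun i j h => hu'.1 i j h) (torus_upper t')
        have hT : iwasawaT (K n) (u₀.1 * Matrix.diagonal (fun i => (t' i : F)) * g.1) =
            fun i => nabs F ((t₁ i : F) * t' i) := by
          funext i
          have := iwasawaT_mul_left hF hK hub g i
          rw [ht₁, Units.val_mul] at this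
          refine this.trans ?_
          change nabs F ((u₀.1 * Matrix.diagonal fun i => (t' i : F)) i i) * _ = _
          rw [Matrix.mul_diagonal, hu'.2, one_mul, nabs_mul, mul_comm]
        rw [hT]
        ring
      rw [lintegral_congr_ae hau, lintegral_mul_const _ hind,
        lintegral_indicator_one (isClosed_entry_le 1).measurableSet]
      simp only [Units.inv_mul_cancel_left]
      rfl
    have hJm' : Measurable fun t : Fin n → F => h (fun i => nabs F ((t₁ i : F) * t i)) *
        torusDensity F n (fun i => (((t₁ i)⁻¹ : Fˣ) : F) * ((t₁ i : F) * t i)) := (hJm t₁).comp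
      (by fun_prop : Continuous fun (t : Fin n → F) i => (t₁ i : F) * t i).measurable
    -- The Iwasawa part t₁ of l is moved from the argument of h into the torus density. The Jacobian
    -- of t ↦ t₁ t is 1 because ∏ |t₁ i| = |det l| = 1.
    rw [lintegral_congr_ae hae, lintegral_const_mul _ hJm',
      lintegral_pi_unit_mul t₁ (fun t => h (fun i => nabs F (t i)) *
        torusDensity F n (fun i => (((t₁ i)⁻¹ : Fˣ) : F) * t i)) (hJm t₁), hprod, inv_one,
      ENNReal.ofReal_one, one_mul, mul_left_comm]
    congr 1
    simp only [J]
    rw [← lintegral_const_mul' _ _ ENNReal.ofReal_ne_top]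
    refine lintegral_congr_ae ((ae_forall_isUnit hu).mono fun t ht => ?_)
    choose t' ht' using ht
    obtain rfl : (fun i => (t' i : F)) = t := funext ht'
    have hD : ∏ m, iwasawaD (K n) g.1 m = ∏ m, ∏ i ∈ Finset.Ici m, nabs F (t₁ i : F) := by
      simp only [iwasawaD, ht₁]
    beta_reduce
    rw [torusDensity_shift hprod, hD]
    ring
  rw [lintegral_congr_ae step3, lintegral_mul_const'' _ (by
    exact ((Finset.measurable_prod _ fun i _ => measurable_iwasawaD hF hK i).pow_const
      _).ennreal_ofReal.aemeasurable)] at step2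
  calc ∫⁻ x, h (iwasawaT (K n) x.out.1) ∂ν
      = c₀⁻¹ * (c₀ * ∫⁻ x, h (iwasawaT (K n) x.out.1) ∂ν) := by
        rw [← mul_assoc, ENNReal.inv_mul_cancel hc₀ hc₀', one_mul]
    _ ≤ c₀⁻¹ * (cG * (c * (I * (V * J)))) := mul_le_mul_right (step1.trans step2) _
    _ = _ := by simp only [mul_assoc]

end Quotient

/-! ## Absolute values of local fields -/

section LocalField

variable {k : Type*} [NontriviallyNormedField k] [ProperSpace k]

theorem nabs_zero : nabs k (0 : k) = 0 := nabs_of_not_isUnit not_isUnit_zero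

theorem nabs_field_pos {x : k} (hx : x ≠ 0) : 0 < nabs k x := nabs_pos (isUnit_iff_ne_zero.2 hx)

variable (k) in
/-- The normalized absolute value as a homomorphism of monoids with zero. -/
def nabsZeroHom : k →*₀ ℝ where
  toFun := nabs k
  map_one' := nabs_one
  map_mul' := nabs_mul
  map_zero' := nabs_zero

theorem nabs_zpow (x : k) (m : ℤ) : nabs k (x ^ m) = nabs k x ^ m := map_zpow₀ (nabsZeroHom k) x m

theorem nabs_inv (x : k) : nabs k x⁻¹ = (nabs k x)⁻¹ := map_inv₀ (nabsZeroHom k) x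

variable [MeasureSpace k] [BorelSpace k] [(volume : Measure k).IsAddHaarMeasure]

theorem volume_closedBall_norm {x : k} (hx : x ≠ 0) :
    volume (Metric.closedBall (0 : k) ‖x‖) =
      ENNReal.ofReal (nabs k x) * volume (Metric.closedBall (0 : k) 1) := by
  rw [← Units.val_mk0 hx, ← volume_unit_smul _ _ Metric.isClosed_closedBall.measurableSet]
  congr 1
  ext y
  simp only [Units.val_mk0, mem_closedBall_zero_iff, Set.mem_image]
  constructor
  · intro hy
    refine ⟨x⁻¹ * y, ?_, by field_simp⟩
    rw [norm_mul, norm_inv, inv_mul_le_iff₀ (norm_pos_iff.2 hx), mul_one]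
    exact hy
  · rintro ⟨z, hz, rfl⟩
    rw [norm_mul]
    exact mul_le_of_le_one_right (norm_nonneg _) hz

/-- The absolute value of x is the volume of the ball of radius ‖x‖ relative to the unit ball, so it
is monotone in the norm. -/
theorem nabs_mono {x y : k} (h : ‖x‖ ≤ ‖y‖) : nabs k x ≤ nabs k y := by
  by_cases hx : x = 0
  · rw [hx, nabs_zero]; exact nabs_nonneg _
  have hy : y ≠ 0 := by
    rintro rfl
    rw [norm_zero] at h
    exact hx (norm_le_zero_iff.1 h)
  have h1 := measure_mono (μ := (volume : Measure k)) (Metric.closedBall_subset_closedBall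
    (x := (0 : k)) h)
  rw [volume_closedBall_norm hx, volume_closedBall_norm hy] at h1
  have h2 := (ENNReal.mul_le_mul_iff_left (Metric.measure_closedBall_pos (volume : Measure k) 0
    one_pos).ne' (isCompact_closedBall (0 : k) 1).measure_lt_top.ne).1 h1
  exact (ENNReal.ofReal_le_ofReal_iff (nabs_nonneg _)).1 h2

/-- Otherwise the balls of radius ‖x‖^m would all have the volume of the unit ball, although they
exhaust the field, whose Haar measure is infinite. -/
theorem one_lt_nabs {x : k} (hx : 1 < ‖x‖) : 1 < nabs k x := by
  have h1 : 1 ≤ nabs k x := by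
    rw [← nabs_one (R := k)]
    exact nabs_mono (by rw [norm_one]; exact hx.le)
  refine lt_of_le_of_ne h1 fun h => ?_
  have hx0 : x ≠ 0 := norm_pos_iff.1 (one_pos.trans hx)
  have h2 : ∀ m : ℕ, volume (Metric.closedBall (0 : k) (‖x‖ ^ m)) =
      volume (Metric.closedBall (0 : k) 1) := by
    intro m
    rw [← norm_pow, volume_closedBall_norm (pow_ne_zero m hx0), nabs_pow, ← h, one_pow,
      ENNReal.ofReal_one, one_mul]
  have h3 : (⋃ m : ℕ, Metric.closedBall (0 : k) (‖x‖ ^ m)) = Set.univ := by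
    refine Set.eq_univ_of_forall fun y => ?_
    obtain ⟨m, hm⟩ := pow_unbounded_of_one_lt ‖y‖ hx
    exact Set.mem_iUnion.2 ⟨m, mem_closedBall_zero_iff.2 hm.le⟩
  have h4 : Monotone fun m : ℕ => Metric.closedBall (0 : k) (‖x‖ ^ m) := fun m m' hm =>
    Metric.closedBall_subset_closedBall (pow_le_pow_right₀ hx.le hm)
  have h5 := h4.measure_iUnion (μ := (volume : Measure k))
  rw [h3, measure_univ_of_isAddLeftInvariant] at h5
  simp only [h2, ciSup_const] at h5
  exact (isCompact_closedBall (0 : k) 1).measure_lt_top.ne h5.symm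

variable (k) in
/-- The normalized absolute value of a local field is a power of its norm. -/
theorem exists_nabs_eq_rpow : ∃ c : ℝ, 0 < c ∧ ∀ x, nabs k x = ‖x‖ ^ c := by
  obtain ⟨x₀, hx₀⟩ := NormedField.exists_one_lt_norm k
  have hn₀ := one_lt_nabs hx₀
  have hl := Real.log_pos hx₀
  have hln := Real.log_pos hn₀
  have hne₀ : x₀ ≠ 0 := norm_pos_iff.1 (one_pos.trans hx₀)
  refine ⟨Real.log (nabs k x₀) / Real.log ‖x₀‖, div_pos hln hl, fun x => ?_⟩
  by_cases hx : x = 0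
  · rw [hx, nabs_zero, norm_zero, Real.zero_rpow (div_pos hln hl).ne']
  have hxp : 0 < ‖x‖ := norm_pos_iff.2 hx
  have hnp : 0 < nabs k x := nabs_field_pos hx
  -- The classical comparison of equivalent absolute values: a rational bound p/q on the first ratio
  -- compares x^q with x₀^p in norm, and `nabs_mono` transfers it to the second, so no rational
  -- separates the two ratios.
  have key : Real.log ‖x‖ / Real.log ‖x₀‖ = Real.log (nabs k x) / Real.log (nabs k x₀) := by
    refine le_antisymm (le_of_forall_rat_lt_imp_le fun r hr => ?_)
      (le_of_forall_lt_rat_imp_le fun r hr => ?_)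
    · have hd : (0 : ℝ) < r.den := by exact_mod_cast r.den_pos
      rw [Rat.cast_def, div_lt_div_iff₀ hd hl] at hr
      rw [Rat.cast_def, div_le_div_iff₀ hd hln]
      have h1 : ‖x₀ ^ r.num‖ ≤ ‖x ^ (r.den : ℤ)‖ := by
        rw [norm_zpow, norm_zpow, ← Real.log_le_log_iff (zpow_pos (one_pos.trans hx₀) _)
          (zpow_pos hxp _), Real.log_zpow, Real.log_zpow]
        push_cast
        linarith
      have h2 := nabs_mono h1
      rw [nabs_zpow, nabs_zpow, ← Real.log_le_log_iff (zpow_pos (one_pos.trans hn₀) _)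
          (zpow_pos hnp _), Real.log_zpow, Real.log_zpow] at h2
      push_cast at h2
      linarith
    · have hd : (0 : ℝ) < r.den := by exact_mod_cast r.den_pos
      rw [Rat.cast_def, div_lt_div_iff₀ hl hd] at hr
      rw [Rat.cast_def, div_le_div_iff₀ hln hd]
      have h1 : ‖x ^ (r.den : ℤ)‖ ≤ ‖x₀ ^ r.num‖ := by
        rw [norm_zpow, norm_zpow, ← Real.log_le_log_iff (zpow_pos hxp _)
          (zpow_pos (one_pos.trans hx₀) _), Real.log_zpow, Real.log_zpow]
        push_cast
        linarith
      have h2 := nabs_mono h1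
      rw [nabs_zpow, nabs_zpow, ← Real.log_le_log_iff (zpow_pos hnp _)
          (zpow_pos (one_pos.trans hn₀) _), Real.log_zpow, Real.log_zpow] at h2
      push_cast at h2
      linarith
  rw [Real.rpow_def_of_pos hxp, ← Real.exp_log hnp]
  congr 1
  field_simp at key ⊢
  linarith

variable (k) in
theorem tameNabs_field : TameNabs k := by
  obtain ⟨c, hc, h⟩ := exists_nabs_eq_rpow k
  refine ⟨?_, c, hc.le, fun x => (h x).le⟩
  rw [show nabs k = fun x => ‖x‖ ^ c from funext h]
  exact continuous_norm.rpow_const fun x => Or.inr hc.le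

theorem ae_isUnit_field : ∀ᵐ x : k, IsUnit x := by
  have : ∀ᵐ x : k, x ≠ 0 := by
    rw [ae_iff]; simp
  exact this.mono fun x hx => isUnit_iff_ne_zero.2 hx

variable (k) in
/-- Integrability on the multiplicative group of a local field. -/
theorem lintegral_min_rpow_lt_top {a : ℝ} (ha : 0 < a) :
    ∫⁻ x : k, ENNReal.ofReal (min (nabs k x ^ a) (nabs k x ^ (-a)) * (nabs k x)⁻¹) < ⊤ := by
  obtain ⟨x₀, hx₀⟩ := NormedField.exists_one_lt_norm k
  have hq := one_lt_nabs hx₀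
  set q := nabs k x₀ with hqdef
  have hq0 : 0 < q := one_pos.trans hq
  have hne₀ : x₀ ≠ 0 := norm_pos_iff.1 (one_pos.trans hx₀)
  have hm : Measurable (nabs k) := (tameNabs_field k).continuous_nabs.measurable
  -- Shells q^j ≤ |x| < q^{j+1}. Their volume is q^j times that of the zeroth shell, which cancels
  -- the factor |x|⁻¹ and leaves two geometric series.
  let A : ℤ → Set k := fun j => nabs k ⁻¹' Set.Ico (q ^ j) (q ^ (j + 1))
  have hAm : ∀ j, MeasurableSet (A j) := fun j => hm measurableSet_Ico
  have hA0 : volume (A 0) < ⊤ := by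
    refine (measure_mono ?_).trans_lt (isCompact_closedBall (0 : k) ‖x₀‖).measure_lt_top
    rintro x ⟨-, hx⟩
    rw [zero_add, zpow_one] at hx
    rw [mem_closedBall_zero_iff]
    by_contra! h
    exact absurd (nabs_mono h.le) (not_le.2 hx)
  have hAj : ∀ j, volume (A j) = ENNReal.ofReal (q ^ j) * volume (A 0) := by
    intro j
    have h1 := volume_unit_smul (Units.mk0 (x₀ ^ j) (zpow_ne_zero j hne₀)) (A 0) (hAm 0)
    rw [Units.val_mk0, nabs_zpow] at h1
    rw [← h1]
    congr 1
    ext x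
    simp only [A, Set.mem_preimage, Set.mem_Ico, Set.mem_image, zpow_zero, zero_add, zpow_one]
    have hqj : 0 < q ^ j := zpow_pos hq0 j
    constructor
    · rintro ⟨h2, h3⟩
      refine ⟨(x₀ ^ j)⁻¹ * x, ?_, by field_simp⟩
      rw [nabs_mul, nabs_inv, nabs_zpow, ← hqdef]
      rw [zpow_add_one₀ hq0.ne'] at h3
      constructor
      · rw [le_inv_mul_iff₀ hqj, mul_one]; exact h2
      · rw [inv_mul_lt_iff₀ hqj]; exact h3
    · rintro ⟨y, ⟨h2, h3⟩, rfl⟩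
      rw [nabs_mul, nabs_zpow, ← hqdef, zpow_add_one₀ hq0.ne']
      exact ⟨le_mul_of_one_le_right hqj.le h2, mul_lt_mul_of_pos_left h3 hqj⟩
  have hcover : ∀ᵐ x : k, x ∈ ⋃ j, A j := by
    refine ae_isUnit_field.mono fun x hx => ?_
    obtain ⟨j, hj⟩ := exists_mem_Ico_zpow (nabs_pos hx) hq
    exact Set.mem_iUnion.2 ⟨j, hj⟩
  have hbound : ∀ j, ∫⁻ x in A j, ENNReal.ofReal (min (nabs k x ^ a) (nabs k x ^ (-a)) *
      (nabs k x)⁻¹) ≤ ENNReal.ofReal (q ^ a * (q ^ (-a)) ^ j.natAbs) * volume (A 0) := by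
    intro j
    have hqj : 0 < q ^ j := zpow_pos hq0 j
    refine (setLIntegral_mono (g := fun _ => ENNReal.ofReal (q ^ a * (q ^ (-a)) ^ j.natAbs *
      (q ^ j)⁻¹)) measurable_const fun x hx => ?_).trans (le_of_eq ?_)
    · refine ENNReal.ofReal_le_ofReal ?_
      obtain ⟨h1, h2⟩ := hx
      have hxp : 0 < nabs k x := hqj.trans_le h1
      refine mul_le_mul ?_ (inv_anti₀ hqj h1) (inv_nonneg.2 hxp.le) (by positivity)
      rcases le_or_gt 0 j with hj | hj
      · obtain ⟨m, rfl⟩ := Int.eq_ofNat_of_zero_le hj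
        refine (min_le_right _ _).trans ?_
        rw [zpow_natCast] at h1
        calc nabs k x ^ (-a) ≤ (q ^ m) ^ (-a) :=
              Real.rpow_le_rpow_of_nonpos (by positivity) h1 (by linarith)
          _ = (q ^ (-a)) ^ m := by
              rw [← Real.rpow_natCast, ← Real.rpow_natCast, ← Real.rpow_mul hq0.le,
                ← Real.rpow_mul hq0.le, mul_comm]
          _ ≤ _ := by
              rw [Int.natAbs_natCast]
              exact le_mul_of_one_le_left (by positivity) (Real.one_le_rpow hq.le ha.le)
      · refine (min_le_left _ _).trans ?_
        have hj' : (j.natAbs : ℝ) = -(j : ℝ) := by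
          rw [Nat.cast_natAbs, abs_of_neg hj]; push_cast; ring
        calc nabs k x ^ a ≤ (q ^ (j + 1)) ^ a := Real.rpow_le_rpow hxp.le h2.le ha.le
          _ = q ^ a * (q ^ (-a)) ^ j.natAbs := by
              rw [← Real.rpow_natCast, ← Real.rpow_intCast, ← Real.rpow_mul hq0.le,
                ← Real.rpow_mul hq0.le, ← Real.rpow_add hq0, hj']
              congr 1
              push_cast
              ring
    · rw [setLIntegral_const, hAj, ← mul_assoc, ← ENNReal.ofReal_mul (by positivity),
        inv_mul_cancel_right₀ hqj.ne']
  have hr1 : q ^ (-a) < 1 := Real.rpow_lt_one_of_one_lt_of_neg hq (by linarith)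
  have hr0 : 0 ≤ q ^ (-a) := Real.rpow_nonneg hq0.le _
  have hsum : Summable fun j : ℤ => q ^ a * (q ^ (-a)) ^ j.natAbs := by
    refine Summable.mul_left _ (Summable.of_nat_of_neg ?_ ?_)
    · simpa using summable_geometric_of_lt_one hr0 hr1
    · simpa using summable_geometric_of_lt_one hr0 hr1
  rw [← Measure.restrict_eq_self_of_ae_mem hcover]
  refine (lintegral_iUnion_le _ _).trans_lt ?_
  refine (ENNReal.tsum_le_tsum hbound).trans_lt ?_
  rw [ENNReal.tsum_mul_right, ← ENNReal.ofReal_tsum_of_nonneg (fun j => by positivity) hsum]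
  exact ENNReal.mul_lt_top ENNReal.ofReal_lt_top hA0

variable (k) in
-- With a = min(1, s - 1) the integrand is at most min(|x|^a, |x|^{-a}) |x|⁻¹, both near 0 and near
-- infinity.
theorem lintegral_max_rpow_lt_top {s : ℝ} (hs : 1 < s) :
    ∫⁻ x : k, ENNReal.ofReal (max 1 (nabs k x) ^ (-s)) < ⊤ := by
  have ha : 0 < min 1 (s - 1) := lt_min one_pos (by linarith)
  refine (lintegral_mono_ae (ae_isUnit_field.mono fun x hx => ENNReal.ofReal_le_ofReal ?_)).trans_lt
    (lintegral_min_rpow_lt_top k ha)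
  have hp := nabs_pos hx
  set y := nabs k x
  have h1 := min_le_left 1 (s - 1)
  have h2 := min_le_right 1 (s - 1)
  set a := min 1 (s - 1)
  rw [← Real.rpow_neg_one y]
  rcases le_total y 1 with hy | hy
  · rw [max_eq_left hy, Real.one_rpow, min_eq_left
      (Real.rpow_le_rpow_of_exponent_ge hp hy (by linarith)), ← Real.rpow_add hp]
    exact Real.one_le_rpow_of_pos_of_le_one_of_nonpos hp hy (by linarith)
  · rw [max_eq_right hy, min_eq_right
      (Real.rpow_le_rpow_of_exponent_le hy (by linarith)), ← Real.rpow_add hp]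
    exact Real.rpow_le_rpow_of_exponent_le hy (by linarith)

end LocalField

/-! ## Finite products of local fields -/

section Product

open scoped Pointwise

variable {ι : Type*} [Fintype ι] {E : ι → Type*} [∀ w, NontriviallyNormedField (E w)]
  [∀ w, ProperSpace (E w)] [∀ w, MeasureSpace (E w)] [∀ w, BorelSpace (E w)]
  [∀ w, (volume : Measure (E w)).IsAddHaarMeasure]

instance : (volume : Measure ((w : ι) → E w)).IsAddHaarMeasure := Measure.pi.isAddHaarMeasure _

theorem nabs_pi (x : (w : ι) → E w) : nabs ((w : ι) → E w) x = ∏ w, nabs (E w) (x w) := by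
  by_cases hx : IsUnit x
  swap
  · rw [nabs_of_not_isUnit hx]
    rw [Pi.isUnit_iff, not_forall] at hx
    obtain ⟨w, hw⟩ := hx
    have h0 : nabs (E w) (x w) = 0 := nabs_of_not_isUnit hw
    exact (Finset.prod_eq_zero (Finset.mem_univ w) h0).symm
  have hxw : ∀ w, IsUnit (x w) := fun w => Pi.isUnit_iff.1 hx w
  obtain ⟨u, rfl⟩ := hx
  let S : Set ((w : ι) → E w) := Set.univ.pi fun w => Metric.closedBall (0 : E w) 1
  have hb0 : ∀ w, volume (Metric.closedBall (0 : E w) 1) ≠ 0 := fun w =>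
    (Metric.measure_closedBall_pos _ _ one_pos).ne'
  have hbt : ∀ w, volume (Metric.closedBall (0 : E w) 1) ≠ ⊤ := fun w =>
    (isCompact_closedBall (0 : E w) 1).measure_lt_top.ne
  have hS : volume S = ∏ w, volume (Metric.closedBall (0 : E w) 1) := volume_pi_pi _
  have hS0 : volume S ≠ 0 := by
    rw [hS]; exact Finset.prod_ne_zero_iff.2 fun w _ => hb0 w
  have hSt : volume S ≠ ⊤ := by
    rw [hS]; exact ENNReal.prod_ne_top fun w _ => hbt w
  have huS : u • S = Set.univ.pi fun w =>
      (fun x => ((hxw w).unit : E w) * x) '' Metric.closedBall (0 : E w) 1 := by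
    ext y
    simp only [Set.mem_pi, Set.mem_univ, true_imp_iff, Set.mem_image]
    constructor
    · rintro ⟨z, hz, rfl⟩ w
      exact ⟨z w, hz w trivial, rfl⟩
    · intro hy
      choose z hz hz' using hy
      exact ⟨z, fun w _ => hz w, funext fun w => hz' w⟩
  have hnn : 0 ≤ ∏ w, nabs (E w) (u.1 w) := Finset.prod_nonneg fun w _ => nabs_nonneg _
  have := distribHaarChar_eq_of_measure_smul_eq_mul (μ := (volume : Measure ((w : ι) → E w)))
    (g := u) hS0 hSt (r := (∏ w, nabs (E w) (u.1 w)).toNNReal) (by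
      rw [huS, volume_pi_pi, hS]
      simp only [fun w => volume_unit_smul (hxw w).unit _
        (Metric.isClosed_closedBall (x := (0 : E w)) (ε := 1)).measurableSet,
        Finset.prod_mul_distrib]
      congr 1
      change _ = ENNReal.ofReal _
      rw [ENNReal.ofReal_prod_of_nonneg (fun w _ => nabs_nonneg _)]
      rfl)
  rw [nabs_units, this, Real.coe_toNNReal _ hnn]

theorem tameNabs_pi : TameNabs ((w : ι) → E w) := by
  choose c hc h using fun w => exists_nabs_eq_rpow (E w)
  refine ⟨?_, ∑ w, c w, Finset.sum_nonneg fun w _ => (hc w).le, fun x => ?_⟩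
  · rw [show nabs ((w : ι) → E w) = fun x => ∏ w, nabs (E w) (x w) from funext nabs_pi]
    exact continuous_finsetProd _ fun w _ =>
      (tameNabs_field (E w)).continuous_nabs.comp (continuous_apply w)
  · rw [nabs_pi]
    rcases (norm_nonneg x).eq_or_lt with hx | hx
    · have hx0 : x = 0 := norm_eq_zero.1 hx.symm
      by_cases hι : Nonempty ι
      · obtain ⟨w⟩ := hι
        refine le_trans (le_of_eq ?_) (Real.rpow_nonneg (norm_nonneg _) _)
        exact Finset.prod_eq_zero (Finset.mem_univ w) (by rw [hx0]; exact nabs_zero)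
      · rw [not_nonempty_iff] at hι
        simp
    · rw [Real.rpow_sum_of_pos hx]
      refine Finset.prod_le_prod (fun w _ => nabs_nonneg _) fun w _ => ?_
      rw [h w]
      exact Real.rpow_le_rpow (norm_nonneg _) (norm_le_pi_norm x w) (hc w).le

theorem ae_isUnit_pi : ∀ᵐ x : (w : ι) → E w, IsUnit x := by
  have h : ∀ᵐ x : (w : ι) → E w, ∀ w, IsUnit (x w) := by
    rw [ae_all_iff]
    intro w
    exact (Measure.quasiMeasurePreserving_eval (fun w => (volume : Measure (E w))) w).ae
      ae_isUnit_field
  exact h.mono fun x hx => Pi.isUnit_iff.2 hx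

/-- The height is ∏ max(1, |x_w|). The absolute value of x itself does not control it, as one
component may be small while another is large; the idempotent e replaces the small components by 1.
-/
theorem hasHeight_pi : HasHeight ((w : ι) → E w) := by
  have hm : ∀ w, Measurable fun x : E w => max 1 (nabs (E w) x) := fun w =>
    measurable_const.max (tameNabs_field (E w)).continuous_nabs.measurable
  refine ⟨fun x => ∏ w, max 1 (nabs (E w) (x w)), Finset.measurable_prod _ fun w _ =>
    (hm w).comp (measurable_pi_apply w), fun x => Finset.one_le_prod fun w _ => le_max_left _ _,
    fun x => ?_, fun s hs => ?_⟩
  · classical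
    refine ⟨fun w => if nabs (E w) (x w) ≤ 1 then 1 else 0, ?_, ?_, ?_⟩
    · refine (pi_norm_le_iff_of_nonneg zero_le_one).2 fun w => ?_
      split_ifs <;> simp
    · refine (pi_norm_le_iff_of_nonneg zero_le_one).2 fun w => ?_
      simp only [Pi.sub_apply, Pi.one_apply]
      split_ifs <;> simp
    · rw [nabs_pi]
      refine Finset.prod_le_prod (fun w _ => le_max_of_le_left zero_le_one) fun w _ => ?_
      simp only [Pi.add_apply, Pi.mul_apply, Pi.sub_apply, Pi.one_apply]
      split_ifs with h
      · simp [h, nabs_one]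
      · simp [(not_le.1 h).le]
  · have hint : ∀ w, Integrable fun x : E w => max 1 (nabs (E w) x) ^ (-s) := by
      intro w
      refine ⟨((hm w).pow_const _).aestronglyMeasurable, ?_⟩
      rw [hasFiniteIntegral_iff_ofReal (Filter.Eventually.of_forall fun x =>
        Real.rpow_nonneg (le_max_of_le_left zero_le_one) _)]
      exact lintegral_max_rpow_lt_top (E w) hs
    have h1 := (Integrable.fintype_prod_dep hint).2
    rw [hasFiniteIntegral_iff_ofReal (Filter.Eventually.of_forall fun x =>
        Finset.prod_nonneg fun w _ => Real.rpow_nonneg (le_max_of_le_left zero_le_one) _)] at h1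
    refine lt_of_eq_of_lt (lintegral_congr fun x => ?_) h1
    rw [Real.finsetProd_rpow _ _ fun w _ => le_max_of_le_left zero_le_one]

end Product

/-! ### The height on a single local field -/

section HeightField

variable (k : Type*) [NontriviallyNormedField k] [ProperSpace k] [MeasureSpace k] [BorelSpace k]
  [(volume : Measure k).IsAddHaarMeasure]

theorem hasHeight_field : HasHeight k := by
  have hm : Measurable fun x : k => max 1 (nabs k x) :=
    measurable_const.max (tameNabs_field k).continuous_nabs.measurable
  refine ⟨fun x => max 1 (nabs k x), hm, fun x => le_max_left _ _, fun x => ?_,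
    fun s hs => lintegral_max_rpow_lt_top k hs⟩
  rcases le_total (nabs k x) 1 with h | h
  · exact ⟨1, by simp, by simp, by simp [h, nabs_one]⟩
  · exact ⟨0, by simp, by simp, by simp [h]⟩

end HeightField

/-! ## Absolute values under extensions -/

section Extension

open scoped Pointwise

variable {F : Type*} [NontriviallyNormedField F] [ProperSpace F] [MeasureSpace F] [BorelSpace F]
  [(volume : Measure F).IsAddHaarMeasure] {R : Type*} [NormedCommRing R] [ProperSpace R]
  [NormedAlgebra F R] [FiniteDimensional F R] [MeasurableSpace R] [BorelSpace R]

/-- In F-linear coordinates multiplication by x is scaling of every coordinate. No field structure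
on R is used, so the case F × F is included. -/
theorem nabs_algebraMap (x : F) :
    nabs R (algebraMap F R x) = nabs F x ^ Module.finrank F R := by
  by_cases hx : x = 0
  · subst hx
    rw [map_zero, nabs_zero]
    by_cases hR : Subsingleton R
    · rw [Module.finrank_zero_of_subsingleton, pow_zero, Subsingleton.elim (0 : R) 1, nabs_one]
    · have : Nontrivial R := not_subsingleton_iff_nontrivial.1 hR
      rw [nabs_of_not_isUnit not_isUnit_zero, zero_pow Module.finrank_pos.ne']
  let d := Module.finrank F R
  let e : R ≃L[F] (Fin d → F) := ContinuousLinearEquiv.ofFinrankEq (by simp [d])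
  let μ : Measure R := (volume : Measure (Fin d → F)).map e.symm
  have hvol : (volume : Measure (Fin d → F)).IsAddHaarMeasure := Measure.pi.isAddHaarMeasure _
  have hμ : μ.IsAddHaarMeasure := e.symm.toLinearEquiv.toAddEquiv.isAddHaarMeasure_map volume
    e.symm.continuous e.continuous
  have hμreg : μ.Regular := inferInstance
  let S : Set R := e ⁻¹' Set.univ.pi fun _ => Metric.closedBall (0 : F) 1
  have hS : ∀ B : Set (Fin d → F), MeasurableSet B → μ (e ⁻¹' B) = volume B := by
    intro B hB
    rw [Measure.map_apply e.symm.continuous.measurable (e.continuous.measurable hB)]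
    congr 1
    ext y
    simp
  have hbm : MeasurableSet (Set.univ.pi fun _ : Fin d => Metric.closedBall (0 : F) 1) :=
    MeasurableSet.univ_pi fun _ => Metric.isClosed_closedBall.measurableSet
  have hS1 : μ S = ∏ _i : Fin d, volume (Metric.closedBall (0 : F) 1) := by
    rw [hS _ hbm, volume_pi_pi]
  have hb0 : volume (Metric.closedBall (0 : F) 1) ≠ 0 :=
    (Metric.measure_closedBall_pos _ _ one_pos).ne'
  have hbt : volume (Metric.closedBall (0 : F) 1) ≠ ⊤ :=
    (isCompact_closedBall (0 : F) 1).measure_lt_top.ne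
  have hS0 : μ S ≠ 0 := by
    rw [hS1]; exact Finset.prod_ne_zero_iff.2 fun w _ => hb0
  have hSt : μ S ≠ ⊤ := by
    rw [hS1]; exact ENNReal.prod_ne_top fun w _ => hbt
  let u : Rˣ := Units.map (algebraMap F R).toMonoidHom (Units.mk0 x hx)
  have hu : (u : R) = algebraMap F R x := rfl
  have hball : MeasurableSet ((fun y => (Units.mk0 x hx : F) * y) '' Metric.closedBall (0 : F) 1) :=
    ((isCompact_closedBall (0 : F) 1).image (by fun_prop)).measurableSet
  have huS : u • S = e ⁻¹' Set.univ.pi fun _ =>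
      (fun y => (Units.mk0 x hx : F) * y) '' Metric.closedBall (0 : F) 1 := by
    ext y
    simp only [Set.mem_preimage, Set.mem_pi, Set.mem_univ, true_imp_iff, Set.mem_image]
    constructor
    · rintro ⟨z, hz, rfl⟩ i
      refine ⟨e z i, hz i trivial, ?_⟩
      change x * e z i = e (algebraMap F R x * z) i
      rw [← Algebra.smul_def, map_smul]
      rfl
    · intro hy
      choose z hz hz' using hy
      refine ⟨e.symm z, fun i _ => by simpa using hz i, ?_⟩
      change algebraMap F R x * e.symm z = y
      rw [← Algebra.smul_def, ← map_smul, ContinuousLinearEquiv.symm_apply_eq]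
      exact funext fun i => hz' i
  have hnn : 0 ≤ nabs F x ^ d := pow_nonneg (nabs_nonneg _) _
  have := distribHaarChar_eq_of_measure_smul_eq_mul (μ := μ)
    (g := u) hS0 hSt (r := (nabs F x ^ d).toNNReal) (by
      rw [huS, hS _ (MeasurableSet.univ_pi fun _ => hball), volume_pi_pi, hS1]
      rw [Finset.prod_const, Finset.prod_const, Finset.card_univ, Fintype.card_fin,
        volume_unit_smul _ _ Metric.isClosed_closedBall.measurableSet, mul_pow]
      congr 1
      change _ = ENNReal.ofReal _
      rw [ENNReal.ofReal_pow (nabs_nonneg _)]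
      rfl)
  rw [← hu, nabs_units, this, Real.coe_toNNReal _ hnn]

end Extension

/-! ## Iwasawa decompositions over local fields -/

section RowReduction

variable {k : Type*} [NormedField k] (K : ∀ n, Subgroup (GLn n k))

/-- If rows can be reduced by elements of `K`, then every invertible matrix is the product of an
upper triangular matrix and an element of `K`. -/
theorem exists_upper_of_row_reduction
    (hb : ∀ n, ∀ κ ∈ K n, ∀ k' : GLn (n + 1) k, k'.1 = blk κ.1 0 0 1 → k' ∈ K (n + 1))
    (hr : ∀ n (v : Fin (n + 1) → k), v ≠ 0 →
      ∃ κ ∈ K (n + 1), ∀ j : Fin n, Matrix.vecMul v κ.1 j.castSucc = 0) :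
    ∀ n (g : GLn n k), ∃ b : GLn n k, b.1.BlockTriangular id ∧ b⁻¹ * g ∈ K n := by
  intro n
  induction n with
  | zero =>
    exact fun g => ⟨1, Matrix.blockTriangular_one, by
      rw [Subsingleton.elim ((1 : GLn 0 k)⁻¹ * g) 1]; exact one_mem _⟩
  | succ n ih =>
    intro g
    have hv : g.1 (Fin.last n) ≠ 0 := by
      intro h
      have h1 : (g.1 * (g⁻¹).1) (Fin.last n) (Fin.last n) = 1 := by simp
      rw [Matrix.mul_apply] at h1
      simp [h] at h1
    obtain ⟨κ, hκ, hz⟩ := hr n _ hv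
    -- The last row of X is (0, …, 0, w), so X is block upper triangular. Invertibility of X makes w
    -- a unit and the upper left block H invertible, and H is decomposed by the induction
    -- hypothesis.
    set X : GLn (n + 1) k := g * κ with hX
    obtain ⟨h, y, w, hXb⟩ : ∃ h y w, X.1 = blk h y 0 w := by
      refine ⟨Matrix.of fun i j => X.1 i.castSucc j.castSucc, fun i => X.1 i.castSucc (Fin.last n),
        X.1 (Fin.last n) (Fin.last n), (eq_blk X.1).trans ?_⟩
      rw [show (fun j : Fin n => X.1 (Fin.last n) j.castSucc) = 0 from funext fun j => hz j]
    obtain ⟨h', y', z', w', hXi⟩ : ∃ h' y' z' w', (X⁻¹).1 = blk h' y' z' w' :=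
      ⟨_, _, _, _, eq_blk _⟩
    have h1 : X.1 * (X⁻¹).1 = 1 := by simp
    rw [hXb, hXi, blk_mul_blk, ← blk_one] at h1
    have hw : w * w' = 1 := by
      simpa using congrFun (congrFun h1 (Fin.last n)) (Fin.last n)
    have hw0 : w ≠ 0 := left_ne_zero_of_mul_eq_one hw
    have hz' : z' = 0 := by
      funext j
      have := congrFun (congrFun h1 (Fin.last n)) j.castSucc
      simpa [hw0] using this
    have hh : h * h' = 1 := by
      ext i j
      have := congrFun (congrFun h1 i.castSucc) j.castSucc
      simpa [hz', Matrix.vecMulVec] using this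
    obtain ⟨H, hH⟩ : ∃ H : GLn n k, H.1 = h := ⟨⟨h, h', hh, mul_eq_one_comm.1 hh⟩, rfl⟩
    obtain ⟨b', hb', hk'⟩ := ih H
    obtain ⟨κ', hκ'⟩ : ∃ κ', κ' = b'⁻¹ * H := ⟨_, rfl⟩
    rw [← hκ'] at hk'
    have hL : glLow κ' 0 ∈ K (n + 1) := hb n κ' hk' _ rfl
    have hbm : (X * (glLow κ' 0)⁻¹).1 = blk b'.1 y 0 w := by
      have h2 : h * (κ'⁻¹).1 = b'.1 := by
        rw [← hH, ← Units.val_mul, hκ']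
        congr 1
        group
      have h3 : ((glLow κ' 0)⁻¹).1 = blk (κ'⁻¹).1 0 (-(Matrix.vecMul 0 (κ'⁻¹).1)) 1 := rfl
      rw [Units.val_mul, hXb, h3, blk_mul_blk, h2]
      simp
    refine ⟨X * (glLow κ' 0)⁻¹, ?_, ?_⟩
    · rw [hbm]
      intro i j
      refine Fin.lastCases ?_ (fun i => ?_) i <;> refine Fin.lastCases ?_ (fun j => ?_) j
      · intro h; exact absurd h (lt_irrefl _)
      · intro _; simp
      · intro h; exact absurd h (not_lt.2 (Fin.le_last _))
      · intro h
        rw [blk_castSucc_castSucc]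
        exact hb' (Fin.castSucc_lt_castSucc_iff.1 h)
    · have : (X * (glLow κ' 0)⁻¹)⁻¹ * g = glLow κ' 0 * κ⁻¹ := by rw [hX]; group
      rw [this]
      exact mul_mem hL (inv_mem hκ)

end RowReduction

/-- The image is the first projection of the compact set of pairs (X, Y) satisfying P with X Y = 1.
Carrying the inverse along avoids any condition on the determinant. -/
theorem isClosed_image_of_inv_mem {R : Type*} [NormedCommRing R] [ProperSpace R] {n : ℕ}
    (K : Subgroup (GLn n R)) (P : Matrix (Fin n) (Fin n) R → Prop) (hP : IsClosed {X | P X})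
    (hb : ∃ B : ℝ, ∀ X, P X → ∀ i j, ‖X i j‖ ≤ B)
    (hK : ∀ g, g ∈ K ↔ P g.1 ∧ P (g⁻¹).1) :
    IsClosed ((fun k : GLn n R => k.1) '' (K : Set (GLn n R))) := by
  obtain ⟨B, hB⟩ := hb
  have hc : IsCompact {X | P X} :=
    (isCompact_entry_le (R := R) (n := n) B).of_isClosed_subset hP fun X hX => hB X hX
  have hcl : IsClosed {p : Matrix (Fin n) (Fin n) R × Matrix (Fin n) (Fin n) R | p.1 * p.2 = 1} :=
    isClosed_eq (continuous_fst.matrix_mul continuous_snd) continuous_const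
  have hi := ((hc.prod hc).inter_right hcl).image continuous_fst
  convert hi.isClosed using 1
  ext X
  constructor
  · rintro ⟨g, hg, rfl⟩
    exact ⟨(g.1, (g⁻¹).1), ⟨(hK g).1 hg, by simp⟩, rfl⟩
  · rintro ⟨⟨X, Y⟩, ⟨⟨hX, hY⟩, hXY⟩, rfl⟩
    have h : X * Y = 1 := hXY
    exact ⟨⟨X, Y, h, mul_eq_one_comm.1 h⟩, (hK _).2 ⟨hX, hY⟩, rfl⟩

/-! ### Iwasawa decomposition for GL_n of the integers -/

section Ultrametric

variable (k : Type*) [NontriviallyNormedField k] [IsUltrametricDist k]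

/-- The group of matrices that are integral together with their inverse. -/
def integralGL (n : ℕ) : Subgroup (GLn n k) where
  carrier := {g | (∀ i j, ‖g.1 i j‖ ≤ 1) ∧ ∀ i j, ‖(g⁻¹).1 i j‖ ≤ 1}
  one_mem' := by
    have : ∀ i j : Fin n, ‖(1 : Matrix (Fin n) (Fin n) k) i j‖ ≤ 1 := fun i j => by
      rw [Matrix.one_apply]; split_ifs <;> simp
    exact ⟨this, by rw [inv_one]; exact this⟩
  mul_mem' := by
    have : ∀ A B : Matrix (Fin n) (Fin n) k, (∀ i j, ‖A i j‖ ≤ 1) → (∀ i j, ‖B i j‖ ≤ 1) →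
        ∀ i j, ‖(A * B) i j‖ ≤ 1 := fun A B hA hB i j => by
      rw [Matrix.mul_apply]
      refine IsUltrametricDist.norm_sum_le_of_forall_le_of_nonneg zero_le_one fun l _ => ?_
      rw [norm_mul]
      exact mul_le_one₀ (hA i l) (norm_nonneg _) (hB l j)
    rintro a b ⟨ha, ha'⟩ ⟨hb, hb'⟩
    exact ⟨this _ _ ha hb, by rw [mul_inv_rev]; exact this _ _ hb' ha'⟩
  inv_mem' := by
    rintro a ⟨ha, ha'⟩
    exact ⟨ha', by rw [inv_inv]; exact ha⟩

variable {k}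

theorem norm_blk_le {n : ℕ} {h : Matrix (Fin n) (Fin n) k} {y z : Fin n → k} {w : k}
    (hh : ∀ i j, ‖h i j‖ ≤ 1) (hy : ∀ i, ‖y i‖ ≤ 1) (hz : ∀ i, ‖z i‖ ≤ 1) (hw : ‖w‖ ≤ 1)
    (i j : Fin (n + 1)) : ‖blk h y z w i j‖ ≤ 1 := by
  refine Fin.lastCases ?_ (fun i => ?_) i <;> refine Fin.lastCases ?_ (fun j => ?_) j
  · simpa using hw
  · simpa using hz j
  · simpa using hy i
  · simpa using hh i j

theorem norm_matrix_one_le {n : ℕ} (i j : Fin n) : ‖(1 : Matrix (Fin n) (Fin n) k) i j‖ ≤ 1 := by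
  rw [Matrix.one_apply]; split_ifs <;> simp

theorem vecMul_blk_castSucc {n : ℕ} (v : Fin (n + 1) → k) (h : Matrix (Fin n) (Fin n) k)
    (y z : Fin n → k) (w : k) (j : Fin n) : Matrix.vecMul v (blk h y z w) j.castSucc =
      Matrix.vecMul (fun i => v i.castSucc) h j + v (Fin.last n) * z j := by
  simp [Matrix.vecMul, dotProduct, Fin.sum_univ_castSucc]

theorem vecMul_blk_last {n : ℕ} (v : Fin (n + 1) → k) (h : Matrix (Fin n) (Fin n) k)
    (y z : Fin n → k) (w : k) : Matrix.vecMul v (blk h y z w) (Fin.last n) =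
      (∑ i, v i.castSucc * y i) + v (Fin.last n) * w := by
  simp [Matrix.vecMul, dotProduct, Fin.sum_univ_castSucc]

/-- When the last entry has maximal norm it serves as a pivot, and the quotients used for the
elimination are integral. -/
theorem integralGL_row_reduction_of_last {n : ℕ} (v : Fin (n + 1) → k)
    (hl : v (Fin.last n) ≠ 0) (h : ∀ i, ‖v i‖ ≤ ‖v (Fin.last n)‖) :
    ∃ κ ∈ integralGL k (n + 1), ∀ j : Fin n, Matrix.vecMul v κ.1 j.castSucc = 0 := by
  set z : Fin n → k := fun j => -(v j.castSucc / v (Fin.last n)) with hz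
  have hz1 : ∀ j, ‖z j‖ ≤ 1 := fun j => by
    rw [hz, norm_neg, norm_div]
    exact div_le_one_of_le₀ (h _) (norm_nonneg _)
  refine ⟨glLow 1 z, ⟨norm_blk_le norm_matrix_one_le (by simp) hz1 (by simp), ?_⟩, fun j => ?_⟩
  · refine norm_blk_le (by rw [inv_one]; exact norm_matrix_one_le) (by simp) (fun j => ?_) (by simp)
    simpa using hz1 j
  · change Matrix.vecMul v (blk _ 0 z 1) _ = 0
    rw [vecMul_blk_castSucc]
    simp [hz, mul_div_cancel₀ _ hl]

/-- If the last entry is strictly smaller than the maximal one, the column of the latter is added to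
the last column. The norms differ, so the ultrametric inequality gives the sum the maximal norm, and
the previous case applies. -/
theorem integralGL_row_reduction {n : ℕ} (v : Fin (n + 1) → k) (hv : v ≠ 0) :
    ∃ κ ∈ integralGL k (n + 1), ∀ j : Fin n, Matrix.vecMul v κ.1 j.castSucc = 0 := by
  obtain ⟨p, -, hp⟩ := Finset.exists_max_image Finset.univ (fun i => ‖v i‖) Finset.univ_nonempty
  have hp' : ∀ i, ‖v i‖ ≤ ‖v p‖ := fun i => hp i (Finset.mem_univ _)
  have hp0 : v p ≠ 0 := by
    intro h0
    refine hv (funext fun i => ?_)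
    have := hp' i
    rw [h0, norm_zero] at this
    simpa using le_antisymm this (norm_nonneg _)
  rcases eq_or_lt_of_le (hp' (Fin.last n)) with he | hlt
  · refine integralGL_row_reduction_of_last v (fun h0 => hp0 ?_) (by rwa [he])
    rw [h0, norm_zero] at he
    exact norm_eq_zero.1 he.symm
  · obtain ⟨q, rfl⟩ : ∃ q : Fin n, p = q.castSucc := by
      rcases Fin.eq_castSucc_or_eq_last p with h | h
      · exact h
      · rw [h] at hlt; exact absurd hlt (lt_irrefl _)
    let e : GLn (n + 1) k :=
      { val := blk 1 (Pi.single q 1) 0 1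
        inv := blk 1 (-Pi.single q 1) 0 1
        val_inv := by
          rw [blk_mul_blk, ← blk_one, Matrix.one_mulVec, one_smul, neg_add_cancel]; simp
        inv_val := by
          rw [blk_mul_blk, ← blk_one, Matrix.one_mulVec, one_smul, add_neg_cancel]; simp }
    have hs : ∀ i, ‖(Pi.single q 1 : Fin n → k) i‖ ≤ 1 := fun i => by
      rw [Pi.single_apply]; split_ifs <;> simp
    have he : e ∈ integralGL k (n + 1) :=
      ⟨norm_blk_le norm_matrix_one_le hs (by simp) (by simp),
        norm_blk_le norm_matrix_one_le (fun i => by simpa using hs i) (by simp) (by simp)⟩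
    have h1 : ∀ j : Fin n, Matrix.vecMul v e.1 j.castSucc = v j.castSucc := fun j => by
      change Matrix.vecMul v (blk 1 (Pi.single q 1) 0 1) _ = _
      rw [vecMul_blk_castSucc]; simp
    have h2 : Matrix.vecMul v e.1 (Fin.last n) = v q.castSucc + v (Fin.last n) := by
      change Matrix.vecMul v (blk 1 (Pi.single q 1) 0 1) _ = _
      rw [vecMul_blk_last]; simp [Pi.single_apply]
    have h3 : ‖Matrix.vecMul v e.1 (Fin.last n)‖ = ‖v q.castSucc‖ := by
      rw [h2, IsUltrametricDist.norm_add_eq_max_of_norm_ne_norm hlt.ne', max_eq_left hlt.le]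
    obtain ⟨κ, hκ, hz⟩ := integralGL_row_reduction_of_last (Matrix.vecMul v e.1)
      (by rw [← norm_ne_zero_iff, h3]; exact norm_ne_zero_iff.2 hp0) (fun i => by
        rw [h3]
        refine Fin.lastCases h3.le (fun j => ?_) i
        rw [h1]; exact hp' _)
    refine ⟨e * κ, mul_mem he hκ, fun j => ?_⟩
    rw [Units.val_mul, ← Matrix.vecMul_vecMul]
    exact hz j

theorem iwasawaFamily_integralGL [ProperSpace k] : IwasawaFamily (integralGL k) := by
  have hb : ∀ n, ∀ κ ∈ integralGL k n, ∀ k' : GLn (n + 1) k, k'.1 = blk κ.1 0 0 1 →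
      k' ∈ integralGL k (n + 1) := by
    intro n κ hκ k' hk'
    have : k' = glLow κ 0 := Units.ext hk'
    subst this
    exact ⟨norm_blk_le hκ.1 (by simp) (by simp) (by simp),
      norm_blk_le hκ.2 (by simp) (by simp) (by simp)⟩
  refine ⟨fun n κ hκ => hκ.1, ?_, hb, fun n => ?_⟩
  · exact exists_upper_of_row_reduction _ hb fun n v hv => integralGL_row_reduction v hv
  · exact isClosed_image_of_inv_mem _ (fun X => ∀ i j, ‖X i j‖ ≤ 1) (isClosed_entry_le 1)
      ⟨1, fun X hX => hX⟩ fun g => Iff.rfl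

end Ultrametric

/-! ### Iwasawa decomposition for orthogonal and unitary groups -/

section Unitary

variable (k : Type*) [RCLike k]

/-- The compact group of `g` with `g g^* = 1`. -/
def unitaryGL (n : ℕ) : Subgroup (GLn n k) where
  carrier := {g | g.1 * star g.1 = 1}
  one_mem' := by simp
  mul_mem' := by
    intro a b ha hb
    have ha' : a.1 * star a.1 = 1 := ha
    have hb' : b.1 * star b.1 = 1 := hb
    change (a.1 * b.1) * star (a.1 * b.1) = 1
    rw [star_mul, mul_assoc, ← mul_assoc b.1, hb', one_mul, ha']
  inv_mem' := by
    intro a ha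
    have ha' : a.1 * star a.1 = 1 := ha
    have h1 : (a⁻¹).1 = star a.1 := left_inv_eq_right_inv (by simp) ha'
    change (a⁻¹).1 * star (a⁻¹).1 = 1
    rw [h1, star_star]
    exact mul_eq_one_comm.1 ha'

variable {k}

theorem mem_unitaryGL {n : ℕ} {g : GLn n k} :
    g ∈ unitaryGL k n ↔ g.1 ∈ Matrix.unitaryGroup (Fin n) k := Matrix.mem_unitaryGroup_iff.symm

/-- Extend the normalized conjugate of v, placed last, to an orthonormal basis and use it as the
columns. The entries of v κ before the last are then inner products of orthogonal vectors. -/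
theorem unitaryGL_row_reduction {n : ℕ} (v : Fin (n + 1) → k) (hv : v ≠ 0) :
    ∃ κ ∈ unitaryGL k (n + 1), ∀ j : Fin n, Matrix.vecMul v κ.1 j.castSucc = 0 := by
  set u : EuclideanSpace k (Fin (n + 1)) := WithLp.toLp 2 fun i => star (v i) with hu
  have hu0 : u ≠ 0 := by
    intro h
    refine hv (funext fun i => ?_)
    have := congrFun (congrArg WithLp.ofLp h) i
    simpa [hu] using this
  set w : Fin (n + 1) → EuclideanSpace k (Fin (n + 1)) := fun _ => ((‖u‖ : k)⁻¹) • u with hw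
  have hn : ‖((‖u‖ : k)⁻¹) • u‖ = 1 := norm_smul_inv_norm hu0
  have ho : Orthonormal k (({Fin.last n} : Set (Fin (n + 1))).domRestrict w) := by
    refine ⟨fun _ => hn, fun i j hij => ?_⟩
    exact absurd (Subtype.ext ((Set.mem_singleton_iff.1 i.2).trans
      (Set.mem_singleton_iff.1 j.2).symm)) hij
  obtain ⟨b, hb⟩ := ho.exists_orthonormalBasis_extension_of_card_eq (by simp)
  set U := (EuclideanSpace.basisFun (Fin (n + 1)) k).toBasis.toMatrix b with hU
  have hUm : U ∈ Matrix.unitaryGroup (Fin (n + 1)) k :=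
    OrthonormalBasis.toMatrix_orthonormalBasis_mem_unitary _ _
  have h1 : U * star U = 1 := Matrix.mem_unitaryGroup_iff.1 hUm
  refine ⟨⟨U, star U, h1, mul_eq_one_comm.1 h1⟩, h1, fun j => ?_⟩
  have h2 : inner k (b (Fin.last n)) (b j.castSucc) = 0 :=
    b.orthonormal.2 (Fin.castSucc_lt_last j).ne'
  rw [hb _ rfl, hw, inner_smul_left] at h2
  have h3 : inner k u (b j.castSucc) = 0 := by
    refine (mul_eq_zero.1 h2).resolve_left ?_
    simpa using hu0
  rw [← h3, PiLp.inner_apply]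
  simp only [Matrix.vecMul, dotProduct, hU, Module.Basis.toMatrix_apply]
  refine Finset.sum_congr rfl fun i _ => ?_
  simp [hu, mul_comm]

theorem isClosed_unitary (n : ℕ) :
    IsClosed {X : Matrix (Fin n) (Fin n) k | X ∈ Matrix.unitaryGroup (Fin n) k} := by
  simp only [Matrix.mem_unitaryGroup_iff]
  exact isClosed_eq (continuous_id.matrix_mul continuous_id.star) continuous_const

theorem iwasawaFamily_unitaryGL : IwasawaFamily (unitaryGL k) := by
  have hb : ∀ n, ∀ κ ∈ unitaryGL k n, ∀ k' : GLn (n + 1) k, k'.1 = blk κ.1 0 0 1 →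
      k' ∈ unitaryGL k (n + 1) := by
    intro n κ hκ k' hk'
    have hκ' : κ.1 * star κ.1 = 1 := hκ
    change k'.1 * star k'.1 = 1
    have hs : star (blk κ.1 0 0 1) = blk (star κ.1) 0 0 1 := by
      refine ext_blk (fun i j => ?_) (fun i => ?_) (fun j => ?_) ?_ <;> simp [Matrix.star_apply]
    rw [hk', hs, blk_mul_blk, hκ', ← blk_one]
    simp
  refine ⟨fun n κ hκ => entry_norm_bound_of_unitary (mem_unitaryGL.1 hκ), ?_, hb, fun n => ?_⟩
  · exact exists_upper_of_row_reduction _ hb fun n v hv => unitaryGL_row_reduction v hv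
  · refine isClosed_image_of_inv_mem _ (fun X => X ∈ Matrix.unitaryGroup (Fin n) k)
      (isClosed_unitary n) ⟨1, fun X hX => entry_norm_bound_of_unitary hX⟩ fun g => ?_
    rw [← mem_unitaryGL, ← mem_unitaryGL]
    exact ⟨fun h => ⟨h, inv_mem h⟩, fun h => h.1⟩

end Unitary

/-! ### Maximal compact subgroups over a product of fields -/

section Product

variable {ι : Type*} [Fintype ι] {E : ι → Type*}

theorem GL_map_eval_apply {n : ℕ} [∀ w, NontriviallyNormedField (E w)] (w : ι) (g : GLn n (∀ w, E w)) (i j : Fin n) :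
    (Matrix.GeneralLinearGroup.map (Pi.evalRingHom E w) g).1 i j = g.1 i j w := rfl

/-- The element of `GL_n(∏ w, E w)` with given components. -/
def glPi {n : ℕ} [∀ w, NontriviallyNormedField (E w)] (g : ∀ w, GLn n (E w)) : GLn n (∀ w, E w) where
  val := Matrix.of fun i j w => (g w).1 i j
  inv := Matrix.of fun i j w => ((g w)⁻¹).1 i j
  val_inv := by
    ext i j w
    have h : ((g w).1 * ((g w)⁻¹).1) i j = (1 : Matrix (Fin n) (Fin n) (E w)) i j := by simp
    rw [Matrix.mul_apply] at h
    rw [Matrix.mul_apply, Finset.sum_apply]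
    refine h.trans ?_
    rw [Matrix.one_apply, Matrix.one_apply]
    split_ifs <;> rfl
  inv_val := by
    ext i j w
    have h : (((g w)⁻¹).1 * (g w).1) i j = (1 : Matrix (Fin n) (Fin n) (E w)) i j := by simp
    rw [Matrix.mul_apply] at h
    rw [Matrix.mul_apply, Finset.sum_apply]
    refine h.trans ?_
    rw [Matrix.one_apply, Matrix.one_apply]
    split_ifs <;> rfl

theorem map_glPi {n : ℕ} [∀ w, NontriviallyNormedField (E w)] (g : ∀ w, GLn n (E w)) (w : ι) :
    Matrix.GeneralLinearGroup.map (Pi.evalRingHom E w) (glPi g) = g w := by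
  ext i j; rfl

/-- The subgroup of `GL_n(∏ w, E w)` of elements with components in given subgroups. -/
def subgroupPi [∀ w, NontriviallyNormedField (E w)] (K : ∀ w n, Subgroup (GLn n (E w))) (n : ℕ) :
    Subgroup (GLn n (∀ w, E w)) :=
  ⨅ w, (K w n).comap (Matrix.GeneralLinearGroup.map (Pi.evalRingHom E w))

theorem mem_subgroupPi [∀ w, NontriviallyNormedField (E w)] {K : ∀ w n, Subgroup (GLn n (E w))} {n : ℕ}
    {g : GLn n (∀ w, E w)} : g ∈ subgroupPi K n ↔
      ∀ w, Matrix.GeneralLinearGroup.map (Pi.evalRingHom E w) g ∈ K w n := by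
  simp [subgroupPi, Subgroup.mem_iInf]

theorem iwasawaFamily_pi [Nonempty ι] [∀ w, NontriviallyNormedField (E w)] [∀ w, ProperSpace (E w)]
    {K : ∀ w n, Subgroup (GLn n (E w))} (hK : ∀ w, IwasawaFamily (K w)) :
    IwasawaFamily (R := ∀ w, E w) (subgroupPi K) := by
  refine ⟨fun n g hg i j => ?_, fun n g => ?_, fun n g hg k' hk' => ?_, fun n => ?_⟩
  · exact (pi_norm_le_iff_of_nonneg zero_le_one).2 fun w =>
      (hK w).norm_le n _ (mem_subgroupPi.1 hg w) i j
  · choose b hb hbk using fun w => (hK w).exists_upper n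
      (Matrix.GeneralLinearGroup.map (Pi.evalRingHom E w) g)
    refine ⟨glPi b, fun i j h => funext fun w => hb w h, mem_subgroupPi.2 fun w => ?_⟩
    rw [map_mul, map_inv, map_glPi]
    exact hbk w
  · refine mem_subgroupPi.2 fun w => (hK w).blk_mem n _ (mem_subgroupPi.1 hg w) _ ?_
    have h1 : ∀ i j, k'.1 i j = blk g.1 0 0 1 i j := fun i j => by rw [hk']
    refine ext_blk (fun i j => ?_) (fun i => ?_) (fun j => ?_) ?_ <;>
      rw [GL_map_eval_apply, h1] <;> simp [GL_map_eval_apply]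
  · have h : (fun k : GLn n (∀ w, E w) => k.1) '' (subgroupPi K n : Set (GLn n (∀ w, E w))) =
        ⋂ w, (fun X : Matrix (Fin n) (Fin n) (∀ w, E w) =>
          (Matrix.of fun i j => X i j w : Matrix (Fin n) (Fin n) (E w))) ⁻¹'
          ((fun k : GLn n (E w) => k.1) '' (K w n : Set (GLn n (E w)))) := by
      ext X
      simp only [Set.mem_iInter, Set.mem_preimage]
      constructor
      · rintro ⟨g, hg, rfl⟩ w
        exact ⟨_, mem_subgroupPi.1 hg w, rfl⟩
      · intro h
        choose g hg hgX using h
        refine ⟨glPi g, mem_subgroupPi.2 fun w => by rw [map_glPi]; exact hg w, ?_⟩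
        ext i j w
        exact congrFun (congrFun (hgX w) i) j
    rw [h]
    refine isClosed_iInter fun w => ((hK w).isClosed n).preimage ?_
    exact continuous_matrix fun i j => (continuous_apply w).comp (continuous_matrix_entry i j)

theorem maxCompactNA_eq (n : ℕ) [∀ w, NontriviallyNormedField (E w)] [∀ w, IsUltrametricDist (E w)] :
    maxCompactNA n E = subgroupPi (fun w => integralGL (E w)) n := by
  have hint : ∀ x : ∀ w, E w, x ∈ integers E ↔ ∀ w, ‖x w‖ ≤ 1 := by
    intro x
    rw [integers, Subring.mem_iInf]
    exact Iff.rfl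
  ext g
  rw [mem_subgroupPi]
  constructor
  · rintro ⟨k, rfl⟩ w
    refine ⟨fun i j => (hint _).1 (k.1 i j).2 w, fun i j => ?_⟩
    rw [← map_inv, ← map_inv]
    exact (hint _).1 ((k⁻¹).1 i j).2 w
  · intro h
    have h1 : ∀ i j, g.1 i j ∈ integers E := fun i j => (hint _).2 fun w => (h w).1 i j
    have h2 : ∀ i j, (g⁻¹).1 i j ∈ integers E := fun i j => (hint _).2 fun w => by
      have := (h w).2 i j
      rw [← map_inv] at this
      exact this
    have hinj : Function.Injective fun X : Matrix (Fin n) (Fin n) (integers E) =>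
        X.map (integers E).subtype := Matrix.map_injective Subtype.val_injective
    refine ⟨⟨Matrix.of fun i j => ⟨g.1 i j, h1 i j⟩, Matrix.of fun i j => ⟨(g⁻¹).1 i j, h2 i j⟩,
      hinj ?_, hinj ?_⟩, ?_⟩
    · beta_reduce
      rw [Matrix.map_mul, Matrix.map_one _ (map_zero _) (map_one _)]
      exact g.mul_inv
    · beta_reduce
      rw [Matrix.map_mul, Matrix.map_one _ (map_zero _) (map_one _)]
      exact g.inv_mul
    · ext i j; rfl

theorem maxCompactArch_eq (n : ℕ) [∀ w, RCLike (E w)] :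
    maxCompactArch n E = subgroupPi (fun w => unitaryGL (E w)) n := by
  ext g
  rw [mem_subgroupPi]
  change g.1 ∈ Matrix.unitaryGroup (Fin n) _ ↔ ∀ w, _ * star _ = _
  rw [Matrix.mem_unitaryGroup_iff]
  constructor
  · intro h w
    ext i j
    have := congrFun (congrFun (congrFun h i) j) w
    rw [Matrix.mul_apply, Finset.sum_apply] at this
    rw [Matrix.mul_apply]
    refine Eq.trans ?_ (this.trans ?_)
    · rfl
    · rw [Matrix.one_apply, Matrix.one_apply]; split_ifs <;> rfl
  · intro h
    ext i j w
    have := congrFun (congrFun (h w) i) j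
    rw [Matrix.mul_apply] at this
    rw [Matrix.mul_apply, Finset.sum_apply]
    refine Eq.trans ?_ (this.trans ?_)
    · rfl
    · rw [Matrix.one_apply, Matrix.one_apply]; split_ifs <;> rfl

end Product

/-! ### The maximal compact subgroup of GL_n(F) maps into that of GL_n(E) -/

section BaseChange

variable {ι : Type*} [Fintype ι] {E : ι → Type*} {F : Type*}

theorem map_algebraMap_mem_maxCompactNA {n : ℕ} [NontriviallyNormedField F] [IsUltrametricDist F]
    [∀ w, NontriviallyNormedField (E w)] [∀ w, IsUltrametricDist (E w)] [∀ w, NormedAlgebra F (E w)]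
    {k : GLn n F} (hk : k ∈ integralGL F n) :
    Matrix.GeneralLinearGroup.map (algebraMap F (∀ w, E w)) k ∈ maxCompactNA n E := by
  rw [maxCompactNA_eq, mem_subgroupPi]
  refine fun w => ⟨fun i j => ?_, fun i j => ?_⟩
  · refine le_trans (le_of_eq ?_) (hk.1 i j)
    exact norm_algebraMap' (E w) (k.1 i j)
  · rw [← map_inv, ← map_inv]
    refine le_trans (le_of_eq ?_) (hk.2 i j)
    exact norm_algebraMap' (E w) ((k⁻¹).1 i j)

/-- The structure map is continuous, hence the identity on real scalars, and it preserves norms.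
Since star x is determined by x · star x = ‖x‖², conjugation is respected. -/
theorem algebraMap_star {F k : Type*} [RCLike F] [RCLike k] [NormedAlgebra F k] (x : F) :
    algebraMap F k (star x) = star (algebraMap F k x) := by
  have hreal : ∀ r : ℝ, algebraMap F k (r : F) = (r : k) := by
    intro r
    have hc : Continuous (algebraMap F k) := continuous_algebraMap F k
    have := map_real_smul ((algebraMap F k : F →+* k) : F →+ k) hc r 1
    simpa [RCLike.real_smul_eq_coe_mul] using this
  by_cases hx : x = 0
  · simp [hx]
  have hy : algebraMap F k x ≠ 0 := by simpa using hx
  have h1 : x * star x = ((‖x‖ ^ 2 : ℝ) : F) := by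
    rw [RCLike.star_def, RCLike.mul_conj]; push_cast; rfl
  have h2 : algebraMap F k x * star (algebraMap F k x) = ((‖x‖ ^ 2 : ℝ) : k) := by
    rw [RCLike.star_def, RCLike.mul_conj, norm_algebraMap']; push_cast; rfl
  refine mul_left_cancel₀ hy ?_
  rw [← map_mul, h1, h2, hreal]

theorem map_algebraMap_mem_maxCompactArch {n : ℕ} [RCLike F] [∀ w, RCLike (E w)]
    [∀ w, NormedAlgebra F (E w)] {k : GLn n F} (hk : k ∈ unitaryGL F n) :
    Matrix.GeneralLinearGroup.map (algebraMap F (∀ w, E w)) k ∈ maxCompactArch n E := by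
  have hk' : k.1 * star k.1 = 1 := hk
  change _ ∈ Matrix.unitaryGroup (Fin n) _
  rw [Matrix.mem_unitaryGroup_iff]
  have hs : star (Matrix.GeneralLinearGroup.map (algebraMap F (∀ w, E w)) k).1 =
      (star k.1).map (algebraMap F (∀ w, E w)) := by
    ext i j w
    exact (algebraMap_star (k.1 j i)).symm
  rw [hs]
  change k.1.map (algebraMap F (∀ w, E w)) * _ = 1
  rw [← Matrix.map_mul, hk', Matrix.map_one _ (map_zero _) (map_one _)]

end BaseChange

/-! ## Integrals depending holomorphically on an exponent -/

section Exponent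

theorem rpow_le_rpow_add_rpow {x p q r : ℝ} (hx : 0 < x) (h1 : p ≤ q) (h2 : q ≤ r) :
    x ^ q ≤ x ^ p + x ^ r := by
  rcases le_total 1 x with h | h
  · exact (Real.rpow_le_rpow_of_exponent_le h h2).trans
      (le_add_of_nonneg_left (Real.rpow_nonneg hx.le _))
  · exact (Real.rpow_le_rpow_of_exponent_ge hx h h1).trans
      (le_add_of_nonneg_right (Real.rpow_nonneg hx.le _))

theorem abs_log_le_rpow {x ε : ℝ} (hx : 0 < x) (hε : 0 < ε) :
    |Real.log x| ≤ (x ^ ε + x ^ (-ε)) / ε := by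
  have h1 := Real.log_le_rpow_div hx.le hε
  have h2 := Real.log_le_rpow_div (inv_pos.2 hx).le hε
  rw [Real.log_inv, Real.inv_rpow hx.le, ← Real.rpow_neg hx.le] at h2
  rw [add_div]
  have h3 : 0 ≤ x ^ ε / ε := by positivity
  have h4 : 0 ≤ x ^ (-ε) / ε := by positivity
  exact abs_le.2 ⟨by linarith, by linarith⟩

variable {X : Type*} [MeasurableSpace X] {ν : Measure X} {f : X → ℂ} {D : X → ℝ} {σ₀ : ℝ}

theorem integrable_mul_rpow (hf : AEStronglyMeasurable f ν) (hD : Measurable D) {σ : ℝ}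
    (hD0 : ∀ x, 0 < D x) (h : ∫⁻ x, ‖f x‖ₑ * ENNReal.ofReal (D x ^ σ) ∂ν < ⊤) :
    Integrable (fun x => ‖f x‖ * D x ^ σ) ν := by
  refine ⟨hf.norm.mul (hD.pow_const σ).aestronglyMeasurable, ?_⟩
  refine lt_of_le_of_lt (le_of_eq (lintegral_congr fun x => ?_)) h
  rw [enorm_mul, enorm_norm, Real.enorm_of_nonneg (Real.rpow_nonneg (hD0 x).le _)]

theorem integrable_mul_cpow (hf : AEStronglyMeasurable f ν) (hD : Measurable D)
    (hD0 : ∀ x, 0 < D x) {s : ℂ}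
    (h : ∫⁻ x, ‖f x‖ₑ * ENNReal.ofReal (D x ^ s.re) ∂ν < ⊤) :
    Integrable (fun x => f x * (D x : ℂ) ^ s) ν := by
  refine (integrable_mul_rpow hf hD hD0 h).mono'
    (hf.mul ((Complex.measurable_ofReal.comp hD).pow_const s).aestronglyMeasurable)
    (Filter.Eventually.of_forall fun x => ?_)
  rw [norm_mul, Complex.norm_cpow_eq_rpow_re_of_pos (hD0 x)]

/-- A power D^{Re s} with a ≤ Re s ≤ b is at most D^a + D^b, so the two edges of the strip control
its interior. -/
theorem norm_integral_mul_cpow_le (hf : AEStronglyMeasurable f ν) (hD : Measurable D)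
    (hD0 : ∀ x, 0 < D x) {a b : ℝ} {s : ℂ} (ha : a ≤ s.re) (hb : s.re ≤ b)
    {A B : ℝ} (hA0 : 0 ≤ A) (hB0 : 0 ≤ B)
    (hA : ∫⁻ x, ‖f x‖ₑ * ENNReal.ofReal (D x ^ a) ∂ν ≤ ENNReal.ofReal A)
    (hB : ∫⁻ x, ‖f x‖ₑ * ENNReal.ofReal (D x ^ b) ∂ν ≤ ENNReal.ofReal B) :
    ‖∫ x, f x * (D x : ℂ) ^ s ∂ν‖ ≤ A + B := by
  have hiA := integrable_mul_rpow hf hD hD0 (hA.trans_lt ENNReal.ofReal_lt_top)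
  have hiB := integrable_mul_rpow hf hD hD0 (hB.trans_lt ENNReal.ofReal_lt_top)
  have hle : ∀ {σ C : ℝ}, 0 ≤ C → ∫⁻ x, ‖f x‖ₑ * ENNReal.ofReal (D x ^ σ) ∂ν ≤ ENNReal.ofReal C →
      Integrable (fun x => ‖f x‖ * D x ^ σ) ν → ∫ x, ‖f x‖ * D x ^ σ ∂ν ≤ C := by
    intro σ C hC h hi
    rw [integral_eq_lintegral_of_nonneg_ae (Filter.Eventually.of_forall fun x =>
      mul_nonneg (norm_nonneg _) (Real.rpow_nonneg (hD0 x).le _)) hi.aestronglyMeasurable]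
    refine ENNReal.toReal_le_of_le_ofReal hC (le_trans (le_of_eq (lintegral_congr fun x => ?_)) h)
    rw [ENNReal.ofReal_mul (norm_nonneg _), ofReal_norm_eq_enorm]
  calc ‖∫ x, f x * (D x : ℂ) ^ s ∂ν‖ ≤ ∫ x, (‖f x‖ * D x ^ a + ‖f x‖ * D x ^ b) ∂ν := by
        refine norm_integral_le_of_norm_le (hiA.add hiB) (Filter.Eventually.of_forall fun x => ?_)
        rw [norm_mul, Complex.norm_cpow_eq_rpow_re_of_pos (hD0 x), ← mul_add]
        exact mul_le_mul_of_nonneg_left (rpow_le_rpow_add_rpow (hD0 x) ha hb) (norm_nonneg _)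
    _ ≤ A + B := by
        rw [integral_add hiA hiB]
        exact add_le_add (hle hA0 hA hiA) (hle hB0 hB hiB)

/-- Differentiation under the integral sign. The logarithm produced by the derivative is absorbed
into D^{±ε}, and ε is chosen so that Re s - 2ε still lies in the region of convergence. -/
theorem differentiableAt_integral_mul_cpow (hf : AEStronglyMeasurable f ν) (hD : Measurable D)
    (hD0 : ∀ x, 0 < D x)
    (h : ∀ σ, σ₀ < σ → ∫⁻ x, ‖f x‖ₑ * ENNReal.ofReal (D x ^ σ) ∂ν < ⊤) {s : ℂ} (hs : σ₀ < s.re) :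
    DifferentiableAt ℂ (fun s => ∫ x, f x * (D x : ℂ) ^ s ∂ν) s := by
  obtain ⟨ε, hε, hε2⟩ : ∃ ε : ℝ, 0 < ε ∧ σ₀ < s.re - 2 * ε :=
    ⟨(s.re - σ₀) / 4, by linarith, by linarith⟩
  have hi : ∀ z : ℂ, σ₀ < z.re → Integrable (fun x => f x * (D x : ℂ) ^ z) ν := fun z hz =>
    integrable_mul_cpow hf hD hD0 (h _ hz)
  have hc : ∀ z : ℂ, AEStronglyMeasurable (fun x => (D x : ℂ) ^ z) ν := fun z =>
    ((Complex.measurable_ofReal.comp hD).pow_const z).aestronglyMeasurable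
  have hb1 := integrable_mul_rpow hf hD hD0 (h (s.re - 2 * ε) hε2)
  have hb2 := integrable_mul_rpow hf hD hD0 (h (s.re + 2 * ε) (by linarith))
  refine (hasDerivAt_integral_of_dominated_loc_of_deriv_le (μ := ν)
    (F := fun z x => f x * (D x : ℂ) ^ z)
    (F' := fun z x => f x * ((D x : ℂ) ^ z * Complex.log (D x)))
    (bound := fun x => 2 / ε * (‖f x‖ * D x ^ (s.re - 2 * ε) + ‖f x‖ * D x ^ (s.re + 2 * ε)))
    (Metric.ball_mem_nhds s hε) (Filter.Eventually.of_forall fun z => hf.mul (hc z)) (hi s hs)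
    (hf.mul ((hc s).mul
      (Complex.measurable_log.comp (Complex.measurable_ofReal.comp hD)).aestronglyMeasurable))
    (Filter.Eventually.of_forall fun x z hz => ?_) ((hb1.add hb2).const_mul _)
    (Filter.Eventually.of_forall fun x z _ => ?_)).2.differentiableAt
  · have hz' : |z.re - s.re| < ε := by
      have h1 : |(z - s).re| ≤ ‖z - s‖ := Complex.abs_re_le_norm (z - s)
      rw [Complex.sub_re] at h1
      rw [Metric.mem_ball, dist_eq_norm] at hz
      exact h1.trans_lt hz
    obtain ⟨hz1, hz2⟩ := abs_lt.1 hz'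
    have h0 := hD0 x
    beta_reduce
    rw [norm_mul, norm_mul, Complex.norm_cpow_eq_rpow_re_of_pos h0, ← Complex.ofReal_log h0.le,
      Complex.norm_real, Real.norm_eq_abs, ← mul_add, mul_left_comm (2 / ε)]
    refine mul_le_mul_of_nonneg_left ?_ (norm_nonneg _)
    have e1 := rpow_le_rpow_add_rpow (p := s.re - 2 * ε) (q := z.re + ε) (r := s.re + 2 * ε) h0
      (by linarith) (by linarith)
    have e2 := rpow_le_rpow_add_rpow (p := s.re - 2 * ε) (q := z.re + -ε) (r := s.re + 2 * ε) h0
      (by linarith) (by linarith)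
    rw [Real.rpow_add h0] at e1 e2
    calc D x ^ z.re * |Real.log (D x)| ≤ D x ^ z.re * ((D x ^ ε + D x ^ (-ε)) / ε) :=
          mul_le_mul_of_nonneg_left (abs_log_le_rpow h0 hε) (Real.rpow_nonneg h0.le _)
      _ = (D x ^ z.re * D x ^ ε + D x ^ z.re * D x ^ (-ε)) / ε := by ring
      _ ≤ (2 * (D x ^ (s.re - 2 * ε) + D x ^ (s.re + 2 * ε))) / ε := by
          gcongr; linarith
      _ = 2 / ε * (D x ^ (s.re - 2 * ε) + D x ^ (s.re + 2 * ε)) := by ring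
  · have h0 : (D x : ℂ) ≠ 0 := Complex.ofReal_ne_zero.2 (hD0 x).ne'
    have := (hasDerivAt_id z).const_cpow (c := (D x : ℂ)) (Or.inl h0)
    simpa [mul_assoc] using this.const_mul (f x)

end Exponent

/-! ## Continuity of seminorms on inductive limits -/

section LimTopology

variable {I A V : Type*} [Nonempty A] [AddCommGroup V] [Module ℂ V]

/-- The topology defined by q alone is a locally convex vector space topology, and the assumed
bounds make every inclusion of a step continuous for it. It is therefore one of the topologies in
the definition of the limit, which is at least as fine. -/
theorem continuous_limTopology_of_bounded (step : I → Submodule ℂ V)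
    (p : (i : I) → SeminormFamily ℂ (step i) A) (q : Seminorm ℂ ↥(⨆ i, step i))
    (h : ∀ i, ∃ (s : Finset A) (C : ℝ), 0 ≤ C ∧ ∀ W : step i,
      q (Submodule.inclusion (le_iSup step i) W) ≤ C * ∑ a ∈ s, p i a W) :
    Continuous[limTopology step p, inferInstance] q := by
  let Q : SeminormFamily ℂ ↥(⨆ i, step i) Unit := fun _ => q
  let τ : TopologicalSpace ↥(⨆ i, step i) := Q.moduleFilterBasis.topology
  have hQ : WithSeminorms Q := ⟨rfl⟩
  have hτ : τ ∈ {τ : TopologicalSpace ↥(⨆ i, step i) | @IsTopologicalAddGroup _ τ _ ∧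
      @ContinuousSMul ℂ _ _ _ τ ∧ @LocallyConvexSpace ℝ _ _ _ _ _ τ ∧
      ∀ i, Continuous[(p i).moduleFilterBasis.topology, τ]
        (Submodule.inclusion (le_iSup step i))} := by
    refine ⟨hQ.topologicalAddGroup, hQ.continuousSMul, hQ.toLocallyConvexSpace, fun i => ?_⟩
    let _ : TopologicalSpace (step i) := (p i).moduleFilterBasis.topology
    have hp : WithSeminorms (p i) := ⟨rfl⟩
    refine hp.continuous_of_isBounded hQ _ fun _ => ?_
    obtain ⟨s, C, hC, hs⟩ := h i
    refine ⟨s, ⟨C * s.card, by positivity⟩, fun W => (hs W).trans ?_⟩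
    have h1 : ∑ a ∈ s, p i a W ≤ s.card * (s.sup (p i)) W := by
      rw [← nsmul_eq_mul]
      exact Finset.sum_le_card_nsmul _ _ _ fun a ha =>
        (Seminorm.le_def.1 (Finset.le_sup (f := p i) ha)) W
    calc C * ∑ a ∈ s, p i a W ≤ C * (s.card * (s.sup (p i)) W) :=
          mul_le_mul_of_nonneg_left h1 hC
      _ = C * s.card * (s.sup (p i)) W := by ring
  have hq : Continuous[τ, inferInstance] q := hQ.continuous_seminorm ()
  exact continuous_sInf_dom hτ hq

end LimTopology

/-! ## Properties of the zeta integral that follow from bounds -/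

section Zeta

variable {n : ℕ} {F : Type*} [NontriviallyNormedField F] [LocallyCompactSpace F]
  {ι : Type*} {E : ι → Type*} [∀ w, NontriviallyNormedField (E w)] [∀ w, NormedAlgebra F (E w)]

/-- The factor `W(h) φ(e_n h)` of the integrand of the zeta integral. -/
def zetaBase (W : GLn n ((w : ι) → E w) → ℂ) (φ : (Fin n → F) → ℂ) (x : UnipQuotient n F) : ℂ :=
  W (Matrix.GeneralLinearGroup.map (algebraMap F ((w : ι) → E w)) x.out) *
    φ (Matrix.vecMul (fun i : Fin n => if (i : ℕ) + 1 = n then 1 else 0) x.out.1)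

/-- The function `|det h|_F` on `N_n(F) \ GL_n(F)`. -/
def quotientDet (x : UnipQuotient n F) : ℝ := nabs F x.out.1.det

variable {I A V : Type*} [Nonempty A] [AddCommGroup V] [Module ℂ V]

/-- Everything follows from the absolute integrals on vertical lines being bounded by finitely many
seminorms on each step. The continuous seminorm is the supremum of |Z(s, W, φ)| over the strip, and
its restriction to a step is bounded through the two edge integrals. -/
theorem zeta_properties [MeasurableSpace (GLn n F)] (ν : Measure (UnipQuotient n F))
    (hD : Measurable (quotientDet : UnipQuotient n F → ℝ))
    (hD0 : ∀ x : UnipQuotient n F, 0 < quotientDet x)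
    (step : I → Submodule ℂ V) (p : (i : I) → SeminormFamily ℂ (step i) A)
    (e : V →ₗ[ℂ] (GLn n ((w : ι) → E w) → ℂ)) (φ : (Fin n → F) → ℂ) (σ₀ : ℝ)
    (hm : ∀ i, ∀ W ∈ step i, AEStronglyMeasurable (zetaBase (e W) φ) ν)
    (hb : ∀ i, ∀ σ, σ₀ < σ → ∃ (s : Finset A) (C : ℝ), 0 ≤ C ∧ ∀ W : step i,
      ∫⁻ x, ‖zetaBase (e W) φ x‖ₑ * ENNReal.ofReal (quotientDet x ^ σ) ∂ν ≤
        ENNReal.ofReal (C * ∑ a ∈ s, p i a W)) :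
    (∀ W ∈ (⨆ i, step i), ∀ s : ℂ, σ₀ < s.re → Integrable (zetaIntegrand (e W) φ s) ν) ∧
    (∀ W ∈ (⨆ i, step i), DifferentiableOn ℂ (zeta ν (e W) φ) {s : ℂ | σ₀ < s.re}) ∧
    (∀ W ∈ (⨆ i, step i), ∀ a b : ℝ, σ₀ < a → a < b →
      ∃ M : ℝ, ∀ s : ℂ, a ≤ s.re → s.re ≤ b → ‖zeta ν (e W) φ s‖ ≤ M) ∧
    (∀ a b : ℝ, σ₀ < a → a < b → ∃ q : Seminorm ℂ ↥(⨆ i, step i),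
      Continuous[limTopology step p, inferInstance] q ∧
        ∀ (W : ↥(⨆ i, step i)) (s : ℂ), a ≤ s.re → s.re ≤ b → ‖zeta ν (e W) φ s‖ ≤ q W) := by
  have hbase : ∀ W W' : V, zetaBase (e (W + W')) φ = zetaBase (e W) φ + zetaBase (e W') φ := by
    intro W W'
    funext x
    simp [zetaBase, add_mul]
  have key : ∀ W ∈ (⨆ i, step i), AEStronglyMeasurable (zetaBase (e W) φ) ν ∧
      ∀ σ, σ₀ < σ → ∫⁻ x, ‖zetaBase (e W) φ x‖ₑ * ENNReal.ofReal (quotientDet x ^ σ) ∂ν < ⊤ := by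
    intro W hW
    -- The supremum consists of finite sums of elements of the steps, so measurability and
    -- finiteness extend by additivity; directedness of the steps is not needed.
    refine Submodule.iSup_induction step (motive := fun W =>
      AEStronglyMeasurable (zetaBase (e W) φ) ν ∧
      ∀ σ, σ₀ < σ → ∫⁻ x, ‖zetaBase (e W) φ x‖ₑ * ENNReal.ofReal (quotientDet x ^ σ) ∂ν < ⊤) hW
      (fun i W hW => ⟨hm i W hW, fun σ hσ => ?_⟩) ⟨?_, fun σ hσ => ?_⟩
      (fun W W' h h' => ⟨?_, fun σ hσ => ?_⟩)
    · obtain ⟨s, C, -, h⟩ := hb i σ hσ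
      exact (h ⟨W, hW⟩).trans_lt ENNReal.ofReal_lt_top
    · rw [show zetaBase (e 0) φ = fun _ => (0 : ℂ) by funext x; simp [zetaBase]]
      exact aestronglyMeasurable_const
    · simp [zetaBase]
    · rw [hbase]; exact h.1.add h'.1
    · rw [hbase]
      have hme : AEMeasurable (fun x =>
          ‖zetaBase (e W) φ x‖ₑ * ENNReal.ofReal (quotientDet x ^ σ)) ν :=
        h.1.enorm.mul (hD.pow_const σ).ennreal_ofReal.aemeasurable
      refine lt_of_le_of_lt (lintegral_mono fun x => ?_)
        ((lintegral_add_left' hme _).trans_lt (ENNReal.add_lt_top.2 ⟨h.2 σ hσ, h'.2 σ hσ⟩))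
      rw [← add_mul]
      exact mul_le_mul_left (enorm_add_le _ _) _
  have hint : ∀ W ∈ (⨆ i, step i), ∀ s : ℂ, σ₀ < s.re → Integrable (zetaIntegrand (e W) φ s) ν :=
    fun W hW s hs => integrable_mul_cpow (key W hW).1 hD hD0 ((key W hW).2 _ hs)
  have hbd : ∀ W ∈ (⨆ i, step i), ∀ a b : ℝ, σ₀ < a → a < b →
      ∃ M : ℝ, ∀ s : ℂ, a ≤ s.re → s.re ≤ b → ‖zeta ν (e W) φ s‖ ≤ M := by
    intro W hW a b ha hab
    refine ⟨_, fun s hs hs' => norm_integral_mul_cpow_le (key W hW).1 hD hD0 hs hs'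
      ENNReal.toReal_nonneg ENNReal.toReal_nonneg
      (ENNReal.ofReal_toReal ((key W hW).2 a ha).ne).ge
      (ENNReal.ofReal_toReal ((key W hW).2 b (ha.trans hab)).ne).ge⟩
  refine ⟨hint, fun W hW s hs => (differentiableAt_integral_mul_cpow (key W hW).1 hD hD0
    (key W hW).2 hs).differentiableWithinAt, hbd, fun a b ha hab => ?_⟩
  -- The map sending W to the function Z(·, W, φ) on the strip; the seminorm is the pullback of the
  -- supremum norm.
  let T : ↥(⨆ i, step i) →ₗ[ℂ] ({s : ℂ // a ≤ s.re ∧ s.re ≤ b} → ℂ) :=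
    { toFun := fun W s => zeta ν (e W) φ s
      map_add' := fun W W' => by
        funext s
        have hs : σ₀ < s.1.re := ha.trans_le s.2.1
        rw [Pi.add_apply, zeta, zeta, zeta, ← integral_add (hint W W.2 s hs) (hint W' W'.2 s hs)]
        refine integral_congr_ae (Filter.Eventually.of_forall fun x => ?_)
        simp only [zetaIntegrand, Submodule.coe_add, map_add, Pi.add_apply]
        ring
      map_smul' := fun c W => by
        funext s
        rw [RingHom.id_apply, Pi.smul_apply, zeta, zeta, ← integral_smul]
        refine integral_congr_ae (Filter.Eventually.of_forall fun x => ?_)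
        simp only [zetaIntegrand, Submodule.coe_smul, map_smul, Pi.smul_apply, smul_eq_mul]
        ring }
  have hT : ∀ W, ∃ C : ℝ, ∀ s, ‖T W s‖ ≤ C * (1 : ℝ) := fun W => by
    obtain ⟨M, hM⟩ := hbd W W.2 a b ha hab
    exact ⟨M, fun s => by rw [mul_one]; exact hM s s.2.1 s.2.2⟩
  have hsup : ∀ W, supSeminorm T (fun _ => 1) (fun _ => zero_le_one) hT W = ⨆ s, ‖T W s‖ / 1 :=
    fun W => rfl
  refine ⟨supSeminorm T (fun _ => 1) (fun _ => zero_le_one) hT,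
    continuous_limTopology_of_bounded step p _ fun i => ?_, fun W s hs hs' => ?_⟩
  · obtain ⟨S₁, C₁, hC₁, h₁⟩ := hb i a ha
    obtain ⟨S₂, C₂, hC₂, h₂⟩ := hb i b (ha.trans hab)
    classical
    refine ⟨S₁ ∪ S₂, C₁ + C₂, add_nonneg hC₁ hC₂, fun W => ?_⟩
    have hn : ∀ S : Finset A, 0 ≤ ∑ a ∈ S, p i a W := fun S =>
      Finset.sum_nonneg fun a _ => apply_nonneg _ _
    rw [hsup]
    refine Real.iSup_le (fun s => ?_) (mul_nonneg (add_nonneg hC₁ hC₂) (hn _))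
    rw [div_one]
    refine (norm_integral_mul_cpow_le (hm i W W.2) hD hD0 s.2.1 s.2.2 (mul_nonneg hC₁ (hn _))
      (mul_nonneg hC₂ (hn _)) (h₁ W) (h₂ W)).trans ?_
    rw [add_mul]
    refine add_le_add (mul_le_mul_of_nonneg_left ?_ hC₁) (mul_le_mul_of_nonneg_left ?_ hC₂)
    · exact Finset.sum_le_sum_of_subset_of_nonneg Finset.subset_union_left
        fun a _ _ => apply_nonneg _ _
    · exact Finset.sum_le_sum_of_subset_of_nonneg Finset.subset_union_right
        fun a _ _ => apply_nonneg _ _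
  · rw [hsup]
    obtain ⟨C, hC⟩ := hT W
    refine (le_of_eq (div_one _).symm).trans (le_ciSup (f := fun s => ‖T W s‖ / 1) ⟨C, ?_⟩
      (⟨s, hs, hs'⟩ : {s : ℂ // a ≤ s.re ∧ s.re ≤ b}))
    rintro _ ⟨s, rfl⟩
    simpa using hC s

end Zeta

/-! ## Estimates on the torus -/

section TorusEstimates

/-- Near 0 at most half of the decay x^q is lost to x^{-e}. For x ≥ 1 the growth x^q is traded for
the decay x^{-q/2} at the price of Y^{2q}. -/
theorem rpow_mul_max_le {x Y q e : ℝ} (hx : 0 < x) (hY : 1 ≤ Y) (hxY : x ≤ Y) (hq : 0 < q)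
    (he : e ≤ q / 2) :
    x ^ q * max 1 x⁻¹ ^ e ≤ Y ^ (2 * q) * min (x ^ (q / 2)) (x ^ (-(q / 2))) := by
  have hY1 : 1 ≤ Y ^ (2 * q) := Real.one_le_rpow hY (by linarith)
  rcases le_total 1 x with h | h
  · rw [max_eq_left (inv_le_one_of_one_le₀ h), Real.one_rpow, mul_one,
      min_eq_right (Real.rpow_le_rpow_of_exponent_le h (by linarith))]
    calc x ^ q ≤ x ^ (2 * q + -(q / 2)) := Real.rpow_le_rpow_of_exponent_le h (by linarith)
      _ = x ^ (2 * q) * x ^ (-(q / 2)) := Real.rpow_add hx _ _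
      _ ≤ Y ^ (2 * q) * x ^ (-(q / 2)) := by gcongr
  · rw [max_eq_right (one_le_inv_iff₀.2 ⟨hx, h⟩),
      min_eq_left (Real.rpow_le_rpow_of_exponent_ge hx h (by linarith))]
    calc x ^ q * x⁻¹ ^ e ≤ x ^ q * x⁻¹ ^ (q / 2) := by
          gcongr
          exact one_le_inv_iff₀.2 ⟨hx, h⟩
      _ = x ^ (q / 2) := by
          rw [Real.inv_rpow hx.le, ← Real.rpow_neg hx.le, ← Real.rpow_add hx]
          congr 1; ring
      _ ≤ Y ^ (2 * q) * x ^ (q / 2) := le_mul_of_one_le_left (by positivity) hY1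

/-- Here Y bounds the x_i from above and Y ∏ max(1, 1/x_i) bounds both x_i and 1/x_i; the factors
Y^a and (…)^{aε} are those of the bound for Ξ_μ. The outcome is integrable against d^×t apart from
Y^N, to be paid for by the decay of W and φ. -/
theorem exists_torus_weight_le (n : ℕ) {c δ a : ℝ} (hc : 0 < c) (hδ : 0 < δ) (ha : 0 ≤ a) :
    ∃ ε : ℝ, 0 < ε ∧ ε ≤ 1 ∧ ∃ N : ℕ, ∀ x : Fin n → ℝ, (∀ i, 0 < x i) → ∀ Y : ℝ, 1 ≤ Y →
      (∀ i, x i ≤ Y) → (∏ i, (x i ^ c) ^ δ) * Y ^ a * (Y * ∏ i, max 1 (x i)⁻¹) ^ (a * ε) ≤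
        Y ^ N * ∏ i, min ((x i ^ c) ^ (δ / 2)) ((x i ^ c) ^ (-(δ / 2))) := by
  set q := c * δ with hqdef
  have hq : 0 < q := mul_pos hc hδ
  -- This makes a ε ≤ q/2, so the loss at 0 uses at most half of the available exponent. The
  -- denominator a + 1 avoids division by zero.
  refine ⟨min 1 (q / (2 * (a + 1))), lt_min one_pos (by positivity), min_le_left _ _, ?_⟩
  set ε := min 1 (q / (2 * (a + 1))) with hε
  have hε0 : 0 < ε := lt_min one_pos (by positivity)
  have he : a * ε ≤ q / 2 := by
    have h1 : ε ≤ q / (2 * (a + 1)) := min_le_right _ _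
    calc a * ε ≤ (a + 1) * (q / (2 * (a + 1))) := by gcongr; linarith
      _ = q / 2 := by field_simp
  obtain ⟨N, hN⟩ := exists_nat_ge (a + a * ε + n * (2 * q))
  refine ⟨N, fun x hx Y hY hxY => ?_⟩
  have hY0 : 0 < Y := one_pos.trans_le hY
  have h1 : ∀ i, (x i ^ c) ^ δ = x i ^ q := fun i => (Real.rpow_mul (hx i).le _ _).symm
  have h2 : ∀ i, (x i ^ c) ^ (δ / 2) = x i ^ (q / 2) := fun i => by
    rw [← Real.rpow_mul (hx i).le]; congr 1; ring
  have h3 : ∀ i, (x i ^ c) ^ (-(δ / 2)) = x i ^ (-(q / 2)) := fun i => by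
    rw [← Real.rpow_mul (hx i).le]; congr 1; ring
  simp only [h1, h2, h3]
  have hmax : ∀ i, (0 : ℝ) ≤ max 1 (x i)⁻¹ := fun i => zero_le_one.trans (le_max_left _ _)
  rw [Real.mul_rpow hY0.le (Finset.prod_nonneg fun i _ => hmax i),
    ← Real.finsetProd_rpow _ _ fun i _ => hmax i]
  have hmin : ∀ i, 0 ≤ min (x i ^ (q / 2)) (x i ^ (-(q / 2))) := fun i =>
    le_min (Real.rpow_nonneg (hx i).le _) (Real.rpow_nonneg (hx i).le _)
  calc (∏ i, x i ^ q) * Y ^ a * (Y ^ (a * ε) * ∏ i, max 1 (x i)⁻¹ ^ (a * ε))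
      = Y ^ (a + a * ε) * ∏ i, x i ^ q * max 1 (x i)⁻¹ ^ (a * ε) := by
        rw [Finset.prod_mul_distrib, Real.rpow_add hY0]; ring
    _ ≤ Y ^ (a + a * ε) * ∏ i, Y ^ (2 * q) * min (x i ^ (q / 2)) (x i ^ (-(q / 2))) := by
        refine mul_le_mul_of_nonneg_left (Finset.prod_le_prod (fun i _ => ?_) fun i _ => ?_)
          (by positivity)
        · exact mul_nonneg (Real.rpow_nonneg (hx i).le _) (Real.rpow_nonneg (hmax i) _)
        · exact rpow_mul_max_le (hx i) hY (hxY i) hq he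
    _ = Y ^ (a + a * ε + n * (2 * q)) * ∏ i, min (x i ^ (q / 2)) (x i ^ (-(q / 2))) := by
        have h4 : Y ^ (n * (2 * q)) = (Y ^ (2 * q)) ^ n := by
          rw [← Real.rpow_natCast (Y ^ (2 * q)), ← Real.rpow_mul hY0.le, mul_comm]
        rw [Finset.prod_mul_distrib, Finset.prod_const, Finset.card_univ, Fintype.card_fin,
          Real.rpow_add hY0 (a + a * ε), h4, mul_assoc]
    _ ≤ Y ^ N * ∏ i, min (x i ^ (q / 2)) (x i ^ (-(q / 2))) := by
        refine mul_le_mul_of_nonneg_right ?_ (Finset.prod_nonneg fun i _ => hmin i)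
        rw [← Real.rpow_natCast]
        exact Real.rpow_le_rpow_of_exponent_le hY hN

theorem le_prod_of_one_le {ι : Type*} [Fintype ι] (f : ι → ℝ) (hf : ∀ i, 1 ≤ f i) (i : ι) :
    f i ≤ ∏ j, f j := by
  classical
  calc f i = ∏ j, if j = i then f j else 1 := by simp
    _ ≤ ∏ j, f j := Finset.prod_le_prod (fun j _ => by
        split_ifs
        · exact zero_le_one.trans (hf j)
        · exact zero_le_one) fun j _ => by
        split_ifs
        · exact le_rfl
        · exact hf j

variable {n : ℕ} {k : Type*} [NormedField k]

/-- The product of `1 + ‖α(t)‖` over the simple roots `α`. -/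
def rootNorm (t : Fin n → kˣ) : ℝ :=
  ∏ i : Fin n, ∏ j : Fin n, if (j : ℕ) = i + 1 then 1 + ‖(t i / t j : k)‖ else 1

theorem one_le_rootNorm_factor (t : Fin n → kˣ) (i j : Fin n) :
    (1 : ℝ) ≤ if (j : ℕ) = i + 1 then 1 + ‖(t i / t j : k)‖ else 1 := by
  split_ifs
  · linarith [norm_nonneg (t i / t j : k)]
  · exact le_rfl

theorem one_le_rootNorm (t : Fin n → kˣ) : 1 ≤ rootNorm t :=
  Finset.one_le_prod fun i _ => Finset.one_le_prod fun j _ => one_le_rootNorm_factor t i j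

theorem norm_div_le_rootNorm (t : Fin n → kˣ) {i j : Fin n} (h : (j : ℕ) = i + 1) :
    ‖(t i / t j : k)‖ ≤ rootNorm t := by
  have h1 := le_prod_of_one_le (fun j : Fin n =>
    if (j : ℕ) = i + 1 then 1 + ‖(t i / t j : k)‖ else 1) (one_le_rootNorm_factor t i) j
  have h2 := le_prod_of_one_le (fun i : Fin n => ∏ j : Fin n,
    if (j : ℕ) = i + 1 then 1 + ‖(t i / t j : k)‖ else 1)
    (fun i => Finset.one_le_prod fun j _ => one_le_rootNorm_factor t i j) i
  rw [if_pos h] at h1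
  have h3 := h1.trans h2
  exact (le_add_of_nonneg_left zero_le_one).trans h3

/-- The entry t_i is the product of the successive ratios t_j / t_{j+1}, j ≥ i, with the last entry.
-/
theorem norm_le_rootNorm_pow (t : Fin n → kˣ) {l : Fin n} (hl : (l : ℕ) + 1 = n) (i : Fin n) :
    ‖(t i : k)‖ ≤ rootNorm t ^ n * (1 + ‖(t l : k)‖) := by
  have h1 := one_le_rootNorm t
  have key : ∀ m : ℕ, ∀ i : Fin n, (i : ℕ) + m + 1 = n →
      ‖(t i : k)‖ ≤ rootNorm t ^ m * (1 + ‖(t l : k)‖) := by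
    intro m
    induction m with
    | zero =>
      intro i hi
      rw [show i = l from Fin.ext (by omega), pow_zero, one_mul]
      linarith
    | succ m ih =>
      intro i hi
      have hj : (i : ℕ) + 1 < n := by omega
      have h2 := ih ⟨i + 1, hj⟩ (by simp; omega)
      have h3 := norm_div_le_rootNorm t (i := i) (j := ⟨i + 1, hj⟩) rfl
      calc ‖(t i : k)‖ = ‖(t i / t ⟨i + 1, hj⟩ : k)‖ * ‖(t ⟨i + 1, hj⟩ : k)‖ := by
            rw [← norm_mul, div_mul_cancel₀ _ (t _).ne_zero]
        _ ≤ rootNorm t * (rootNorm t ^ m * (1 + ‖(t l : k)‖)) := by gcongr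
        _ = _ := by ring
  refine (key (n - 1 - i) i (by have := i.2; omega)).trans ?_
  gcongr
  omega

end TorusEstimates

/-! ## The spherical function in terms of the Iwasawa decomposition -/

theorem Xi_nonneg {n : ℕ} {ι : Type*} [Fintype ι] {E : ι → Type*}
    [∀ w, NontriviallyNormedField (E w)] [∀ w, LocallyCompactSpace (E w)]
    [MeasurableSpace (GLn n ((w : ι) → E w))]
    {K : Subgroup (GLn n ((w : ι) → E w))} (κ : Measure K) (μ : Fin n → ℝ)
    (g : GLn n ((w : ι) → E w)) : 0 ≤ Xi κ μ g := by
  refine integral_nonneg fun k => ?_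
  change 0 ≤ sphericalVector K μ (k * g)
  unfold sphericalVector
  split_ifs
  · exact Finset.prod_nonneg fun i _ => Real.rpow_nonneg (nabs_nonneg _) _
  · exact le_rfl

section Spherical

variable {n : ℕ} {ι : Type*} [Fintype ι] [Nonempty ι] {E : ι → Type*}
  [∀ w, NontriviallyNormedField (E w)] [∀ w, ProperSpace (E w)]
  {K : ∀ n, Subgroup (GLn n ((w : ι) → E w))}

theorem sphericalVector_eq (hR : TameNabs ((w : ι) → E w)) (hK : IwasawaFamily K) (μ : Fin n → ℝ)
    (g : GLn n ((w : ι) → E w)) : sphericalVector (K n) μ g =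
      ∏ i : Fin n, iwasawaT (K n) g.1 i ^ (((n : ℝ) - 1 - 2 * (i : ℕ)) / 2 + μ i) := by
  have h : ∃ b : GLn n ((w : ι) → E w), (∀ i j : Fin n, j < i → b.1 i j = 0) ∧ b⁻¹ * g ∈ K n := by
    obtain ⟨b, hb, hg⟩ := hK.exists_upper n g
    exact ⟨b, fun i j h => hb h, hg⟩
  rw [sphericalVector, dif_pos h, borelChar]
  refine Finset.prod_congr rfl fun i _ => ?_
  have h1 : h.choose.1.BlockTriangular id := fun i j hij => h.choose_spec.1 i j hij
  have h2 : g.1 = h.choose.1 * (h.choose⁻¹ * g).1 := by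
    rw [← Units.val_mul, mul_inv_cancel_left]
  rw [h2, iwasawaT_mul hR hK h1 h.choose_spec.2]

/-- Only an upper bound is needed, so integrability of the spherical vector over K need not be known
here. -/
theorem ofReal_Xi_le (hR : TameNabs ((w : ι) → E w)) (hK : IwasawaFamily K) (μ : Fin n → ℝ)
    [MeasurableSpace (GLn n ((w : ι) → E w))] (κ : Measure (K n)) (g : GLn n ((w : ι) → E w)) :
    ENNReal.ofReal (Xi κ μ g) ≤ ∫⁻ k : K n, ENNReal.ofReal (∏ i : Fin n,
      iwasawaT (K n) (k.1 * g).1 i ^ (((n : ℝ) - 1 - 2 * (i : ℕ)) / 2 + μ i)) ∂κ := by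
  refine (ENNReal.ofReal_le_ofReal (Real.le_norm_self _)).trans ?_
  rw [ofReal_norm_eq_enorm, Xi]
  refine (enorm_integral_le_lintegral_enorm _).trans (le_of_eq (lintegral_congr fun k => ?_))
  rw [sphericalVector_eq hR hK, Real.enorm_of_nonneg]
  exact Finset.prod_nonneg fun i _ => Real.rpow_nonneg (iwasawaT_nonneg _ _ _) _

end Spherical

/-! ## The bound for the zeta integral -/

section ZetaBound

variable {n : ℕ} {F : Type*} [NontriviallyNormedField F] [ProperSpace F]
  {ι : Type*} [Fintype ι] {E : ι → Type*} [∀ w, NontriviallyNormedField (E w)]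
  [∀ w, ProperSpace (E w)] [∀ w, NormedAlgebra F (E w)]

/-- The image in `A_n(E)` of an element of `A_n(F)`. -/
def baseTorus (E : ι → Type*) [∀ w, NontriviallyNormedField (E w)] [∀ w, NormedAlgebra F (E w)]
    (t : Fin n → Fˣ) : Fin n → UnitGroup ((w : ι) → E w) :=
  fun i => Units.map (algebraMap F ((w : ι) → E w) : F →* _) (t i)

theorem map_torus (t : Fin n → Fˣ) :
    Matrix.GeneralLinearGroup.map (algebraMap F ((w : ι) → E w)) (torus t) =
      torus (baseTorus E t) := by
  refine Units.ext ?_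
  change (Matrix.diagonal fun i => (t i : F)).map _ = Matrix.diagonal _
  rw [Matrix.diagonal_map (map_zero _)]
  rfl

theorem map_mem_unip {u : GLn n F} (hu : u ∈ unip n F) :
    Matrix.GeneralLinearGroup.map (algebraMap F ((w : ι) → E w)) u ∈ unip n ((w : ι) → E w) := by
  refine ⟨fun i j h => ?_, fun i => ?_⟩
  · change algebraMap F ((w : ι) → E w) (u.1 i j) = 0
    rw [hu.1 i j h, map_zero]
  · change algebraMap F ((w : ι) → E w) (u.1 i i) = 1
    rw [hu.2 i, map_one]

variable [MeasureSpace F] [BorelSpace F] [(volume : Measure F).IsAddHaarMeasure]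
  [∀ w, MeasureSpace (E w)] [∀ w, BorelSpace (E w)]
  [∀ w, (volume : Measure (E w)).IsAddHaarMeasure] [∀ w, FiniteDimensional F (E w)]

theorem exists_unip_torus_decomposition {K : ∀ n, Subgroup (GLn n F)} (hK : IwasawaFamily K)
    (h : GLn n F) : ∃ u ∈ unip n F, ∃ t : Fin n → Fˣ, ∃ k ∈ K n, h = u * torus t * k := by
  obtain ⟨b, hb, k, hk, rfl⟩ := exists_iwasawa hK h
  obtain ⟨u, t, hu, hbt, -⟩ := exists_unip_mul_torus hb
  have h1 : (b * (torus t)⁻¹).1 = u := by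
    rw [Units.val_mul, hbt, mul_assoc, ← Units.val_mul, mul_inv_cancel, Units.val_one, mul_one]
  exact ⟨b * (torus t)⁻¹, ⟨fun i j hij => by rw [h1]; exact hu.1 i j hij,
    fun i => by rw [h1]; exact hu.2 i⟩, t, k, hk, by rw [inv_mul_cancel_right]⟩

/-- The last row of u t k is t_l times the last row of k. Multiplying back by k⁻¹, which has bounded
entries, recovers t_l, so the decay of φ(e_n h) is decay in t_l. -/
theorem norm_last_le {K : ∀ n, Subgroup (GLn n F)} (hK : IwasawaFamily K) {u : GLn n F}
    (hu : u ∈ unip n F) (t : Fin n → Fˣ) {k : GLn n F} (hk : k ∈ K n) {l : Fin n}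
    (hl : (l : ℕ) + 1 = n) : ‖(t l : F)‖ ≤ n *
      ‖Matrix.vecMul (fun i : Fin n => if (i : ℕ) + 1 = n then 1 else 0) (u * torus t * k).1‖ := by
  set v := Matrix.vecMul (fun i : Fin n => if (i : ℕ) + 1 = n then (1 : F) else 0)
    (u * torus t * k).1 with hv
  have h1 : Matrix.vecMul v (k⁻¹).1 l = t l := by
    rw [hv, Matrix.vecMul_vecMul, ← Units.val_mul, mul_inv_cancel_right]
    have h2 : ∀ i : Fin n, ((i : ℕ) + 1 = n) ↔ i = l := fun i => by
      rw [Fin.ext_iff]; omega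
    simp only [Matrix.vecMul, dotProduct, h2, ite_mul, one_mul, zero_mul, Finset.sum_ite_eq',
      Finset.mem_univ, if_true]
    change (u.1 * Matrix.diagonal fun i => (t i : F)) l l = t l
    rw [Matrix.mul_diagonal, hu.2, one_mul]
  rw [← h1]
  refine (norm_sum_le Finset.univ fun j => v j * (k⁻¹).1 j l).trans ?_
  calc ∑ j, ‖v j * (k⁻¹).1 j l‖ ≤ ∑ _j : Fin n, ‖v‖ := Finset.sum_le_sum fun j _ => by
        rw [norm_mul]
        exact (mul_le_mul (norm_le_pi_norm v j) (hK.norm_le n _ (inv_mem hk) j l) (norm_nonneg _)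
          (norm_nonneg _)).trans (mul_one _).le
    _ = n * ‖v‖ := by simp

theorem norm_apply_map {ψ : AddChar ((w : ι) → E w) Circle} {W : GLn n ((w : ι) → E w) → ℂ}
    (hW : W ∈ equivariant ψ) {u : GLn n F} (hu : u ∈ unip n F) (t : Fin n → Fˣ) (k : GLn n F) :
    ‖W (Matrix.GeneralLinearGroup.map (algebraMap F ((w : ι) → E w)) (u * torus t * k))‖ =
      ‖W (torus (baseTorus E t) *
        Matrix.GeneralLinearGroup.map (algebraMap F ((w : ι) → E w)) k)‖ := by
  rw [map_mul, map_mul, mul_assoc, hW _ (map_mem_unip hu), map_torus, norm_mul, psiN,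
    Circle.norm_coe, one_mul]

/-- The exponents n - 1 - 2i and 2i - n add up to -1, so the integral is a product of integrals over
F^× with respect to d^×t. -/
theorem lintegral_torus_majorant_lt_top (n : ℕ) {δ : ℝ} (hδ : 0 < δ) :
    ∫⁻ t : Fin n → F, ENNReal.ofReal (∏ i : Fin n, nabs F (t i) ^ ((n : ℝ) - 1 - 2 * (i : ℕ)) *
      min (nabs F (t i) ^ δ) (nabs F (t i) ^ (-δ))) * torusDensity F n t < ⊤ := by
  have hm : Measurable fun x : F =>
      ENNReal.ofReal (min (nabs F x ^ δ) (nabs F x ^ (-δ)) * (nabs F x)⁻¹) := by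
    have := (tameNabs_field F).continuous_nabs.measurable
    exact (((this.pow_const _).min (this.pow_const _)).mul this.inv).ennreal_ofReal
  have h : ∀ᵐ t : Fin n → F, ENNReal.ofReal (∏ i : Fin n,
      nabs F (t i) ^ ((n : ℝ) - 1 - 2 * (i : ℕ)) *
        min (nabs F (t i) ^ δ) (nabs F (t i) ^ (-δ))) * torusDensity F n t =
      ∏ i, ENNReal.ofReal (min (nabs F (t i) ^ δ) (nabs F (t i) ^ (-δ)) * (nabs F (t i))⁻¹) := by
    refine (ae_forall_isUnit ae_isUnit_field).mono fun t ht => ?_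
    have hp : ∀ i, 0 < nabs F (t i) := fun i => nabs_pos (ht i)
    have hmin : ∀ i, 0 ≤ min (nabs F (t i) ^ δ) (nabs F (t i) ^ (-δ)) := fun i =>
      le_min (Real.rpow_nonneg (hp i).le _) (Real.rpow_nonneg (hp i).le _)
    rw [torusDensity, ← ENNReal.ofReal_mul (Finset.prod_nonneg fun i _ =>
      mul_nonneg (Real.rpow_nonneg (hp i).le _) (hmin i)), ← Finset.prod_mul_distrib,
      ← ENNReal.ofReal_prod_of_nonneg fun i _ => mul_nonneg (hmin i) (inv_nonneg.2 (hp i).le)]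
    congr 1
    refine Finset.prod_congr rfl fun i _ => ?_
    rw [mul_right_comm, ← Real.rpow_add (hp i), mul_comm, ← Real.rpow_neg_one]
    congr 2
    ring
  rw [lintegral_congr_ae h, lintegral_pi_prod _ fun _ => hm]
  exact ENNReal.prod_lt_top fun i _ => lintegral_min_rpow_lt_top F hδ

theorem quotientDet_eq {K : ∀ n, Subgroup (GLn n F)} (hK : IwasawaFamily K)
    (x : UnipQuotient n F) : quotientDet x = ∏ i, iwasawaT (K n) x.out.1 i :=
  (prod_iwasawaT (tameNabs_field F) hK x.out).symm

/-- The integrals `∫ |W(h) φ(e_n h)| |det h|^σ dh` converge if `W` decays rapidly on the torus. -/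
theorem exists_lintegral_zetaBase_le (hn : 1 ≤ n) (hE : ∑ w, Module.finrank F (E w) = 2)
    {KF : ∀ n, Subgroup (GLn n F)} (hKF : IwasawaFamily KF)
    {KE : ∀ n, Subgroup (GLn n ((w : ι) → E w))} (hKE : IwasawaFamily (R := (w : ι) → E w) KE)
    (hmap : ∀ k ∈ KF n, Matrix.GeneralLinearGroup.map (algebraMap F ((w : ι) → E w)) k ∈ KE n)
    [MeasurableSpace (GLn n F)] [BorelSpace (GLn n F)] (lG : Measure (GLn n F)) [lG.IsHaarMeasure]
    (lN : Measure (unip n F)) [lN.IsHaarMeasure] (ν : Measure (UnipQuotient n F))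
    (hν : IsQuotientMeasure lG lN ν)
    [MeasurableSpace (GLn n ((w : ι) → E w))] [BorelSpace (GLn n ((w : ι) → E w))]
    (κ : Measure (KE n)) [κ.IsMulLeftInvariant] [IsProbabilityMeasure κ]
    (μ : Fin n → ℝ) {r σ : ℝ} (hr : ∀ i, r ≤ μ i) (hσ : -2 * r < σ)
    (ψ : AddChar ((w : ι) → E w) Circle) (φ : (Fin n → F) → ℂ)
    (hφ : ∀ M : ℕ, ∃ C : ℝ, 0 ≤ C ∧ ∀ v, (1 + ‖v‖) ^ M * ‖φ v‖ ≤ C) :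
    ∃ (N : ℕ) (C : ℝ), 0 ≤ C ∧ ∀ W ∈ equivariant ψ, ∀ P : ℝ, 0 ≤ P →
      (∀ t : Fin n → Fˣ, ∀ k ∈ KE n, rootNorm t ^ N * ‖W (torus (baseTorus E t) * k)‖ ≤
        P * Xi κ μ (torus (baseTorus E t))) →
      ∫⁻ x, ‖zetaBase W φ x‖ₑ * ENNReal.ofReal (quotientDet x ^ σ) ∂ν ≤ ENNReal.ofReal (C * P) := by
  have : Nonempty ι := by
    by_contra h
    rw [not_nonempty_iff] at h
    simp at hE
  have hR : TameNabs ((w : ι) → E w) := tameNabs_pi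
  have hF := tameNabs_field F
  obtain ⟨c, hc, hnabs⟩ := exists_nabs_eq_rpow F
  obtain ⟨a, ha, hXi⟩ := exists_lintegral_spherical_le hR hKE ae_isUnit_pi hasHeight_pi n κ μ hr
  -- The exponent of each |t_i| left after the modular characters cancel: σ from |det h|^σ and 2r
  -- from Ξ_μ, doubled by the passage from E to F.
  set δ := σ + 2 * r with hδdef
  have hδ : 0 < δ := by linarith
  obtain ⟨ε, hε, hε1, N, hN⟩ := exists_torus_weight_le n hc hδ ha
  obtain ⟨C₁, hC₁, hXi⟩ := hXi ε hε hε1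
  obtain ⟨C₂, hC₂, hφ⟩ := hφ N
  obtain ⟨C₃, hC₃, hq⟩ := exists_lintegral_quotient_le hF hKF (hasHeight_field F) n lG lN ν hν
  let G : (Fin n → ℝ) → ℝ := fun x => ∏ i : Fin n, x i ^ ((n : ℝ) - 1 - 2 * (i : ℕ)) *
    min (x i ^ (δ / 2)) (x i ^ (-(δ / 2)))
  have hG : Measurable fun x => ENNReal.ofReal (G x) := by
    refine (Finset.measurable_prod _ fun i _ => ?_).ennreal_ofReal
    exact ((measurable_pi_apply i).pow_const _).mul
      (((measurable_pi_apply i).pow_const _).min ((measurable_pi_apply i).pow_const _))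
  have hq' := hq _ hG
  have hfin := lintegral_torus_majorant_lt_top (F := F) n (half_pos hδ)
  set A := C₃ * ∫⁻ t : Fin n → F, ENNReal.ofReal (G fun i => nabs F (t i)) * torusDensity F n t
    with hA
  have hAtop : A ≠ ⊤ := ENNReal.mul_ne_top hC₃ hfin.ne
  -- The required decay is Y^N, and Y contains the n-th power of the root product; hence n N powers
  -- are asked of W, while φ supplies N powers of 1 + ‖t_l‖.
  refine ⟨n * N, C₁ * ((n : ℝ) ^ N * C₂) * A.toReal, by positivity, fun W hW P hP hWb => ?_⟩
  have hn0 : 0 < n := hn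
  let l : Fin n := ⟨n - 1, by omega⟩
  have hl : (l : ℕ) + 1 = n := by simp only [l]; omega
  have hpt : ∀ x : UnipQuotient n F, ‖zetaBase W φ x‖ * quotientDet x ^ σ ≤
      C₁ * ((n : ℝ) ^ N * C₂) * P * G (iwasawaT (KF n) x.out.1) := by
    intro x
    obtain ⟨u, hu, t, k, hk, hx⟩ := exists_unip_torus_decomposition hKF x.out
    have hT : ∀ i, iwasawaT (KF n) x.out.1 i = nabs F (t i : F) := by
      intro i
      have hub : u.1.BlockTriangular id := fun i j h => hu.1 i j h
      have htb : (torus t).1.BlockTriangular id := Matrix.blockTriangular_diagonal _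
      rw [hx, Units.val_mul, iwasawaT_mul hF hKF (b := u * torus t) (hub.mul htb) hk, Units.val_mul,
        upper_mul_diag hub htb, hu.2, one_mul]
      change nabs F (Matrix.diagonal (fun i => (t i : F)) i i) = _
      rw [Matrix.diagonal_apply_eq]
    have hdet : quotientDet x = ∏ i, nabs F (t i : F) := by
      rw [quotientDet_eq hKF]; simp only [hT]
    have hz0 : ∀ i, 0 < nabs F (t i : F) := fun i => nabs_pos (t i).isUnit
    have hx0 : ∀ i, 0 < ‖(t i : F)‖ := fun i => norm_pos_iff.2 (t i).ne_zero
    -- Y bounds every ‖t_i‖. With Z below, Y Z bounds the inverses as well and plays the part of L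
    -- in the estimate of Ξ_μ.
    set Y := rootNorm t ^ n * (1 + ‖(t l : F)‖) with hY
    have hr1 := one_le_rootNorm t
    have hY1 : 1 ≤ Y := by
      have h1 : 1 ≤ rootNorm t ^ n := one_le_pow₀ hr1
      have h2 : 1 ≤ 1 + ‖(t l : F)‖ := by linarith [norm_nonneg (t l : F)]
      nlinarith
    have hY0 : 0 < Y := one_pos.trans_le hY1
    have hxY : ∀ i, ‖(t i : F)‖ ≤ Y := norm_le_rootNorm_pow t hl
    set Z := ∏ i, max 1 ‖(t i : F)‖⁻¹ with hZ
    have hZ1 : 1 ≤ Z := Finset.one_le_prod fun i _ => le_max_left _ _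
    have hYZ : Y ≤ Y * Z := le_mul_of_one_le_right hY0.le hZ1
    have hnt : ∀ i, ‖((baseTorus E t i : UnitGroup ((w : ι) → E w)) : (w : ι) → E w)‖ =
        ‖(t i : F)‖ := fun i => norm_algebraMap' ((w : ι) → E w) (t i : F)
    have hnt' : ∀ i, ‖(((baseTorus E t i)⁻¹ : UnitGroup ((w : ι) → E w)) : (w : ι) → E w)‖ =
        ‖(t i : F)‖⁻¹ := fun i => by
      rw [show (baseTorus E t i)⁻¹ = baseTorus E (fun i => (t i)⁻¹) i from rfl]
      refine (norm_algebraMap' ((w : ι) → E w) (((t i)⁻¹ : Fˣ) : F)).trans ?_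
      rw [Units.val_inv_eq_inv_val, norm_inv]
    -- The total degree 2 of E over F enters here: the exponents (n - 1 - 2i)/2 + r over E become n
    -- - 1 - 2i + 2r over F, so that δ_E^{1/2} restricts to δ_F.
    have hne : ∀ i, nabs ((w : ι) → E w)
        ((baseTorus E t i : UnitGroup ((w : ι) → E w)) : (w : ι) → E w) = nabs F (t i : F) ^ 2 := by
      intro i
      have h1 := nabs_algebraMap (R := (w : ι) → E w) (t i : F)
      rwa [Module.finrank_pi_fintype, hE] at h1
    have hXb : Xi κ μ (torus (baseTorus E t)) ≤ C₁ * Y ^ a * (Y * Z) ^ (a * ε) *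
        ∏ i : Fin n, nabs F (t i : F) ^ ((n : ℝ) - 1 - 2 * (i : ℕ) + 2 * r) := by
      have h1 := (ofReal_Xi_le hR hKE μ κ _).trans (hXi (baseTorus E t) Y (Y * Z) hY1
        (fun i => (hnt i).trans_le (hxY i)) (hY1.trans hYZ)
        (fun i => (hnt i).trans_le ((hxY i).trans hYZ)) (fun i => (hnt' i).trans_le ?_))
      · refine ((ENNReal.ofReal_le_ofReal_iff ?_).1 h1).trans (le_of_eq ?_)
        · refine mul_nonneg (by positivity) (Finset.prod_nonneg fun i _ =>
            Real.rpow_nonneg (nabs_nonneg _) _)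
        · congr 1
          refine Finset.prod_congr rfl fun i _ => ?_
          rw [hne, ← Real.rpow_natCast, ← Real.rpow_mul (hz0 i).le]
          congr 1
          push_cast
          ring
      · calc ‖(t i : F)‖⁻¹ ≤ max 1 ‖(t i : F)‖⁻¹ := le_max_right _ _
          _ ≤ Z := le_prod_of_one_le (fun i => max 1 ‖(t i : F)‖⁻¹) (fun i => le_max_left _ _) i
          _ ≤ Y * Z := le_mul_of_one_le_left (zero_le_one.trans hZ1) hY1
    set v := Matrix.vecMul (fun i : Fin n => if (i : ℕ) + 1 = n then (1 : F) else 0) x.out.1 with hv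
    have hφb : (1 + ‖(t l : F)‖) ^ N * ‖φ v‖ ≤ (n : ℝ) ^ N * C₂ := by
      have h1 : ‖(t l : F)‖ ≤ n * ‖v‖ := by
        rw [hv, hx]; exact norm_last_le hKF hu t hk hl
      have h2 : (1 : ℝ) ≤ n := by exact_mod_cast hn
      calc (1 + ‖(t l : F)‖) ^ N * ‖φ v‖ ≤ (n * (1 + ‖v‖)) ^ N * ‖φ v‖ := by
            gcongr
            linarith
        _ = (n : ℝ) ^ N * ((1 + ‖v‖) ^ N * ‖φ v‖) := by rw [mul_pow]; ring
        _ ≤ _ := by gcongr; exact hφ v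
    have hWx : rootNorm t ^ (n * N) * ‖W (Matrix.GeneralLinearGroup.map
        (algebraMap F ((w : ι) → E w)) x.out)‖ ≤ P * Xi κ μ (torus (baseTorus E t)) := by
      rw [hx, norm_apply_map hW hu]
      exact hWb t _ (hmap k hk)
    have hX0 := Xi_nonneg κ μ (torus (baseTorus E t))
    have hprod : Y ^ N * ‖zetaBase W φ x‖ ≤
        (P * Xi κ μ (torus (baseTorus E t))) * ((n : ℝ) ^ N * C₂) := by
      rw [zetaBase, norm_mul, hY, mul_pow, ← pow_mul, mul_mul_mul_comm]
      exact mul_le_mul hWx hφb (by positivity) (by positivity)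
    have hw := hN (fun i => ‖(t i : F)‖) hx0 Y hY1 hxY
    simp only [← hnabs] at hw
    have hGe : G (iwasawaT (KF n) x.out.1) =
        (∏ i : Fin n, nabs F (t i : F) ^ ((n : ℝ) - 1 - 2 * (i : ℕ))) *
          ∏ i, min (nabs F (t i : F) ^ (δ / 2)) (nabs F (t i : F) ^ (-(δ / 2))) := by
      simp only [G, hT, Finset.prod_mul_distrib]
    have hYN : 0 < Y ^ N := pow_pos hY0 N
    refine le_of_mul_le_mul_left ?_ hYN
    have hsplit : (∏ i : Fin n, nabs F (t i : F) ^ ((n : ℝ) - 1 - 2 * (i : ℕ) + 2 * r)) *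
        (∏ i, nabs F (t i : F)) ^ σ =
        (∏ i : Fin n, nabs F (t i : F) ^ ((n : ℝ) - 1 - 2 * (i : ℕ))) *
          ∏ i, nabs F (t i : F) ^ δ := by
      rw [← Real.finsetProd_rpow _ _ fun i _ => (hz0 i).le, ← Finset.prod_mul_distrib,
        ← Finset.prod_mul_distrib]
      refine Finset.prod_congr rfl fun i _ => ?_
      rw [← Real.rpow_add (hz0 i), ← Real.rpow_add (hz0 i), hδdef]
      congr 1
      ring
    have hd0 : 0 ≤ (∏ i, nabs F (t i : F)) ^ σ :=
      Real.rpow_nonneg (Finset.prod_nonneg fun i _ => (hz0 i).le) _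
    have hm0 : 0 ≤ ∏ i : Fin n, nabs F (t i : F) ^ ((n : ℝ) - 1 - 2 * (i : ℕ)) :=
      Finset.prod_nonneg fun i _ => Real.rpow_nonneg (hz0 i).le _
    rw [hdet, hGe]
    calc Y ^ N * (‖zetaBase W φ x‖ * (∏ i, nabs F (t i : F)) ^ σ)
        = Y ^ N * ‖zetaBase W φ x‖ * (∏ i, nabs F (t i : F)) ^ σ := by ring
      _ ≤ (P * (C₁ * Y ^ a * (Y * Z) ^ (a * ε) *
            ∏ i : Fin n, nabs F (t i : F) ^ ((n : ℝ) - 1 - 2 * (i : ℕ) + 2 * r))) *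
            ((n : ℝ) ^ N * C₂) * (∏ i, nabs F (t i : F)) ^ σ := by
          refine mul_le_mul_of_nonneg_right (hprod.trans ?_) hd0
          gcongr
      _ = C₁ * ((n : ℝ) ^ N * C₂) * P * (Y ^ a * (Y * Z) ^ (a * ε)) *
            ((∏ i : Fin n, nabs F (t i : F) ^ ((n : ℝ) - 1 - 2 * (i : ℕ) + 2 * r)) *
              (∏ i, nabs F (t i : F)) ^ σ) := by ring
      _ = C₁ * ((n : ℝ) ^ N * C₂) * P *
            (∏ i : Fin n, nabs F (t i : F) ^ ((n : ℝ) - 1 - 2 * (i : ℕ))) *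
            ((∏ i, nabs F (t i : F) ^ δ) * Y ^ a * (Y * Z) ^ (a * ε)) := by rw [hsplit]; ring
      _ ≤ C₁ * ((n : ℝ) ^ N * C₂) * P *
            (∏ i : Fin n, nabs F (t i : F) ^ ((n : ℝ) - 1 - 2 * (i : ℕ))) *
            (Y ^ N * ∏ i, min (nabs F (t i : F) ^ (δ / 2)) (nabs F (t i : F) ^ (-(δ / 2)))) :=
          mul_le_mul_of_nonneg_left hw (by positivity)
      _ = _ := by ring
  have hD0 : ∀ x : UnipQuotient n F, 0 ≤ quotientDet x := fun x => nabs_nonneg _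
  calc ∫⁻ x, ‖zetaBase W φ x‖ₑ * ENNReal.ofReal (quotientDet x ^ σ) ∂ν
      ≤ ∫⁻ x, ENNReal.ofReal (C₁ * ((n : ℝ) ^ N * C₂) * P) *
          ENNReal.ofReal (G (iwasawaT (KF n) x.out.1)) ∂ν := by
        refine lintegral_mono fun x => ?_
        rw [← ofReal_norm_eq_enorm, ← ENNReal.ofReal_mul (norm_nonneg _),
          ← ENNReal.ofReal_mul (by positivity)]
        exact ENNReal.ofReal_le_ofReal (hpt x)
    _ = ENNReal.ofReal (C₁ * ((n : ℝ) ^ N * C₂) * P) *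
          ∫⁻ x, ENNReal.ofReal (G (iwasawaT (KF n) x.out.1)) ∂ν :=
        lintegral_const_mul' _ _ ENNReal.ofReal_ne_top
    _ ≤ ENNReal.ofReal (C₁ * ((n : ℝ) ^ N * C₂) * P) * ENNReal.ofReal A.toReal := by
        rw [ENNReal.ofReal_toReal hAtop]
        exact mul_le_mul_right hq' _
    _ = ENNReal.ofReal (C₁ * ((n : ℝ) ^ N * C₂) * A.toReal * P) := by
        rw [← ENNReal.ofReal_mul (by positivity)]
        congr 1
        ring

end ZetaBound

/-! ## Measurability of the integrand -/

section Measurability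

variable {n : ℕ} {F : Type*} [NontriviallyNormedField F] [ProperSpace F]
  {ι : Type*} [Fintype ι] {E : ι → Type*} [∀ w, NontriviallyNormedField (E w)]
  [∀ w, ProperSpace (E w)] [∀ w, NormedAlgebra F (E w)]

theorem measurable_comp_out [MeasurableSpace (GLn n F)] {Y : Type*} [MeasurableSpace Y]
    {f : GLn n F → Y} (hf : Measurable f) (hinv : ∀ u ∈ unip n F, ∀ g, f (u * g) = f g) :
    Measurable fun x : UnipQuotient n F => f x.out := by
  refine measurable_from_quotient.2 ?_
  convert hf using 1
  funext g
  have h : (QuotientGroup.rightRel (unip n F)) (Quotient.out (Quotient.mk'' g : UnipQuotient n F)) g :=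
    Quotient.mk_out g
  rw [QuotientGroup.rightRel_apply] at h
  have h2 := hinv _ h (Quotient.out (Quotient.mk'' g : UnipQuotient n F))
  rw [inv_mul_cancel_right] at h2
  exact h2.symm

theorem continuous_GL_map :
    Continuous (Matrix.GeneralLinearGroup.map (n := Fin n) (algebraMap F ((w : ι) → E w))) := by
  rw [isEmbedding_GL_val.continuous_iff]
  refine continuous_matrix fun i j => ?_
  exact (continuous_algebraMap F ((w : ι) → E w)).comp
    ((continuous_matrix_entry i j).comp Units.continuous_val)

/-- Triviality of ψ on F makes the integrand left invariant under N_n(F), so it descends to the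
quotient independently of representatives. -/
theorem psiN_map {ψ : AddChar ((w : ι) → E w) Circle}
    (hψ : ∀ x : F, ψ (algebraMap F ((w : ι) → E w) x) = 1) (u : GLn n F) :
    psiN ψ (Matrix.GeneralLinearGroup.map (algebraMap F ((w : ι) → E w)) u) = 1 := by
  have h : (-1) ^ n * ∑ i : Fin n, ∑ j : Fin n, (if (j : ℕ) = i + 1 then
      (Matrix.GeneralLinearGroup.map (algebraMap F ((w : ι) → E w)) u).1 i j else 0) =
      algebraMap F ((w : ι) → E w) ((-1) ^ n * ∑ i : Fin n, ∑ j : Fin n,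
        if (j : ℕ) = i + 1 then u.1 i j else 0) := by
    simp only [map_mul, map_pow, map_neg, map_one, map_sum, apply_ite (algebraMap F ((w : ι) → E w)),
      map_zero]
    rfl
  rw [psiN, h, hψ, Circle.coe_one]

theorem measurable_quotientDet [MeasurableSpace (GLn n F)] [BorelSpace (GLn n F)]
    [MeasureSpace F] [BorelSpace F] [(volume : Measure F).IsAddHaarMeasure] :
    Measurable (quotientDet : UnipQuotient n F → ℝ) := by
  refine measurable_comp_out (f := fun g : GLn n F => nabs F g.1.det) ?_ fun u hu g => ?_
  · exact ((tameNabs_field F).continuous_nabs.comp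
      (Units.continuous_val.matrix_det)).measurable
  · have h : IsUpUnip u.1 := hu
    rw [Units.val_mul, Matrix.det_mul, h.det, one_mul]

theorem measurable_zetaBase [MeasurableSpace (GLn n F)] [BorelSpace (GLn n F)]
    {ψ : AddChar ((w : ι) → E w) Circle} (hψ : ∀ x : F, ψ (algebraMap F ((w : ι) → E w) x) = 1)
    {W : GLn n ((w : ι) → E w) → ℂ} (hW : W ∈ equivariant ψ) (hWc : Continuous W)
    {φ : (Fin n → F) → ℂ} (hφ : Continuous φ) :
    Measurable (zetaBase W φ : UnipQuotient n F → ℂ) := by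
  refine measurable_comp_out (f := fun g : GLn n F =>
    W (Matrix.GeneralLinearGroup.map (algebraMap F ((w : ι) → E w)) g) *
      φ (Matrix.vecMul (fun i : Fin n => if (i : ℕ) + 1 = n then 1 else 0) g.1)) ?_ fun u hu g => ?_
  · exact ((hWc.comp continuous_GL_map).mul
      (hφ.comp (continuous_const.matrix_vecMul Units.continuous_val))).measurable
  · have he : Matrix.vecMul (fun i : Fin n => if (i : ℕ) + 1 = n then (1 : F) else 0) u.1 =
        fun i : Fin n => if (i : ℕ) + 1 = n then 1 else 0 := by
      funext j
      rw [Matrix.vecMul, dotProduct]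
      rcases Nat.eq_zero_or_pos n with h0 | h0
      · exact absurd j.2 (by omega)
      have h2 : ∀ i : Fin n, ((i : ℕ) + 1 = n) ↔ i = ⟨n - 1, by omega⟩ := fun i => by
        rw [Fin.ext_iff]; simp only; omega
      simp only [h2, ite_mul, one_mul, zero_mul, Finset.sum_ite_eq', Finset.mem_univ, if_true]
      split_ifs with hj
      · rw [hj]; exact hu.2 _
      · refine hu.1 _ _ (lt_of_le_of_ne (Fin.le_def.2 ?_) hj)
        have := j.2
        simp only
        omega
    change W _ * φ (Matrix.vecMul _ (u * g).1) = _
    rw [map_mul, hW _ (map_mem_unip hu), psiN_map hψ, one_mul, Units.val_mul,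
      ← Matrix.vecMul_vecMul, he]

end Measurability

/-! ## Comparison of the weights -/

section Weights

variable {n : ℕ} {F : Type*} [NontriviallyNormedField F]
  {ι : Type*} [Fintype ι] {E : ι → Type*} [∀ w, NontriviallyNormedField (E w)]
  [∀ w, ProperSpace (E w)] [∀ w, NormedAlgebra F (E w)]
  [∀ w, MeasureSpace (E w)] [∀ w, BorelSpace (E w)]
  [∀ w, (volume : Measure (E w)).IsAddHaarMeasure]

variable (E) in
theorem exists_rootFactor_le (R : ℝ) (hR : 0 ≤ R) : ∃ (C : ℝ) (M : ℕ), 0 ≤ C ∧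
    ∀ t : Fin n → Fˣ, rootFactor (baseTorus E t) ^ R ≤ C * rootNorm t ^ M := by
  choose c hc hnabs using fun w => exists_nabs_eq_rpow (E w)
  set c' := ∑ w, c w with hc'
  have hcc : ∀ w, c w ≤ c' := fun w =>
    Finset.single_le_sum (fun w _ => (hc w).le) (Finset.mem_univ w)
  have hc0 : 0 ≤ c' := Finset.sum_nonneg fun w _ => (hc w).le
  set q := Fintype.card ι * (n * n) with hq
  obtain ⟨M, hM⟩ := exists_nat_ge (c' * q * R)
  refine ⟨((2 : ℝ) ^ q) ^ R, M, by positivity, fun t => ?_⟩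
  have h1 := one_le_rootNorm t
  have h0 : 0 < rootNorm t := one_pos.trans_le h1
  have hrp : 1 ≤ rootNorm t ^ c' := Real.one_le_rpow h1 hc0
  have hfac : ∀ (w : ι) (i j : Fin n), (if (j : ℕ) = i + 1 then
      1 + nabs (E w) ((baseTorus E t i).1 w / (baseTorus E t j).1 w) else 1) ≤
      2 * rootNorm t ^ c' := by
    intro w i j
    split_ifs with hij
    · have h2 : (baseTorus E t i).1 w / (baseTorus E t j).1 w =
          algebraMap F (E w) (t i / t j : F) := by rw [map_div₀]; rfl
      have h3 : nabs (E w) ((baseTorus E t i).1 w / (baseTorus E t j).1 w) ≤ rootNorm t ^ c' := by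
        rw [h2, hnabs, norm_algebraMap']
        exact (Real.rpow_le_rpow (norm_nonneg _) (norm_div_le_rootNorm t hij) (hc w).le).trans
          (Real.rpow_le_rpow_of_exponent_le h1 (hcc w))
      linarith
    · linarith
  have hnn : ∀ (w : ι) (i j : Fin n), 0 ≤ (if (j : ℕ) = i + 1 then
      1 + nabs (E w) ((baseTorus E t i).1 w / (baseTorus E t j).1 w) else 1) := by
    intro w i j
    split_ifs
    · exact add_nonneg zero_le_one (nabs_nonneg _)
    · exact zero_le_one
  have hle : rootFactor (baseTorus E t) ≤ (2 * rootNorm t ^ c') ^ q := by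
    calc rootFactor (baseTorus E t) ≤ ∏ _w : ι, ∏ _i : Fin n, ∏ _j : Fin n, 2 * rootNorm t ^ c' :=
          Finset.prod_le_prod (fun w _ => Finset.prod_nonneg fun i _ => Finset.prod_nonneg
            fun j _ => hnn w i j) fun w _ => Finset.prod_le_prod (fun i _ => Finset.prod_nonneg
            fun j _ => hnn w i j) fun i _ => Finset.prod_le_prod (fun j _ => hnn w i j)
            fun j _ => hfac w i j
      _ = (2 * rootNorm t ^ c') ^ q := by
          simp only [Finset.prod_const, Finset.card_univ, Fintype.card_fin, ← pow_mul]
          congr 1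
          rw [hq]; ring
  calc rootFactor (baseTorus E t) ^ R ≤ ((2 * rootNorm t ^ c') ^ q) ^ R :=
        Real.rpow_le_rpow (zero_le_one.trans (one_le_rootFactor _)) hle hR
    _ = ((2 : ℝ) ^ q) ^ R * rootNorm t ^ (c' * q * R) := by
        rw [mul_pow, Real.mul_rpow (by positivity) (by positivity),
          ← Real.rpow_natCast (rootNorm t ^ c'), ← Real.rpow_mul h0.le, ← Real.rpow_mul h0.le]
    _ ≤ ((2 : ℝ) ^ q) ^ R * rootNorm t ^ M := by
        gcongr
        rw [← Real.rpow_natCast]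
        exact Real.rpow_le_rpow_of_exponent_le h1 hM

/-- Of the logarithmic factor only that it is at most 1 is used: the strict inequality on Re s
leaves room for the small power losses in the estimate of Ξ_μ. -/
theorem weight_le [MeasurableSpace (GLn n ((w : ι) → E w))]
    {K : Subgroup (GLn n ((w : ι) → E w))} (κ : Measure K) (μ : Fin n → ℝ) (R : ℝ) {d : ℝ}
    (hd : 0 ≤ d) (t : Fin n → UnitGroup ((w : ι) → E w)) :
    weight κ μ R d t ≤ rootFactor t ^ R * Xi κ μ (torus t) := by
  refine mul_le_of_le_one_right (mul_nonneg (Real.rpow_nonneg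
    (zero_le_one.trans (one_le_rootFactor t)) _) (Xi_nonneg κ μ _)) ?_
  exact Real.rpow_le_one_of_one_le_of_nonpos (le_max_left _ _) (neg_nonpos.2 hd)

variable (F) in
/-- A bound in terms of the weight gives a bound by the spherical function, up to a power of the
simple roots. -/
theorem exists_weight_baseTorus_le [MeasurableSpace (GLn n ((w : ι) → E w))]
    {K : Subgroup (GLn n ((w : ι) → E w))} (κ : Measure K) (μ : Fin n → ℝ) {R : ℝ} (hR : 0 ≤ R) :
    ∃ (C : ℝ) (M : ℕ), 0 ≤ C ∧ ∀ t : Fin n → Fˣ, ∀ d, 0 ≤ d →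
      weight κ μ R d (baseTorus E t) ≤ C * rootNorm t ^ M * Xi κ μ (torus (baseTorus E t)) := by
  obtain ⟨C, M, hC, h⟩ := exists_rootFactor_le (n := n) (F := F) E R hR
  exact ⟨C, M, hC, fun t d hd => (weight_le κ μ R hd _).trans
    (mul_le_mul_of_nonneg_right (h t) (Xi_nonneg κ μ _))⟩

theorem norm_le_supSeminorm {V X : Type*} [AddCommGroup V] [Module ℂ V] (D : V →ₗ[ℂ] (X → ℂ))
    (v : X → ℝ) (hv : ∀ x, 0 ≤ v x) (h : ∀ W, ∃ C : ℝ, ∀ x, ‖D W x‖ ≤ C * v x) (W : V) (x : X) :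
    ‖D W x‖ ≤ supSeminorm D v hv h W * v x := by
  obtain ⟨C, hC⟩ := h W
  rcases (hv x).eq_or_lt with h0 | h0
  · have := hC x
    rw [← h0, mul_zero] at this ⊢
    exact this
  · rw [← div_le_iff₀ h0]
    refine le_ciSup (f := fun x => ‖D W x‖ / v x) ⟨max C 0, ?_⟩ x
    rintro _ ⟨x, rfl⟩
    refine div_le_of_le_mul₀ (hv x) (le_max_right _ _) ((hC x).trans ?_)
    exact mul_le_mul_of_nonneg_right (le_max_left _ _) (hv x)

end Weights

/-! ## Root subgroups -/

section RootSubgroup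

variable {n : ℕ} {R : Type*} [CommRing R]

/-- The unipotent element with entry `z` at the place `(i, j)`. -/
def rootElement {i j : Fin n} (h : (j : ℕ) = i + 1) (z : R) : GLn n R where
  val := Matrix.transvection i j z
  inv := Matrix.transvection i j (-z)
  val_inv := by
    rw [Matrix.transvection_mul_transvection_same i j (Fin.ne_of_val_ne (by omega)),
      add_neg_cancel, Matrix.transvection_zero]
  inv_val := by
    rw [Matrix.transvection_mul_transvection_same i j (Fin.ne_of_val_ne (by omega)),
      neg_add_cancel, Matrix.transvection_zero]

theorem rootElement_mem {i j : Fin n} (h : (j : ℕ) = i + 1) (z : R) :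
    rootElement h z ∈ unip n R := by
  refine ⟨fun a b hab => ?_, fun a => ?_⟩
  · change (1 + Matrix.single i j z) a b = 0
    rw [Matrix.add_apply, Matrix.one_apply_ne hab.ne', Matrix.single_apply, if_neg, add_zero]
    rintro ⟨rfl, rfl⟩
    exact absurd (Fin.lt_def.1 hab) (by omega)
  · change (1 + Matrix.single i j z) a a = 1
    rw [Matrix.add_apply, Matrix.one_apply_eq, Matrix.single_apply, if_neg, add_zero]
    rintro ⟨rfl, rfl⟩
    omega

theorem psiN_rootElement (ψ : AddChar R Circle) {i j : Fin n} (h : (j : ℕ) = i + 1) (z : R) :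
    psiN ψ (rootElement h z) = ψ ((-1) ^ n * z) := by
  have h1 : ∑ a : Fin n, ∑ b : Fin n, (if (b : ℕ) = a + 1 then (rootElement h z).1 a b else 0) =
      z := by
    have h2 : ∀ a b : Fin n, (if (b : ℕ) = a + 1 then (rootElement h z).1 a b else 0) =
        Matrix.single i j z a b := by
      intro a b
      change (if (b : ℕ) = a + 1 then (1 + Matrix.single i j z) a b else 0) = _
      split_ifs with hab
      · rw [Matrix.add_apply, Matrix.one_apply_ne (Fin.ne_of_val_ne (by omega)), zero_add]
      · rw [Matrix.single_apply, if_neg]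
        rintro ⟨rfl, rfl⟩
        exact hab h
    simp only [h2, Matrix.single_apply]
    rw [Finset.sum_eq_single i, Finset.sum_eq_single j] <;> simp +contextual [eq_comm]
  rw [psiN, h1]

theorem torus_mul_rootElement (t : Fin n → UnitGroup R) {i j : Fin n} (h : (j : ℕ) = i + 1) (z : R) :
    torus t * rootElement h z = rootElement h (t i * (((t j)⁻¹ : Rˣ) : R) * z) * torus t := by
  refine Units.ext ?_
  change Matrix.diagonal (fun i => (t i : R)) * (1 + Matrix.single i j z) =
    (1 + Matrix.single i j _) * Matrix.diagonal (fun i => (t i : R))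
  rw [mul_add, add_mul, mul_one, one_mul]
  congr 1
  ext a b
  rw [Matrix.diagonal_mul, Matrix.mul_diagonal, Matrix.single_apply, Matrix.single_apply]
  split_ifs with hab
  · obtain ⟨rfl, rfl⟩ := hab
    rw [mul_right_comm _ z, mul_assoc (t _ : R), Units.inv_mul, mul_one]
  · simp

end RootSubgroup

/-! ## Decay of Whittaker functions, non-Archimedean case -/

section DecayNA

theorem exists_norm_sub_one_lt_mem {R : Type*} [NormedCommRing R] [CompleteSpace R] {n : ℕ}
    (J : Subgroup (GLn n R)) (hJ : IsOpen (J : Set (GLn n R))) :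
    ∃ δ : ℝ, 0 < δ ∧ ∀ g : GLn n R, (∀ i j, ‖(g.1 - 1) i j‖ < δ) → g ∈ J := by
  have h1 : IsOpen ((fun g : GLn n R => g.1) '' (J : Set (GLn n R))) :=
    isOpenEmbedding_GL_val.isOpenMap _ hJ
  have h2 : IsOpen {a : Fin n → Fin n → R |
      Matrix.of a ∈ (fun g : GLn n R => g.1) '' (J : Set (GLn n R))} :=
    h1.preimage (f := fun a : Fin n → Fin n → R => Matrix.of a) continuous_id
  obtain ⟨δ, hδ, hb⟩ := Metric.isOpen_iff.1 h2 (fun i j => (1 : Matrix (Fin n) (Fin n) R) i j)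
    ⟨1, one_mem J, rfl⟩
  refine ⟨δ, hδ, fun g hg => ?_⟩
  have h3 : (fun i j => g.1 i j) ∈ Metric.ball
      (fun i j => (1 : Matrix (Fin n) (Fin n) R) i j) δ := by
    rw [Metric.mem_ball, dist_pi_lt_iff hδ]
    intro i
    rw [dist_pi_lt_iff hδ]
    intro j
    rw [dist_eq_norm]
    exact hg i j
  obtain ⟨g', hg', he⟩ := hb h3
  rwa [show g = g' from Units.ext he.symm]

variable {n : ℕ} {F : Type*} [NontriviallyNormedField F]
  {ι : Type*} [Fintype ι] {E : ι → Type*} [∀ w, NontriviallyNormedField (E w)]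
  [∀ w, ProperSpace (E w)] [∀ w, NormedAlgebra F (E w)]

theorem norm_conj_single_le {R : Type*} [NormedCommRing R] {a b : Matrix (Fin n) (Fin n) R}
    (ha : ∀ i j, ‖a i j‖ ≤ 1) (hb : ∀ i j, ‖b i j‖ ≤ 1) (i j : Fin n) (z : R) (p q : Fin n) :
    ‖(a * Matrix.single i j z * b) p q‖ ≤ ‖z‖ := by
  rw [Matrix.mul_apply, Finset.sum_eq_single j]
  · rw [Matrix.mul_single_apply_same]
    calc ‖a p i * z * b j q‖ ≤ ‖a p i‖ * ‖z‖ * ‖b j q‖ :=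
          (norm_mul_le _ _).trans (mul_le_mul_of_nonneg_right (norm_mul_le _ _) (norm_nonneg _))
      _ ≤ 1 * ‖z‖ * 1 := by
          have := ha p i
          have := hb j q
          gcongr
      _ = ‖z‖ := by ring
  · intro l _ hl
    rw [Matrix.mul_single_apply_of_ne (hbj := hl), zero_mul]
  · simp

/-- Whittaker functions that are invariant under an open subgroup vanish on the part of the torus
where a simple root is large. -/
theorem exists_rootNorm_le_of_ne_zero {K : Subgroup (GLn n ((w : ι) → E w))}
    (hK : ∀ k ∈ K, ∀ i j, ‖k.1 i j‖ ≤ 1) (J : Subgroup (GLn n ((w : ι) → E w)))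
    (hJ : IsOpen (J : Set (GLn n ((w : ι) → E w)))) {ψ : AddChar ((w : ι) → E w) Circle}
    (hψ : ψ ≠ 1) : ∃ c : ℝ, ∀ W ∈ equivariant ψ, (∀ j ∈ J, ∀ g, W (g * j) = W g) →
      ∀ (t : Fin n → Fˣ), ∀ k ∈ K, W (torus (baseTorus E t) * k) ≠ 0 → rootNorm t ≤ c := by
  obtain ⟨x₀, hx₀⟩ : ∃ x₀, ψ x₀ ≠ 1 := by
    by_contra! h
    exact hψ (DFunLike.ext _ _ h)
  obtain ⟨δ, hδ, hmem⟩ := exists_norm_sub_one_lt_mem J hJ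
  have hroot : ∀ W ∈ equivariant ψ, (∀ j ∈ J, ∀ g, W (g * j) = W g) → ∀ (t : Fin n → Fˣ),
      ∀ k ∈ K, W (torus (baseTorus E t) * k) ≠ 0 → ∀ i j : Fin n, (j : ℕ) = i + 1 →
        ‖(t i / t j : F)‖ ≤ ‖x₀‖ / δ := by
    intro W hW hWJ t k hk hne i j hij
    by_contra! hlt
    have ha0 : 0 < ‖(t i / t j : F)‖ := norm_pos_iff.2 (div_ne_zero (t i).ne_zero (t j).ne_zero)
    -- Chosen so that moving the root element with entry y from the right of t to its left produces
    -- the character value ψ(x₀) ≠ 1; the sign compensates the one in ψ_n. If |t_i / t_j| is large,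
    -- y is so small that the conjugate of the root element by k lies in J. Then W(tk) = ψ(x₀)
    -- W(tk), which forces W(tk) = 0.
    set y : (w : ι) → E w := (-1) ^ n * ((t j / t i : F) • x₀) with hy
    have hyn : ‖y‖ < δ := by
      have h1 : ‖y‖ = ‖(t i / t j : F)‖⁻¹ * ‖x₀‖ := by
        rw [← norm_inv, inv_div, ← norm_smul, hy]
        rcases neg_one_pow_eq_or ((w : ι) → E w) n with h | h <;> rw [h] <;> simp
      rw [h1, inv_mul_lt_iff₀ ha0, ← div_lt_iff₀ hδ]
      exact hlt
    have hj : k⁻¹ * rootElement hij y * k ∈ J := by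
      refine hmem _ fun p q => lt_of_le_of_lt ?_ hyn
      have h2 : (k⁻¹ * rootElement hij y * k).1 - 1 = (k⁻¹).1 * Matrix.single i j y * k.1 := by
        change (k⁻¹).1 * (1 + Matrix.single i j y) * k.1 - 1 = _
        rw [mul_add, add_mul, mul_one, ← Units.val_mul, inv_mul_cancel, Units.val_one,
          add_sub_cancel_left]
      rw [h2]
      exact norm_conj_single_le (hK _ (inv_mem hk)) (hK _ hk) i j y p q
    have h3 := hWJ _ hj (torus (baseTorus E t) * k)
    have h4 : torus (baseTorus E t) * k * (k⁻¹ * rootElement hij y * k) =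
        rootElement hij (baseTorus E t i * (((baseTorus E t j)⁻¹ : UnitGroup ((w : ι) → E w)) :
          (w : ι) → E w) * y) * (torus (baseTorus E t) * k) := by
      rw [← mul_assoc (rootElement hij _), ← torus_mul_rootElement]
      group
    have h5 : (-1) ^ n * ((baseTorus E t i : (w : ι) → E w) *
        (((baseTorus E t j)⁻¹ : UnitGroup ((w : ι) → E w)) : (w : ι) → E w) * y) = x₀ := by
      have h6 : (baseTorus E t i : (w : ι) → E w) *
          (((baseTorus E t j)⁻¹ : UnitGroup ((w : ι) → E w)) : (w : ι) → E w) =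
          algebraMap F ((w : ι) → E w) (t i * ((t j)⁻¹ : Fˣ)) := by rw [map_mul]; rfl
      have h7 : ((t i : F) * ((t j)⁻¹ : Fˣ)) * (t j / t i) = 1 := by
        rw [Units.val_inv_eq_inv_val]
        field_simp
      rw [h6, hy, mul_left_comm _ ((-1) ^ n), ← mul_assoc ((-1) ^ n), ← mul_pow, neg_one_mul,
        neg_neg, one_pow, one_mul, ← Algebra.smul_def, smul_smul, h7, one_smul]
    rw [h4, hW _ (rootElement_mem hij _), psiN_rootElement, h5] at h3
    refine hx₀ (Circle.ext ?_)
    rw [Circle.coe_one]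
    exact mul_right_cancel₀ hne (h3.trans (one_mul _).symm)
  refine ⟨∏ _i : Fin n, ∏ _j : Fin n, (1 + ‖x₀‖ / δ), fun W hW hWJ t k hk hne => ?_⟩
  have h0 : ∀ i j : Fin n, (0 : ℝ) ≤ if (j : ℕ) = i + 1 then 1 + ‖(t i / t j : F)‖ else 1 :=
    fun i j => zero_le_one.trans (one_le_rootNorm_factor t i j)
  refine Finset.prod_le_prod (fun i _ => Finset.prod_nonneg fun j _ => h0 i j) fun i _ =>
    Finset.prod_le_prod (fun j _ => h0 i j) fun j _ => ?_
  split_ifs with hij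
  · have := hroot W hW hWJ t k hk hne i j hij
    linarith
  · have : 0 ≤ ‖x₀‖ / δ := by positivity
    linarith

variable [∀ w, MeasureSpace (E w)] [∀ w, BorelSpace (E w)]
  [∀ w, (volume : Measure (E w)).IsAddHaarMeasure]

/-- On the support of W the root product is bounded by a constant depending only on J, so every
power of it is harmless and the single seminorm with d = 1 suffices. -/
theorem exists_decay_NA [MeasurableSpace (GLn n ((w : ι) → E w))]
    {K : Subgroup (GLn n ((w : ι) → E w))} (hK : ∀ k ∈ K, ∀ i j, ‖k.1 i j‖ ≤ 1) (κ : Measure K)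
    {ψ : AddChar ((w : ι) → E w) Circle} (hψ : ψ ≠ 1) (μ : Fin n → ℝ)
    (i : {J : Subgroup (GLn n ((w : ι) → E w)) //
      IsOpen (J : Set (GLn n ((w : ι) → E w))) ∧
      IsCompact (J : Set (GLn n ((w : ι) → E w)))} × {R : ℝ // 0 < R}) (N : ℕ) :
    ∃ (s : Finset {d : ℝ // 0 < d}) (C : ℝ), 0 ≤ C ∧ ∀ (W : stepNA κ ψ μ i) (t : Fin n → Fˣ),
      ∀ k ∈ K, rootNorm t ^ N * ‖W.1 (torus (baseTorus E t) * k)‖ ≤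
        (C * ∑ a ∈ s, seminormsNA κ ψ μ i a W) * Xi κ μ (torus (baseTorus E t)) := by
  obtain ⟨c, hc⟩ := exists_rootNorm_le_of_ne_zero (F := F) hK i.1.1 i.1.2.1 hψ
  obtain ⟨C, M, hC, hw⟩ := exists_weight_baseTorus_le F κ μ i.2.2.le
  refine ⟨{⟨1, one_pos⟩}, |c| ^ N * (C * |c| ^ M), by positivity, fun W t k hk => ?_⟩
  rw [Finset.sum_singleton]
  have hX := Xi_nonneg κ μ (torus (baseTorus E t))
  set P := seminormsNA κ ψ μ i ⟨1, one_pos⟩ W with hP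
  have hP0 : 0 ≤ P := apply_nonneg _ _
  by_cases hne : W.1 (torus (baseTorus E t) * k) = 0
  · rw [hne, norm_zero, mul_zero]
    positivity
  have h1 : rootNorm t ≤ |c| := (hc W.1 W.2.1.1 W.2.2 t k hk hne).trans (le_abs_self c)
  have h0 : 0 ≤ rootNorm t := zero_le_one.trans (one_le_rootNorm t)
  have h2 : ‖W.1 (torus (baseTorus E t) * k)‖ ≤ P * weight κ μ i.2 1 (baseTorus E t) :=
    norm_le_supSeminorm (restrictTK K ∘ₗ (stepNA κ ψ μ i).subtype) _ _ _ W
      (baseTorus E t, ⟨k, hk⟩)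
  calc rootNorm t ^ N * ‖W.1 (torus (baseTorus E t) * k)‖
      ≤ |c| ^ N * (P * (C * |c| ^ M * Xi κ μ (torus (baseTorus E t)))) := by
        refine mul_le_mul (pow_le_pow_left₀ h0 h1 N) (h2.trans ?_) (norm_nonneg _) (by positivity)
        refine mul_le_mul_of_nonneg_left ((hw t 1 zero_le_one).trans ?_) hP0
        gcongr
    _ = _ := by ring

theorem continuous_of_right_invariant {G : Type*} [Group G] [TopologicalSpace G]
    [IsTopologicalGroup G] {Y : Type*} [TopologicalSpace Y] (J : Subgroup G)
    (hJ : IsOpen (J : Set G)) {W : G → Y} (hW : ∀ j ∈ J, ∀ g, W (g * j) = W g) : Continuous W := by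
  refine (IsLocallyConstant.iff_exists_open W).2 (fun g => ?_) |>.continuous
  refine ⟨(fun x => g⁻¹ * x) ⁻¹' (J : Set G), hJ.preimage (continuous_const_mul _), ?_, fun x hx => ?_⟩
  · simp [one_mem]
  · have := hW _ hx g
    rwa [mul_inv_cancel_left] at this

end DecayNA

/-! ## Decay of Whittaker functions, Archimedean case -/

section DecayArch

theorem torus_mul_single {n : ℕ} {R : Type*} [CommRing R] (t : Fin n → UnitGroup R) (i j : Fin n)
    (z : R) : (torus t).1 * Matrix.single i j z =
      Matrix.single i j (t i * (((t j)⁻¹ : Rˣ) : R) * z) * (torus t).1 := by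
  change Matrix.diagonal (fun i => (t i : R)) * Matrix.single i j z =
    Matrix.single i j _ * Matrix.diagonal (fun i => (t i : R))
  ext a b
  rw [Matrix.diagonal_mul, Matrix.mul_diagonal, Matrix.single_apply, Matrix.single_apply]
  split_ifs with hab
  · obtain ⟨rfl, rfl⟩ := hab
    rw [mul_right_comm _ z, mul_assoc (t _ : R), Units.inv_mul, mul_one]
  · simp

/-- A differentiable character of `ℝ` with vanishing derivative is trivial. -/
theorem eq_one_of_deriv_eq_zero {χ : ℝ → ℂ} (h0 : χ 0 = 1) (hadd : ∀ s t, χ (s + t) = χ s * χ t)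
    (hd : DifferentiableAt ℝ χ 0) (hz : deriv χ 0 = 0) (s : ℝ) : χ s = 1 := by
  have h : ∀ s, HasDerivAt χ 0 s := by
    intro s
    have h1 : HasDerivAt χ 0 (s - s) := by
      rw [sub_self, ← hz]; exact hd.hasDerivAt
    have h2 := (h1.comp_sub_const s s).const_mul (χ s)
    rw [mul_zero] at h2
    refine h2.congr_of_eventuallyEq (Filter.Eventually.of_forall fun t => ?_)
    beta_reduce
    rw [← hadd, add_sub_cancel]
  rw [← h0]
  exact is_const_of_deriv_eq_zero (fun s => (h s).differentiableAt) (fun s => (h s).deriv) s 0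

variable {n : ℕ} {ι : Type*} [Fintype ι] {E : ι → Type*} [∀ w, RCLike (E w)]

theorem extend_val (f : GLn n ((w : ι) → E w) → ℂ) (g : GLn n ((w : ι) → E w)) :
    extend f g.1 = f g := by
  rw [extend, dif_pos g.isUnit]
  congr 1
  exact Units.ext rfl

theorem continuous_of_mem_smoothFunctions {f : GLn n ((w : ι) → E w) → ℂ}
    (hf : f ∈ smoothFunctions n E) : Continuous f := by
  have h1 : ContinuousOn (fun a : Fin n → Fin n → ((w : ι) → E w) => extend f (Matrix.of a))
      {a | IsUnit (Matrix.of a)} := ContDiffOn.continuousOn hf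
  have h2 : Continuous fun g : GLn n ((w : ι) → E w) => fun i j => g.1 i j :=
    continuous_pi fun i => continuous_pi fun j =>
      (continuous_matrix_entry i j).comp Units.continuous_val
  refine (h1.comp_continuous h2 fun g => g.isUnit).congr fun g => extend_val f g

theorem extend_mul {ψ : AddChar ((w : ι) → E w) Circle} {f : GLn n ((w : ι) → E w) → ℂ}
    (hf : f ∈ equivariant ψ) {u : GLn n ((w : ι) → E w)} (hu : u ∈ unip n ((w : ι) → E w))
    (A : Matrix (Fin n) (Fin n) ((w : ι) → E w)) : extend f (u.1 * A) = psiN ψ u * extend f A := by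
  by_cases hA : IsUnit A
  · obtain ⟨g, rfl⟩ := hA
    rw [← Units.val_mul, extend_val, extend_val, hf u hu]
  · have h : ¬ IsUnit (u.1 * A) := fun h => hA ((Units.isUnit_units_mul u A).1 h)
    rw [extend, dif_neg h, extend, dif_neg hA, mul_zero]

/-- Right derivatives commute with left translations. -/
theorem rightDeriv_equivariant {ψ : AddChar ((w : ι) → E w) Circle}
    {f : GLn n ((w : ι) → E w) → ℂ} (hf : f ∈ equivariant ψ)
    (X : Matrix (Fin n) (Fin n) ((w : ι) → E w)) : rightDeriv X f ∈ equivariant ψ := by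
  intro u hu g
  change deriv (fun s : ℝ => extend f ((u * g).1 + s • ((u * g).1 * X))) 0 =
    psiN ψ u * deriv (fun s : ℝ => extend f (g.1 + s • (g.1 * X))) 0
  rw [← deriv_const_mul_field]
  congr 1
  funext s
  rw [← extend_mul hf hu, Units.val_mul, mul_add, mul_assoc, Matrix.mul_smul]

theorem iterDeriv_equivariant {ψ : AddChar ((w : ι) → E w) Circle} (f : smoothFunctions n E)
    (hf : f.1 ∈ equivariant ψ) (L : List (Matrix (Fin n) (Fin n) ((w : ι) → E w))) :
    (iterDeriv L f).1 ∈ equivariant ψ := by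
  induction L with
  | nil => exact hf
  | cons X L ih => exact rightDeriv_equivariant ih X

theorem rightDeriv_eq_sum {m : Type*} [Fintype m]
    (b : Module.Basis m ℝ (Matrix (Fin n) (Fin n) ((w : ι) → E w)))
    {f : GLn n ((w : ι) → E w) → ℂ} (hf : f ∈ smoothFunctions n E)
    (X : Matrix (Fin n) (Fin n) ((w : ι) → E w)) (g : GLn n ((w : ι) → E w)) :
    rightDeriv X f g = ∑ l, b.repr X l • rightDeriv (b l) f g := by
  let M : Matrix (Fin n) (Fin n) ((w : ι) → E w) →ₗ[ℝ] (Fin n → Fin n → ((w : ι) → E w)) :=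
    { toFun := fun X i j => (g.1 * X) i j
      map_add' := fun X Y => by funext i j; rw [mul_add]; rfl
      map_smul' := fun c X => by funext i j; rw [Matrix.mul_smul]; rfl }
  let D : Matrix (Fin n) (Fin n) ((w : ι) → E w) →ₗ[ℝ] ℂ :=
    (fderiv ℝ (fun a : Fin n → Fin n → ((w : ι) → E w) => extend f (Matrix.of a))
      (fun i j => g.1 i j)).toLinearMap ∘ₗ M
  have h : ∀ X, rightDeriv X f g = D X := fun X => (rightDeriv_eq hf X g).2
  rw [h, ← b.sum_repr X, map_sum]
  simp only [map_smul, h, b.sum_repr]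

variable {F : Type*} [RCLike F] [∀ w, NormedAlgebra F (E w)]

/-- The derivative of a Whittaker function along a root subgroup at a point of the torus. -/
theorem exists_norm_root_mul_le (ψ : AddChar ((w : ι) → E w) Circle) (hψ : ψ ≠ 1) :
    ∃ c B : ℝ, 0 ≤ c ∧ ∀ (t : Fin n → Fˣ) (i j : Fin n), (j : ℕ) = i + 1 →
      ∃ y : (w : ι) → E w, ‖y‖ ≤ B ∧ ∀ f ∈ smoothFunctions n E, f ∈ equivariant ψ →
        ∀ k : GLn n ((w : ι) → E w), ‖(t i / t j : F)‖ * ‖f (torus (baseTorus E t) * k)‖ ≤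
          c * ‖rightDeriv ((k⁻¹).1 * Matrix.single i j y * k.1) f (torus (baseTorus E t) * k)‖ := by
  obtain ⟨x₀, hx₀⟩ : ∃ x₀, ψ x₀ ≠ 1 := by
    by_contra! h
    exact hψ (DFunLike.ext _ _ h)
  let χ : ℝ → ℂ := fun s => (ψ (s • x₀) : ℂ)
  have hχ0 : χ 0 = 1 := by simp [χ]
  have hχadd : ∀ s t, χ (s + t) = χ s * χ t := fun s t => by
    simp only [χ, add_smul, AddChar.map_add_eq_mul, Circle.coe_mul]
  refine ⟨‖deriv χ 0‖⁻¹, ‖x₀‖, by positivity, fun t i j hij => ?_⟩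
  set r := ‖(t i / t j : F)‖ with hr
  have hr0 : 0 < r := norm_pos_iff.2 (div_ne_zero (t i).ne_zero (t j).ne_zero)
  -- The phase of t_i / t_j is removed, so y has the norm of x₀ while the conjugated entry is the
  -- real multiple r x₀ up to sign. Along the corresponding curve through t k the function is χ(r s)
  -- f(t k), whose derivative at 0 carries the factor r.
  set y : (w : ι) → E w := (-1) ^ n * (r • ((t j / t i : F) • x₀)) with hy
  refine ⟨y, ?_, fun f hf hfe k => ?_⟩
  · have h1 : ‖y‖ = r * (r⁻¹ * ‖x₀‖) := by
      rw [hr, ← norm_inv, inv_div, ← norm_smul (t j / t i : F), ← hr, hy]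
      rcases neg_one_pow_eq_or ((w : ι) → E w) n with h | h <;> rw [h] <;>
        simp [norm_smul, abs_of_pos hr0]
    rw [h1, mul_inv_cancel_left₀ hr0.ne']
  · set T := torus (baseTorus E t) with hT
    set X := (k⁻¹).1 * Matrix.single i j y * k.1 with hX
    set z := (baseTorus E t i : (w : ι) → E w) *
      (((baseTorus E t j)⁻¹ : UnitGroup ((w : ι) → E w)) : (w : ι) → E w) * y with hz
    have hgX : (T * k).1 * X = Matrix.single i j z * (T * k).1 := by
      rw [hX, Units.val_mul, mul_assoc, ← mul_assoc k.1, ← mul_assoc k.1, ← Units.val_mul,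
        mul_inv_cancel, Units.val_one, one_mul, ← mul_assoc, hT, torus_mul_single, mul_assoc]
    have hzx : ∀ s : ℝ, (-1) ^ n * (s • z) = (r * s) • x₀ := by
      intro s
      have h6 : (baseTorus E t i : (w : ι) → E w) *
          (((baseTorus E t j)⁻¹ : UnitGroup ((w : ι) → E w)) : (w : ι) → E w) =
          algebraMap F ((w : ι) → E w) (t i * ((t j)⁻¹ : Fˣ)) := by rw [map_mul]; rfl
      have h7 : ((t i : F) * ((t j)⁻¹ : Fˣ)) * (t j / t i) = 1 := by
        rw [Units.val_inv_eq_inv_val]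
        field_simp
      have h8 : (-1) ^ n * z = r • x₀ := by
        rw [hz, h6, hy, mul_left_comm _ ((-1) ^ n), ← mul_assoc ((-1) ^ n), ← mul_pow, neg_one_mul,
          neg_neg, one_pow, one_mul, mul_smul_comm, ← Algebra.smul_def, smul_smul, h7, one_smul]
      rw [mul_smul_comm, h8, smul_smul, mul_comm]
    have hcurve : ∀ s : ℝ, extend f ((T * k).1 + s • ((T * k).1 * X)) =
        χ (r * s) * f (T * k) := by
      intro s
      have h1 : (T * k).1 + s • ((T * k).1 * X) = (rootElement hij (s • z) * (T * k)).1 := by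
        rw [hgX, Units.val_mul (rootElement hij (s • z))]
        change _ = (1 + Matrix.single i j (s • z)) * _
        rw [add_mul, one_mul, ← Matrix.smul_single, Matrix.smul_mul]
      rw [h1, extend_val, hfe _ (rootElement_mem hij _), psiN_rootElement, hzx]
    have hd : DifferentiableAt ℝ (fun s : ℝ => χ (r * s) * f (T * k)) 0 := by
      have h1 := (rightDeriv_eq hf X (T * k)).1
      have h2 : DifferentiableAt ℝ (fun s : ℝ => extend f ((T * k).1 + s • ((T * k).1 * X))) 0 := h1
      rwa [funext hcurve] at h2
    have hval : rightDeriv X f (T * k) = deriv (fun s : ℝ => χ (r * s) * f (T * k)) 0 := by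
      change deriv (fun s : ℝ => extend f ((T * k).1 + s • ((T * k).1 * X))) 0 = _
      rw [funext hcurve]
    by_cases hne : f (T * k) = 0
    · rw [hne, norm_zero, mul_zero]
      positivity
    -- The smoothness of χ is read off from that of f, at a point where f does not vanish.
    have hd1 : DifferentiableAt ℝ χ 0 := by
      have h1 : χ = fun s => (fun s : ℝ => χ (r * s) * f (T * k)) (r⁻¹ * s) * (f (T * k))⁻¹ := by
        funext s
        beta_reduce
        rw [mul_inv_cancel_left₀ hr0.ne', mul_inv_cancel_right₀ hne]
      rw [h1]
      refine DifferentiableAt.mul_const ?_ _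
      refine DifferentiableAt.comp (0 : ℝ) (g := fun s : ℝ => χ (r * s) * f (T * k))
        (f := fun s : ℝ => r⁻¹ * s) ?_ (by fun_prop)
      rw [mul_zero]
      exact hd
    -- A vanishing derivative would make χ constant, against χ(1) = ψ(x₀) ≠ 1.
    have hc : deriv χ 0 ≠ 0 := by
      intro h0
      refine hx₀ (Circle.ext ?_)
      have := eq_one_of_deriv_eq_zero hχ0 hχadd hd1 h0 1
      simpa [χ] using this
    have hder : HasDerivAt (fun s : ℝ => χ (r * s) * f (T * k)) (r • deriv χ 0 * f (T * k)) 0 := by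
      have h1 : HasDerivAt χ (deriv χ 0) (r * 0) := by rw [mul_zero]; exact hd1.hasDerivAt
      have h2 : HasDerivAt (fun s : ℝ => r * s) r 0 := by
        simpa using (hasDerivAt_id (0 : ℝ)).const_mul r
      exact (h1.scomp (0 : ℝ) h2).mul_const _
    rw [hval, hder.deriv, norm_mul, norm_smul, Real.norm_of_nonneg hr0.le]
    refine le_of_eq ?_
    have := norm_ne_zero_iff.2 hc
    field_simp

theorem exists_norm_repr_le {m : Type*} [Fintype m]
    (b : Module.Basis m ℝ (Matrix (Fin n) (Fin n) ((w : ι) → E w))) (B : ℝ) :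
    ∃ C : ℝ, 0 ≤ C ∧ ∀ X : Matrix (Fin n) (Fin n) ((w : ι) → E w), (∀ i j, ‖X i j‖ ≤ B) →
      ∀ l, ‖b.repr X l‖ ≤ C := by
  have h : ∀ l, ∃ C : ℝ, ∀ X ∈ {X : Matrix (Fin n) (Fin n) ((w : ι) → E w) | ∀ i j, ‖X i j‖ ≤ B},
      ‖b.coord l X‖ ≤ C := fun l =>
    (isCompact_entry_le (R := (w : ι) → E w) (n := n) B).exists_bound_of_continuousOn
      (LinearMap.continuous_of_finiteDimensional (b.coord l)).continuousOn
  choose C hC using h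
  refine ⟨∑ l, |C l|, Finset.sum_nonneg fun l _ => abs_nonneg _, fun X hX l => ?_⟩
  exact (hC l X hX).trans ((le_abs_self _).trans
    (Finset.single_le_sum (f := fun l => |C l|) (fun l _ => abs_nonneg _) (Finset.mem_univ l)))

variable (E) in
/-- The functions `g` on the torus such that `g(t) |f(t k)|` is bounded by finitely many derivatives
of `f` at `t k`, for all Whittaker functions `f`. -/
def DerivControlled (ψ : AddChar ((w : ι) → E w) Circle) (K : Subgroup (GLn n ((w : ι) → E w)))
    (g : (Fin n → Fˣ) → ℝ) : Prop :=
  (∀ t, 0 ≤ g t) ∧ ∃ (S : Finset (List (Matrix (Fin n) (Fin n) ((w : ι) → E w)))) (C : ℝ), 0 ≤ C ∧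
    ∀ f : smoothFunctions n E, f.1 ∈ equivariant ψ → ∀ t, ∀ k ∈ K,
      g t * ‖f.1 (torus (baseTorus E t) * k)‖ ≤
        C * ∑ L ∈ S, ‖(iterDeriv L f).1 (torus (baseTorus E t) * k)‖

variable {ψ : AddChar ((w : ι) → E w) Circle} {K : Subgroup (GLn n ((w : ι) → E w))}

theorem DerivControlled.one : DerivControlled (F := F) E ψ K 1 := by
  refine ⟨fun _ => zero_le_one, {[]}, 1, zero_le_one, fun f _ t k _ => ?_⟩
  rw [Finset.sum_singleton]
  exact le_rfl

/-- Derivatives of an equivariant function are again equivariant, so the bound for g' applies to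
each derivative occurring in the bound for g; the words of derivations are concatenated. -/
theorem DerivControlled.mul {g g' : (Fin n → Fˣ) → ℝ} (hg : DerivControlled E ψ K g)
    (hg' : DerivControlled E ψ K g') : DerivControlled E ψ K (g * g') := by
  classical
  obtain ⟨hg0, S, C, hC, h⟩ := hg
  obtain ⟨hg0', S', C', hC', h'⟩ := hg'
  refine ⟨fun t => mul_nonneg (hg0 t) (hg0' t), Finset.image₂ (fun L' L => L' ++ L) S' S,
    C * (C' * (S.card * S'.card)), by positivity, fun f hf t k hk => ?_⟩
  set x := torus (baseTorus E t) * k with hx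
  set Q := ∑ L ∈ Finset.image₂ (fun L' L => L' ++ L) S' S, ‖(iterDeriv L f).1 x‖ with hQ
  have h2 : ∀ L ∈ S, g' t * ‖(iterDeriv L f).1 x‖ ≤ C' * (S'.card * Q) := by
    intro L hL
    refine (h' (iterDeriv L f) (iterDeriv_equivariant f hf L) t k hk).trans
      (mul_le_mul_of_nonneg_left ?_ hC')
    rw [← nsmul_eq_mul]
    refine Finset.sum_le_card_nsmul _ _ _ fun L' hL' => ?_
    have h3 : iterDeriv L' (iterDeriv L f) = iterDeriv (L' ++ L) f := by
      simp only [iterDeriv, List.map_append, List.prod_append, Module.End.mul_apply]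
    rw [h3]
    exact Finset.single_le_sum (f := fun L => ‖(iterDeriv L f).1 x‖) (fun _ _ => norm_nonneg _)
      (Finset.mem_image₂_of_mem hL' hL)
  calc (g * g') t * ‖f.1 x‖ = g' t * (g t * ‖f.1 x‖) := by rw [Pi.mul_apply]; ring
    _ ≤ g' t * (C * ∑ L ∈ S, ‖(iterDeriv L f).1 x‖) :=
        mul_le_mul_of_nonneg_left (h f hf t k hk) (hg0' t)
    _ = C * ∑ L ∈ S, g' t * ‖(iterDeriv L f).1 x‖ := by rw [← Finset.mul_sum]; ring
    _ ≤ C * (S.card • (C' * (S'.card * Q))) :=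
        mul_le_mul_of_nonneg_left (Finset.sum_le_card_nsmul _ _ _ h2) hC
    _ = _ := by rw [nsmul_eq_mul]; ring

/-- The direction of differentiation k⁻¹ E k varies with t and k but stays in a bounded set.
Expanded in a fixed real basis of the matrices it has bounded coefficients, so finitely many fixed
derivations are enough. -/
theorem DerivControlled.root (hK : ∀ k ∈ K, ∀ i j, ‖k.1 i j‖ ≤ 1) (hψ : ψ ≠ 1) {i j : Fin n}
    (hij : (j : ℕ) = i + 1) :
    DerivControlled E ψ K fun t : Fin n → Fˣ => 1 + ‖(t i / t j : F)‖ := by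
  classical
  obtain ⟨c, B, hc, hy⟩ := exists_norm_root_mul_le (n := n) (F := F) ψ hψ
  let b := Module.finBasis ℝ (Matrix (Fin n) (Fin n) ((w : ι) → E w))
  obtain ⟨C, hC, hb⟩ := exists_norm_repr_le b B
  refine ⟨fun t => add_nonneg zero_le_one (norm_nonneg _),
    {[]} ∪ Finset.univ.image fun l => [b l], 1 + c * C * Fintype.card (Fin (Module.finrank ℝ
      (Matrix (Fin n) (Fin n) ((w : ι) → E w)))), by positivity, fun f hf t k hk => ?_⟩
  set x := torus (baseTorus E t) * k with hx
  set Q := ∑ L ∈ {[]} ∪ Finset.univ.image fun l => [b l], ‖(iterDeriv L f).1 x‖ with hQ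
  have hle : ∀ L ∈ ({[]} ∪ Finset.univ.image fun l => [b l] :
      Finset (List (Matrix (Fin n) (Fin n) ((w : ι) → E w)))), ‖(iterDeriv L f).1 x‖ ≤ Q :=
    fun L hL => Finset.single_le_sum (f := fun L => ‖(iterDeriv L f).1 x‖)
      (fun _ _ => norm_nonneg _) hL
  have h0 : ‖f.1 x‖ ≤ Q := hle [] (by simp)
  have h1 : ∀ l, ‖rightDeriv (b l) f.1 x‖ ≤ Q := fun l => hle [b l] (by simp)
  obtain ⟨y, hyB, hy⟩ := hy t i j hij
  have h2 : ‖(t i / t j : F)‖ * ‖f.1 x‖ ≤ c * (C * (Fintype.card (Fin (Module.finrank ℝ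
      (Matrix (Fin n) (Fin n) ((w : ι) → E w)))) * Q)) := by
    refine (hy f.1 f.2 hf k).trans (mul_le_mul_of_nonneg_left ?_ hc)
    rw [rightDeriv_eq_sum b f.2]
    refine (norm_sum_le _ _).trans ?_
    calc ∑ l, ‖b.repr ((k⁻¹).1 * Matrix.single i j y * k.1) l • rightDeriv (b l) f.1 x‖
        ≤ ∑ _l : Fin (Module.finrank ℝ (Matrix (Fin n) (Fin n) ((w : ι) → E w))), C * Q := by
          refine Finset.sum_le_sum fun l _ => ?_
          rw [norm_smul]
          refine mul_le_mul (hb _ (fun p q => ?_) l) (h1 l) (norm_nonneg _) hC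
          exact (norm_conj_single_le (hK _ (inv_mem hk)) (hK _ hk) i j y p q).trans hyB
      _ = _ := by rw [Finset.sum_const, Finset.card_univ, nsmul_eq_mul]; ring
  rw [add_mul, one_mul, add_mul, one_mul]
  refine add_le_add h0 (h2.trans (le_of_eq ?_))
  ring

theorem DerivControlled.rootNorm_pow (hK : ∀ k ∈ K, ∀ i j, ‖k.1 i j‖ ≤ 1) (hψ : ψ ≠ 1) (N : ℕ) :
    DerivControlled (F := F) E ψ K fun t => rootNorm t ^ N := by
  have hprod : ∀ (s : Finset (Fin n)) (G : Fin n → (Fin n → Fˣ) → ℝ),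
      (∀ i, DerivControlled E ψ K (G i)) → DerivControlled E ψ K (∏ i ∈ s, G i) := fun s G hG =>
    Finset.prod_induction _ _ (fun _ _ h h' => h.mul h') DerivControlled.one fun i _ => hG i
  have h1 : DerivControlled (F := F) E ψ K rootNorm := by
    have he : (rootNorm : (Fin n → Fˣ) → ℝ) = ∏ i : Fin n, ∏ j : Fin n,
        fun t : Fin n → Fˣ => if (j : ℕ) = i + 1 then 1 + ‖(t i / t j : F)‖ else 1 := by
      funext t
      simp only [rootNorm, Finset.prod_apply]
    rw [he]
    refine hprod _ _ fun i => hprod _ _ fun j => ?_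
    by_cases hij : (j : ℕ) = i + 1
    · simp only [if_pos hij]
      exact DerivControlled.root hK hψ hij
    · simp only [if_neg hij]
      exact DerivControlled.one
  induction N with
  | zero =>
    simp only [pow_zero]
    exact DerivControlled.one
  | succ N ih =>
    simp only [pow_succ]
    exact ih.mul h1

variable [∀ w, MeasureSpace (E w)] [∀ w, BorelSpace (E w)]
  [∀ w, (volume : Measure (E w)).IsAddHaarMeasure]

/-- N + M powers of the root product are gained by differentiation; M of them are spent on the root
factor in the growth condition satisfied by the derivatives. -/
theorem exists_decay_Arch [MeasurableSpace (GLn n ((w : ι) → E w))]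
    {K : Subgroup (GLn n ((w : ι) → E w))} (hK : ∀ k ∈ K, ∀ i j, ‖k.1 i j‖ ≤ 1) (κ : Measure K)
    {ψ : AddChar ((w : ι) → E w) Circle} (hψ : ψ ≠ 1) (μ : Fin n → ℝ) (R : {R : ℝ // 0 < R})
    (N : ℕ) :
    ∃ (s : Finset (List (Matrix (Fin n) (Fin n) ((w : ι) → E w)) × {d : ℝ // 0 < d})) (C : ℝ),
      0 ≤ C ∧ ∀ (W : stepArch κ ψ μ R) (t : Fin n → Fˣ), ∀ k ∈ K,
        rootNorm t ^ N * ‖W.1.1 (torus (baseTorus E t) * k)‖ ≤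
          (C * ∑ a ∈ s, seminormsArch κ ψ μ R a W) * Xi κ μ (torus (baseTorus E t)) := by
  obtain ⟨C, M, hC, hw⟩ := exists_weight_baseTorus_le F κ μ R.2.le
  obtain ⟨-, S, C', hC', hS⟩ := DerivControlled.rootNorm_pow (F := F) hK hψ (N + M)
  refine ⟨S.map ⟨fun L => (L, ⟨1, one_pos⟩), fun _ _ h => (Prod.mk.inj h).1⟩, C' * C,
    by positivity, fun W t k hk => ?_⟩
  rw [Finset.sum_map]
  set x := torus (baseTorus E t) * k with hx
  set X := Xi κ μ (torus (baseTorus E t)) with hXdef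
  have hr : 0 < rootNorm t ^ M := pow_pos (one_pos.trans_le (one_le_rootNorm t)) M
  have h1 := hS W.1 W.2.1 t k hk
  have h2 : ∀ L ∈ S, ‖(iterDeriv L W.1).1 x‖ ≤
      seminormsArch κ ψ μ R (L, ⟨1, one_pos⟩) W * (C * rootNorm t ^ M * X) := by
    intro L _
    have h3 : ‖(iterDeriv L W.1).1 x‖ ≤
        seminormsArch κ ψ μ R (L, ⟨1, one_pos⟩) W * weight κ μ R 1 (baseTorus E t) :=
      norm_le_supSeminorm (restrictTK K ∘ₗ (smoothFunctions n E).subtype ∘ₗ iterDeriv L ∘ₗ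
        (stepArch κ ψ μ R).subtype) _ _ _ W (baseTorus E t, ⟨k, hk⟩)
    exact h3.trans (mul_le_mul_of_nonneg_left (hw t 1 zero_le_one) (apply_nonneg _ _))
  refine le_of_mul_le_mul_left ?_ hr
  calc rootNorm t ^ M * (rootNorm t ^ N * ‖W.1.1 x‖) = rootNorm t ^ (N + M) * ‖W.1.1 x‖ := by
        rw [pow_add]; ring
    _ ≤ C' * ∑ L ∈ S, ‖(iterDeriv L W.1).1 x‖ := h1
    _ ≤ C' * ∑ L ∈ S, seminormsArch κ ψ μ R (L, ⟨1, one_pos⟩) W * (C * rootNorm t ^ M * X) :=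
        mul_le_mul_of_nonneg_left (Finset.sum_le_sum h2) hC'
    _ = _ := by
        rw [← Finset.sum_mul]
        change C' * ((∑ L ∈ S, seminormsArch κ ψ μ R (L, ⟨1, one_pos⟩) W) * _) = rootNorm t ^ M *
          (C' * C * (∑ L ∈ S, seminormsArch κ ψ μ R (L, ⟨1, one_pos⟩) W) * X)
        ring

end DecayArch

/-! ## Zeta integrals of rapidly decaying Whittaker functions -/

section HaarMeasureSpace

variable (k : Type*) [NormedField k] [ProperSpace k]

/-- The Borel measurable structure and an additive Haar measure on a local field. -/
abbrev haarMeasureSpace : MeasureSpace k :=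
  @MeasureSpace.mk k (borel k) (@Measure.addHaar k _ _ _ (borel k) (@BorelSpace.mk k _ (borel k) rfl) _)

theorem borelSpace_haarMeasureSpace : @BorelSpace k _ (haarMeasureSpace k).toMeasurableSpace :=
  @BorelSpace.mk k _ (borel k) rfl

theorem isAddHaarMeasure_haarMeasureSpace :
    @Measure.IsAddHaarMeasure k _ _ (haarMeasureSpace k).toMeasurableSpace
      (haarMeasureSpace k).volume := by
  let _ : MeasurableSpace k := borel k
  have : BorelSpace k := ⟨rfl⟩
  exact inferInstanceAs (Measure.addHaar : Measure k).IsAddHaarMeasure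

end HaarMeasureSpace

section Decay

variable {n : ℕ} {F : Type*} [NontriviallyNormedField F] [ProperSpace F]
  {ι : Type*} [Fintype ι] {E : ι → Type*} [∀ w, NontriviallyNormedField (E w)]
  [∀ w, ProperSpace (E w)] [∀ w, NormedAlgebra F (E w)] [∀ w, FiniteDimensional F (E w)]
  {I A V : Type*} [Nonempty A] [AddCommGroup V] [Module ℂ V]

/-- The form common to both cases: the two kinds of local fields differ only in the maximal compact
groups, the shape of the steps and the proof of decay. The exponent r of the estimates is taken to
be min μ. -/
theorem zeta_properties_of_decay (hn : 1 ≤ n) (hE : ∑ w, Module.finrank F (E w) = 2)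
    {KF : ∀ n, Subgroup (GLn n F)} (hKF : IwasawaFamily KF)
    {KE : ∀ n, Subgroup (GLn n ((w : ι) → E w))} (hKE : IwasawaFamily (R := (w : ι) → E w) KE)
    (hmap : ∀ k ∈ KF n, Matrix.GeneralLinearGroup.map (algebraMap F ((w : ι) → E w)) k ∈ KE n)
    {ψ : AddChar ((w : ι) → E w) Circle} (hψF : ∀ x : F, ψ (algebraMap F ((w : ι) → E w) x) = 1)
    [MeasurableSpace (GLn n F)] [BorelSpace (GLn n F)] (lG : Measure (GLn n F)) [lG.IsHaarMeasure]
    (lN : Measure (unip n F)) [lN.IsHaarMeasure] (ν : Measure (UnipQuotient n F))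
    (hν : IsQuotientMeasure lG lN ν)
    [MeasurableSpace (GLn n ((w : ι) → E w))] [BorelSpace (GLn n ((w : ι) → E w))]
    (κ : Measure (KE n)) [κ.IsMulLeftInvariant] [IsProbabilityMeasure κ] (μ : Fin n → ℝ)
    (step : I → Submodule ℂ V) (p : (i : I) → SeminormFamily ℂ (step i) A)
    (e : V →ₗ[ℂ] (GLn n ((w : ι) → E w) → ℂ))
    (he : ∀ i, ∀ W ∈ step i, e W ∈ equivariant ψ ∧ Continuous (e W))
    (hdecay : ∀ i (N : ℕ), ∃ (s : Finset A) (C : ℝ), 0 ≤ C ∧ ∀ (W : step i) (t : Fin n → Fˣ),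
      ∀ k ∈ KE n, rootNorm t ^ N * ‖e W (torus (baseTorus E t) * k)‖ ≤
        (C * ∑ a ∈ s, p i a W) * Xi κ μ (torus (baseTorus E t)))
    (φ : (Fin n → F) → ℂ) (hφc : Continuous φ)
    (hφ : ∀ M : ℕ, ∃ C : ℝ, 0 ≤ C ∧ ∀ v, (1 + ‖v‖) ^ M * ‖φ v‖ ≤ C) :
    (∀ W ∈ (⨆ i, step i), ∀ s : ℂ, -2 * (⨅ i, μ i) < s.re →
      Integrable (zetaIntegrand (e W) φ s) ν) ∧
    (∀ W ∈ (⨆ i, step i),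
      DifferentiableOn ℂ (zeta ν (e W) φ) {s : ℂ | -2 * (⨅ i, μ i) < s.re}) ∧
    (∀ W ∈ (⨆ i, step i), ∀ a b : ℝ, -2 * (⨅ i, μ i) < a → a < b →
      ∃ M : ℝ, ∀ s : ℂ, a ≤ s.re → s.re ≤ b → ‖zeta ν (e W) φ s‖ ≤ M) ∧
    (∀ a b : ℝ, -2 * (⨅ i, μ i) < a → a < b → ∃ q : Seminorm ℂ ↥(⨆ i, step i),
      Continuous[limTopology step p, inferInstance] q ∧
        ∀ (W : ↥(⨆ i, step i)) (s : ℂ), a ≤ s.re → s.re ≤ b → ‖zeta ν (e W) φ s‖ ≤ q W) := by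
  let _ : MeasureSpace F := haarMeasureSpace F
  have : BorelSpace F := borelSpace_haarMeasureSpace F
  have : (volume : Measure F).IsAddHaarMeasure := isAddHaarMeasure_haarMeasureSpace F
  let _ : ∀ w, MeasureSpace (E w) := fun w => haarMeasureSpace (E w)
  have : ∀ w, BorelSpace (E w) := fun w => borelSpace_haarMeasureSpace (E w)
  have : ∀ w, (volume : Measure (E w)).IsAddHaarMeasure := fun w =>
    isAddHaarMeasure_haarMeasureSpace (E w)
  refine zeta_properties ν measurable_quotientDet (fun x => nabs_pos ?_) step p e φ _
    (fun i W hW => (measurable_zetaBase hψF (he i W hW).1 (he i W hW).2 hφc).aestronglyMeasurable)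
    fun i σ hσ => ?_
  · exact (Matrix.isUnit_iff_isUnit_det _).1 x.out.isUnit
  · obtain ⟨N, C, hC, h⟩ := exists_lintegral_zetaBase_le hn hE hKF hKE hmap lG lN ν hν κ μ
      (fun i => ciInf_le (Set.finite_range μ).bddBelow i) hσ ψ φ hφ
    obtain ⟨s, C', hC', hd⟩ := hdecay i N
    refine ⟨s, C * C', mul_nonneg hC hC', fun W => ?_⟩
    have h0 : 0 ≤ C' * ∑ a ∈ s, p i a W :=
      mul_nonneg hC' (Finset.sum_nonneg fun a _ => apply_nonneg _ _)
    rw [mul_assoc]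
    exact h (e W) (he i W W.2).1 _ h0 (hd W)

end Decay

theorem exists_bound_of_hasCompactSupport {X : Type*} [NormedAddCommGroup X] {φ : X → ℂ}
    (hφ : Continuous φ) (hs : HasCompactSupport φ) (M : ℕ) :
    ∃ C : ℝ, 0 ≤ C ∧ ∀ v, (1 + ‖v‖) ^ M * ‖φ v‖ ≤ C := by
  have h1 : Continuous fun v => (((1 + ‖v‖) ^ M : ℝ) : ℂ) * φ v := by fun_prop
  obtain ⟨C, hC⟩ := (hs.mul_left (f := fun v => (((1 + ‖v‖) ^ M : ℝ) : ℂ))).exists_bound_of_continuous h1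
  refine ⟨max C 0, le_max_right _ _, fun v => le_max_of_le_left ?_⟩
  have := hC v
  rwa [Pi.mul_apply, norm_mul, Complex.norm_real, Real.norm_of_nonneg (by positivity)] at this

theorem exists_bound_schwartz {X : Type*} [NormedAddCommGroup X] [NormedSpace ℝ X]
    (φ : SchwartzMap X ℂ) (M : ℕ) : ∃ C : ℝ, 0 ≤ C ∧ ∀ v, (1 + ‖v‖) ^ M * ‖φ v‖ ≤ C := by
  have h := fun v => SchwartzMap.one_add_le_sup_seminorm_apply (𝕜 := ℝ) (m := (M, 0)) (k := M)
    (n := 0) le_rfl le_rfl φ v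
  simp only [norm_iteratedFDeriv_zero] at h
  exact ⟨_, le_trans (by positivity) (h 0), h⟩

end AsaiZeta

end

/-! ### The theorem in the p-adic and the Archimedean case -/

theorem lemma3p3p1 (n : ℕ) (hn : 1 ≤ n) (μ : Fin n → ℝ) :
    -- The non-Archimedean case.
    (∀ (F : Type*) [NontriviallyNormedField F] [IsUltrametricDist F] [LocallyCompactSpace F]
      [CharZero F]
      -- `E = ∏ w, E w` is a quadratic étale algebra over `F`: a quadratic extension or `F × F`.
      (ι : Type*) [Fintype ι] (E : ι → Type*) [∀ w, NontriviallyNormedField (E w)]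
      [∀ w, IsUltrametricDist (E w)] [∀ w, LocallyCompactSpace (E w)]
      [∀ w, NormedAlgebra F (E w)] [∀ w, FiniteDimensional F (E w)]
      (_ : ∑ w, Module.finrank F (E w) = 2)
      (ψ : AddChar ((w : ι) → E w) Circle) (_ : Continuous ψ) (_ : ψ ≠ 1)
      (_ : ∀ x : F, ψ (algebraMap F ((w : ι) → E w) x) = 1)
      -- Haar measures, and the quotient measure on `N_n(F) \ GL_n(F)`.
      [MeasurableSpace (AsaiZeta.GLn n F)] [BorelSpace (AsaiZeta.GLn n F)]
      (lG : Measure (AsaiZeta.GLn n F)) [lG.IsHaarMeasure]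
      (lN : Measure (AsaiZeta.unip n F)) [lN.IsHaarMeasure]
      (ν : Measure (AsaiZeta.UnipQuotient n F)) (_ : AsaiZeta.IsQuotientMeasure lG lN ν)
      [MeasurableSpace (AsaiZeta.GLn n ((w : ι) → E w))]
      [BorelSpace (AsaiZeta.GLn n ((w : ι) → E w))]
      (κ : Measure (AsaiZeta.maxCompactNA n E)) [κ.IsHaarMeasure] [IsProbabilityMeasure κ]
      -- A Schwartz function.
      (φ : (Fin n → F) → ℂ) (_ : IsLocallyConstant φ) (_ : HasCompactSupport φ),
      (∀ W ∈ AsaiZeta.spaceNA κ ψ μ, ∀ s : ℂ, -2 * (⨅ i, μ i) < s.re →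
        Integrable (AsaiZeta.zetaIntegrand W φ s) ν) ∧
      (∀ W ∈ AsaiZeta.spaceNA κ ψ μ,
        DifferentiableOn ℂ (AsaiZeta.zeta ν W φ) {s : ℂ | -2 * (⨅ i, μ i) < s.re}) ∧
      (∀ W ∈ AsaiZeta.spaceNA κ ψ μ, ∀ a b : ℝ, -2 * (⨅ i, μ i) < a → a < b →
        ∃ M : ℝ, ∀ s : ℂ, a ≤ s.re → s.re ≤ b → ‖AsaiZeta.zeta ν W φ s‖ ≤ M) ∧
      (∀ a b : ℝ, -2 * (⨅ i, μ i) < a → a < b →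
        ∃ p : Seminorm ℂ (AsaiZeta.spaceNA κ ψ μ),
          Continuous[AsaiZeta.topologyNA κ ψ μ, inferInstance] p ∧
          ∀ (W : AsaiZeta.spaceNA κ ψ μ) (s : ℂ), a ≤ s.re → s.re ≤ b →
            ‖AsaiZeta.zeta ν W.1 φ s‖ ≤ p W)) ∧
    -- The Archimedean case.
    (∀ (F : Type*) [RCLike F]
      (ι : Type*) [Fintype ι] (E : ι → Type*) [∀ w, RCLike (E w)]
      [∀ w, NormedAlgebra F (E w)] [∀ w, FiniteDimensional F (E w)]
      (_ : ∑ w, Module.finrank F (E w) = 2)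
      (ψ : AddChar ((w : ι) → E w) Circle) (_ : Continuous ψ) (_ : ψ ≠ 1)
      (_ : ∀ x : F, ψ (algebraMap F ((w : ι) → E w) x) = 1)
      [MeasurableSpace (AsaiZeta.GLn n F)] [BorelSpace (AsaiZeta.GLn n F)]
      (lG : Measure (AsaiZeta.GLn n F)) [lG.IsHaarMeasure]
      (lN : Measure (AsaiZeta.unip n F)) [lN.IsHaarMeasure]
      (ν : Measure (AsaiZeta.UnipQuotient n F)) (_ : AsaiZeta.IsQuotientMeasure lG lN ν)
      [MeasurableSpace (AsaiZeta.GLn n ((w : ι) → E w))]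
      [BorelSpace (AsaiZeta.GLn n ((w : ι) → E w))]
      (κ : Measure (AsaiZeta.maxCompactArch n E)) [κ.IsHaarMeasure] [IsProbabilityMeasure κ]
      (φ : SchwartzMap (Fin n → F) ℂ),
      (∀ W ∈ AsaiZeta.spaceArch κ ψ μ, ∀ s : ℂ, -2 * (⨅ i, μ i) < s.re →
        Integrable (AsaiZeta.zetaIntegrand W.1 φ s) ν) ∧
      (∀ W ∈ AsaiZeta.spaceArch κ ψ μ,
        DifferentiableOn ℂ (AsaiZeta.zeta ν W.1 φ) {s : ℂ | -2 * (⨅ i, μ i) < s.re}) ∧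
      (∀ W ∈ AsaiZeta.spaceArch κ ψ μ, ∀ a b : ℝ, -2 * (⨅ i, μ i) < a → a < b →
        ∃ M : ℝ, ∀ s : ℂ, a ≤ s.re → s.re ≤ b → ‖AsaiZeta.zeta ν W.1 φ s‖ ≤ M) ∧
      (∀ a b : ℝ, -2 * (⨅ i, μ i) < a → a < b →
        ∃ p : Seminorm ℂ (AsaiZeta.spaceArch κ ψ μ),
          Continuous[AsaiZeta.topologyArch κ ψ μ, inferInstance] p ∧
          ∀ (W : AsaiZeta.spaceArch κ ψ μ) (s : ℂ), a ≤ s.re → s.re ≤ b →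
            ‖AsaiZeta.zeta ν W.1.1 φ s‖ ≤ p W)) := by
  refine ⟨?_, ?_⟩
  · intro F _ _ _ _ ι _ E _ _ _ _ _ hE ψ _ hψ hψF _ _ lG _ lN _ ν hν _ _ κ _ _ φ hφ hφs
    have : ProperSpace F := ProperSpace.of_locallyCompactSpace F
    have : ∀ w, ProperSpace (E w) := fun w => ProperSpace.of_locallyCompactSpace (E w)
    have : Nonempty ι := by
      by_contra h
      rw [not_nonempty_iff] at h
      simp at hE
    have hKE : AsaiZeta.IwasawaFamily (R := (w : ι) → E w) fun n => AsaiZeta.maxCompactNA n E := by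
      rw [funext fun n => AsaiZeta.maxCompactNA_eq (E := E) n]
      exact AsaiZeta.iwasawaFamily_pi fun w => AsaiZeta.iwasawaFamily_integralGL
    have hφc : Continuous φ := hφ.continuous
    let _ : ∀ w, MeasureSpace (E w) := fun w => AsaiZeta.haarMeasureSpace (E w)
    have : ∀ w, BorelSpace (E w) := fun w => AsaiZeta.borelSpace_haarMeasureSpace (E w)
    have : ∀ w, (volume : Measure (E w)).IsAddHaarMeasure := fun w =>
      AsaiZeta.isAddHaarMeasure_haarMeasureSpace (E w)
    -- Continuity of W comes from invariance under an open subgroup, the rapid decay of φ from its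
    -- compact support.
    exact AsaiZeta.zeta_properties_of_decay hn hE (KF := AsaiZeta.integralGL F)
      AsaiZeta.iwasawaFamily_integralGL hKE
      (fun k hk => AsaiZeta.map_algebraMap_mem_maxCompactNA hk) hψF lG lN ν hν κ μ
      (AsaiZeta.stepNA κ ψ μ) (AsaiZeta.seminormsNA κ ψ μ) LinearMap.id
      (fun i W hW => ⟨hW.1.1, AsaiZeta.continuous_of_right_invariant i.1.1 i.1.2.1 hW.2⟩)
      (AsaiZeta.exists_decay_NA (hKE.norm_le n) κ hψ μ) φ hφc
      (AsaiZeta.exists_bound_of_hasCompactSupport hφc hφs)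
  · intro F _ ι _ E _ _ _ hE ψ _ hψ hψF _ _ lG _ lN _ ν hν _ _ κ _ _ φ
    have : Nonempty ι := by
      by_contra h
      rw [not_nonempty_iff] at h
      simp at hE
    have hKE : AsaiZeta.IwasawaFamily (R := (w : ι) → E w)
        fun n => AsaiZeta.maxCompactArch n E := by
      rw [funext fun n => AsaiZeta.maxCompactArch_eq (E := E) n]
      exact AsaiZeta.iwasawaFamily_pi fun w => AsaiZeta.iwasawaFamily_unitaryGL
    let _ : ∀ w, MeasureSpace (E w) := fun w => AsaiZeta.haarMeasureSpace (E w)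
    have : ∀ w, BorelSpace (E w) := fun w => AsaiZeta.borelSpace_haarMeasureSpace (E w)
    have : ∀ w, (volume : Measure (E w)).IsAddHaarMeasure := fun w =>
      AsaiZeta.isAddHaarMeasure_haarMeasureSpace (E w)
    -- Here the steps lie in the space of smooth functions, so the evaluation map is its inclusion
    -- into all functions; φ decays rapidly because it is a Schwartz function.
    exact AsaiZeta.zeta_properties_of_decay hn hE (KF := AsaiZeta.unitaryGL F)
      AsaiZeta.iwasawaFamily_unitaryGL hKE
      (fun k hk => AsaiZeta.map_algebraMap_mem_maxCompactArch hk) hψF lG lN ν hν κ μ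
      (AsaiZeta.stepArch κ ψ μ) (AsaiZeta.seminormsArch κ ψ μ)
      (AsaiZeta.smoothFunctions n E).subtype
      (fun i W hW => ⟨hW.1, AsaiZeta.continuous_of_mem_smoothFunctions W.2⟩)
      (AsaiZeta.exists_decay_Arch (hKE.norm_le n) κ hψ μ) φ φ.continuous
      (AsaiZeta.exists_bound_schwartz φ)
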